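/- **Lattices, norms, symmetries.** Let $L_{tp},L_{sp}$ be positive odd integers, $X=\mathbb Z^3/L_{sp}\mathbb Z^3$, $\mathcal X_0=(\mathbb Z/L_{tp}\mathbb Z)\times X$ and $\mathcal Y=(\mathbb Z/L_{tp}\mathbb Z)\times\mathbb Z^3$, with the quotient Euclidean metrics $d$. The temperature $T$ is determined by $\frac1{kT}=\theta L_{tp}$, where $\theta$ is introduced below. Write $x=(x_0,\mathbf x)$, $\langle f,g\rangle=\sum f g$ (no conjugation), and $\partial_\nu\psi(x)=\psi(x+e_\nu)-\psi(x)$, $0\le\nu\le3$. The norm of a kernel $f$ of $r\ge 1$ arguments is $\|f\|_{\mathfrak m}=\max_i\sup_{u_i}\sum_{u_j,\,j\neq i}|f(u_1,\dots,u_r)|e^{\mathfrak m\tau(u_1,\dots,u_r)}$, with $\tau$ the minimal length of a tree with vertices in the lattice having $u_1,\dots,u_r$ among its vertices (an edge $\{u,u'\}$ has length $d(u,u')$). The norm with mass $\mathfrak m$ and weights $\kappa_i$ of a power series in fields $\alpha_1,\dots,\alpha_s$, with kernels $f_{r_1,\dots,r_s}$ symmetric in the arguments belonging to each field, is $\sum_{r_1,\dots,r_s}\|f_{r_1,\dots,r_s}\|_{\mathfrak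 m}\prod_i\kappa_i^{r_i}$; when only a mass is given, all weights are $1$. $\mathfrak S$ is the group generated by the lattice translations and the reflections $R_0,\dots,R_3$. For $\nu'\ge1$, $(R_{\nu'}F)(\psi_*,\psi)=F(R_{\nu'}\psi_*,R_{\nu'}\psi)$, and $(R_0F)(\psi_*,\psi)=\overline{F(R_0\psi^*,R_0\psi_*^*)}$, where $(R_{\nu'}\psi)(u)=\psi(R_{\nu'}u)$; on derivative fields, $(R_{\nu'}\psi_\nu)(u)=\psi_\nu(R_{\nu'}u)$ for $\nu\ne\nu'$ and $(R_{\nu'}\psi_{\nu'})(u)=-\psi_{\nu'}(R_{\nu'}u-e_{\nu'})$. A function $F(\psi_*,\psi)$ is particle number preserving if $F(e^{-it}\psi_*,e^{it}\psi)=F(\psi_*,\psi)$ for all $t\in\mathbb R$. Invariance of a kernel $V(x_1,\dots,x_4)$ under $\mathfrak S$ means invariance of the monomial $\sum V(x_1,\dots,x_4)\psi_*(x_1)\psi(x_2)\psi_*(x_3)\psi(x_4)$, expressed through its kernel. **Constants.** Fix constants $\mathfrak m,c_v,D_{\mathcal H},K_\mu>0$, $\frac12<e_\mu\le1$, $0<c_{\mathcal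 H}<C_{\mathcal H}$, exponents $e_r,e_R,e_{R'}>0$ with $3e_R+4e_r<1$, $1\le4e_R+2e_r$, $2(e_R+e_r)<e_\mu$, $e_{R'}+e_r<1$, $\frac12\le e_{R'}$, and $0<\theta\le1$, $K>0$. **Model.** $\mathbf h=\nabla^*\mathcal H\nabla$, where $\mathcal H$ is a real, symmetric, translation and reflection invariant, strictly positive definite operator on $L^2$ of the nearest neighbour bonds of $\mathbb Z^3$ (reflections acting on functions on bonds as on gradients), with $\sum_{\mathbf x,i,j}e^{6\mathfrak m d(\mathbf x,0)}|\mathcal H(\langle0,e_i\rangle,\langle\mathbf x,\mathbf x+e_j\rangle)|\le D_{\mathcal H}$ and with the eigenvalues of the periodization of $\mathcal H$ in $[c_{\mathcal H},C_{\mathcal H}]$. $\mathbf v$ is a real, symmetric, translation and reflection invariant, strictly positive definite kernel on $\mathbb Z^3$ whose norm $|||\mathbf v|||=\sup_{\mathbf x}\sum_{\mathbf y}e^{5\mathfrak m d(\mathbf x,\mathbf y)}|\mathbf v(\mathbf x,\mathbf y)|$ satisfies $\frac14\mathfrak v\le|||\mathbf v|||\le\frac12\mathfrak v$. $h,v$ are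 the periodizations of $\mathbf h,\mathbf v$ to $X$; the smallest eigenvalue of $v$ is at least $c_v|||\mathbf v|||$. Finally $\mu\in\mathbb R$, $|\mu|\le K_\mu\mathfrak v^{e_\mu}$. **Output of the ultraviolet flow.** Let $$I_\theta^{(SF)}(\alpha^*,\beta)=\mathcal Z_\theta^{|X|}e^{\langle\alpha^*,j(\theta)\beta\rangle+V_\theta(\alpha^*,\beta)+\mathcal D_\theta(\alpha^*,\beta)}\chi_\theta(\alpha,\beta),$$ where $\mathcal Z_\theta$ is a constant, $j(t)=e^{-t(h-\mu)}$, and $$V_\theta(\alpha^*,\beta)=-\int_0^\theta\big\langle[j(t)\alpha^*][j(\theta-t)\beta],\,v\,[j(t)\alpha^*][j(\theta-t)\beta]\big\rangle\,dt .$$ The function $\mathcal D_\theta=\mathcal R_\theta+\mathcal E_\theta$ is given by power series with real kernels. It is invariant under $\alpha_*\to e^{-it}\alpha_*,\ \beta\to e^{it}\beta$, under translations and reflections of $X$, and satisfies $\overline{\mathcal D_\theta(\beta^*,\alpha_*^*)}=\mathcal D_\theta(\alpha_*,\beta)$. $\mathcal R_\theta$ is bilinear in $\alpha_*$ and $\beta$,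 and $\mathcal E_\theta$ is of degree at least two both in $\alpha_*$ and in $\beta$. Their norms with mass $2\mathfrak m$ and weight $2(\frac1{\theta\mathfrak v})^{e_R+e_r}$ for both fields are at most $K\theta\,\mathfrak v^{\mathfrak m\log\frac1{\mathfrak v}}$ and $K(\mathfrak v\theta)^{2-6e_R-8e_r}$, respectively. The cutoff $\chi_\theta(\alpha,\beta)$ is one if $|\alpha(\mathbf x)|,|\beta(\mathbf x)|\le(\frac1{\theta\mathfrak v})^{e_R+e_r}$ and $|\alpha(\mathbf x)-\beta(\mathbf x)|\le(\frac1{\theta\mathfrak v})^{e_r}$ for all $\mathbf x\in X$ and $|\nabla\alpha(b)|,|\nabla\beta(b)|\le(\frac1\theta)^{e_{R'}}(\frac1{\theta\mathfrak v})^{e_r}$ for all bonds $b$, and zero otherwise. **Proposition D.1.** There are $K_v>0$, depending only on $\theta,\mathfrak m,c_v,K_\mu,K$ and $\mathcal H$; $C_r>0$, depending only on $\mathfrak m,K_\mu,K$; and $0<\bar{\mathfrak v}\le1$, depending only on the constants fixed above, such that for all $0<\mathfrak v\le\bar{\mathfrak v}$ and all data as above the following holds. There are $\mathbf V_0$, $\mu_0$,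 $\tilde{\mathcal R}_{In}$, $\mathcal R_0^{(6)}$ and $\mathcal E_0$, as described below, such that both of the following integrands are integrable and $$\int\prod_{\tau\in\theta\mathbb Z\cap(0,\frac1{kT}]}\Big[\prod_{\mathbf x\in X}\tfrac{d\alpha_\tau(\mathbf x)^*\wedge d\alpha_\tau(\mathbf x)}{2\pi i}e^{-\alpha_\tau(\mathbf x)^*\alpha_\tau(\mathbf x)}\Big]I_\theta^{(SF)}(\alpha_{\tau-\theta}^*,\alpha_\tau)$$ $$=\mathcal Z_{In}^{|\mathcal X_0|}\int\prod_{x\in\mathcal X_0}\tfrac{d\psi(x)^*\wedge d\psi(x)}{2\pi i}\;e^{-\langle\psi^*,D_0\psi\rangle-\mathcal V_0(\psi^*,\psi)+\mu_0\langle\psi^*,\psi\rangle+\mathcal R_0(\psi^*,\psi)+\mathcal E_0(\psi^*,\psi)}\chi_0(\psi),$$ where $\alpha_0=\alpha_{1/kT}$, $\mathcal Z_{In}=\mathcal Z_\theta e^{-\theta\mu}$, $D_0=1-e^{-h_0}-e^{-h_0}\partial_0$, $h_0=\theta h$, and: * $\mathbf V_0$ is a real kernel on $\mathcal Y^4$,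 invariant under $x_1\leftrightarrow x_3$, under $x_2\leftrightarrow x_4$ and under $\mathfrak S$; $\mathcal V_0(\psi_*,\psi)=\frac12\sum_{x_1,\dots,x_4\in\mathcal X_0}V_0(x_1,\dots,x_4)\psi_*(x_1)\psi(x_2)\psi_*(x_3)\psi(x_4)$ with $V_0$ the spatial periodization of $\mathbf V_0$; $\|\mathbf V_0\|_{\frac23\mathfrak m}\le K_v\mathfrak v$ and $\|\mathbf V_0\|_0\ge\frac1{K_v}\mathfrak v$; for every $x_1$, $\big|\frac12\sum_{x_2,x_3,x_4}V_0(x_1,\dots,x_4)-\theta\sum_{\mathbf x\in X}v(0,\mathbf x)\big|\le K_v\mathfrak v^{2-2e_R-4e_r}$; and $\big\|\mathbf V_0-\delta_{x_{1,0},x_{3,0}}\delta_{x_{2,0},x_{4,0}}\delta_{x_{1,0},x_{2,0}-1}\mathbf v_\theta(\mathbf x_1,\dots,\mathbf x_4)\big\|_{\frac23\mathfrak m}\le K_v\mathfrak v^{2-2e_R-4e_r}$ with $$\mathbf v_\theta(\mathbf x_1,\dots,\mathbf x_4)=\sum_{\mathbf x,\mathbf y\in\mathbb Z^3}\int_0^\theta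 dt\,e^{-t\mathbf h}(\mathbf x,\mathbf x_1)e^{-(\theta-t)\mathbf h}(\mathbf x,\mathbf x_2)\mathbf v(\mathbf x,\mathbf y)e^{-t\mathbf h}(\mathbf y,\mathbf x_3)e^{-(\theta-t)\mathbf h}(\mathbf y,\mathbf x_4)$$ $$\qquad+\sum_{\mathbf x,\mathbf y\in\mathbb Z^3}\int_0^\theta dt\,e^{-t\mathbf h}(\mathbf x,\mathbf x_3)e^{-(\theta-t)\mathbf h}(\mathbf x,\mathbf x_2)\mathbf v(\mathbf x,\mathbf y)e^{-t\mathbf h}(\mathbf y,\mathbf x_1)e^{-(\theta-t)\mathbf h}(\mathbf y,\mathbf x_4).$$ * $\mu_0\in\mathbb R$ and $|\mu_0-(1-e^{-\theta\mu})|\le K\theta\,\mathfrak v^{\mathfrak m\log\frac1{\mathfrak v}}$. * $\mathcal R_0(\psi_*,\psi)=\tilde{\mathcal R}_{In}\big((\psi_*,\{\partial_\nu\psi_*\}),(\psi,\{\partial_\nu\psi\})\big)+\mathcal R_0^{(6)}(\psi_*,\psi)$. Both terms are $\mathfrak S$ invariant and particle number preserving with real kernels. $\tilde{\mathcal R}_{In}\big((\psi_*,\{\psi_{*\nu}\}),(\psi,\{\psi_\nu\})\big)$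 is of degree two, each monomial having either one field $\psi_{(*)}$ and one field $\psi_{(*)0}$, or two fields $\psi_{(*)\nu}$ with $1\le\nu\le3$; $\|\tilde{\mathcal R}_{In}\|_{\mathfrak m}\le C_r\mathfrak v^{\mathfrak m\log\frac1{\mathfrak v}}$. $\mathcal R_0^{(6)}$ is of degree three in each of $\psi_*$ and $\psi$, and $\|\mathcal R_0^{(6)}\|_{2\mathfrak m}\le e^{-3\theta\mu+6\mathfrak m}K(\mathfrak v\theta)^{2-2e_r}$. * $\mathcal E_0(\psi_*,\psi)$ is $\mathfrak S$ invariant and particle number preserving with real kernels, is of degree at least four both in $\psi_*$ and in $\psi$, has norm with mass $2\mathfrak m$ and weight $2e^{\theta\mu/2-\mathfrak m}(\frac1{\theta\mathfrak v})^{e_R+e_r}$ at most $K(\mathfrak v\theta)^{2-6e_R-8e_r}$, and its power series converges absolutely whenever $|\psi_*(x)|,|\psi(x)|\le e^{\theta\mu/2}(\frac1{\theta\mathfrak v})^{e_R+e_r}$ for all $x$. * $\chi_0(\psi)$ is one if, for all $x\in\mathcal X_0$, $|\psi(x)|\le e^{\theta\mu/2}(\frac1{\theta\mathfrak v})^{e_R+e_r}$,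 $|\partial_\nu\psi(x)|\le e^{\theta\mu/2}(\frac1\theta)^{e_{R'}}(\frac1{\theta\mathfrak v})^{e_r}$ for $1\le\nu\le3$, and $|\partial_0\psi(x)|\le e^{\theta\mu/2}(\frac1{\theta\mathfrak v})^{e_r}$; it is zero otherwise. -/

import Mathlib

open scoped ENNReal ComplexConjugate

noncomputable section

namespace BoseFlow

/-! ### Lattices

`ZMod 0` is `ℤ`, so `Sp 0` is `ℤ³` and `Sp L` (with `L ≠ 0`) is the torus `ℤ³ / L ℤ³`;
likewise `STLat Lt 0` is `(ℤ / Lt ℤ) × ℤ³` and `STLat Lt L` is the space-time torus. -/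

/-- The spatial lattice `ℤ³ / L ℤ³` (which is `ℤ³` for `L = 0`). -/
abbrev Sp (L : ℕ) : Type := Fin 3 → ZMod L

/-- The space-time lattice `(ℤ / Lt ℤ) × (ℤ³ / L ℤ³)`; `x.1` is the time, `x.2` the position. -/
abbrev STLat (Lt L : ℕ) : Type := ZMod Lt × Sp L

/-- Nearest neighbour bonds: `(x, j)` is the bond `⟨x, x + e_j⟩`. -/
abbrev Bond (L : ℕ) : Type := Sp L × Fin 3

/-- Distance from `a ∈ ℤ / nℤ` to `0` (the usual absolute value for `n = 0`). -/
def absMin {n : ℕ} (a : ZMod n) : ℝ := |((a.valMinAbs : ℤ) : ℝ)|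

/-- The (quotient) Euclidean distance on the spatial lattice. -/
def spDist {L : ℕ} (x y : Sp L) : ℝ := Real.sqrt (∑ i, absMin (x i - y i) ^ 2)

/-- The (quotient) Euclidean distance on the space-time lattice. -/
def stDist {Lt L : ℕ} (x y : STLat Lt L) : ℝ :=
  Real.sqrt (absMin (x.1 - y.1) ^ 2 + ∑ i, absMin (x.2 i - y.2 i) ^ 2)

/-- The unit vector `e_j` of the spatial lattice. -/
def spUnit {L : ℕ} (j : Fin 3) : Sp L := Pi.single j 1

/-- The unit vector `e_ν` of the space-time lattice (`ν = 0` is the time direction). -/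
def stUnit {Lt L : ℕ} (ν : Fin 4) : STLat Lt L :=
  Fin.cases (1, 0) (fun j => (0, spUnit j)) ν

/-- Reflection of the `j`-th spatial coordinate. -/
def spRefl {L : ℕ} (j : Fin 3) (x : Sp L) : Sp L := Function.update x j (-x j)

/-- Reflection of the `ν`-th space-time coordinate. -/
def stRefl {Lt L : ℕ} (ν : Fin 4) (x : STLat Lt L) : STLat Lt L :=
  Fin.cases (-x.1, x.2) (fun j => (x.1, spRefl j x.2)) ν

/-- The projection `ℤ³ → ℤ³ / L ℤ³`. -/
def spProj (L : ℕ) (x : Sp 0) : Sp L := fun i => ZMod.castHom (dvd_zero L) (ZMod L) (x i)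

/-- A choice of representatives for `ℤ³ → ℤ³ / L ℤ³`. -/
def spLift {L : ℕ} (x : Sp L) : Sp 0 := fun i => ((x i).valMinAbs : ZMod 0)

/-- The projection `(ℤ / Lt ℤ) × ℤ³ → (ℤ / Lt ℤ) × (ℤ³ / L ℤ³)`. -/
def stProj (Lt L : ℕ) (x : STLat Lt 0) : STLat Lt L := (x.1, spProj L x.2)

/-- A choice of representatives for `stProj`. -/
def stLift {Lt L : ℕ} (x : STLat Lt L) : STLat Lt 0 := (x.1, spLift x.2)

/-- Periodization of a (translation invariant) function of `n + 1` points along `π : C → X`: the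
first point is lifted by the section `σ`, and one sums over all lifts of the other points. -/
def periodize {C X : Type*} {n : ℕ} (π : C → X) (σ : X → C) (f : (Fin (n + 1) → C) → ℝ)
    (x : Fin (n + 1) → X) : ℝ :=
  ∑' ξ : {ξ : Fin (n + 1) → C // ξ 0 = σ (x 0) ∧ ∀ i, π (ξ i) = x i}, f ξ.1

/-! ### Tree length and norms -/

open Classical in
/-- The minimal length of a tree whose vertices are points of `X`, among them all the `u i`; an
edge joining `x` and `y` has length `d x y`. -/
def treeLength {X ι : Type*} (d : X → X → ℝ) (u : ι → X) : ℝ :=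
  sInf {ℓ : ℝ | ∃ (V : Finset X) (G : SimpleGraph V), G.IsTree ∧ (∀ i, u i ∈ V) ∧
    ℓ = (1 / 2) * ∑ x : V, ∑ y : V, if G.Adj x y then d x y else 0}

open Classical in
/-- The norm `‖f‖_m` of a kernel on a unit lattice `X`: the maximum over `i` and `u` of the sum,
over all arguments but the `i`-th, which is `u`, of `|f| exp (m τ)`, with `τ` the tree length.
(A constant, that is a kernel without arguments, has its absolute value as norm.) -/
def kernelNorm {X ι : Type*} (d : X → X → ℝ) (m : ℝ) (f : (ι → X) → ℝ) : ℝ≥0∞ :=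
  if IsEmpty ι then ∑' x : ι → X, ENNReal.ofReal |f x|
  else ⨆ (i : ι) (u : X), ∑' x : ι → X,
    if x i = u then ENNReal.ofReal (|f x| * Real.exp (m * treeLength d x)) else 0

/-- A power series, with real kernels, in fields on `X` indexed by `S`. Its kernel of multidegree
`r` has `r s` arguments for the field `s`. -/
abbrev FieldSeries (S X : Type*) : Type _ := (r : S → ℕ) → (((s : S) × Fin (r s)) → X) → ℝ

namespace FieldSeries

variable {S X : Type*}

/-- The kernels are invariant under permutations of the arguments that belong to one field. -/
def IsSymm (F : FieldSeries S X) : Prop :=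
  ∀ (r : S → ℕ) (p : (s : S) → Equiv.Perm (Fin (r s))) (x : ((s : S) × Fin (r s)) → X),
    F r (fun q => x ⟨q.1, p q.1 q.2⟩) = F r x

/-- The value of the power series at the fields `φ`. -/
def eval [Fintype S] [DecidableEq S] [Fintype X] (F : FieldSeries S X) (φ : S → X → ℂ) : ℂ :=
  ∑' r : S → ℕ, ∑ x : ((s : S) × Fin (r s)) → X, (F r x : ℂ) * ∏ q, φ q.1 (x q)

/-- Absolute convergence of the power series at the fields `φ`. -/
def AbsConv [Fintype S] [DecidableEq S] [Fintype X] (F : FieldSeries S X) (φ : S → X → ℂ) :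
    Prop :=
  Summable fun r : S → ℕ => ∑ x : ((s : S) × Fin (r s)) → X, |F r x| * ∏ q, ‖φ q.1 (x q)‖

/-- The norm with mass `m` and weights `κ`. -/
def norm [Fintype S] (d : X → X → ℝ) (m : ℝ) (κ : S → ℝ) (F : FieldSeries S X) : ℝ≥0∞ :=
  ∑' r : S → ℕ, kernelNorm d m (F r) * ∏ s, ENNReal.ofReal (κ s) ^ r s

end FieldSeries

/-! ### Operators -/

/-- `(∇ f)(⟨x, x + e_j⟩) = f (x + e_j) - f x`. -/
def grad {L : ℕ} {A : Type*} [AddCommGroup A] (f : Sp L → A) (b : Bond L) : A :=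
  f (b.1 + spUnit b.2) - f b.1

/-- The adjoint `∇^*`. -/
def gradAdj {L : ℕ} (F : Bond L → ℝ) (x : Sp L) : ℝ :=
  ∑ j, (F (x - spUnit j, j) - F (x, j))

/-- The kernel of `𝐡 = ∇^* 𝓗 ∇` on `ℤ³`. -/
def kinetic (H : Bond 0 → Bond 0 → ℝ) (x y : Sp 0) : ℝ :=
  gradAdj (fun b => ∑' b', H b b' * grad (Pi.single y (1 : ℝ)) b') x

/-- Powers of the operator with kernel `A`. -/
def kerPow {X : Type*} [DecidableEq X] (A : X → X → ℝ) : ℕ → X → X → ℝ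
  | 0 => fun x y => if x = y then 1 else 0
  | n + 1 => fun x y => ∑' z, A x z * kerPow A n z y

/-- The kernel of the exponential of the operator with kernel `A`. -/
def kerExp {X : Type*} [DecidableEq X] (A : X → X → ℝ) (x y : X) : ℝ :=
  ∑' n : ℕ, ((n.factorial : ℝ)⁻¹) * kerPow A n x y

/-- The kernel of `e^{-t 𝐡}` on `ℤ³`. -/
def heatZ (H : Bond 0 → Bond 0 → ℝ) (t : ℝ) : Sp 0 → Sp 0 → ℝ :=
  kerExp fun x y => -t * kinetic H x y

/-- The periodization to `ℤ³ / L ℤ³` of a two point kernel on `ℤ³`. -/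
def periodize₂ (L : ℕ) (f : Sp 0 → Sp 0 → ℝ) : Matrix (Sp L) (Sp L) ℝ :=
  Matrix.of fun x y => periodize (spProj L) spLift (fun ξ : Fin 2 → Sp 0 => f (ξ 0) (ξ 1)) ![x, y]

/-- The periodization of an operator on functions on bonds. -/
def periodizeBond (L : ℕ) (H : Bond 0 → Bond 0 → ℝ) : Matrix (Bond L) (Bond L) ℝ :=
  Matrix.of fun b b' => periodize₂ L (fun x y => H (x, b.2) (y, b'.2)) b.1 b'.1

/-- A real matrix acting on complex fields. -/
def act {X : Type*} [Fintype X] (A : Matrix X X ℝ) (f : X → ℂ) (x : X) : ℂ :=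
  ∑ y, (A x y : ℂ) * f y

/-- The bilinear ("real") inner product `∑ f g`. -/
def bil {X : Type*} [Fintype X] (f g : X → ℂ) : ℂ := ∑ x, f x * g x

/-- The forward derivatives on the space-time lattice. -/
def fwd {Lt L : ℕ} (ν : Fin 4) (ψ : STLat Lt L → ℂ) (x : STLat Lt L) : ℂ := ψ (x + stUnit ν) - ψ x

/-! ### The constants and the model -/

/-- The constants. `e_r`, `e_R`, `e_R'` are the exponents governing the small field conditions,
`θ` is the time step and `K` the constant in the bounds on the output of the ultraviolet flow. -/
structure Constants where
  mass : ℝ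
  c_v : ℝ
  D_H : ℝ
  K_μ : ℝ
  e_μ : ℝ
  c_H : ℝ
  C_H : ℝ
  e_r : ℝ
  e_R : ℝ
  e_R' : ℝ
  θ : ℝ
  K : ℝ

/-- The conditions imposed on the constants. -/
structure Constants.Admissible (c : Constants) : Prop where
  mass_pos : 0 < c.mass
  c_v_pos : 0 < c.c_v
  D_H_pos : 0 < c.D_H
  K_μ_pos : 0 < c.K_μ
  e_μ_gt : 1 / 2 < c.e_μ
  e_μ_le : c.e_μ ≤ 1
  c_H_pos : 0 < c.c_H
  c_H_lt : c.c_H < c.C_H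
  e_r_pos : 0 < c.e_r
  e_R_pos : 0 < c.e_R
  e_R'_pos : 0 < c.e_R'
  exp₁ : 3 * c.e_R + 4 * c.e_r < 1
  exp₂ : 1 ≤ 4 * c.e_R + 2 * c.e_r
  exp₃ : 2 * (c.e_R + c.e_r) < c.e_μ
  exp₄ : c.e_R' + c.e_r < 1
  exp₅ : 1 / 2 ≤ c.e_R'
  θ_pos : 0 < c.θ
  θ_le : c.θ ≤ 1
  K_pos : 0 < c.K

/-- The reflection of a bond. For `b.2 = j` it reverses the orientation. -/
def bondRefl {L : ℕ} (j : Fin 3) (b : Bond L) : Bond L :=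
  if b.2 = j then (spRefl j b.1 - spUnit j, b.2) else (spRefl j b.1, b.2)

/-- The sign picked up by a function on oriented bonds (such as a gradient) under `bondRefl`. -/
def bondSign {L : ℕ} (j : Fin 3) (b : Bond L) : ℝ := if b.2 = j then -1 else 1

/-- The quadratic form of the real symmetric kernel `A` is strictly positive on `ℓ²`. -/
def StrictPosDef {X : Type*} (A : X → X → ℝ) : Prop :=
  ∀ f : X → ℝ, Summable (fun x => f x ^ 2) → f ≠ 0 → 0 < ∑' x, f x * ∑' y, A x y * f y

/-- The hypotheses on `𝓗`, for the periodic box of side `L`. -/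
structure KineticHyp (c : Constants) (L : ℕ) [NeZero L] (H : Bond 0 → Bond 0 → ℝ) : Prop where
  symm : ∀ b b', H b b' = H b' b
  trans : ∀ (a : Sp 0) b b', H (b.1 + a, b.2) (b'.1 + a, b'.2) = H b b'
  refl : ∀ (j : Fin 3) b b',
    bondSign j b * H (bondRefl j b) (bondRefl j b') * bondSign j b' = H b b'
  posDef : StrictPosDef H
  decay : ∑' x : Sp 0, ∑ i : Fin 3, ∑ j : Fin 3,
    ENNReal.ofReal (Real.exp (6 * c.mass * spDist x 0) * |H (0, i) (x, j)|)
      ≤ ENNReal.ofReal c.D_H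
  eigenvalues : ∀ lam : ℝ, Module.End.HasEigenvalue (Matrix.toLin' (periodizeBond L H)) lam →
    c.c_H ≤ lam ∧ lam ≤ c.C_H

/-- The weighted norm `sup_x ∑_y e^{5 m d(x,y)} |𝐯(x,y)|` of the interaction. -/
def vNorm (m : ℝ) (v : Sp 0 → Sp 0 → ℝ) : ℝ≥0∞ :=
  ⨆ x, ∑' y, ENNReal.ofReal (Real.exp (5 * m * spDist x y) * |v x y|)

/-- The hypotheses on the interaction `𝐯`, for the periodic box of side `L`. -/
structure InteractionHyp (c : Constants) (fv : ℝ) (L : ℕ) [NeZero L] (v : Sp 0 → Sp 0 → ℝ) :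
    Prop where
  symm : ∀ x y, v x y = v y x
  trans : ∀ a x y, v (x + a) (y + a) = v x y
  refl : ∀ (j : Fin 3) x y, v (spRefl j x) (spRefl j y) = v x y
  posDef : StrictPosDef v
  lower : ENNReal.ofReal (fv / 4) ≤ vNorm c.mass v
  upper : vNorm c.mass v ≤ ENNReal.ofReal (fv / 2)
  eigenvalues : ∀ lam : ℝ, Module.End.HasEigenvalue (Matrix.toLin' (periodize₂ L v)) lam →
    c.c_v * (vNorm c.mass v).toReal ≤ lam

/-! ### The output of the ultraviolet flow -/

/-- `R = (1/(θ 𝔳))^{e_R + e_r}`, the bound on small fields. -/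
def Constants.fieldBound (c : Constants) (fv : ℝ) : ℝ := (1 / (c.θ * fv)) ^ (c.e_R + c.e_r)

/-- `(1/θ)^{e_R'} (1/(θ 𝔳))^{e_r}`, the bound on spatial derivatives of small fields. -/
def Constants.gradBound (c : Constants) (fv : ℝ) : ℝ :=
  (1 / c.θ) ^ c.e_R' * (1 / (c.θ * fv)) ^ c.e_r

/-- `(1/(θ 𝔳))^{e_r}`, the bound on time differences of small fields. -/
def Constants.diffBound (c : Constants) (fv : ℝ) : ℝ := (1 / (c.θ * fv)) ^ c.e_r

/-- `𝔳^{m log (1/𝔳)}`. -/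
def nonpert (m fv : ℝ) : ℝ := fv ^ (m * Real.log (1 / fv))

/-- `𝓓_θ(α_*, β) = 𝓡_θ(α_*, β) + 𝓔_θ(α_*, β)`. -/
def Dθ {L : ℕ} [NeZero L] (R E : FieldSeries (Fin 2) (Sp L)) (αs β : Sp L → ℂ) : ℂ :=
  R.eval ![αs, β] + E.eval ![αs, β]

/-- The properties of the functions `𝓡_θ` and `𝓔_θ` produced by the ultraviolet flow. Both are
given by power series in `α_*` (field `0`) and `β` (field `1`) with real kernels. -/
structure UVOutput (c : Constants) (fv : ℝ) (L : ℕ) [NeZero L]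
    (R E : FieldSeries (Fin 2) (Sp L)) : Prop where
  R_symm : R.IsSymm
  E_symm : E.IsSymm
  /-- `𝓡_θ` is bilinear in `α_*` and `β`. -/
  R_bilinear : ∀ r, ¬(r 0 = 1 ∧ r 1 = 1) → R r = 0
  /-- `𝓔_θ` has degree at least two both in `α_*` and in `β`. -/
  E_degree : ∀ r, ¬(2 ≤ r 0 ∧ 2 ≤ r 1) → E r = 0
  R_norm : R.norm spDist (2 * c.mass) (fun _ => 2 * c.fieldBound fv)
    ≤ ENNReal.ofReal (c.K * c.θ * nonpert c.mass fv)
  E_norm : E.norm spDist (2 * c.mass) (fun _ => 2 * c.fieldBound fv)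
    ≤ ENNReal.ofReal (c.K * (fv * c.θ) ^ (2 - 6 * c.e_R - 8 * c.e_r))
  /-- `U(1)` invariance. -/
  u1 : ∀ (t : ℝ) (αs β : Sp L → ℂ),
    Dθ R E (Complex.exp (-(t * Complex.I)) • αs) (Complex.exp (t * Complex.I) • β) = Dθ R E αs β
  /-- Invariance under translations. -/
  trans : ∀ (a : Sp L) (αs β : Sp L → ℂ),
    Dθ R E (fun x => αs (x - a)) (fun x => β (x - a)) = Dθ R E αs β
  /-- Invariance under reflections. -/
  refl : ∀ (j : Fin 3) (αs β : Sp L → ℂ),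
    Dθ R E (fun x => αs (spRefl j x)) (fun x => β (spRefl j x)) = Dθ R E αs β
  /-- Invariance under time reversal. -/
  timeRev : ∀ αs β : Sp L → ℂ, conj (Dθ R E (star β) (star αs)) = Dθ R E αs β

/-- `j(t) = e^{-t(h - μ)}` on the periodic box. -/
def jop (H : Bond 0 → Bond 0 → ℝ) (μ : ℝ) (L : ℕ) [NeZero L] (t : ℝ) : Matrix (Sp L) (Sp L) ℝ :=
  NormedSpace.exp (-t • (periodize₂ L (kinetic H) - μ • (1 : Matrix (Sp L) (Sp L) ℝ)))

/-- `V_θ(α_*, β)`. -/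
def Vθ (H : Bond 0 → Bond 0 → ℝ) (v : Sp 0 → Sp 0 → ℝ) (μ θ : ℝ) {L : ℕ} [NeZero L]
    (αs β : Sp L → ℂ) : ℂ :=
  -∫ t in (0 : ℝ)..θ,
    bil (act (jop H μ L t) αs * act (jop H μ L (θ - t)) β)
      (act (periodize₂ L v) (act (jop H μ L t) αs * act (jop H μ L (θ - t)) β))

open Classical in
/-- The small field cutoff `χ_θ(α, β)`. -/
def χθ (c : Constants) (fv : ℝ) {L : ℕ} (α β : Sp L → ℂ) : ℂ :=
  if (∀ x, ‖α x‖ ≤ c.fieldBound fv ∧ ‖β x‖ ≤ c.fieldBound fv) ∧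
      (∀ b, ‖grad α b‖ ≤ c.gradBound fv ∧ ‖grad β b‖ ≤ c.gradBound fv) ∧
      (∀ x, ‖α x - β x‖ ≤ c.diffBound fv) then 1 else 0

/-- The pure small field contribution `I_θ^{(SF)}(α^*, β)`, as a function of `α` and `β`. -/
def ISF (c : Constants) (fv : ℝ) (H : Bond 0 → Bond 0 → ℝ) (v : Sp 0 → Sp 0 → ℝ) (μ : ℝ) {L : ℕ}
    [NeZero L] (Zθ : ℂ) (R E : FieldSeries (Fin 2) (Sp L)) (α β : Sp L → ℂ) : ℂ :=
  Zθ ^ Fintype.card (Sp L) *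
    Complex.exp (bil (star α) (act (jop H μ L c.θ) β) + Vθ H v μ c.θ (star α) β
      + Dθ R E (star α) β) * χθ c fv α β

/-- The measure `∏_x dψ(x)^* ∧ dψ(x) / (2πi)`; as `dz^* ∧ dz = 2i dx ∧ dy`, it is Lebesgue measure
divided by `π` at each site. -/
def fieldMeasure (X : Type*) [Fintype X] : MeasureTheory.Measure (X → ℂ) :=
  MeasureTheory.Measure.pi fun _ => ENNReal.ofReal (1 / Real.pi) • MeasureTheory.volume

/-- The integrand of the pure small field functional integral. The times `τ ∈ θℤ ∩ (0, 1/kT]`,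
with `1/kT = θ Lt` and `α_0 = α_{1/kT}`, are labelled by `n = τ/θ ∈ ℤ / Lt ℤ`; that is, the field
`α_τ(x)` is written `α (n, x)`. -/
def smallFieldIntegrand (c : Constants) (fv : ℝ) (H : Bond 0 → Bond 0 → ℝ) (v : Sp 0 → Sp 0 → ℝ)
    (μ : ℝ) (Lt : ℕ) {L : ℕ} [NeZero Lt] [NeZero L] (Zθ : ℂ) (R E : FieldSeries (Fin 2) (Sp L))
    (α : STLat Lt L → ℂ) : ℂ :=
  ∏ n : ZMod Lt, ((∏ x : Sp L, Complex.exp (-(conj (α (n, x)) * α (n, x)))) *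
    ISF c fv H v μ Zθ R E (fun x => α (n - 1, x)) (fun x => α (n, x)))

/-! ### Symmetries of functions of fields on the space-time lattice -/

/-- Extended fields `(ψ, {ψ_ν})`: `none` labels `ψ`, `some ν` labels `ψ_ν`. -/
abbrev TField (Lt L : ℕ) : Type := Option (Fin 4) → STLat Lt L → ℂ

/-- `(ψ, {∂_ν ψ})`. -/
def jet {Lt L : ℕ} (ψ : STLat Lt L → ℂ) : TField Lt L
  | none => ψ
  | some ν => fwd ν ψ

/-- Translations of extended fields. -/
def tTrans {Lt L : ℕ} (a : STLat Lt L) (φ : TField Lt L) : TField Lt L := fun o u => φ o (u - a)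

/-- Reflections of extended fields. -/
def tRefl {Lt L : ℕ} (ν' : Fin 4) (φ : TField Lt L) : TField Lt L
  | none => fun u => φ none (stRefl ν' u)
  | some ν => fun u =>
      if ν = ν' then -φ (some ν) (stRefl ν' u - stUnit ν') else φ (some ν) (stRefl ν' u)

/-- Invariance of `F(ψ̃_*, ψ̃)` under the group `𝔖` generated by translations, spatial reflections
and the time reflection (which exchanges and conjugates the fields and conjugates the value). -/
structure SInvariant {Lt L : ℕ} (F : TField Lt L → TField Lt L → ℂ) : Prop where
  trans : ∀ (a : STLat Lt L) φs φ, F (tTrans a φs) (tTrans a φ) = F φs φ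
  refl : ∀ (j : Fin 3) φs φ, F (tRefl j.succ φs) (tRefl j.succ φ) = F φs φ
  timeRefl : ∀ φs φ, conj (F (tRefl 0 (star φ)) (tRefl 0 (star φs))) = F φs φ

/-- Particle number preservation. -/
def NumberPreserving {Lt L : ℕ} (F : TField Lt L → TField Lt L → ℂ) : Prop :=
  ∀ (t : ℝ) φs φ,
    F (Complex.exp (-(t * Complex.I)) • φs) (Complex.exp (t * Complex.I) • φ) = F φs φ

/-- The function of extended fields given by a power series in `(ψ_*, {ψ_{*ν}})` (fields `(0, o)`)
and `(ψ, {ψ_ν})` (fields `(1, o)`). -/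
def extEval {Lt L : ℕ} [NeZero Lt] [NeZero L]
    (F : FieldSeries (Fin 2 × Option (Fin 4)) (STLat Lt L)) (φs φ : TField Lt L) : ℂ :=
  F.eval fun s => ![φs, φ] s.1 s.2

/-- A power series in `ψ_*` (field `0`) and `ψ` (field `1`), as a function of extended fields. -/
def plainEval {Lt L : ℕ} [NeZero Lt] [NeZero L] (F : FieldSeries (Fin 2) (STLat Lt L))
    (φs φ : TField Lt L) : ℂ :=
  F.eval ![φs none, φ none]

/-- The type `(p_u, p_0, p_sp)` of a multidegree in the extended fields: the numbers of
undifferentiated fields, of fields `ψ_{(*)0}`, and of fields `ψ_{(*)ν}` with `1 ≤ ν ≤ 3`. -/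
def monoType (r : Fin 2 × Option (Fin 4) → ℕ) : ℕ × ℕ × ℕ :=
  (∑ s, r (s, none), ∑ s, r (s, some 0), ∑ s, ∑ j : Fin 3, r (s, some j.succ))

/-- Invariance under `𝔖` of the kernel `V` of a quartic monomial
`∑ V(x₁,x₂,x₃,x₄) ψ_*(x₁) ψ(x₂) ψ_*(x₃) ψ(x₄)` with `V` real. -/
structure QuarticSInvariant {Lt L : ℕ} (V : (Fin 4 → STLat Lt L) → ℝ) : Prop where
  trans : ∀ (a : STLat Lt L) x, V (fun i => x i + a) = V x
  refl : ∀ (j : Fin 3) x, V (fun i => stRefl j.succ (x i)) = V x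
  timeRefl : ∀ x, V ![stRefl 0 (x 1), stRefl 0 (x 0), stRefl 0 (x 3), stRefl 0 (x 2)] = V x

/-! ### The rewritten action -/

/-- `D₀ = 1 - e^{-h₀} - e^{-h₀} ∂₀` with `h₀ = θ h` acting on the spatial variables. -/
def D₀ (H : Bond 0 → Bond 0 → ℝ) (θ : ℝ) {Lt L : ℕ} [NeZero L] (ψ : STLat Lt L → ℂ)
    (x : STLat Lt L) : ℂ :=
  ψ x - act (NormedSpace.exp (-(θ • periodize₂ L (kinetic H)))) (fun y => ψ (x.1, y)) x.2
    - act (NormedSpace.exp (-(θ • periodize₂ L (kinetic H)))) (fun y => fwd 0 ψ (x.1, y)) x.2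

/-- The explicit kernel `𝐯_θ(x₁,x₂,x₃,x₄)` on `ℤ³`. -/
def vθ (H : Bond 0 → Bond 0 → ℝ) (v : Sp 0 → Sp 0 → ℝ) (θ : ℝ) (x₁ x₂ x₃ x₄ : Sp 0) : ℝ :=
  (∑' p : Sp 0 × Sp 0, ∫ t in (0 : ℝ)..θ,
    heatZ H t p.1 x₁ * heatZ H (θ - t) p.1 x₂ * v p.1 p.2 *
      heatZ H t p.2 x₃ * heatZ H (θ - t) p.2 x₄) +
  ∑' p : Sp 0 × Sp 0, ∫ t in (0 : ℝ)..θ,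
    heatZ H t p.1 x₃ * heatZ H (θ - t) p.1 x₂ * v p.1 p.2 *
      heatZ H t p.2 x₁ * heatZ H (θ - t) p.2 x₄

/-- The kernel
`δ(x_{1,0}, x_{3,0}) δ(x_{2,0}, x_{4,0}) δ(x_{1,0}, x_{2,0} - 1) 𝐯_θ(𝐱₁, 𝐱₂, 𝐱₃, 𝐱₄)`. -/
def leadingKernel (H : Bond 0 → Bond 0 → ℝ) (v : Sp 0 → Sp 0 → ℝ) (θ : ℝ) {Lt : ℕ}
    (x : Fin 4 → STLat Lt 0) : ℝ :=
  if (x 0).1 = (x 2).1 ∧ (x 1).1 = (x 3).1 ∧ (x 0).1 = (x 1).1 - 1 then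
    vθ H v θ (x 0).2 (x 1).2 (x 2).2 (x 3).2 else 0

/-- The spatial periodization of a kernel on `((ℤ / Lt ℤ) × ℤ³)⁴`. -/
def periodize₄ {Lt : ℕ} (L : ℕ) (V : (Fin 4 → STLat Lt 0) → ℝ) : (Fin 4 → STLat Lt L) → ℝ :=
  periodize (stProj Lt L) stLift V

/-- `½ ∑ V(x₁,x₂,x₃,x₄) ψ_*(x₁) ψ(x₂) ψ_*(x₃) ψ(x₄)`. -/
def quartic {Lt L : ℕ} [NeZero Lt] [NeZero L] (V : (Fin 4 → STLat Lt L) → ℝ)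
    (ψs ψ : STLat Lt L → ℂ) : ℂ :=
  (1 / 2) * ∑ x : Fin 4 → STLat Lt L, (V x : ℂ) * ψs (x 0) * ψ (x 1) * ψs (x 2) * ψ (x 3)

open Classical in
/-- The small field cutoff `χ₀(ψ)`. -/
def χ₀ (c : Constants) (fv μ : ℝ) {Lt L : ℕ} (ψ : STLat Lt L → ℂ) : ℂ :=
  if (∀ x, ‖ψ x‖ ≤ Real.exp (c.θ * μ / 2) * c.fieldBound fv) ∧
      (∀ (j : Fin 3) x, ‖fwd j.succ ψ x‖ ≤ Real.exp (c.θ * μ / 2) * c.gradBound fv) ∧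
      (∀ x, ‖fwd 0 ψ x‖ ≤ Real.exp (c.θ * μ / 2) * c.diffBound fv) then 1 else 0

/-- `𝓡₀(ψ_*, ψ) = 𝓡̃((ψ_*, {∂_ν ψ_*}), (ψ, {∂_ν ψ})) + 𝓡₀^{(6)}(ψ_*, ψ)`. -/
def R₀ {Lt L : ℕ} [NeZero Lt] [NeZero L] (Rt : FieldSeries (Fin 2 × Option (Fin 4)) (STLat Lt L))
    (R6 : FieldSeries (Fin 2) (STLat Lt L)) (ψs ψ : STLat Lt L → ℂ) : ℂ :=
  extEval Rt (jet ψs) (jet ψ) + R6.eval ![ψs, ψ]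

/-- The integrand `e^{-⟨ψ^*, D₀ψ⟩ - 𝓥₀ + μ₀⟨ψ^*, ψ⟩ + 𝓡₀ + 𝓔₀} χ₀(ψ)`, where `V` is the kernel of
`𝓥₀`. -/
def blockSpinIntegrand (c : Constants) (fv : ℝ) (H : Bond 0 → Bond 0 → ℝ) (μ : ℝ) {Lt L : ℕ}
    [NeZero Lt] [NeZero L] (V : (Fin 4 → STLat Lt L) → ℝ) (μ₀ : ℝ)
    (Rt : FieldSeries (Fin 2 × Option (Fin 4)) (STLat Lt L)) (R6 E0 : FieldSeries (Fin 2) (STLat Lt L))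
    (ψ : STLat Lt L → ℂ) : ℂ :=
  Complex.exp (-bil (star ψ) (D₀ H c.θ ψ) - quartic V (star ψ) ψ + (μ₀ : ℂ) * bil (star ψ) ψ
    + R₀ Rt R6 (star ψ) ψ + E0.eval ![star ψ, ψ]) * χ₀ c fv μ ψ

end BoseFlow

end

open BoseFlow

/-!
The two integrals differ only by the substitution `α_{θn}(x) = e^{-θμ/2} ψ(n, x)`. Its Jacobian is
`e^{-θμ}` for every point of space-time (`BoseFlow.integral_comp_rescale`), and the product of the
cutoffs `χ_θ` becomes `χ₀` (`BoseFlow.prod_χθ_slice`). As `χ₀` restricts the fields to a compact set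
on which all power series converge, both integrands are integrable. It remains to write the action
in the new variables (`BoseFlow.action_eq`) and to check symmetries and norms, degree by degree.

*The degrees.* The kernels of a convergent power series are determined by the values of the series
(`BoseFlow.FieldSeries.eq_of_eval_eq`), hence all the symmetries of the function `𝓓_θ` are
symmetries of its kernels (`BoseFlow.UVOutput.kernelSymm`). By particle number conservation only
kernels of equal degrees in both fields occur (`BoseFlow.eval_decompose`).

*Degree one.* With `e^{-θh}` from `j(θ)` the quadratic terms combine to `-⟨ψ_*, D₀ψ⟩`
(`BoseFlow.bil_D₀`) and `⟨ψ_*, ψ⟩`. The kernel `r` of `𝓡_θ` contributes `∑ r(x,y) ψ_*(n-1,x)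
ψ(n,y)`. Replacing `ψ_*(n-1)` or `ψ(n)` by the value at the neighbouring time costs a term with a
derivative `∂₀`, and at equal times `∑ r(x,y) ψ_*(x) ψ(y) = r̂ ⟨ψ_*, ψ⟩ - ½ ∑ r(x,y) (ψ_*(x) -
ψ_*(y)) (ψ(x) - ψ(y))` with `r̂ = ∑_y r(0,y)`. The first term goes to `μ₀` (`BoseFlow.chemPot`). In
the second one the differences are sums of derivatives along lattice paths, whose lengths are
controlled by the exponential decay of `r` (`BoseFlow.bilKernel`, `BoseFlow.extEval_bilKernel_jet`,
`BoseFlow.norm_bilKernel_le`).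

*Degree two.* The kernel of `V_θ` on the torus is the periodization of the explicit kernel `𝐯_θ`. To
see this, expand the heat kernels `e^{-t𝐡}` on `ℤ³` in exponential series, which converge absolutely
in weighted `ℓ¹` norms uniformly in `t`, and use that an operator on `ℤ³` and its periodization act
in the same way on periodic functions (`BoseFlow.Intertwines`, `BoseFlow.KineticHyp.sum_vθ₄_eq_Vθ`).
The quartic part of `𝓔_θ` lives on the torus and is lifted to `ℤ³` by choosing representatives close
to one of the four points, averaged over this point (`BoseFlow.liftKernel`). The sum of both
(`BoseFlow.fullKernel`) gives `𝐕₀`. As `𝐡` annihilates the constants, `𝐯_θ`, summed over three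
arguments, is exactly `2θ ∑_x v(0,x)`, which is of order `𝔳` by the lower bound on the eigenvalues
of `v`. The lifted part is of order `𝔳^{2-2e_R-4e_r}`, hence smaller, and this gives the lower bound
on the norm of `𝐕₀` (`BoseFlow.UVOutput.quarticKernel_bounds`).

*Higher degrees.* The parts of degree three and of degree at least four are simply placed in
space-time, with `ψ_*` at time `n-1` and `ψ` at time `n` (`BoseFlow.place`). One vertical edge for
each argument `ψ_*` connects the two time slices, so that the norm with mass `2𝔪` grows by at most
`e^{2𝔪}` for each of these arguments (`BoseFlow.kernelNorm_place_le`).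
-/

noncomputable section

namespace BoseFlow

/-! ### Distances -/

lemma absMin_nonneg {n : ℕ} (a : ZMod n) : 0 ≤ absMin a := abs_nonneg _

lemma absMin_eq_natAbs {n : ℕ} (a : ZMod n) : absMin a = (a.valMinAbs.natAbs : ℝ) := by
  rw [absMin, ← Int.cast_abs, Int.abs_eq_natAbs]; simp

@[simp] lemma absMin_zero {n : ℕ} : absMin (0 : ZMod n) = 0 := by simp [absMin]

@[simp] lemma absMin_neg {n : ℕ} (a : ZMod n) : absMin (-a) = absMin a := by
  simp [absMin_eq_natAbs]

lemma absMin_intCast_le {n : ℕ} (k : ℤ) : absMin (k : ZMod n) ≤ |(k : ℝ)| := by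
  rw [absMin_eq_natAbs, ← Int.cast_abs, Int.abs_eq_natAbs, Int.cast_natCast, Nat.cast_le]
  rcases Nat.eq_zero_or_pos n with rfl | hn
  · exact le_rfl
  · have : NeZero n := ⟨hn.ne'⟩
    have := ZMod.natAbs_min_of_le_div_two n (k : ZMod n).valMinAbs k (by simp)
      (ZMod.natAbs_valMinAbs_le _)
    exact this

lemma absMin_one_le {n : ℕ} : absMin (1 : ZMod n) ≤ 1 := by
  simpa using absMin_intCast_le (n := n) 1

lemma absMin_add_le {n : ℕ} (a b : ZMod n) : absMin (a + b) ≤ absMin a + absMin b := by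
  have h := absMin_intCast_le (n := n) (a.valMinAbs + b.valMinAbs)
  push_cast [ZMod.coe_valMinAbs] at h
  exact h.trans (abs_add_le _ _)

/-- Minkowski's inequality, for nonnegative vectors satisfying a componentwise triangle
inequality. -/
lemma sqrt_sum_sq_le {ι : Type*} [Fintype ι] (a b c : ι → ℝ) (hc : ∀ i, 0 ≤ c i)
    (h : ∀ i, c i ≤ a i + b i) :
    √(∑ i, c i ^ 2) ≤ √(∑ i, a i ^ 2) + √(∑ i, b i ^ 2) := by
  have h1 := norm_add_le (WithLp.toLp 2 a) (WithLp.toLp 2 b)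
  simp only [EuclideanSpace.norm_eq, PiLp.add_apply, Real.norm_eq_abs, sq_abs] at h1
  refine le_trans (Real.sqrt_le_sqrt (Finset.sum_le_sum fun i _ => ?_)) h1
  exact pow_le_pow_left₀ (hc i) (h i) 2

/-- `d` is a pseudometric (as an unbundled real valued function). -/
structure IsPseudoDist {X : Type*} (d : X → X → ℝ) : Prop where
  self : ∀ x, d x x = 0
  symm : ∀ x y, d x y = d y x
  triangle : ∀ x y z, d x z ≤ d x y + d y z

lemma IsPseudoDist.nonneg {X : Type*} {d : X → X → ℝ} (h : IsPseudoDist d) (x y : X) :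
    0 ≤ d x y := by
  have := h.triangle x y x
  rw [h.self, h.symm y x] at this; linarith

lemma isPseudoDist_spDist {L : ℕ} : IsPseudoDist (spDist (L := L)) where
  self x := by simp [spDist]
  symm x y := by
    unfold spDist; congr 2; ext i; rw [← absMin_neg, neg_sub]
  triangle x y z := by
    refine sqrt_sum_sq_le _ _ _ (fun i => absMin_nonneg _) fun i => ?_
    refine le_trans (le_of_eq ?_) (absMin_add_le _ _); congr 1; ring

lemma stDist_eq_sqrt_option {Lt L : ℕ} (x y : STLat Lt L) :
    stDist x y = √(∑ i : Option (Fin 3), (i.elim (absMin (x.1 - y.1))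
      (fun j => absMin (x.2 j - y.2 j))) ^ 2) := by
  simp [stDist, Fintype.sum_option]

lemma isPseudoDist_stDist {Lt L : ℕ} : IsPseudoDist (stDist (Lt := Lt) (L := L)) where
  self x := by simp [stDist]
  symm x y := by
    unfold stDist
    have h : ∀ {n : ℕ} (a b : ZMod n), absMin (a - b) = absMin (b - a) := fun a b => by
      rw [← absMin_neg, neg_sub]
    simp only [h (x.1), h (x.2 _)]
  triangle x y z := by
    simp only [stDist_eq_sqrt_option]
    refine sqrt_sum_sq_le _ _ _ (fun i => ?_) fun i => ?_
    · cases i <;> exact absMin_nonneg _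
    · cases i <;>
        (refine le_trans (le_of_eq ?_) (absMin_add_le _ _); dsimp only [Option.elim]; congr 1; ring)

lemma spDist_nonneg {L : ℕ} (x y : Sp L) : 0 ≤ spDist x y := isPseudoDist_spDist.nonneg x y

lemma spDist_add_right {L : ℕ} (x y a : Sp L) : spDist (x + a) (y + a) = spDist x y := by
  simp [spDist]

lemma spDist_eq_sub {L : ℕ} (x y : Sp L) : spDist x y = spDist (x - y) 0 := by
  simp [spDist]

lemma absMin_le_spDist {L : ℕ} (x y : Sp L) (i : Fin 3) : absMin (x i - y i) ≤ spDist x y := by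
  unfold spDist
  refine Real.le_sqrt_of_sq_le ?_
  exact Finset.single_le_sum (f := fun i => absMin (x i - y i) ^ 2)
    (fun i _ => sq_nonneg _) (Finset.mem_univ i)

lemma spDist_le_of_absMin_le {L M : ℕ} {x y : Sp L} {x' y' : Sp M}
    (h : ∀ i, absMin (x i - y i) ≤ absMin (x' i - y' i)) : spDist x y ≤ spDist x' y' :=
  Real.sqrt_le_sqrt (Finset.sum_le_sum fun i _ => pow_le_pow_left₀ (absMin_nonneg _) (h i) 2)

lemma spDist_add_spUnit_le {L : ℕ} (x : Sp L) (j : Fin 3) : spDist (x + spUnit j) x ≤ 1 := by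
  unfold spDist
  rw [Real.sqrt_le_one]
  rw [Finset.sum_eq_single j]
  · simp only [spUnit, Pi.add_apply, Pi.single_eq_same, add_sub_cancel_left]
    have := absMin_one_le (n := L)
    have h0 := absMin_nonneg (1 : ZMod L)
    nlinarith
  · intro i _ hi; simp [spUnit, hi]
  · simp

@[simp] lemma stDist_same_time {Lt L : ℕ} (n : ZMod Lt) (x y : Sp L) :
    stDist (Lt := Lt) (n, x) (n, y) = spDist x y := by
  simp [stDist, spDist]

@[simp] lemma stDist_same_space {Lt L : ℕ} (n n' : ZMod Lt) (x : Sp L) :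
    stDist (Lt := Lt) (n, x) (n', x) = absMin (n - n') := by
  simp [stDist, Real.sqrt_sq (absMin_nonneg _)]

lemma stDist_le {Lt L : ℕ} (x y : STLat Lt L) :
    stDist x y ≤ absMin (x.1 - y.1) + spDist x.2 y.2 := by
  refine (isPseudoDist_stDist.triangle x (y.1, x.2) y).trans (le_of_eq ?_)
  rw [← stDist_same_time y.1 x.2 y.2, ← stDist_same_space x.1 y.1 x.2]

/-! ### Tree length -/

section Tree
variable {X ι : Type*} {d : X → X → ℝ}

open Classical in
/-- Twice the total edge length of the image of a finite graph in `X`. -/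
def graphSum {W : Type*} [Fintype W] (d : X → X → ℝ) (G : SimpleGraph W) (f : W → X) : ℝ :=
  ∑ a, ∑ b, if G.Adj a b then d (f a) (f b) else 0

lemma graphSum_nonneg {W : Type*} [Fintype W] (hd : IsPseudoDist d) (G : SimpleGraph W)
    (f : W → X) : 0 ≤ graphSum d G f :=
  Finset.sum_nonneg fun a _ => Finset.sum_nonneg fun b _ => by
    split_ifs
    exacts [hd.nonneg _ _, le_rfl]

lemma treeLength_bddBelow (hd : IsPseudoDist d) (u : ι → X) :
    BddBelow {ℓ : ℝ | ∃ (V : Finset X) (G : SimpleGraph V), G.IsTree ∧ (∀ i, u i ∈ V) ∧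
      ℓ = (1 / 2) * graphSum d G Subtype.val} := by
  refine ⟨0, ?_⟩
  rintro ℓ ⟨V, G, -, -, rfl⟩
  have := graphSum_nonneg hd G Subtype.val
  positivity

lemma treeLength_eq (u : ι → X) : treeLength d u =
    sInf {ℓ : ℝ | ∃ (V : Finset X) (G : SimpleGraph V), G.IsTree ∧ (∀ i, u i ∈ V) ∧
      ℓ = (1 / 2) * graphSum d G Subtype.val} := rfl

open Classical in
/-- A connected graph that passes through all the points bounds the tree length, as its image in
`X` has a spanning tree. -/
lemma exists_tree_le_of_connected {W : Type*} [Fintype W] (hd : IsPseudoDist d)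
    {G : SimpleGraph W} (hG : G.Connected) (f : W → X) (u : ι → X) (hu : ∀ i, ∃ w, f w = u i) :
    ∃ (V : Finset X) (T : SimpleGraph V), T.IsTree ∧ (∀ i, u i ∈ V) ∧
      (1 / 2) * graphSum d T Subtype.val ≤ (1 / 2) * graphSum d G f := by
  set V : Finset X := Finset.univ.image f
  have hV : ∀ w, f w ∈ V := fun w => Finset.mem_image_of_mem f (Finset.mem_univ w)
  let G' : SimpleGraph V :=
    { Adj := fun a b => a ≠ b ∧ ∃ w w', G.Adj w w' ∧ f w = a ∧ f w' = b
      symm := ⟨fun a b ⟨h, w, w', h1, h2, h3⟩ => ⟨h.symm, w', w, h1.symm, h3, h2⟩⟩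
      loopless := ⟨fun a h => h.1 rfl⟩ }
  have hreach : ∀ w w' (p : G.Walk w w'), G'.Reachable ⟨f w, hV w⟩ ⟨f w', hV w'⟩ := by
    intro w w' p
    induction p with
    | nil => exact SimpleGraph.Reachable.refl _
    | @cons a b c hab p ih =>
      by_cases hf : f a = f b
      · have : (⟨f a, hV a⟩ : V) = ⟨f b, hV b⟩ := Subtype.ext hf
        rw [this]; exact ih
      · refine SimpleGraph.Reachable.trans (SimpleGraph.Adj.reachable ?_) ih
        exact ⟨fun h => hf (congrArg Subtype.val h), a, b, hab, rfl, rfl⟩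
  obtain ⟨w0⟩ := hG.nonempty
  have : Nonempty V := ⟨⟨f w0, hV w0⟩⟩
  have hG' : G'.Connected := by
    refine SimpleGraph.Connected.mk ?_
    rintro ⟨a, ha⟩ ⟨b, hb⟩
    obtain ⟨w, -, rfl⟩ := Finset.mem_image.1 ha
    obtain ⟨w', -, rfl⟩ := Finset.mem_image.1 hb
    obtain ⟨p⟩ := hG.preconnected w w'
    exact hreach w w' p
  obtain ⟨T, hT, hTree⟩ := hG'.exists_isTree_le
  refine ⟨V, T, hTree, fun i => ?_, ?_⟩
  · obtain ⟨w, hw⟩ := hu i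
    rw [← hw]; exact hV w
  · gcongr
    -- an edge of `T` is the image of at least one edge of `G`
    have key : ∀ a b : V, (if T.Adj a b then d a b else 0) ≤
        ∑ w, ∑ w', if f w = a ∧ f w' = b then (if G.Adj w w' then d (f w) (f w') else 0)
          else 0 := by
      intro a b
      have hnn : ∀ w w', 0 ≤ (if f w = a ∧ f w' = b then
          (if G.Adj w w' then d (f w) (f w') else 0) else 0 : ℝ) := by
        intro w w'; split_ifs
        exacts [hd.nonneg _ _, le_rfl, le_rfl]
      split_ifs with h
      · obtain ⟨-, w, w', h1, h2, h3⟩ := hT h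
        refine le_trans ?_ (Finset.single_le_sum (fun w _ => Finset.sum_nonneg fun w' _ => hnn w w')
          (Finset.mem_univ w))
        refine le_trans ?_ (Finset.single_le_sum (fun w' _ => hnn w w') (Finset.mem_univ w'))
        simp [h1, h2, h3]
      · exact Finset.sum_nonneg fun w _ => Finset.sum_nonneg fun w' _ => hnn w w'
    calc graphSum d T Subtype.val ≤ ∑ a : V, ∑ b : V, ∑ w, ∑ w',
          if f w = a ∧ f w' = b then (if G.Adj w w' then d (f w) (f w') else 0) else 0 :=
          Finset.sum_le_sum fun a _ => Finset.sum_le_sum fun b _ => key a b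
      _ = ∑ w, ∑ w', ∑ a : V, ∑ b : V,
          if f w = a ∧ f w' = b then (if G.Adj w w' then d (f w) (f w') else 0) else 0 := by
          simp_rw [Finset.sum_comm (s := (Finset.univ : Finset V)) (t := (Finset.univ : Finset W))]
      _ = graphSum d G f := by
          refine Finset.sum_congr rfl fun w _ => Finset.sum_congr rfl fun w' _ => ?_
          rw [Finset.sum_eq_single ⟨f w, hV w⟩, Finset.sum_eq_single ⟨f w', hV w'⟩]
          · simp
          · intro b _ hb
            rw [if_neg]; rintro ⟨-, h⟩; exact hb (Subtype.ext h.symm)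
          · simp
          · intro a _ ha
            refine Finset.sum_eq_zero fun b _ => ?_
            rw [if_neg]; rintro ⟨h, -⟩; exact ha (Subtype.ext h.symm)
          · simp

lemma treeLength_le_of_connected {W : Type*} [Fintype W] (hd : IsPseudoDist d)
    {G : SimpleGraph W} (hG : G.Connected) (f : W → X) (u : ι → X) (hu : ∀ i, ∃ w, f w = u i) :
    treeLength d u ≤ (1 / 2) * graphSum d G f := by
  obtain ⟨V, T, hT, hV, hle⟩ := exists_tree_le_of_connected hd hG f u hu
  exact (csInf_le (treeLength_bddBelow hd u) ⟨V, T, hT, hV, rfl⟩).trans hle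

/-- The complete graph on the given points has a spanning tree, so the infimum in the definition of
the tree length is over a nonempty set. -/
lemma exists_tree [Finite ι] [Nonempty X] (u : ι → X) :
    ∃ (V : Finset X) (G : SimpleGraph V), G.IsTree ∧ (∀ i, u i ∈ V) := by
  classical
  have := Fintype.ofFinite ι
  obtain ⟨x⟩ := ‹Nonempty X›
  let V : Finset X := insert x (Finset.univ.image u)
  have : Nonempty V := ⟨⟨x, Finset.mem_insert_self _ _⟩⟩
  obtain ⟨T, -, hT⟩ := (SimpleGraph.connected_top (V := V)).exists_isTree_le
  exact ⟨V, T, hT,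
    fun i => Finset.mem_insert_of_mem (Finset.mem_image_of_mem u (Finset.mem_univ i))⟩

/-- Moving a configuration along an isometric embedding `g` and then displacing its points costs at
most the sum of the displacements: attach every displaced point as a leaf to the point it comes
from. -/
lemma treeLength_le_add_sum {Y : Type*} {d' : Y → Y → ℝ} [Fintype ι] [Nonempty Y]
    (hd : IsPseudoDist d) (g : Y → X) (hg : ∀ a b, d (g a) (g b) = d' a b)
    (u : ι → Y) (w : ι → X) :
    treeLength d w ≤ treeLength d' u + ∑ i, d (g (u i)) (w i) := by
  classical
  rw [← sub_le_iff_le_add]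
  rw [treeLength_eq (d := d') u]
  have hne : {ℓ : ℝ | ∃ (V : Finset Y) (G : SimpleGraph V), G.IsTree ∧ (∀ i, u i ∈ V) ∧
      ℓ = (1 / 2) * graphSum d' G Subtype.val}.Nonempty := by
    obtain ⟨V, G, h1, h2⟩ := exists_tree u
    exact ⟨_, V, G, h1, h2, rfl⟩
  refine le_csInf hne ?_
  rintro ℓ ⟨V, G, hG, hV, rfl⟩
  rw [sub_le_iff_le_add]
  -- the tree `G`, with the leaf `inr i` attached to the vertex `u i`
  let adj : V ⊕ ι → V ⊕ ι → Prop
    | .inl a, .inl b => G.Adj a b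
    | .inl a, .inr i => (a : Y) = u i
    | .inr i, .inl a => (a : Y) = u i
    | .inr _, .inr _ => False
  let G' : SimpleGraph (V ⊕ ι) :=
    { Adj := adj
      symm := ⟨by
        rintro (a | i) (b | j) h
        · exact SimpleGraph.Adj.symm h
        · exact h
        · exact h
        · exact h⟩
      loopless := ⟨by
        rintro (a | i) h
        · exact G.irrefl h
        · exact h⟩ }
  have hl : ∀ a b : V, G'.Reachable (.inl a) (.inl b) := by
    intro a b
    obtain ⟨p⟩ := hG.connected.preconnected a b
    induction p with
    | nil => exact SimpleGraph.Reachable.refl _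
    | @cons a b c hab p ih => exact (SimpleGraph.Adj.reachable (G := G') hab).trans ih
  have hr : ∀ i, G'.Reachable (.inl ⟨u i, hV i⟩) (.inr i) := fun i =>
    SimpleGraph.Adj.reachable (show G'.Adj (.inl ⟨u i, hV i⟩) (.inr i) from rfl)
  obtain ⟨v0⟩ := hG.connected.nonempty
  have h0 : ∀ z, G'.Reachable (.inl v0) z := by
    rintro (a | i)
    · exact hl _ _
    · exact (hl _ _).trans (hr i)
  have : Nonempty (V ⊕ ι) := ⟨.inl v0⟩
  have hconn : G'.Connected := SimpleGraph.Connected.mk fun a b => (h0 a).symm.trans (h0 b)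
  refine (treeLength_le_of_connected hd hconn (Sum.elim (fun a => g a) w) w
    fun i => ⟨.inr i, rfl⟩).trans (le_of_eq ?_)
  -- every leaf has exactly one neighbour
  have e1 : ∀ (a : V), (∑ i, if (a : Y) = u i then d (g a) (w i) else 0)
      = ∑ i, if a = ⟨u i, hV i⟩ then d (g (u i)) (w i) else 0 := by
    intro a
    refine Finset.sum_congr rfl fun i _ => ?_
    by_cases h : (a : Y) = u i
    · rw [if_pos h, if_pos (Subtype.ext h), h]
    · rw [if_neg h, if_neg (fun h' => h (congrArg Subtype.val h'))]
  have e2 : ∑ a : V, ∑ i, (if (a : Y) = u i then d (g a) (w i) else 0)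
      = ∑ i, d (g (u i)) (w i) := by
    simp_rw [e1]; rw [Finset.sum_comm]; simp
  have e3 : ∑ i, ∑ a : V, (if (a : Y) = u i then d (w i) (g a) else 0)
      = ∑ i, d (g (u i)) (w i) := by
    rw [Finset.sum_comm, ← e2]; simp_rw [hd.symm (w _)]
  have : graphSum d G' (Sum.elim (fun a : V => g a) w)
      = graphSum d' G Subtype.val + 2 * ∑ i, d (g (u i)) (w i) := by
    simp only [graphSum, Fintype.sum_sum_type, Sum.elim_inl, Sum.elim_inr, Finset.sum_add_distrib]
    have e4 : ∀ (a b : V) [Decidable (G'.Adj (.inl a) (.inl b))],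
        (if G'.Adj (.inl a) (.inl b) then d (g a) (g b) else 0)
        = if G.Adj a b then d' a b else 0 := fun a b _ => by
      rw [hg]
    have e5 : ∀ (a : V) i [Decidable (G'.Adj (.inl a) (.inr i))],
        (if G'.Adj (.inl a) (.inr i) then d (g a) (w i) else 0)
        = if (a : Y) = u i then d (g a) (w i) else 0 := fun a i _ => if_congr Iff.rfl rfl rfl
    have e6 : ∀ (a : V) i [Decidable (G'.Adj (.inr i) (.inl a))],
        (if G'.Adj (.inr i) (.inl a) then d (w i) (g a) else 0)
        = if (a : Y) = u i then d (w i) (g a) else 0 := fun a i _ => if_congr Iff.rfl rfl rfl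
    have e7 : ∀ i j [Decidable (G'.Adj (.inr i) (.inr j))],
        (if G'.Adj (.inr i) (.inr j) then d (w i) (w j) else 0) = 0 :=
      fun i j _ => if_neg (fun h => h)
    simp_rw [e4, e5, e6, e7]
    rw [e2, e3]; simp; ring
  rw [this]; ring

/-- The tree length is at most that of the star with centre `c`: all the points are displaced from
`c`. -/
lemma treeLength_le_star [Fintype ι] (hd : IsPseudoDist d) (c : X) (u : ι → X) :
    treeLength d u ≤ ∑ i, d c (u i) := by
  have h := treeLength_le_add_sum (d' := fun _ _ : Unit => 0) hd (fun _ => c)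
    (fun _ _ => hd.self c) (fun _ : ι => ()) u
  have h0 : treeLength (fun _ _ : Unit => (0 : ℝ)) (fun _ : ι => ()) ≤ 0 := by
    have := treeLength_le_of_connected (d := fun _ _ : Unit => (0 : ℝ))
      ⟨fun _ => rfl, fun _ _ => rfl, fun _ _ _ => by simp⟩
      (SimpleGraph.connected_top (V := Unit)) id (fun _ : ι => ()) (fun _ => ⟨(), rfl⟩)
    simpa [graphSum] using this
  linarith

/-- Any two of the points are at most the tree length apart. -/
lemma dist_le_treeLength [Finite ι] (hd : IsPseudoDist d) (u : ι → X) (i j : ι) :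
    d (u i) (u j) ≤ treeLength d u := by
  classical
  have : Nonempty X := ⟨u i⟩
  rw [treeLength_eq]
  refine le_csInf ?_ ?_
  · obtain ⟨V, G, h1, h2⟩ := exists_tree u
    exact ⟨_, V, G, h1, h2, rfl⟩
  rintro ℓ ⟨V, G, hG, hV, rfl⟩
  let wt : Sym2 V → ℝ := Sym2.lift ⟨fun a b => d a b, fun a b => hd.symm a b⟩
  have hwt : ∀ e, 0 ≤ wt e := by
    intro e; induction e with | _ a b => exact hd.nonneg _ _
  have hwalk : ∀ (a b : V) (p : G.Walk a b), d a b ≤ (p.edges.map wt).sum := by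
    intro a b p
    induction p with
    | nil => simp [hd.self]
    | @cons a b c hab p ih =>
      simp only [SimpleGraph.Walk.edges_cons, List.map_cons, List.sum_cons]
      exact (hd.triangle _ _ _).trans (by gcongr; exact le_rfl)
  -- a path from `u i` to `u j` uses every edge of the tree at most once
  obtain ⟨p, hp⟩ := hG.connected.exists_isPath ⟨u i, hV i⟩ ⟨u j, hV j⟩
  refine (hwalk _ _ p).trans ?_
  have h1 : (p.edges.map wt).sum = ∑ e ∈ p.edges.toFinset, wt e := by
    rw [List.sum_toFinset _ hp.isTrail.edges_nodup]
  have h2 : ∑ e ∈ p.edges.toFinset, wt e ≤ ∑ e ∈ G.edgeFinset, wt e := by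
    refine Finset.sum_le_sum_of_subset_of_nonneg ?_ fun e _ _ => hwt e
    intro e he
    exact SimpleGraph.mem_edgeFinset.2 (p.edges_subset_edgeSet (List.mem_toFinset.1 he))
  -- `graphSum` counts every edge with both orientations
  have h3 : graphSum d G Subtype.val = 2 * ∑ e ∈ G.edgeFinset, wt e := by
    have e1 : graphSum d G Subtype.val = ∑ q : V × V with G.Adj q.1 q.2, wt s(q.1, q.2) := by
      rw [Finset.sum_filter, Fintype.sum_prod_type]
      rfl
    rw [e1, Finset.mul_sum]
    rw [← Finset.sum_fiberwise_of_maps_to (t := G.edgeFinset) (g := fun q : V × V => s(q.1, q.2))]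
    · refine Finset.sum_congr rfl fun e he => ?_
      induction e with | _ a b =>
      have hab : G.Adj a b := by simpa using he
      have : ({q ∈ ({q : V × V | G.Adj q.1 q.2} : Finset (V × V)) | s(q.1, q.2) = s(a, b)})
          = {(a, b), (b, a)} := by
        ext ⟨x, y⟩
        simp only [Finset.mem_filter, Finset.mem_univ, true_and, Sym2.eq_iff, Finset.mem_insert,
          Finset.mem_singleton, Prod.mk.injEq]
        constructor
        · rintro ⟨-, h⟩; exact h
        · rintro (⟨rfl, rfl⟩ | ⟨rfl, rfl⟩)
          exacts [⟨hab, .inl ⟨rfl, rfl⟩⟩, ⟨hab.symm, .inr ⟨rfl, rfl⟩⟩]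
      rw [this, Finset.sum_pair]
      · rw [Sym2.eq_swap (a := b)]; ring
      · intro h; exact hab.ne (Prod.ext_iff.1 h).1
    · rintro ⟨x, y⟩ h; simpa using h
  rw [h1, h3]; linarith

lemma treeLength_nonneg (hd : IsPseudoDist d) (u : ι → X) : 0 ≤ treeLength d u := by
  rw [treeLength_eq]
  refine Real.sInf_nonneg ?_
  rintro ℓ ⟨V, G, -, -, rfl⟩
  have := graphSum_nonneg hd G Subtype.val
  positivity

end Tree

/-! ### Uniqueness of the kernels of a power series -/

lemma prod_sigma_fst {S M : Type*} [Fintype S] [CommMonoid M] (r : S → ℕ) (c : S → M) :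
    ∏ q : (s : S) × Fin (r s), c q.1 = ∏ s, c s ^ r s := by
  rw [Fintype.prod_sigma]
  simp

/-- A power series that vanishes for small positive arguments has vanishing coefficients: divided by
the power of its first nonvanishing term, it tends to that coefficient at `0`. -/
lemma coeff_eq_zero_of_tsum_eq_zero (a : ℕ → ℂ) (ha : Summable fun n => ‖a n‖)
    (h : ∀ t : ℝ, 0 < t → t ≤ 1 → ∑' n, a n * (t : ℂ) ^ n = 0) : ∀ n, a n = 0 := by
  by_contra hne
  push Not at hne
  classical
  set n := Nat.find hne with hn
  have hn0 : a n ≠ 0 := Nat.find_spec hne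
  have hlt : ∀ k < n, a k = 0 := fun k hk => by
    have := Nat.find_min hne hk; simpa using this
  have hsum : Summable fun k => ‖a (k + n)‖ := (summable_nat_add_iff n).2 ha
  set g : ℝ → ℂ := fun t => ∑' k, a (k + n) * (t : ℂ) ^ k with hg
  have hcont : ContinuousOn g (Set.Icc 0 1) := by
    refine continuousOn_tsum (fun k => ?_) hsum fun k t ht => ?_
    · fun_prop
    · rw [norm_mul, norm_pow, Complex.norm_real, Real.norm_eq_abs, abs_of_nonneg ht.1]
      exact mul_le_of_le_one_right (norm_nonneg _) (pow_le_one₀ ht.1 ht.2)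
  have hzero : ∀ t ∈ Set.Ioc (0 : ℝ) 1, g t = 0 := by
    intro t ht
    have hs : Summable fun k => a k * (t : ℂ) ^ k := by
      refine Summable.of_norm_bounded ha fun k => ?_
      rw [norm_mul, norm_pow, Complex.norm_real, Real.norm_eq_abs, abs_of_nonneg ht.1.le]
      exact mul_le_of_le_one_right (norm_nonneg _) (pow_le_one₀ ht.1.le ht.2)
    have h1 := h t ht.1 ht.2
    rw [← hs.sum_add_tsum_nat_add n, Finset.sum_eq_zero, zero_add] at h1
    · have h2 : ∑' k, a (k + n) * (t : ℂ) ^ (k + n) = g t * (t : ℂ) ^ n := by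
        rw [hg, ← tsum_mul_right]
        congr 1; ext k; ring
      rw [h2] at h1
      rcases mul_eq_zero.1 h1 with h3 | h3
      · exact h3
      · exact absurd h3 (pow_ne_zero n (by exact_mod_cast ht.1.ne'))
    · intro k hk
      rw [hlt k (Finset.mem_range.1 hk), zero_mul]
  have hlim : Filter.Tendsto g (nhdsWithin 0 (Set.Ioc 0 1)) (nhds (g 0)) :=
    (hcont 0 (by simp)).mono_left (nhdsWithin_mono _ Set.Ioc_subset_Icc_self)
  have hlim0 : Filter.Tendsto g (nhdsWithin 0 (Set.Ioc 0 1)) (nhds 0) := by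
    refine tendsto_const_nhds.congr' ?_
    filter_upwards [self_mem_nhdsWithin] with t ht
    exact (hzero t ht).symm
  have hb : (nhdsWithin (0 : ℝ) (Set.Ioc 0 1)).NeBot := by
    rw [nhdsWithin_Ioc_eq_nhdsGT one_pos]; infer_instance
  have h0 : g 0 = a n := by
    rw [hg]
    dsimp only
    rw [tsum_eq_single 0]
    · simp
    · intro k hk; simp [hk]
  exact hn0 (h0 ▸ tendsto_nhds_unique hlim hlim0)

/-- A double power series that vanishes for small positive arguments has vanishing
coefficients. -/
lemma coeff₂_eq_zero_of_tsum_eq_zero (a : (Fin 2 → ℕ) → ℂ) (ha : Summable fun r => ‖a r‖)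
    (h : ∀ s t : ℝ, 0 < s → s ≤ 1 → 0 < t → t ≤ 1 →
      ∑' r, a r * (s : ℂ) ^ r 0 * (t : ℂ) ^ r 1 = 0) : ∀ r, a r = 0 := by
  let e : ℕ × ℕ ≃ (Fin 2 → ℕ) := (finTwoArrowEquiv ℕ).symm
  have he : Summable fun p : ℕ × ℕ => ‖a (e p)‖ := (e.summable_iff (f := fun r => ‖a r‖)).2 ha
  have hnn : ∀ p : ℕ × ℕ, 0 ≤ ‖a (e p)‖ := fun p => norm_nonneg _
  have hrow := (summable_prod_of_nonneg hnn).1 he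
  have e0 : ∀ i j, e (i, j) 0 = i := fun i j => rfl
  have e1 : ∀ i j, e (i, j) 1 = j := fun i j => rfl
  have bound : ∀ (t : ℝ), 0 < t → t ≤ 1 → ∀ (z : ℂ) n, ‖z * (t : ℂ) ^ n‖ ≤ ‖z‖ := by
    intro t h0 h1 z n
    rw [norm_mul, norm_pow, Complex.norm_real, Real.norm_eq_abs, abs_of_nonneg h0.le]
    exact mul_le_of_le_one_right (norm_nonneg _) (pow_le_one₀ h0.le h1)
  -- apply the statement for one variable to the first argument and then to the second one
  have key : ∀ t : ℝ, 0 < t → t ≤ 1 → ∀ i, ∑' j, a (e (i, j)) * (t : ℂ) ^ j = 0 := by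
    intro t ht0 ht1
    have hrow' : ∀ i, Summable fun j => ‖a (e (i, j)) * (t : ℂ) ^ j‖ := fun i =>
      Summable.of_nonneg_of_le (fun _ => norm_nonneg _) (fun j => bound t ht0 ht1 _ j) (hrow.1 i)
    refine coeff_eq_zero_of_tsum_eq_zero _ ?_ fun s hs0 hs1 => ?_
    · refine Summable.of_nonneg_of_le (fun _ => norm_nonneg _) (fun i => ?_) hrow.2
      exact (norm_tsum_le_tsum_norm (hrow' i)).trans
        ((hrow' i).tsum_le_tsum (fun j => bound t ht0 ht1 _ j) (hrow.1 i))
    · have h1 := h s t hs0 hs1 ht0 ht1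
      rw [← e.tsum_eq] at h1
      have hs : Summable fun p : ℕ × ℕ =>
          a (e p) * (s : ℂ) ^ (e p) 0 * (t : ℂ) ^ (e p) 1 :=
        Summable.of_norm_bounded he fun p =>
          (bound t ht0 ht1 _ _).trans (bound s hs0 hs1 _ _)
      rw [hs.tsum_prod] at h1
      rw [← h1]
      refine tsum_congr fun i => ?_
      rw [← tsum_mul_right]
      refine tsum_congr fun j => ?_
      rw [e0, e1]; ring
  intro r
  have hr : r = e (r 0, r 1) := by
    ext i; fin_cases i <;> rfl
  rw [hr]
  exact coeff_eq_zero_of_tsum_eq_zero (fun j => a (e (r 0, j))) (hrow.1 _)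
    (fun t h0 h1 => key t h0 h1 _) _

/-- A symmetric kernel whose monomial vanishes identically is zero. -/
lemma kernel_eq_zero_of_monomial_eq_zero {S X : Type*} [Fintype S] [DecidableEq S] [Fintype X]
    (r : S → ℕ)
    (f : (((s : S) × Fin (r s)) → X) → ℝ)
    (hsymm : ∀ (p : (s : S) → Equiv.Perm (Fin (r s))) (x : ((s : S) × Fin (r s)) → X),
      f (fun q => x ⟨q.1, p q.1 q.2⟩) = f x)
    (h : ∀ φ : S → X → ℂ, ∑ x, (f x : ℂ) * ∏ q, φ q.1 (x q) = 0) : f = 0 := by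
  classical
  -- the content of a configuration: how often each point occurs as an argument of each field
  let e : (((s : S) × Fin (r s)) → X) → (S × X →₀ ℕ) :=
    fun x => ∑ q, Finsupp.single (q.1, x q) 1
  -- the monomial as a polynomial in the values of the fields
  let P : MvPolynomial (S × X) ℂ := ∑ x, MvPolynomial.monomial (e x) (f x : ℂ)
  have hP : P = 0 := by
    refine MvPolynomial.funext fun v => ?_
    rw [map_zero, ← h fun s y => v (s, y), map_sum]
    refine Finset.sum_congr rfl fun x _ => ?_
    have h1 : MvPolynomial.monomial (e x) (f x : ℂ)
        = MvPolynomial.C (f x : ℂ) * ∏ q, MvPolynomial.X (q.1, x q) := by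
      rw [← mul_one (f x : ℂ), ← MvPolynomial.C_mul_monomial, MvPolynomial.monomial_sum_one,
          mul_one]
      rfl
    rw [h1, map_mul, MvPolynomial.eval_C, map_prod]
    simp
  funext x0
  have hc : MvPolynomial.coeff (e x0) P = 0 := by rw [hP]; simp
  -- configurations with the same content differ by a permutation in each field
  have hperm : ∀ x, e x = e x0 → f x = f x0 := by
    intro x hx
    have hs : ∀ s, ∃ p : Equiv.Perm (Fin (r s)), ∀ k, x ⟨s, k⟩ = x0 ⟨s, p k⟩ := by
      intro s
      have hy : ∀ (z : ((s : S) × Fin (r s)) → X) y,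
          e z (s, y) = Fintype.card {k // z ⟨s, k⟩ = y} := by
        intro z y
        simp only [e, Finsupp.finsetSum_apply, Finsupp.single_apply, Prod.mk.injEq]
        rw [Fintype.sum_sigma, Finset.sum_eq_single s]
        · simp only [true_and, Finset.sum_boole, Nat.cast_id, Fintype.card_subtype]
        · intro s' _ hs'; simp [hs']
        · simp
      let p : Equiv.Perm (Fin (r s)) := Equiv.ofFiberEquiv
        (f := fun k => x ⟨s, k⟩) (g := fun k => x0 ⟨s, k⟩)
        fun y => Fintype.equivOfCardEq (by rw [← hy, ← hy, hx])
      exact ⟨p, fun k => (Equiv.ofFiberEquiv_map (f := fun k => x ⟨s, k⟩)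
          (g := fun k => x0 ⟨s, k⟩) _ k).symm⟩
    choose p hp using hs
    have : x = fun q => x0 ⟨q.1, p q.1 q.2⟩ := by
      funext ⟨s, k⟩; exact hp s k
    rw [this, hsymm]
  simp only [P, MvPolynomial.coeff_sum, MvPolynomial.coeff_monomial] at hc
  -- hence the coefficient of this content in `P` is a positive multiple of `f x0`
  have hc' : ∑ x, (if e x = e x0 then (f x : ℂ) else 0)
      = ((Finset.univ.filter fun x => e x = e x0).card : ℂ) * f x0 := by
    rw [← Finset.sum_filter, Finset.sum_congr rfl (g := fun _ => (f x0 : ℂ)), Finset.sum_const,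
      nsmul_eq_mul]
    intro x hx
    rw [hperm x (Finset.mem_filter.1 hx).2]
  rw [hc'] at hc
  rcases mul_eq_zero.1 hc with h0 | h0
  · exfalso
    have : (Finset.univ.filter fun x => e x = e x0).card ≠ 0 :=
      Finset.card_ne_zero.2 ⟨x0, by simp⟩
    exact this (by exact_mod_cast h0)
  · simpa using h0

/-! ### Homogeneous parts of a power series -/

namespace FieldSeries

variable {S X : Type*} [Fintype S] [DecidableEq S] [Fintype X]

/-- The homogeneous part of multidegree `r` of the function given by a power series. -/
def hom (F : FieldSeries S X) (r : S → ℕ) (φ : S → X → ℂ) : ℂ :=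
  ∑ x : ((s : S) × Fin (r s)) → X, (F r x : ℂ) * ∏ q, φ q.1 (x q)

/-- The sum of the absolute values of all the entries of a kernel. -/
def absSum (F : FieldSeries S X) (r : S → ℕ) : ℝ := ∑ x, |F r x|

lemma absSum_nonneg (F : FieldSeries S X) (r : S → ℕ) : 0 ≤ F.absSum r :=
  Finset.sum_nonneg fun _ _ => abs_nonneg _

lemma eval_eq_tsum_hom (F : FieldSeries S X) (φ : S → X → ℂ) : F.eval φ = ∑' r, F.hom r φ := rfl

lemma sum_abs_mul_prod_le (F : FieldSeries S X) (r : S → ℕ) {φ : S → X → ℂ} {κ : S → ℝ}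
    (hφ : ∀ s x, ‖φ s x‖ ≤ κ s) :
    ∑ x, |F r x| * ∏ q, ‖φ q.1 (x q)‖ ≤ F.absSum r * ∏ s, κ s ^ r s := by
  rw [absSum, Finset.sum_mul, ← prod_sigma_fst]
  refine Finset.sum_le_sum fun x _ => mul_le_mul_of_nonneg_left ?_ (abs_nonneg _)
  exact Finset.prod_le_prod (fun _ _ => norm_nonneg _) fun q _ => hφ _ _

lemma norm_hom_le (F : FieldSeries S X) (r : S → ℕ) {φ : S → X → ℂ} {κ : S → ℝ}
    (hφ : ∀ s x, ‖φ s x‖ ≤ κ s) : ‖F.hom r φ‖ ≤ F.absSum r * ∏ s, κ s ^ r s := by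
  refine le_trans ((norm_sum_le _ _).trans (le_of_eq ?_)) (F.sum_abs_mul_prod_le r hφ)
  refine Finset.sum_congr rfl fun x _ => ?_
  rw [norm_mul, norm_prod, Complex.norm_real, Real.norm_eq_abs]

lemma hom_smul (F : FieldSeries S X) (r : S → ℕ) (c : S → ℂ) (φ : S → X → ℂ) :
    F.hom r (fun s => c s • φ s) = (∏ s, c s ^ r s) * F.hom r φ := by
  rw [hom, hom, Finset.mul_sum, ← prod_sigma_fst]
  refine Finset.sum_congr rfl fun x _ => ?_
  simp only [Pi.smul_apply, smul_eq_mul, Finset.prod_mul_distrib]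
  ring

lemma summable_hom {F : FieldSeries S X} {κ : S → ℝ}
    (hF : Summable fun r => F.absSum r * ∏ s, κ s ^ r s) {φ : S → X → ℂ}
    (hφ : ∀ s x, ‖φ s x‖ ≤ κ s) : Summable fun r => ‖F.hom r φ‖ :=
  Summable.of_nonneg_of_le (fun _ => norm_nonneg _) (fun r => F.norm_hom_le r hφ) hF

lemma conj_hom (F : FieldSeries S X) (r : S → ℕ) (φ : S → X → ℂ) :
    conj (F.hom r φ) = F.hom r (star φ) := by
  simp [hom, map_sum]

lemma conj_eval (F : FieldSeries S X) (φ : S → X → ℂ) : conj (F.eval φ) = F.eval (star φ) := by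
  rw [eval_eq_tsum_hom, eval_eq_tsum_hom, Complex.conj_tsum]
  exact tsum_congr fun r => F.conj_hom r φ

/-- Relabelling the points. -/
lemma hom_comp_equiv (F : FieldSeries S X) (e : X ≃ X) (r : S → ℕ) (φ : S → X → ℂ) :
    hom (fun r x => F r (fun q => e (x q))) r φ = F.hom r (fun s y => φ s (e.symm y)) := by
  unfold hom
  refine Fintype.sum_equiv (Equiv.arrowCongr (Equiv.refl _) e) _ _ fun x => ?_
  change _ = (F r (fun q => e (x q)) : ℂ) * ∏ q, φ q.1 (e.symm (e (x q)))
  simp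

lemma absSum_comp_equiv (F : FieldSeries S X) (e : X ≃ X) (r : S → ℕ) :
    absSum (fun r x => F r (fun q => e (x q))) r = F.absSum r := by
  unfold absSum
  exact Fintype.sum_equiv (Equiv.arrowCongr (Equiv.refl _) e) _ _ fun x => rfl

/-- Exchanging the two fields. -/
def swap (F : FieldSeries (Fin 2) X) : FieldSeries (Fin 2) X :=
  fun r x => F (fun s => r (Fin.rev s)) (fun q => x ⟨Fin.rev q.1, q.2⟩)

/-- The relabelling of arguments that underlies the exchange of the fields. -/
def revArg (r : Fin 2 → ℕ) : ((s : Fin 2) × Fin (r (Fin.rev s))) ≃ ((s : Fin 2) × Fin (r s)) :=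
  Equiv.sigmaCongrLeft (β := fun s => Fin (r s)) Fin.revPerm

lemma hom_swap (F : FieldSeries (Fin 2) X) (r : Fin 2 → ℕ) (φ : Fin 2 → X → ℂ) :
    F.swap.hom r φ = F.hom (fun s => r (Fin.rev s)) (fun s => φ (Fin.rev s)) := by
  unfold hom swap
  refine Fintype.sum_equiv (Equiv.arrowCongr (revArg r).symm (Equiv.refl X)) _ _ fun x => ?_
  have h : ∀ q, (Equiv.arrowCongr (revArg r).symm (Equiv.refl X)) x q = x (revArg r q) :=
    fun q => by simp [Equiv.arrowCongr]
  simp only [h]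
  congr 1
  rw [← (revArg r).prod_comp]
  rfl

lemma absSum_swap (F : FieldSeries (Fin 2) X) (r : Fin 2 → ℕ) :
    F.swap.absSum r = F.absSum (fun s => r (Fin.rev s)) := by
  unfold absSum swap
  exact Fintype.sum_equiv (Equiv.arrowCongr (revArg r).symm (Equiv.refl X)) _ _ fun x => rfl

/-- The involution `r ↦ r ∘ Fin.rev` on multidegrees. -/
def revDeg : (Fin 2 → ℕ) ≃ (Fin 2 → ℕ) := Equiv.arrowCongr Fin.revPerm (Equiv.refl ℕ)

lemma revDeg_apply (r : Fin 2 → ℕ) : revDeg r = fun s => r (Fin.rev s) := rfl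

lemma eval_swap (F : FieldSeries (Fin 2) X) (φ : Fin 2 → X → ℂ) :
    F.swap.eval φ = F.eval (fun s => φ (Fin.rev s)) := by
  rw [eval_eq_tsum_hom, eval_eq_tsum_hom, ← revDeg.tsum_eq]
  refine tsum_congr fun r => ?_
  rw [hom_swap]; simp [revDeg_apply]

/-! ### Power series with the same values -/

lemma coeff_eq_of_tsum_eq {a b : (Fin 2 → ℕ) → ℂ} (ha : Summable fun r => ‖a r‖)
    (hb : Summable fun r => ‖b r‖)
    (h : ∀ s t : ℝ, 0 < s → s ≤ 1 → 0 < t → t ≤ 1 →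
      ∑' r, a r * (s : ℂ) ^ r 0 * (t : ℂ) ^ r 1 = ∑' r, b r * (s : ℂ) ^ r 0 * (t : ℂ) ^ r 1)
    (r : Fin 2 → ℕ) : a r = b r := by
  have hs : ∀ {a : (Fin 2 → ℕ) → ℂ}, (Summable fun r => ‖a r‖) → ∀ s t : ℝ, 0 < s → s ≤ 1 →
      0 < t → t ≤ 1 → Summable fun r => a r * (s : ℂ) ^ r 0 * (t : ℂ) ^ r 1 := by
    intro a ha s t h0 h1 h2 h3
    refine Summable.of_norm_bounded ha fun r => ?_
    simp only [norm_mul, norm_pow, Complex.norm_real, Real.norm_eq_abs, abs_of_nonneg h0.le,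
      abs_of_nonneg h2.le]
    rw [mul_assoc]
    exact mul_le_of_le_one_right (norm_nonneg _)
      (mul_le_one₀ (pow_le_one₀ h0.le h1) (by positivity) (pow_le_one₀ h2.le h3))
  refine sub_eq_zero.1 (coeff₂_eq_zero_of_tsum_eq_zero (fun r => a r - b r) ?_ ?_ r)
  · exact Summable.of_nonneg_of_le (fun _ => norm_nonneg _) (fun r => norm_sub_le _ _) (ha.add hb)
  · intro s t h0 h1 h2 h3
    simp only [sub_mul]
    rw [(hs ha s t h0 h1 h2 h3).tsum_sub (hs hb s t h0 h1 h2 h3), h s t h0 h1 h2 h3, sub_self]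

lemma eval_scaled (F : FieldSeries (Fin 2) X) (φ : Fin 2 → X → ℂ) (s t : ℂ) :
    F.eval (fun i => (![s, t] i) • φ i) = ∑' r, F.hom r φ * s ^ r 0 * t ^ r 1 := by
  rw [eval_eq_tsum_hom]
  refine tsum_congr fun r => ?_
  rw [hom_smul]; simp; ring

/-- Two convergent power series that agree on small fields have the same homogeneous parts. -/
lemma hom_eq_of_eval_eq {F G : FieldSeries (Fin 2) X} {κ : ℝ} (hκ : 0 < κ)
    (hF : Summable fun r => F.absSum r * ∏ s, κ ^ r s)
    (hG : Summable fun r => G.absSum r * ∏ s, κ ^ r s)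
    (h : ∀ φ : Fin 2 → X → ℂ, (∀ s x, ‖φ s x‖ ≤ κ) → F.eval φ = G.eval φ)
    (r : Fin 2 → ℕ) (φ : Fin 2 → X → ℂ) : F.hom r φ = G.hom r φ := by
  -- for small fields, scale the two fields separately and compare the coefficients
  have small : ∀ φ : Fin 2 → X → ℂ, (∀ s x, ‖φ s x‖ ≤ κ) → F.hom r φ = G.hom r φ := by
    intro φ hφ
    refine coeff_eq_of_tsum_eq (summable_hom hF hφ) (summable_hom hG hφ) ?_ r
    intro s t h0 h1 h2 h3
    rw [← eval_scaled, ← eval_scaled]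
    refine h _ fun i x => ?_
    rw [Pi.smul_apply, norm_smul]
    refine le_trans (mul_le_of_le_one_left (norm_nonneg _) ?_) (hφ i x)
    fin_cases i
    · simpa [abs_of_pos h0] using h1
    · simpa [abs_of_pos h2] using h3
  -- arbitrary fields become small after multiplication by a constant
  obtain ⟨B, hB⟩ : ∃ B : ℝ, ∀ s x, ‖φ s x‖ ≤ B := by
    refine ⟨∑ s, ∑ x, ‖φ s x‖, fun s x => ?_⟩
    refine le_trans ?_ (Finset.single_le_sum (f := fun s => ∑ x, ‖φ s x‖)
      (fun s _ => Finset.sum_nonneg fun x _ => norm_nonneg _) (Finset.mem_univ s))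
    exact Finset.single_le_sum (f := fun x => ‖φ s x‖) (fun x _ => norm_nonneg _)
      (Finset.mem_univ x)
  set c : ℝ := κ / (|B| + 1) with hc
  have hB1 : 0 < |B| + 1 := by positivity
  have hc0 : 0 < c := div_pos hκ hB1
  have h1 := small (fun s => (fun _ => (c : ℂ)) s • φ s) fun s x => by
    rw [Pi.smul_apply, norm_smul, Complex.norm_real, Real.norm_eq_abs, abs_of_pos hc0]
    calc c * ‖φ s x‖ ≤ c * (|B| + 1) := by
          gcongr; linarith [hB s x, le_abs_self B]
      _ = κ := by rw [hc]; field_simp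
  rw [hom_smul, hom_smul] at h1
  refine mul_left_cancel₀ ?_ h1
  exact Finset.prod_ne_zero_iff.2 fun s _ => pow_ne_zero _ (by exact_mod_cast hc0.ne')

/-- Two convergent power series with symmetric kernels that agree on small fields have the same
kernels. -/
lemma eq_of_eval_eq {F G : FieldSeries (Fin 2) X} {κ : ℝ} (hκ : 0 < κ)
    (hFs : F.IsSymm) (hGs : G.IsSymm)
    (hF : Summable fun r => F.absSum r * ∏ s, κ ^ r s)
    (hG : Summable fun r => G.absSum r * ∏ s, κ ^ r s)
    (h : ∀ φ : Fin 2 → X → ℂ, (∀ s x, ‖φ s x‖ ≤ κ) → F.eval φ = G.eval φ) : F = G := by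
  funext r
  refine sub_eq_zero.1 (kernel_eq_zero_of_monomial_eq_zero r (F r - G r) ?_ fun φ => ?_)
  · intro p x
    simp only [Pi.sub_apply, hFs r p x, hGs r p x]
  · have := hom_eq_of_eval_eq hκ hF hG h r φ
    simp only [Pi.sub_apply, Complex.ofReal_sub, sub_mul, Finset.sum_sub_distrib]
    exact sub_eq_zero.2 this

end FieldSeries

/-! ### Kernel norms -/

section KernelNorm
variable {X ι : Type*} {d : X → X → ℝ}

lemma kernelNorm_of_nonempty [Nonempty ι] (m : ℝ) (f : (ι → X) → ℝ) :
    kernelNorm d m f = open Classical in ⨆ (i : ι) (u : X), ∑' x : ι → X,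
      if x i = u then ENNReal.ofReal (|f x| * Real.exp (m * treeLength d x)) else 0 := by
  rw [kernelNorm, if_neg (not_isEmpty_iff.2 ‹_›)]

lemma kernelNorm_le [Nonempty ι] {m : ℝ} {f : (ι → X) → ℝ} {B : ℝ≥0∞}
    (h : open Classical in ∀ (i : ι) (u : X), ∑' x : ι → X,
      (if x i = u then ENNReal.ofReal (|f x| * Real.exp (m * treeLength d x)) else 0) ≤ B) :
    kernelNorm d m f ≤ B := by
  rw [kernelNorm_of_nonempty]
  exact iSup_le fun i => iSup_le fun u => h i u

open Classical in
lemma le_kernelNorm (m : ℝ) (f : (ι → X) → ℝ) (i : ι) (u : X) :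
    ∑' x : ι → X, (if x i = u then
      ENNReal.ofReal (|f x| * Real.exp (m * treeLength d x)) else 0) ≤ kernelNorm d m f := by
  have : Nonempty ι := ⟨i⟩
  rw [kernelNorm_of_nonempty]
  exact le_iSup_of_le i (le_iSup_of_le u le_rfl)

@[simp] lemma kernelNorm_zero (m : ℝ) : kernelNorm d m (0 : (ι → X) → ℝ) = 0 := by
  unfold kernelNorm; split_ifs <;> simp

/-- On a finite space, summing over the fixed argument bounds the sum of all the entries. -/
lemma sum_abs_le_card_mul_kernelNorm [Fintype X] [Nonempty X] [Fintype ι] [DecidableEq ι]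
    (hd : IsPseudoDist d) {m : ℝ} (hm : 0 ≤ m) (f : (ι → X) → ℝ) :
    ENNReal.ofReal (∑ x, |f x|) ≤ Fintype.card X * kernelNorm d m f := by
  classical
  rw [ENNReal.ofReal_sum_of_nonneg fun _ _ => abs_nonneg _]
  rcases isEmpty_or_nonempty ι with hι | ⟨⟨i⟩⟩
  · rw [kernelNorm, if_pos hι, tsum_fintype]
    refine le_mul_of_one_le_left zero_le ?_
    exact_mod_cast Fintype.card_pos
  · calc ∑ x, ENNReal.ofReal |f x|
        = ∑ u : X, ∑ x : ι → X, if x i = u then ENNReal.ofReal |f x| else 0 := by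
          rw [Finset.sum_comm]; simp
      _ ≤ ∑ u : X, kernelNorm d m f := by
          refine Finset.sum_le_sum fun u _ => le_trans ?_ (le_kernelNorm m f i u)
          rw [tsum_fintype]
          refine Finset.sum_le_sum fun x _ => ?_
          split_ifs
          · refine ENNReal.ofReal_le_ofReal (le_mul_of_one_le_right (abs_nonneg _) ?_)
            exact Real.one_le_exp (mul_nonneg hm (treeLength_nonneg hd x))
          · exact le_rfl
      _ = _ := by simp

/-- A power series of finite norm converges absolutely on fields bounded by the weights. -/
lemma summable_absSum_of_norm_ne_top {S : Type*} [Fintype S] [DecidableEq S] [Fintype X]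
    [Nonempty X] (hd : IsPseudoDist d) {m : ℝ} (hm : 0 ≤ m) {κ : S → ℝ} (hκ : ∀ s, 0 ≤ κ s)
    {F : FieldSeries S X} (hF : F.norm d m κ ≠ ⊤) :
    Summable fun r => F.absSum r * ∏ s, κ s ^ r s := by
  have hnn : ∀ r, 0 ≤ F.absSum r * ∏ s, κ s ^ r s := fun r =>
    mul_nonneg (F.absSum_nonneg r) (Finset.prod_nonneg fun s _ => pow_nonneg (hκ s) _)
  have h1 : ∑' r, ENNReal.ofReal (F.absSum r * ∏ s, κ s ^ r s)
      ≤ Fintype.card X * F.norm d m κ := by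
    rw [FieldSeries.norm, ← ENNReal.tsum_mul_left]
    refine ENNReal.tsum_le_tsum fun r => ?_
    rw [ENNReal.ofReal_mul (F.absSum_nonneg r), ← mul_assoc,
      ENNReal.ofReal_prod_of_nonneg fun s _ => pow_nonneg (hκ s) _]
    simp_rw [ENNReal.ofReal_pow (hκ _)]
    gcongr
    exact sum_abs_le_card_mul_kernelNorm hd hm (F r)
  have h2 : ∑' r, ENNReal.ofReal (F.absSum r * ∏ s, κ s ^ r s) ≠ ⊤ :=
    ne_top_of_le_ne_top (ENNReal.mul_ne_top (by simp) hF) h1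
  have := ENNReal.summable_toReal h2
  simpa [ENNReal.toReal_ofReal (hnn _)] using this

lemma kernelNorm_mul_le_norm {S : Type*} [Fintype S] (m : ℝ) (κ : S → ℝ) (F : FieldSeries S X)
    (r : S → ℕ) : kernelNorm d m (F r) * ∏ s, ENNReal.ofReal (κ s) ^ r s ≤ F.norm d m κ :=
  ENNReal.le_tsum r

end KernelNorm

/-! ### Symmetries of the kernels -/

/-- The symmetries, on the level of kernels, of a power series on the spatial lattice that is
symmetric in each field and invariant under translations, reflections, `U(1)` and the exchange of
the two fields. -/
structure KernelSymm {L : ℕ} (F : FieldSeries (Fin 2) (Sp L)) : Prop where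
  isSymm : F.IsSymm
  trans : ∀ (a : Sp L) r x, F r (fun q => x q + a) = F r x
  refl : ∀ (j : Fin 3) r x, F r (fun q => spRefl j (x q)) = F r x
  charge : ∀ r : Fin 2 → ℕ, r 0 ≠ r 1 → F r = 0
  swap : F.swap = F

lemma spRefl_involutive {L : ℕ} (j : Fin 3) : Function.Involutive (spRefl (L := L) j) := by
  intro x; simp [spRefl]

/-- A reflection as a permutation of the spatial lattice. -/
def spReflEquiv (L : ℕ) (j : Fin 3) : Sp L ≃ Sp L := (spRefl_involutive j).toPerm

@[simp] lemma spReflEquiv_apply {L : ℕ} (j : Fin 3) (x : Sp L) : spReflEquiv L j x = spRefl j x :=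
  rfl

@[simp] lemma spReflEquiv_symm_apply {L : ℕ} (j : Fin 3) (x : Sp L) :
    (spReflEquiv L j).symm x = spRefl j x := rfl

section UV
variable {L : ℕ} [NeZero L] {c : Constants} {fv : ℝ} {R E : FieldSeries (Fin 2) (Sp L)}

lemma Constants.Admissible.fieldBound_pos (hc : c.Admissible) (hfv : 0 < fv) :
    0 < c.fieldBound fv :=
  Real.rpow_pos_of_pos (one_div_pos.2 (mul_pos hc.θ_pos hfv)) _

lemma Constants.Admissible.one_le_fieldBound (hc : c.Admissible) (hfv : 0 < fv) (h1 : fv ≤ 1) :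
    1 ≤ c.fieldBound fv := by
  refine Real.one_le_rpow ?_ (add_pos hc.e_R_pos hc.e_r_pos).le
  rw [le_div_iff₀ (mul_pos hc.θ_pos hfv), one_mul]
  exact mul_le_one₀ hc.θ_le hfv.le h1

lemma UVOutput.summable_R (hc : c.Admissible) (hfv : 0 < fv) (h : UVOutput c fv L R E) :
    Summable fun r => R.absSum r * ∏ s, (fun _ : Fin 2 => 2 * c.fieldBound fv) s ^ r s :=
  summable_absSum_of_norm_ne_top isPseudoDist_spDist (by linarith [hc.mass_pos])
    (fun _ => by linarith [hc.fieldBound_pos hfv]) (ne_top_of_le_ne_top (by simp) h.R_norm)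

lemma UVOutput.summable_E (hc : c.Admissible) (hfv : 0 < fv) (h : UVOutput c fv L R E) :
    Summable fun r => E.absSum r * ∏ s, (fun _ : Fin 2 => 2 * c.fieldBound fv) s ^ r s :=
  summable_absSum_of_norm_ne_top isPseudoDist_spDist (by linarith [hc.mass_pos])
    (fun _ => by linarith [hc.fieldBound_pos hfv]) (ne_top_of_le_ne_top (by simp) h.E_norm)

lemma UVOutput.summable_add (hc : c.Admissible) (hfv : 0 < fv) (h : UVOutput c fv L R E) :
    Summable fun r => FieldSeries.absSum (R + E) r *
      ∏ s, (fun _ : Fin 2 => 2 * c.fieldBound fv) s ^ r s := by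
  have hp := hc.fieldBound_pos hfv
  refine Summable.of_nonneg_of_le (fun r => mul_nonneg (FieldSeries.absSum_nonneg _ _)
    (by positivity)) (fun r => ?_) ((h.summable_R hc hfv).add (h.summable_E hc hfv))
  rw [← add_mul]
  refine mul_le_mul_of_nonneg_right ?_ (by positivity)
  rw [FieldSeries.absSum, FieldSeries.absSum, FieldSeries.absSum, ← Finset.sum_add_distrib]
  exact Finset.sum_le_sum fun x _ => abs_add_le _ _

/-- The sum of two convergent series is the series of the sums of the kernels. Outside the region of
convergence this may fail, as divergent series have the value `0`. -/
lemma UVOutput.Dθ_eq (hc : c.Admissible) (hfv : 0 < fv) (h : UVOutput c fv L R E)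
    {φ : Fin 2 → Sp L → ℂ} (hφ : ∀ s x, ‖φ s x‖ ≤ 2 * c.fieldBound fv) :
    Dθ R E (φ 0) (φ 1) = FieldSeries.eval (R + E) φ := by
  have h0 : φ = ![φ 0, φ 1] := by funext i; fin_cases i <;> rfl
  rw [Dθ, ← h0, FieldSeries.eval_eq_tsum_hom, FieldSeries.eval_eq_tsum_hom,
    FieldSeries.eval_eq_tsum_hom, ← Summable.tsum_add
    (FieldSeries.summable_hom (h.summable_R hc hfv) hφ).of_norm
    (FieldSeries.summable_hom (h.summable_E hc hfv) hφ).of_norm]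
  refine tsum_congr fun r => ?_
  simp [FieldSeries.hom, add_mul, Finset.sum_add_distrib]

/-- The symmetries of the function `𝓓_θ` are symmetries of its kernels. -/
lemma UVOutput.kernelSymm (hc : c.Admissible) (hfv : 0 < fv) (h : UVOutput c fv L R E) :
    KernelSymm (R + E) := by
  have hκ : 0 < 2 * c.fieldBound fv := by linarith [hc.fieldBound_pos hfv]
  have hS := h.summable_add hc hfv
  have hsymm : FieldSeries.IsSymm (R + E) := fun r p x => by
    simp only [Pi.add_apply, h.R_symm r p x, h.E_symm r p x]
  have hD := fun φ hφ => h.Dθ_eq (φ := φ) hc hfv hφ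
  -- symmetries that act on the points
  have of_equiv : ∀ e : Sp L ≃ Sp L,
      (∀ αs β : Sp L → ℂ, Dθ R E (fun x => αs (e.symm x)) (fun x => β (e.symm x)) = Dθ R E αs β) →
      ∀ r x, (R + E) r (fun q => e (x q)) = (R + E) r x := by
    intro e he r x
    have key := FieldSeries.eq_of_eval_eq (F := fun r x => (R + E) r (fun q => e (x q)))
      (G := R + E) hκ (fun r p x => hsymm r p (fun q => e (x q))) hsymm
      (by simpa only [FieldSeries.absSum_comp_equiv] using hS) hS (fun φ hφ => ?_)
    · exact congrFun (congrFun key r) x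
    · have h1 : FieldSeries.eval (fun r x => (R + E) r (fun q => e (x q))) φ
          = FieldSeries.eval (R + E) (fun s y => φ s (e.symm y)) := by
        rw [FieldSeries.eval_eq_tsum_hom, FieldSeries.eval_eq_tsum_hom]
        exact tsum_congr fun r => FieldSeries.hom_comp_equiv _ _ _ _
      rw [h1, ← hD _ fun s x => hφ s _, ← hD φ hφ]
      exact he _ _
  refine ⟨hsymm, fun a r x => ?_, fun j r x => ?_, fun r hr => ?_, ?_⟩
  · refine of_equiv (Equiv.addRight a) (fun αs β => ?_) r x
    simpa [sub_eq_add_neg] using h.trans a αs β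
  · exact of_equiv (spReflEquiv L j) (fun αs β => h.refl j αs β) r x
  · -- rotate by the angle `π / (r 1 - r 0)`, which reverses the sign of this homogeneous part
    refine kernel_eq_zero_of_monomial_eq_zero r ((R + E) r) (hsymm r) fun φ => ?_
    have hk : ((r 1 : ℂ) - r 0) ≠ 0 := sub_ne_zero.2 fun h => hr (by exact_mod_cast h.symm)
    set t : ℝ := Real.pi / ((r 1 : ℝ) - r 0) with ht
    let w : Fin 2 → ℂ := ![Complex.exp (-(t * Complex.I)), Complex.exp (t * Complex.I)]
    have hw : ∀ s, ‖w s‖ = 1 := by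
      intro s
      fin_cases s
      · simpa [w] using Complex.norm_exp_ofReal_mul_I (-t)
      · exact Complex.norm_exp_ofReal_mul_I t
    have small : ∀ φ : Fin 2 → Sp L → ℂ, (∀ s x, ‖φ s x‖ ≤ 2 * c.fieldBound fv) →
        FieldSeries.hom (R + E) r φ = 0 := by
      intro φ hφ
      have hφw : ∀ s x, ‖(w s • φ s) x‖ ≤ 2 * c.fieldBound fv := fun s x => by
        rw [Pi.smul_apply, norm_smul, hw, one_mul]; exact hφ s x
      have h1 := FieldSeries.coeff_eq_of_tsum_eq (FieldSeries.summable_hom hS hφ)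
        (FieldSeries.summable_hom hS hφw) (fun s' t' h0 h1 h2 h3 => ?_) r
      · rw [FieldSeries.hom_smul] at h1
        have h2 : ∏ s, w s ^ r s = -1 := by
          simp only [w, Fin.prod_univ_two, Matrix.cons_val_zero, Matrix.cons_val_one]
          rw [← Complex.exp_nat_mul, ← Complex.exp_nat_mul, ← Complex.exp_add,
            ← Complex.exp_pi_mul_I]
          congr 1
          rw [ht]; push_cast; field_simp; ring
        rw [h2] at h1
        have h3 : (2 : ℂ) * FieldSeries.hom (R + E) r φ = 0 := by linear_combination h1
        simpa using h3
      · rw [← FieldSeries.eval_scaled, ← FieldSeries.eval_scaled]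
        have hle : ∀ i, ‖(![(s' : ℂ), (t' : ℂ)] i)‖ ≤ 1 := by
          intro i; fin_cases i
          · simpa [abs_of_pos h0] using h1
          · simpa [abs_of_pos h2] using h3
        have hsc : ∀ ψ : Fin 2 → Sp L → ℂ, (∀ s x, ‖ψ s x‖ ≤ 2 * c.fieldBound fv) → ∀ i x,
            ‖(![(s' : ℂ), (t' : ℂ)] i • ψ i) x‖ ≤ 2 * c.fieldBound fv := by
          intro ψ hψ i x
          rw [Pi.smul_apply, norm_smul]
          exact le_trans (mul_le_of_le_one_left (norm_nonneg _) (hle i)) (hψ i x)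
        rw [← hD _ (hsc φ hφ), ← hD _ (hsc _ hφw)]
        rw [← h.u1 t]
        congr 1 <;> simp only [w, Matrix.cons_val_zero, Matrix.cons_val_one] <;>
          exact smul_comm _ _ _
    -- pass from small to arbitrary fields, using the series with the single kernel `(R + E) r`
    have h0 := FieldSeries.hom_eq_of_eval_eq (F := fun r' => if r' = r then (R + E) r' else 0)
      (G := fun _ => 0) hκ ?_ ?_ ?_ r φ
    · simpa [FieldSeries.hom] using h0
    · refine Summable.of_nonneg_of_le (fun r => mul_nonneg (FieldSeries.absSum_nonneg _ _)
        (by positivity)) (fun r' => ?_) hS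
      refine mul_le_mul_of_nonneg_right ?_ (by positivity)
      by_cases hr' : r' = r
      · simp [FieldSeries.absSum, hr']
      · simpa [FieldSeries.absSum, hr'] using Finset.sum_nonneg fun _ _ => abs_nonneg _
    · simp [FieldSeries.absSum]
    · intro φ hφ
      rw [FieldSeries.eval_eq_tsum_hom, FieldSeries.eval_eq_tsum_hom]
      refine tsum_congr fun r' => ?_
      by_cases hr' : r' = r
      · subst hr'
        simpa [FieldSeries.hom] using small φ hφ
      · simp [FieldSeries.hom, hr']
  -- as the kernels are real, time reversal amounts to the exchange of the fields
  · refine FieldSeries.eq_of_eval_eq hκ (fun r p x => ?_) hsymm ?_ hS fun φ hφ => ?_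
    · exact hsymm _ (fun s => p (Fin.rev s)) (fun q => x ⟨Fin.rev q.1, q.2⟩)
    · have := (FieldSeries.revDeg.summable_iff).2 hS
      refine this.congr fun r => ?_
      rw [Function.comp_apply, FieldSeries.absSum_swap]
      simp [FieldSeries.revDeg_apply, Fin.prod_univ_two, mul_comm]
    · rw [FieldSeries.eval_swap, ← hD φ hφ]
      have h1 := h.timeRev (φ 0) (φ 1)
      rw [← h1]
      have h2 := h.Dθ_eq (φ := ![star (φ 1), star (φ 0)]) hc hfv (by
        intro s x
        fin_cases s
        · simpa using hφ 1 x
        · simpa using hφ 0 x)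
      simp only [Matrix.cons_val_zero, Matrix.cons_val_one] at h2
      rw [h2, FieldSeries.conj_eval]
      congr 1
      funext s; fin_cases s <;> simp

end UV

/-- The part of a power series with multidegrees in `p`. -/
def FieldSeries.restrict {S X : Type*} (F : FieldSeries S X) (p : (S → ℕ) → Prop)
    [DecidablePred p] : FieldSeries S X := fun r => if p r then F r else 0

lemma FieldSeries.restrict_apply {S X : Type*} (F : FieldSeries S X) (p : (S → ℕ) → Prop)
    [DecidablePred p] (r : S → ℕ) : F.restrict p r = if p r then F r else 0 := rfl

lemma KernelSymm.restrict {L : ℕ} {F : FieldSeries (Fin 2) (Sp L)} (hF : KernelSymm F)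
    (p : (Fin 2 → ℕ) → Prop) [DecidablePred p] (hp : ∀ r, p (fun s => r (Fin.rev s)) ↔ p r) :
    KernelSymm (F.restrict p) where
  isSymm r σ x := by
    unfold FieldSeries.restrict; split_ifs
    exacts [hF.isSymm r σ x, rfl]
  trans a r x := by
    unfold FieldSeries.restrict; split_ifs
    exacts [hF.trans a r x, rfl]
  refl j r x := by
    unfold FieldSeries.restrict; split_ifs
    exacts [hF.refl j r x, rfl]
  charge r hr := by
    unfold FieldSeries.restrict; split_ifs
    exacts [hF.charge r hr, rfl]
  swap := by
    funext r x
    have h := congrFun (congrFun hF.swap r) x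
    unfold FieldSeries.swap FieldSeries.restrict
    simp only [hp]
    split_ifs
    exacts [h, rfl]

/-! ### From the spatial lattice to the space-time lattice -/

/-- The times of the two fields in the `n`-th factor of the functional integral. -/
def placeTime {Lt : ℕ} (n : ZMod Lt) (s : Fin 2) : ZMod Lt := if s = 0 then n - 1 else n

@[simp] lemma placeTime_zero {Lt : ℕ} (n : ZMod Lt) : placeTime n 0 = n - 1 := rfl

@[simp] lemma placeTime_one {Lt : ℕ} (n : ZMod Lt) : placeTime n 1 = n := rfl

lemma placeTime_eq_iff {Lt : ℕ} (n t : ZMod Lt) (s : Fin 2) :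
    placeTime n s = t ↔ n = t - placeTime 0 s := by
  fin_cases s
  · simp [sub_eq_iff_eq_add]
  · simp

/-- The sum over the times of the power series `F(κ ψ_*(n - 1, ·), κ ψ(n, ·))`. -/
def place (Lt : ℕ) [NeZero Lt] {L : ℕ} (κ : ℝ) (F : FieldSeries (Fin 2) (Sp L)) :
    FieldSeries (Fin 2) (STLat Lt L) := fun r x =>
  ∑ n : ZMod Lt, if ∀ q, (x q).1 = placeTime n q.1 then
    κ ^ (r 0 + r 1) * F r (fun q => (x q).2) else 0

/-- Points of a product with prescribed first coordinates are given by their second coordinates. -/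
lemma tsum_ite_fst_eq {ι A B M : Type*} [AddCommMonoid M] [TopologicalSpace M] (T : ι → A)
    (g : (ι → A × B) → M) [∀ x : ι → A × B, Decidable (∀ q, (x q).1 = T q)] :
    ∑' x, (if ∀ q, (x q).1 = T q then g x else 0) = ∑' y : ι → B, g (fun q => (T q, y q)) := by
  have hinj : Function.Injective fun (y : ι → B) (q : ι) => (T q, y q) := by
    intro y y' h
    funext q
    exact congrArg Prod.snd (congrFun h q)
  rw [← hinj.tsum_eq]
  · simp
  · intro x hx
    have : ∀ q, (x q).1 = T q := by
      by_contra h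
      simp [h] at hx
    exact ⟨fun q => (x q).2, funext fun q => Prod.ext (this q).symm rfl⟩

section Place
variable {Lt L : ℕ} [NeZero Lt] {κ : ℝ} {F : FieldSeries (Fin 2) (Sp L)}

lemma isSymm_place (hF : F.IsSymm) : (place Lt κ F).IsSymm := by
  intro r p x
  unfold place
  refine Finset.sum_congr rfl fun n _ => ?_
  have h1 := hF r p (fun q => (x q).2)
  have h2 : (∀ q : (s : Fin 2) × Fin (r s), (x ⟨q.1, p q.1 q.2⟩).1 = placeTime n q.1) ↔
      ∀ q, (x q).1 = placeTime n q.1 := by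
    constructor
    · rintro h ⟨s, k⟩
      simpa using h ⟨s, (p s).symm k⟩
    · rintro h ⟨s, k⟩
      exact h ⟨s, p s k⟩
  simp only [h1, h2]

open Classical in
/-- A spatial tree, at the time of the field `ψ`, is completed to a space-time tree by one vertical
edge for every argument of `ψ_*`. -/
lemma kernelNorm_place_le (hκ : 0 ≤ κ) {m : ℝ} (hm : 0 ≤ m) (F : FieldSeries (Fin 2) (Sp L))
    (r : Fin 2 → ℕ) (hr : r 0 ≠ 0) :
    kernelNorm stDist m (place Lt κ F r)
      ≤ ENNReal.ofReal (κ ^ (r 0 + r 1) * Real.exp (m * r 0)) * kernelNorm spDist m (F r) := by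
  have : Nonempty ((s : Fin 2) × Fin (r s)) := ⟨⟨0, ⟨0, Nat.pos_of_ne_zero hr⟩⟩⟩
  refine kernelNorm_le fun i u => ?_
  have htree : ∀ (n : ZMod Lt) (y : ((s : Fin 2) × Fin (r s)) → Sp L),
      treeLength stDist (fun q => (placeTime n q.1, y q)) ≤ treeLength spDist y + r 0 := by
    intro n y
    refine (treeLength_le_add_sum isPseudoDist_stDist (fun z => (n, z))
      (fun a b => stDist_same_time n a b) y _).trans ?_
    gcongr
    rw [Fintype.sum_sigma]
    simp only [stDist_same_space, Fin.sum_univ_two, placeTime_zero, placeTime_one]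
    have := absMin_one_le (n := Lt)
    simp only [sub_sub_cancel, Finset.sum_const, Finset.card_univ, Fintype.card_fin, nsmul_eq_mul,
      sub_self, absMin_zero, mul_zero, add_zero]
    exact mul_le_of_le_one_right (by positivity) this
  set w : (((s : Fin 2) × Fin (r s)) → STLat Lt L) → ℝ≥0∞ := fun x =>
    if x i = u then ENNReal.ofReal (κ ^ (r 0 + r 1) * |F r (fun q => (x q).2)| *
      Real.exp (m * treeLength stDist x)) else 0 with hw
  calc _ ≤ ∑' x : ((s : Fin 2) × Fin (r s)) → STLat Lt L, ∑ n : ZMod Lt,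
        (if ∀ q, (x q).1 = placeTime n q.1 then w x else 0) := by
        refine ENNReal.tsum_le_tsum fun x => ?_
        by_cases hx : x i = u
        · simp only [hw, if_pos hx]
          calc _ ≤ ENNReal.ofReal (∑ n : ZMod Lt, if ∀ q, (x q).1 = placeTime n q.1 then
                κ ^ (r 0 + r 1) * |F r (fun q => (x q).2)| *
                  Real.exp (m * treeLength stDist x) else 0) := by
                refine ENNReal.ofReal_le_ofReal ?_
                unfold place
                refine (mul_le_mul_of_nonneg_right (Finset.abs_sum_le_sum_abs _ _)
                  (Real.exp_pos _).le).trans (le_of_eq ?_)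
                rw [Finset.sum_mul]
                refine Finset.sum_congr rfl fun n _ => ?_
                split_ifs
                · rw [abs_mul, abs_of_nonneg (pow_nonneg hκ _)]
                · simp
            _ ≤ _ := by
                rw [ENNReal.ofReal_sum_of_nonneg]
                · refine Finset.sum_le_sum fun n _ => ?_
                  split_ifs
                  · exact le_rfl
                  · simp
                · intro n _
                  split_ifs
                  · positivity
                  · exact le_rfl
        · simp [hx]
    _ = ∑ n : ZMod Lt, ∑' y : ((s : Fin 2) × Fin (r s)) → Sp L,
          w (fun q => (placeTime n q.1, y q)) := by
        rw [Summable.tsum_finsetSum fun _ _ => ENNReal.summable]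
        refine Finset.sum_congr rfl fun n _ => ?_
        exact tsum_ite_fst_eq (fun q : (s : Fin 2) × Fin (r s) => placeTime n q.1) w
    -- the time of the fixed argument determines `n`
    _ ≤ ∑ n : ZMod Lt, if n = u.1 - placeTime 0 i.1 then
          ENNReal.ofReal (κ ^ (r 0 + r 1) * Real.exp (m * r 0)) * kernelNorm spDist m (F r)
          else 0 := by
        refine Finset.sum_le_sum fun n _ => ?_
        split_ifs with hn
        · refine le_trans ?_ (mul_le_mul_right (le_kernelNorm m (F r) i u.2) _)
          rw [← ENNReal.tsum_mul_left]
          refine ENNReal.tsum_le_tsum fun y => ?_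
          simp only [hw]
          by_cases hy : y i = u.2
          · rw [if_pos hy, ← ENNReal.ofReal_mul (by positivity)]
            refine le_trans (b := ENNReal.ofReal (κ ^ (r 0 + r 1) * |F r y| *
              Real.exp (m * treeLength stDist (fun q => (placeTime n q.1, y q))))) ?_ ?_
            · split_ifs
              · exact le_rfl
              · simp
            · refine ENNReal.ofReal_le_ofReal ?_
              have h1 : Real.exp (m * treeLength stDist (fun q => (placeTime n q.1, y q)))
                  ≤ Real.exp (m * r 0) * Real.exp (m * treeLength spDist y) := by
                rw [← Real.exp_add, Real.exp_le_exp]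
                nlinarith [htree n y]
              calc _ ≤ κ ^ (r 0 + r 1) * |F r y| *
                    (Real.exp (m * r 0) * Real.exp (m * treeLength spDist y)) := by gcongr
                _ = _ := by ring
          · rw [if_neg, if_neg hy]
            · simp
            · intro h; exact hy (congrArg Prod.snd h)
        · rw [ENNReal.tsum_eq_zero.2]
          intro y
          simp only [hw]
          rw [if_neg]
          intro h
          exact hn ((placeTime_eq_iff _ _ _).1 (congrArg Prod.fst h))
    _ = _ := by simp

variable [NeZero L]

lemma hom_place (F : FieldSeries (Fin 2) (Sp L)) (r : Fin 2 → ℕ)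
    (φ : Fin 2 → STLat Lt L → ℂ) :
    (place Lt κ F).hom r φ
      = (κ : ℂ) ^ (r 0 + r 1) * ∑ n, F.hom r (fun s y => φ s (placeTime n s, y)) := by
  unfold FieldSeries.hom place
  simp only [Complex.ofReal_sum, Finset.sum_mul]
  rw [Finset.sum_comm, Finset.mul_sum]
  refine Finset.sum_congr rfl fun n _ => ?_
  have h := tsum_ite_fst_eq (fun q : (s : Fin 2) × Fin (r s) => placeTime n q.1)
    (fun x : ((s : Fin 2) × Fin (r s)) → STLat Lt L =>
      (κ : ℂ) ^ (r 0 + r 1) * ((F r (fun q => (x q).2) : ℂ) * ∏ q, φ q.1 (x q)))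
  rw [tsum_fintype, tsum_fintype, ← Finset.mul_sum] at h
  rw [← h]
  refine Finset.sum_congr rfl fun x _ => ?_
  split_ifs
  · push_cast; ring
  · simp

lemma absSum_place_le (hκ : 0 ≤ κ) (F : FieldSeries (Fin 2) (Sp L)) (r : Fin 2 → ℕ) :
    (place Lt κ F).absSum r ≤ Lt * (κ ^ (r 0 + r 1) * F.absSum r) := by
  unfold FieldSeries.absSum place
  calc _ ≤ ∑ x : ((s : Fin 2) × Fin (r s)) → STLat Lt L, ∑ n : ZMod Lt,
        if ∀ q, (x q).1 = placeTime n q.1 then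
          κ ^ (r 0 + r 1) * |F r (fun q => (x q).2)| else 0 := by
        refine Finset.sum_le_sum fun x _ => (Finset.abs_sum_le_sum_abs _ _).trans (le_of_eq ?_)
        refine Finset.sum_congr rfl fun n _ => ?_
        split_ifs
        · rw [abs_mul, abs_of_nonneg (pow_nonneg hκ _)]
        · simp
    _ = _ := by
        rw [Finset.sum_comm]
        have h := fun n : ZMod Lt =>
          tsum_ite_fst_eq (fun q : (s : Fin 2) × Fin (r s) => placeTime n q.1)
          (fun x : ((s : Fin 2) × Fin (r s)) → STLat Lt L =>
            κ ^ (r 0 + r 1) * |F r (fun q => (x q).2)|)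
        simp only [tsum_fintype] at h
        simp only [h, Finset.sum_const, Finset.card_univ, ZMod.card, nsmul_eq_mul, Finset.mul_sum]

lemma summable_absSum_place (hκ : 0 < κ) {K : ℝ} (hK : 0 ≤ K)
    (hF : Summable fun r => F.absSum r * ∏ s, (fun _ : Fin 2 => K) s ^ r s) :
    Summable fun r => (place Lt κ F).absSum r * ∏ s, (fun _ : Fin 2 => κ⁻¹ * K) s ^ r s := by
  refine Summable.of_nonneg_of_le (fun r => mul_nonneg (FieldSeries.absSum_nonneg _ _)
    (by positivity)) (fun r => ?_) (hF.mul_left (Lt : ℝ))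
  refine (mul_le_mul_of_nonneg_right (absSum_place_le hκ.le F r) (by positivity)).trans
    (le_of_eq ?_)
  simp only [Fin.prod_univ_two, mul_pow, inv_pow, pow_add]
  field_simp

lemma eval_place_eq (F : FieldSeries (Fin 2) (Sp L)) (hκ : 0 ≤ κ) {K : ℝ}
    (hF : Summable fun r => F.absSum r * ∏ s, (fun _ : Fin 2 => K) s ^ r s)
    {φ : Fin 2 → STLat Lt L → ℂ} (hφ : ∀ s x, κ * ‖φ s x‖ ≤ K) :
    (place Lt κ F).eval φ = ∑ n, F.eval (fun s y => κ * φ s (placeTime n s, y)) := by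
  rw [FieldSeries.eval_eq_tsum_hom]
  simp only [FieldSeries.eval_eq_tsum_hom]
  rw [← Summable.tsum_finsetSum]
  · refine tsum_congr fun r => ?_
    rw [hom_place, Finset.mul_sum]
    refine Finset.sum_congr rfl fun n _ => ?_
    have := F.hom_smul r (fun _ => (κ : ℂ)) (fun s y => φ s (placeTime n s, y))
    rw [Fin.prod_univ_two, ← pow_add] at this
    rw [← this]; rfl
  · intro n _
    refine (FieldSeries.summable_hom hF fun s x => ?_).of_norm
    rw [norm_mul, Complex.norm_real, Real.norm_eq_abs, abs_of_nonneg hκ]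
    exact hφ _ _

lemma numberPreserving_place (hF : KernelSymm F) : NumberPreserving (plainEval (place Lt κ F)) := by
  intro t φs φ
  unfold plainEval
  rw [FieldSeries.eval_eq_tsum_hom, FieldSeries.eval_eq_tsum_hom]
  refine tsum_congr fun r => ?_
  have h := (place Lt κ F).hom_smul r ![Complex.exp (-(t * Complex.I)), Complex.exp (t * Complex.I)]
    ![φs none, φ none]
  have h0 : (fun s => ![Complex.exp (-(t * Complex.I)), Complex.exp (t * Complex.I)] s •
      ![φs none, φ none] s) = ![(Complex.exp (-(t * Complex.I)) • φs) none,
        (Complex.exp (t * Complex.I) • φ) none] := by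
    funext s; fin_cases s <;> rfl
  rw [h0] at h
  rw [h]
  by_cases hr : r 0 = r 1
  · rw [Fin.prod_univ_two]
    simp only [Matrix.cons_val_zero, Matrix.cons_val_one]
    rw [hr, ← mul_pow, ← Complex.exp_add]
    simp
  · have : (place Lt κ F).hom r ![φs none, φ none] = 0 := by
      rw [hom_place]
      simp [FieldSeries.hom, hF.charge r hr]
    rw [this, mul_zero]

lemma KernelSymm.hom_sub (hF : KernelSymm F) (a : Sp L) (r : Fin 2 → ℕ) (φ : Fin 2 → Sp L → ℂ) :
    F.hom r (fun s y => φ s (y - a)) = F.hom r φ := by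
  have h := F.hom_comp_equiv (Equiv.addRight a) r φ
  simp only [Equiv.addRight_symm, Equiv.coe_addRight, ← sub_eq_add_neg] at h
  rw [← h]
  unfold FieldSeries.hom
  simp only [hF.trans a]

lemma KernelSymm.hom_refl (hF : KernelSymm F) (j : Fin 3) (r : Fin 2 → ℕ)
    (φ : Fin 2 → Sp L → ℂ) : F.hom r (fun s y => φ s (spRefl j y)) = F.hom r φ := by
  have h := F.hom_comp_equiv (spReflEquiv L j) r φ
  simp only [spReflEquiv_symm_apply, spReflEquiv_apply] at h
  rw [← h]
  unfold FieldSeries.hom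
  simp only [hF.refl j]

/-- A spatial power series with symmetric kernels induces an `𝔖` invariant space-time function. -/
lemma sInvariant_place (hF : KernelSymm F) : SInvariant (plainEval (place Lt κ F)) where
  trans a φs φ := by
    unfold plainEval
    rw [FieldSeries.eval_eq_tsum_hom, FieldSeries.eval_eq_tsum_hom]
    refine tsum_congr fun r => ?_
    rw [hom_place, hom_place]
    congr 1
    refine Fintype.sum_equiv (Equiv.subRight a.1) _ _ fun n => ?_
    refine Eq.trans ?_ (hF.hom_sub a.2 r _)
    congr 1
    funext s y
    fin_cases s
    · change φs none (n - 1 - a.1, y - a.2) = φs none (n - a.1 - 1, y - a.2)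
      rw [sub_right_comm]
    · rfl
  refl j φs φ := by
    unfold plainEval
    rw [FieldSeries.eval_eq_tsum_hom, FieldSeries.eval_eq_tsum_hom]
    refine tsum_congr fun r => ?_
    rw [hom_place, hom_place]
    congr 1
    refine Finset.sum_congr rfl fun n _ => ?_
    refine Eq.trans ?_ (hF.hom_refl j r _)
    congr 1
    funext s y
    fin_cases s <;> simp [tRefl, stRefl]
  timeRefl φs φ := by
    unfold plainEval
    rw [FieldSeries.conj_eval, FieldSeries.eval_eq_tsum_hom, FieldSeries.eval_eq_tsum_hom,
      ← FieldSeries.revDeg.tsum_eq]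
    refine tsum_congr fun r => ?_
    rw [hom_place, hom_place, FieldSeries.revDeg_apply]
    congr 1
    · rw [add_comm]; rfl
    -- The reflection maps the times `n - 1, n` of `ψ_*, ψ` to `1 - n, -n`. After the exchange of
    -- the fields these are the times of the term `1 - n`.
    refine Fintype.sum_equiv (Equiv.subLeft 1) _ _ fun n => ?_
    rw [show F.hom r (fun s y => ![φs none, φ none] s (placeTime (Equiv.subLeft 1 n) s, y))
      = F.swap.hom r (fun s y => ![φs none, φ none] s (placeTime (Equiv.subLeft 1 n) s, y)) by
        rw [hF.swap], FieldSeries.hom_swap]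
    congr 1
    funext s y
    fin_cases s
    · simp [tRefl, stRefl]
    · simp [tRefl, stRefl]

end Place

/-! ### Bilinear power series -/

section Quad

/-- The power series `∑ k a b u u' φ (0, a) u φ (1, b) u'`. -/
def quad {O X : Type*} [Fintype O] (k : O → O → X → X → ℝ) : FieldSeries (Fin 2 × O) X := fun r x =>
  if ∑ a, r (0, a) = 1 ∧ ∑ b, r (1, b) = 1 then
    ∑ p : ((s : Fin 2 × O) × Fin (r s)), ∑ q : ((s : Fin 2 × O) × Fin (r s)),
      if p.1.1 = 0 ∧ q.1.1 = 1 then k p.1.2 q.1.2 (x p) (x q) else 0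
  else 0

lemma isSymm_quad {O X : Type*} [Fintype O] (k : O → O → X → X → ℝ) : (quad k).IsSymm := by
  intro r σ x
  unfold quad
  split_ifs with h
  · let e : ((s : Fin 2 × O) × Fin (r s)) ≃ ((s : Fin 2 × O) × Fin (r s)) :=
      Equiv.sigmaCongrRight σ
    let g : ((s : Fin 2 × O) × Fin (r s)) → ((s : Fin 2 × O) × Fin (r s)) → ℝ := fun p q =>
      if p.1.1 = 0 ∧ q.1.1 = 1 then k p.1.2 q.1.2 (x p) (x q) else 0
    exact (Finset.sum_congr rfl fun p _ => e.sum_comp (g (e p))).trans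
      (e.sum_comp fun p => ∑ q, g p q)
  · rfl

variable {O X : Type*} [DecidableEq O]

/-- The multidegree of a monomial with one field `(0, a)` and one field `(1, b)`. -/
def bideg (a b : O) : Fin 2 × O → ℕ := fun s => if s = (0, a) ∨ s = (1, b) then 1 else 0

/-- The two arguments of a bilinear monomial. -/
def bidegArg (a b : O) : Fin 2 ≃ ((s : Fin 2 × O) × Fin (bideg a b s)) where
  toFun i := if i = 0 then ⟨(0, a), ⟨0, by simp [bideg]⟩⟩ else ⟨(1, b), ⟨0, by simp [bideg]⟩⟩
  invFun q := q.1.1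
  left_inv i := by fin_cases i <;> rfl
  right_inv := by
    rintro ⟨s, k⟩
    have hk : (k : ℕ) < bideg a b s := k.2
    have hs : s = (0, a) ∨ s = (1, b) := by
      by_contra h
      simp [bideg, h] at hk
    have hk0 : (k : ℕ) = 0 := by
      have : bideg a b s = 1 := by simp [bideg, hs]
      omega
    rcases hs with rfl | rfl
    · exact congrArg (Sigma.mk _) (Fin.ext hk0.symm)
    · exact congrArg (Sigma.mk _) (Fin.ext hk0.symm)

lemma bidegArg_zero_fst (a b : O) : (bidegArg a b 0).1 = (0, a) := rfl

lemma bidegArg_one_fst (a b : O) : (bidegArg a b 1).1 = (1, b) := rfl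

/-- The entries of a pair of points, as a function on the arguments of a bilinear monomial. -/
def bidegFun (a b : O) : X × X ≃ (((s : Fin 2 × O) × Fin (bideg a b s)) → X) :=
  (finTwoArrowEquiv X).symm.trans (Equiv.arrowCongr (bidegArg a b) (Equiv.refl X))

lemma bidegFun_zero (a b : O) (p : X × X) : bidegFun a b p (bidegArg a b 0) = p.1 := by
  simp [bidegFun, Equiv.arrowCongr]

lemma bidegFun_one (a b : O) (p : X × X) : bidegFun a b p (bidegArg a b 1) = p.2 := by
  simp [bidegFun, Equiv.arrowCongr]

lemma bideg_injective : Function.Injective fun p : O × O => bideg p.1 p.2 := by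
  rintro ⟨a, b⟩ ⟨a', b'⟩ h
  have h1 := congrFun h (0, a)
  have h2 := congrFun h (1, b)
  simp only [bideg, Prod.mk.injEq, true_and, zero_ne_one, false_and, or_false, if_true,
    one_ne_zero, false_or] at h1 h2
  rw [eq_comm, ite_eq_left_iff] at h1 h2
  ext
  · by_contra h; exact absurd (h1 h) (by simp)
  · by_contra h; exact absurd (h2 h) (by simp)

variable [Fintype O]

/-- The monomials that are linear in the fields `(0, ·)` and in the fields `(1, ·)` are those with
one field `(0, a)` and one field `(1, b)`. -/
lemma sum_eq_one_and_iff (r : Fin 2 × O → ℕ) :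
    (∑ a, r (0, a) = 1 ∧ ∑ b, r (1, b) = 1) ↔ ∃ a b, r = bideg a b := by
  have key : ∀ f : O → ℕ, ∑ a, f a = 1 → ∃ a, ∀ a', f a' = if a' = a then 1 else 0 := by
    intro f hf
    obtain ⟨a, -, ha⟩ := Finset.exists_ne_zero_of_sum_ne_zero (by rw [hf]; exact one_ne_zero)
    refine ⟨a, fun a' => ?_⟩
    have h1 := Finset.sum_erase_add _ f (Finset.mem_univ a)
    rw [hf] at h1
    have h2 : f a = 1 ∧ ∑ x ∈ Finset.univ.erase a, f x = 0 := by omega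
    split_ifs with h
    · rw [h, h2.1]
    · exact Finset.sum_eq_zero_iff.1 h2.2 a' (by simp [h])
  constructor
  · rintro ⟨h0, h1⟩
    obtain ⟨a, ha⟩ := key _ h0
    obtain ⟨b, hb⟩ := key _ h1
    refine ⟨a, b, ?_⟩
    funext ⟨s, o⟩
    fin_cases s
    · simp [bideg, ha]
    · simp [bideg, hb]
  · rintro ⟨a, b, rfl⟩
    simp [bideg]

lemma quad_bideg (k : O → O → X → X → ℝ) (a b : O)
    (x : ((s : Fin 2 × O) × Fin (bideg a b s)) → X) :
    quad k (bideg a b) x = k a b (x (bidegArg a b 0)) (x (bidegArg a b 1)) := by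
  unfold quad
  rw [if_pos ((sum_eq_one_and_iff _).2 ⟨a, b, rfl⟩), ← (bidegArg a b).sum_comp]
  simp_rw [← (bidegArg a b).sum_comp (fun q => if _ ∧ q.1.1 = 1 then _ else _)]
  simp [Fin.sum_univ_two, bidegArg_zero_fst, bidegArg_one_fst]

lemma quad_eq_zero (k : O → O → X → X → ℝ) (r : Fin 2 × O → ℕ) (hr : ∀ a b, r ≠ bideg a b) :
    quad k r = 0 := by
  funext x
  unfold quad
  rw [if_neg]; · rfl
  rw [sum_eq_one_and_iff]
  rintro ⟨a, b, h⟩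
  exact hr a b h

lemma hom_quad [Fintype X] (k : O → O → X → X → ℝ) (a b : O) (φ : Fin 2 × O → X → ℂ) :
    (quad k).hom (bideg a b) φ = ∑ u, ∑ u', (k a b u u' : ℂ) * φ (0, a) u * φ (1, b) u' := by
  unfold FieldSeries.hom
  rw [← (bidegFun a b).sum_comp, Fintype.sum_prod_type]
  refine Finset.sum_congr rfl fun u _ => Finset.sum_congr rfl fun u' _ => ?_
  rw [quad_bideg, bidegFun_zero, bidegFun_one, ← (bidegArg a b).prod_comp, Fin.prod_univ_two,
    bidegFun_zero, bidegFun_one, bidegArg_zero_fst, bidegArg_one_fst, mul_assoc]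

lemma eval_quad [Fintype X] (k : O → O → X → X → ℝ) (φ : Fin 2 × O → X → ℂ) :
    (quad k).eval φ
      = ∑ a, ∑ b, ∑ u, ∑ u', (k a b u u' : ℂ) * φ (0, a) u * φ (1, b) u' := by
  rw [FieldSeries.eval_eq_tsum_hom, ← bideg_injective.tsum_eq, tsum_fintype,
    Fintype.sum_prod_type]
  · simp only [hom_quad]
  · intro r hr
    by_contra h
    refine hr ?_
    dsimp only [FieldSeries.hom]
    rw [quad_eq_zero k r]
    · simp
    · rintro a b rfl
      exact h ⟨(a, b), rfl⟩

/-- A tree through two points has at least the length of, and can be chosen as, a single edge. Hence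
the norm is a weighted `ℓ¹` bound on rows and columns. -/
lemma kernelNorm_quad_le [Fintype X] {d : X → X → ℝ} (hd : IsPseudoDist d) {m : ℝ} (hm : 0 ≤ m)
    (k : O → O → X → X → ℝ) (a b : O) {B : ℝ}
    (h0 : ∀ u, ∑ u', |k a b u u'| * Real.exp (m * d u u') ≤ B)
    (h1 : ∀ u', ∑ u, |k a b u u'| * Real.exp (m * d u u') ≤ B) :
    kernelNorm d m (quad k (bideg a b)) ≤ ENNReal.ofReal B := by
  classical
  have : Nonempty ((s : Fin 2 × O) × Fin (bideg a b s)) := ⟨bidegArg a b 0⟩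
  refine kernelNorm_le fun i u => ?_
  have htree : ∀ x : ((s : Fin 2 × O) × Fin (bideg a b s)) → X,
      treeLength d x ≤ d (x (bidegArg a b 0)) (x (bidegArg a b 1)) := by
    intro x
    refine (treeLength_le_star hd (x (bidegArg a b 0)) x).trans (le_of_eq ?_)
    rw [← (bidegArg a b).sum_comp]
    simp [hd.self]
  rw [tsum_fintype, ← (bidegFun a b).sum_comp]
  have hle : ∀ p : X × X, (if bidegFun a b p i = u then ENNReal.ofReal
      (|quad k (bideg a b) (bidegFun a b p)| * Real.exp (m * treeLength d (bidegFun a b p)))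
      else 0) ≤ if bidegFun a b p i = u then
        ENNReal.ofReal (|k a b p.1 p.2| * Real.exp (m * d p.1 p.2)) else 0 := by
    intro p
    split_ifs
    · refine ENNReal.ofReal_le_ofReal ?_
      rw [quad_bideg, bidegFun_zero, bidegFun_one]
      have := htree (bidegFun a b p)
      rw [bidegFun_zero, bidegFun_one] at this
      gcongr
    · exact le_rfl
  refine (Finset.sum_le_sum fun p _ => hle p).trans ?_
  rw [Fintype.sum_prod_type]
  obtain ⟨j, rfl⟩ := (bidegArg a b).surjective i
  fin_cases j
  · simp only [Fin.zero_eta, bidegFun_zero]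
    rw [Finset.sum_eq_single u]
    · simp only [if_true]
      rw [← ENNReal.ofReal_sum_of_nonneg fun _ _ => by positivity]
      exact ENNReal.ofReal_le_ofReal (h0 u)
    · intro u' _ hu; simp [hu]
    · simp
  · simp only [Fin.mk_one, bidegFun_one]
    rw [Finset.sum_comm, Finset.sum_eq_single u]
    · simp only [if_true]
      rw [← ENNReal.ofReal_sum_of_nonneg fun _ _ => by positivity]
      exact ENNReal.ofReal_le_ofReal (h1 u)
    · intro u' _ hu; simp [hu]
    · simp

lemma norm_quad_le [Fintype X] {d : X → X → ℝ} {m : ℝ} (k : O → O → X → X → ℝ) {B : O → O → ℝ}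
    (hB : ∀ a b, 0 ≤ B a b)
    (h : ∀ a b, kernelNorm d m (quad k (bideg a b)) ≤ ENNReal.ofReal (B a b)) :
    (quad k).norm d m (fun _ => 1) ≤ ENNReal.ofReal (∑ a, ∑ b, B a b) := by
  unfold FieldSeries.norm
  simp only [ENNReal.ofReal_one, one_pow, Finset.prod_const_one, mul_one]
  rw [← bideg_injective.tsum_eq, tsum_fintype, Fintype.sum_prod_type,
    ENNReal.ofReal_sum_of_nonneg fun a _ => Finset.sum_nonneg fun b _ => hB a b]
  · refine Finset.sum_le_sum fun a _ => ?_
    rw [ENNReal.ofReal_sum_of_nonneg fun b _ => hB a b]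
    exact Finset.sum_le_sum fun b _ => h a b
  · intro r hr
    by_contra hc
    refine hr ?_
    dsimp only
    rw [quad_eq_zero k r]
    · exact kernelNorm_zero m
    · rintro a b rfl
      exact hc ⟨(a, b), rfl⟩

end Quad

/-! ### Lattice paths -/

section Path
variable {L : ℕ}

/-- The sum of a function over the (signed) bonds of the straight path of `k` steps in direction
`j` that starts at `w`. -/
def lineSum {A : Type*} [AddCommGroup A] (f : Sp L → A) (j : Fin 3) (w : Sp L) (k : ℤ) : A :=
  ∑ s ∈ Finset.Ico 0 k, f (w + Pi.single j (s : ZMod L))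
    - ∑ s ∈ Finset.Ico k 0, f (w + Pi.single j (s : ZMod L))

lemma lineSum_add_one {A : Type*} [AddCommGroup A] (f : Sp L → A) (j : Fin 3) (w : Sp L) (k : ℤ) :
    lineSum f j w (k + 1) = lineSum f j w k + f (w + Pi.single j (k : ZMod L)) := by
  unfold lineSum
  rcases le_or_gt 0 k with hk | hk
  · rw [← Finset.insert_Ico_right_eq_Ico_add_one hk, Finset.sum_insert (by simp),
      Finset.Ico_eq_empty (a := k + 1) (by omega), Finset.Ico_eq_empty (a := k) (by omega)]
    simp [add_comm]
  · rw [← Finset.insert_Ico_add_one_left_eq_Ico hk, Finset.sum_insert (by simp),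
      Finset.Ico_eq_empty (b := k + 1) (by omega), Finset.Ico_eq_empty (b := k) (by omega)]
    simp

/-- The gradient is summed to the difference of the values at the end points. -/
lemma lineSum_grad {A : Type*} [AddCommGroup A] (f : Sp L → A) (j : Fin 3) (w : Sp L) (k : ℤ) :
    lineSum (fun z => f (z + spUnit j) - f z) j w k = f (w + Pi.single j (k : ZMod L)) - f w := by
  have step : ∀ k : ℤ, w + Pi.single j ((k + 1 : ℤ) : ZMod L)
      = w + Pi.single j (k : ZMod L) + spUnit j := by
    intro k
    rw [spUnit, add_assoc, ← Pi.single_add]; push_cast; rfl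
  induction k using Int.induction_on with
  | zero => simp [lineSum]
  | succ n ih => rw [lineSum_add_one, ih, step]; abel
  | pred n ih =>
    have h := lineSum_add_one (fun z => f (z + spUnit j) - f z) j w (-(n : ℤ) - 1)
    have h2 := step (-(n : ℤ) - 1)
    rw [sub_add_cancel] at h h2
    rw [ih, h2] at h
    have h3 := eq_sub_of_add_eq h.symm
    rw [h3]; abel

/-- A reflection in the direction of a path reverses the path. A bond is given by its lower end
point, which leads to the shift by one step and to the sign. -/
lemma lineSum_refl_self {A : Type*} [AddCommGroup A] (f : Sp L → A) (j : Fin 3) (w : Sp L)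
    (k : ℤ) : lineSum (fun u => -f (spRefl j u - spUnit j)) j w k
      = lineSum f j (spRefl j w) (-k) := by
  have h : ∀ s : ℤ, spRefl j (w + Pi.single j (s : ZMod L)) - spUnit j
      = spRefl j w + Pi.single j ((-s - 1 : ℤ) : ZMod L) := by
    intro s; funext i
    by_cases hi : i = j
    · subst hi; simp [spRefl, spUnit]; ring
    · simp [spRefl, spUnit, hi]
  have hr : ∀ a b : ℤ, ∑ s ∈ Finset.Ico a b,
      f (spRefl j w + Pi.single j ((-s - 1 : ℤ) : ZMod L))
      = ∑ s ∈ Finset.Ico (-b) (-a), f (spRefl j w + Pi.single j (s : ZMod L)) := by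
    intro a b
    refine Finset.sum_nbij' (fun s => -s - 1) (fun s => -s - 1) ?_ ?_ ?_ ?_ ?_
    · intro s hs; simp only [Finset.mem_Ico] at hs ⊢; omega
    · intro s hs; simp only [Finset.mem_Ico] at hs ⊢; omega
    · intro s _; ring
    · intro s _; ring
    · intro s _; rfl
  unfold lineSum
  simp only [h, Finset.sum_neg_distrib, hr, neg_zero]
  abel

lemma lineSum_refl_of_ne {A : Type*} [AddCommGroup A] (f : Sp L → A) {i j : Fin 3} (hij : i ≠ j)
    (w : Sp L) (k : ℤ) : lineSum (fun u => f (spRefl j u)) i w k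
      = lineSum f i (spRefl j w) k := by
  have h : ∀ s : ℤ, spRefl j (w + Pi.single i (s : ZMod L))
      = spRefl j w + Pi.single i (s : ZMod L) := by
    intro s; funext l
    by_cases hl : l = j
    · subst hl; simp [spRefl, hij.symm]
    · simp [spRefl, hl]
  simp only [lineSum, h]

/-- The corners of the path from `y` to `x` that moves along the coordinate directions in their
natural order. -/
def corner (y x : Sp L) (n : ℕ) : Sp L := fun i => if (i : ℕ) < n then x i else y i

/-- The (signed, minimal) number of steps in direction `j` from `y` to `x`. -/
def steps (y x : Sp L) (j : Fin 3) : ℤ := (x j - y j).valMinAbs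

/-- The sum of the bond functions `f j` over the path from `y` to `x`. -/
def pathSum {A : Type*} [AddCommGroup A] (f : Fin 3 → Sp L → A) (y x : Sp L) : A :=
  ∑ j, lineSum (f j) j (corner y x j) (steps y x j)

lemma pathSum_grad {A : Type*} [AddCommGroup A] (f : Sp L → A) (y x : Sp L) :
    pathSum (fun j z => f (z + spUnit j) - f z) y x = f x - f y := by
  have h : ∀ j : Fin 3, corner y x j + Pi.single j ((steps y x j : ℤ) : ZMod L)
      = corner y x (j + 1) := by
    intro j; funext i
    by_cases hi : i = j
    · subst hi; simp [corner, steps]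
    · have : (i : ℕ) ≠ j := fun h => hi (Fin.ext h)
      have h2 : ((i : ℕ) < j) ↔ (i : ℕ) < j + 1 := by omega
      simp [corner, hi, h2]
  have h0 : corner y x 0 = y := by funext i; simp [corner]
  have h3 : corner y x 3 = x := by funext i; simp [corner]
  unfold pathSum
  simp only [lineSum_grad, h]
  rw [Fin.sum_univ_three]
  simp only [Fin.val_zero, Fin.val_one, Fin.val_two, zero_add, one_add_one_eq_two,
    show 2 + 1 = 3 from rfl, h0, h3]
  abel

lemma valMinAbs_neg_of_odd (hL : Odd L) (a : ZMod L) : (-a).valMinAbs = -a.valMinAbs := by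
  refine ZMod.valMinAbs_neg_of_ne_half fun h => ?_
  obtain ⟨k, hk⟩ := hL
  omega

lemma corner_refl (j : Fin 3) (y x : Sp L) (n : ℕ) :
    corner (spRefl j y) (spRefl j x) n = spRefl j (corner y x n) := by
  funext i
  by_cases hi : i = j
  · subst hi; simp only [corner, spRefl, Function.update_self]; split_ifs <;> rfl
  · simp [corner, spRefl, hi]

/-- Paths are mapped to paths by reflections: the minimal number of steps changes its sign, as on a
torus of odd size there is no tie between the two directions. -/
lemma pathSum_refl {A : Type*} [AddCommGroup A] (hL : Odd L) (f : Fin 3 → Sp L → A) (j : Fin 3)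
    (y x : Sp L) :
    pathSum (fun i u => if i = j then -f i (spRefl j u - spUnit j) else f i (spRefl j u)) y x
      = pathSum f (spRefl j y) (spRefl j x) := by
  unfold pathSum
  refine Finset.sum_congr rfl fun i _ => ?_
  by_cases hi : i = j
  · subst hi
    simp only [if_true]
    rw [lineSum_refl_self, corner_refl]
    congr 1
    simp only [steps, spRefl, Function.update_self]
    rw [← valMinAbs_neg_of_odd hL]; congr 1; ring
  · simp only [if_neg hi]
    rw [lineSum_refl_of_ne _ hi, corner_refl]
    congr 1
    simp [steps, spRefl, hi]

lemma pathSum_sub {A : Type*} [AddCommGroup A] (f : Fin 3 → Sp L → A) (a y x : Sp L) :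
    pathSum (fun i u => f i (u - a)) y x = pathSum f (y - a) (x - a) := by
  unfold pathSum
  refine Finset.sum_congr rfl fun i _ => ?_
  have h1 : steps (y - a) (x - a) i = steps y x i := by simp [steps]
  have h2 : corner (y - a) (x - a) i = corner y x i - a := by
    funext l; simp only [corner, Pi.sub_apply]; split_ifs <;> rfl
  rw [h1, h2]
  simp only [lineSum, sub_add_eq_add_sub]

/-- The signed number of times the path from `y` to `x` passes through the bond `(u, j)`. -/
def crossing (j : Fin 3) (y x u : Sp L) : ℝ :=
  lineSum (fun z => if z = u then (1 : ℝ) else 0) j (corner y x j) (steps y x j)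

lemma sum_crossing_mul [NeZero L] (j : Fin 3) (y x : Sp L) (f : Sp L → ℂ) :
    ∑ u, (crossing j y x u : ℂ) * f u = lineSum f j (corner y x j) (steps y x j) := by
  have h : ∀ A : Finset ℤ, ∑ u, ((∑ s ∈ A, (fun z => if z = u then (1 : ℝ) else 0)
      (corner y x j + Pi.single j (s : ZMod L)) : ℝ) : ℂ) * f u
      = ∑ s ∈ A, f (corner y x j + Pi.single j (s : ZMod L)) := by
    intro A
    simp only [Complex.ofReal_sum, Finset.sum_mul]
    rw [Finset.sum_comm]
    refine Finset.sum_congr rfl fun s _ => ?_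
    rw [Finset.sum_eq_single (corner y x j + Pi.single j (s : ZMod L))]
    · simp
    · intro u _ hu; simp [hu.symm]
    · simp
  unfold crossing lineSum
  rw [← h, ← h, ← Finset.sum_sub_distrib]
  refine Finset.sum_congr rfl fun u _ => ?_
  rw [Complex.ofReal_sub, sub_mul]

lemma crossing_add (j : Fin 3) (y x u a : Sp L) :
    crossing j (y + a) (x + a) (u + a) = crossing j y x u := by
  unfold crossing
  have h1 : steps (y + a) (x + a) j = steps y x j := by simp [steps]
  have h2 : corner (y + a) (x + a) j = corner y x j + a := by
    funext l; simp only [corner, Pi.add_apply]; split_ifs <;> rfl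
  rw [h1, h2]
  have h3 : ∀ s : ZMod L, (corner y x j + a + Pi.single j s = u + a)
      ↔ (corner y x j + Pi.single j s = u) := fun s => by
    rw [add_right_comm, add_left_inj]
  simp only [lineSum, h3]

lemma abs_crossing_le (j : Fin 3) (y x u : Sp L) : |crossing j y x u| ≤
    ∑ s ∈ Finset.Ico 0 (steps y x j) ∪ Finset.Ico (steps y x j) 0,
      if corner y x j + Pi.single j (s : ZMod L) = u then 1 else 0 := by
  unfold crossing lineSum
  rw [Finset.sum_union]
  · refine (abs_sub _ _).trans (add_le_add (le_of_eq (abs_of_nonneg ?_))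
      (le_of_eq (abs_of_nonneg ?_))) <;>
    exact Finset.sum_nonneg fun _ _ => by dsimp only; split_ifs <;> simp
  · rw [Finset.disjoint_left]
    intro s h1 h2
    simp only [Finset.mem_Ico] at h1 h2; omega

/-- The path moves by the minimal number of steps in each direction. -/
lemma sum_abs_crossing_le [NeZero L] (j : Fin 3) (y x : Sp L) :
    ∑ u, |crossing j y x u| ≤ absMin (x j - y j) := by
  refine (Finset.sum_le_sum fun u _ => abs_crossing_le j y x u).trans ?_
  rw [Finset.sum_comm]
  simp only [Finset.sum_ite_eq, Finset.mem_univ, if_true, Finset.sum_const, nsmul_eq_mul, mul_one]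
  rw [absMin, ← Int.cast_abs]
  have : ((Finset.Ico 0 (steps y x j) ∪ Finset.Ico (steps y x j) 0).card : ℤ)
      ≤ |(x j - y j).valMinAbs| := by
    refine (Int.ofNat_le.2 (Finset.card_union_le _ _)).trans ?_
    simp only [Int.card_Ico, steps]
    push_cast
    rcases le_total 0 (x j - y j).valMinAbs with h | h
    · rw [abs_of_nonneg h]; simp [h]
    · rw [abs_of_nonpos h]; simp [h]
  exact_mod_cast this

/-- The path stays in the smallest box that contains `x` and `y`. -/
lemma exists_of_crossing_ne_zero {j : Fin 3} {y x u : Sp L} (h : crossing j y x u ≠ 0) (i : Fin 3) :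
    ∃ t : ℤ, u i = y i + t ∧ (0 ≤ t ∧ t ≤ steps y x i ∨ steps y x i ≤ t ∧ t ≤ 0) := by
  have h1 : ∃ s ∈ Finset.Ico 0 (steps y x j) ∪ Finset.Ico (steps y x j) 0,
      corner y x j + Pi.single j (s : ZMod L) = u := by
    by_contra hc
    push Not at hc
    have h2 := abs_crossing_le j y x u
    rw [Finset.sum_eq_zero fun s hs => if_neg (hc s hs)] at h2
    exact h (abs_eq_zero.1 (le_antisymm h2 (abs_nonneg _)))
  obtain ⟨s, hs, rfl⟩ := h1
  simp only [Finset.mem_union, Finset.mem_Ico] at hs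
  by_cases hi : i = j
  · subst hi
    exact ⟨s, by simp [corner], by omega⟩
  · by_cases hlt : (i : ℕ) < j
    · refine ⟨steps y x i, by simp [corner, hi, hlt, steps], ?_⟩
      rcases le_total 0 (steps y x i) with h | h
      · exact .inl ⟨h, le_rfl⟩
      · exact .inr ⟨le_rfl, h⟩
    · refine ⟨0, by simp [corner, hi, hlt], ?_⟩
      rcases le_total 0 (steps y x i) with h | h
      · exact .inl ⟨le_rfl, h⟩
      · exact .inr ⟨h, le_rfl⟩

/-- Two bonds on the path from `y` to `x` are at most as far apart as `y` and `x`. -/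
lemma spDist_le_of_crossing_ne_zero {j j' : Fin 3} {y x u u' : Sp L}
    (h : crossing j y x u ≠ 0) (h' : crossing j' y x u' ≠ 0) : spDist u u' ≤ spDist x y := by
  refine spDist_le_of_absMin_le fun i => ?_
  obtain ⟨t, ht, hb⟩ := exists_of_crossing_ne_zero h i
  obtain ⟨t', ht', hb'⟩ := exists_of_crossing_ne_zero h' i
  have : u i - u' i = ((t - t' : ℤ) : ZMod L) := by rw [ht, ht']; push_cast; ring
  rw [this]
  refine (absMin_intCast_le _).trans ?_
  rw [absMin, ← Int.cast_abs, ← Int.cast_abs, Int.cast_le]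
  change |t - t'| ≤ |steps y x i|
  rcases le_total 0 (steps y x i) with h | h
  · rw [abs_of_nonneg h, abs_le]; omega
  · rw [abs_of_nonpos h, abs_le]; omega

end Path

/-! ### The part bilinear in the fields and their derivatives -/

/-- The kernels of
`ρ/2 ∑ r(x,y) φ_*(n,x) φ_0(n,y) - ρ/2 ∑ r(x,y) φ_{*0}(n,x) φ(n+1,y)
  - ρ/2 ∑ r(x,y) (∑_{path y → x} φ_{*ν}(n,·)) (∑_{path y → x} φ_ν(n,·))`. -/
def bilKernel {Lt L : ℕ} [NeZero L] (ρ : ℝ) (r : Sp L → Sp L → ℝ) :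
    Option (Fin 4) → Option (Fin 4) → STLat Lt L → STLat Lt L → ℝ
  | none, none => 0
  | none, some ν => Fin.cases
      (fun u u' => if u'.1 = u.1 then ρ / 2 * r u.2 u'.2 else 0) (fun _ => 0) ν
  | some ν, none => Fin.cases
      (fun u u' => if u'.1 = u.1 + 1 then -(ρ / 2 * r u.2 u'.2) else 0) (fun _ => 0) ν
  | some ν, some ν' => Fin.cases 0 (fun j => Fin.cases 0 (fun j' => fun u u' =>
      if u'.1 = u.1 then
        -(ρ / 2 * ∑ x, ∑ y, r x y * crossing j y x u.2 * crossing j' y x u'.2) else 0) ν') ν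

/-- Only monomials with one field and one time derivative, or with two spatial derivatives, occur.
-/
lemma eq_zero_of_monoType {Lt L : ℕ} [NeZero L] (ρ : ℝ) (r : Sp L → Sp L → ℝ)
    (s : Fin 2 × Option (Fin 4) → ℕ) (h1 : monoType s ≠ (1, 1, 0)) (h2 : monoType s ≠ (0, 0, 2)) :
    quad (bilKernel (Lt := Lt) ρ r) s = 0 := by
  by_cases hs : ∃ a b, s = bideg a b
  · obtain ⟨a, b, rfl⟩ := hs
    funext x
    rw [quad_bideg]
    rcases a with _ | ν <;> rcases b with _ | ν'
    · rfl
    · induction ν' using Fin.cases with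
      | zero => exact absurd (by decide) h1
      | succ j => rfl
    · induction ν using Fin.cases with
      | zero => exact absurd (by decide) h1
      | succ j => rfl
    · induction ν using Fin.cases with
      | zero => rfl
      | succ j =>
        induction ν' using Fin.cases with
        | zero => rfl
        | succ j' =>
          have key : ∀ j j' : Fin 3,
              monoType (bideg (some j.succ) (some j'.succ)) = (0, 0, 2) := by decide
          exact absurd (key j j') h2
  · push Not at hs
    exact quad_eq_zero _ _ hs

/-- The spatial derivative fields at time `n`. -/
def spPart {Lt L : ℕ} (φ : TField Lt L) (n : ZMod Lt) (j : Fin 3) (u : Sp L) : ℂ :=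
  φ (some j.succ) (n, u)

lemma sum_stLat {Lt L : ℕ} [NeZero Lt] [NeZero L] (f : STLat Lt L → ℂ) :
    ∑ u, f u = ∑ n, ∑ x, f (n, x) := Fintype.sum_prod_type _

section
variable {Lt L : ℕ} [NeZero Lt] [NeZero L] {ρ : ℝ} {r : Sp L → Sp L → ℝ}

lemma sum_mul_sum_mul_sum {P U : Type*} [Fintype P] [Fintype U] (c : P → ℂ) (a b : P → U → ℂ) :
    ∑ u, ∑ u', ∑ p, c p * a p u * b p u' = ∑ p, c p * (∑ u, a p u) * ∑ u', b p u' := by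
  calc _ = ∑ u, ∑ p, ∑ u', c p * a p u * b p u' :=
        Finset.sum_congr rfl fun u _ => Finset.sum_comm
    _ = ∑ p, ∑ u, ∑ u', c p * a p u * b p u' := Finset.sum_comm
    _ = _ := Finset.sum_congr rfl fun p _ => by
        rw [Finset.mul_sum Finset.univ (a p), Finset.sum_mul_sum]

/-- The bilinear form with the kernels `bilKernel`. -/
lemma extEval_bilKernel (φs φ : TField Lt L) :
    extEval (quad (bilKernel ρ r)) φs φ
      = ρ / 2 * (∑ n, ∑ x, ∑ y, r x y * φs none (n, x) * φ (some 0) (n, y))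
        - ρ / 2 * (∑ n, ∑ x, ∑ y, r x y * φs (some 0) (n, x) * φ none (n + 1, y))
        - ρ / 2 * (∑ n, ∑ x, ∑ y,
          r x y * pathSum (spPart φs n) y x * pathSum (spPart φ n) y x) := by
  unfold extEval
  rw [eval_quad]
  -- the blocks of kernels: underived fields, time derivatives, and spatial derivatives
  have e00 : (∑ u : STLat Lt L, ∑ u' : STLat Lt L,
      (bilKernel ρ r none none u u' : ℂ) * φs none u * φ none u') = 0 := by simp [bilKernel]
  have e01 : (∑ u : STLat Lt L, ∑ u' : STLat Lt L,
      (bilKernel ρ r none (some 0) u u' : ℂ) * φs none u * φ (some 0) u')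
      = ρ / 2 * (∑ n, ∑ x, ∑ y, r x y * φs none (n, x) * φ (some 0) (n, y)) := by
    simp only [sum_stLat, Finset.mul_sum]
    refine Finset.sum_congr rfl fun n _ => Finset.sum_congr rfl fun x _ => ?_
    rw [Finset.sum_eq_single n]
    · refine Finset.sum_congr rfl fun y _ => ?_
      simp [bilKernel]; ring
    · intro n' _ hn; simp [bilKernel, hn]
    · simp
  have e0s : ∀ j : Fin 3, (∑ u : STLat Lt L, ∑ u' : STLat Lt L,
      (bilKernel ρ r none (some j.succ) u u' : ℂ) * φs none u * φ (some j.succ) u') = 0 := by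
    simp [bilKernel]
  have e10 : (∑ u : STLat Lt L, ∑ u' : STLat Lt L,
      (bilKernel ρ r (some 0) none u u' : ℂ) * φs (some 0) u * φ none u')
      = -(ρ / 2 * (∑ n, ∑ x, ∑ y, r x y * φs (some 0) (n, x) * φ none (n + 1, y))) := by
    simp only [sum_stLat, Finset.mul_sum, ← Finset.sum_neg_distrib]
    refine Finset.sum_congr rfl fun n _ => Finset.sum_congr rfl fun x _ => ?_
    rw [Finset.sum_eq_single (n + 1)]
    · refine Finset.sum_congr rfl fun y _ => ?_
      simp [bilKernel]; ring
    · intro n' _ hn; simp [bilKernel, hn]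
    · simp
  have es0 : ∀ j : Fin 3, (∑ u : STLat Lt L, ∑ u' : STLat Lt L,
      (bilKernel ρ r (some j.succ) none u u' : ℂ) * φs (some j.succ) u * φ none u') = 0 := by
    simp [bilKernel]
  have et0 : ∀ ν : Fin 4, (∑ u : STLat Lt L, ∑ u' : STLat Lt L,
      (bilKernel ρ r (some 0) (some ν) u u' : ℂ) * φs (some 0) u * φ (some ν) u') = 0 := by
    intro ν; simp [bilKernel]
  have et1 : ∀ j : Fin 3, (∑ u : STLat Lt L, ∑ u' : STLat Lt L,
      (bilKernel ρ r (some j.succ) (some 0) u u' : ℂ) * φs (some j.succ) u * φ (some 0) u')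
        = 0 := by
    intro ν; simp [bilKernel]
  have ess : ∀ j j' : Fin 3, (∑ u : STLat Lt L, ∑ u' : STLat Lt L,
      (bilKernel ρ r (some j.succ) (some j'.succ) u u' : ℂ) * φs (some j.succ) u *
        φ (some j'.succ) u')
      = -(ρ / 2 * ∑ n, ∑ x, ∑ y, r x y * lineSum (spPart φs n j) j (corner y x j) (steps y x j)
        * lineSum (spPart φ n j') j' (corner y x j') (steps y x j')) := by
    intro j j'
    simp only [← sum_crossing_mul]
    rw [sum_stLat, Finset.mul_sum, ← Finset.sum_neg_distrib]
    refine Finset.sum_congr rfl fun n _ => ?_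
    have h1 : ∀ u : Sp L, (∑ u' : STLat Lt L,
        (bilKernel ρ r (some j.succ) (some j'.succ) (n, u) u' : ℂ) * φs (some j.succ) (n, u) *
        φ (some j'.succ) u') = ∑ u' : Sp L, ∑ x, ∑ y, -(ρ / 2 * (r x y *
          ((crossing j y x u : ℂ) * spPart φs n j u) *
          ((crossing j' y x u' : ℂ) * spPart φ n j' u'))) := by
      intro u
      rw [sum_stLat, Finset.sum_eq_single n]
      · refine Finset.sum_congr rfl fun u' _ => ?_
        simp only [bilKernel, Fin.cases_succ, if_true, spPart]
        push_cast
        simp only [Finset.mul_sum, Finset.sum_mul, ← Finset.sum_neg_distrib]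
        refine Finset.sum_congr rfl fun x _ => Finset.sum_congr rfl fun y _ => ?_
        ring
      · intro n' _ hn; simp [bilKernel, hn]
      · simp
    simp only [h1]
    have h2 := sum_mul_sum_mul_sum (P := Sp L × Sp L) (U := Sp L)
      (fun p => -(ρ / 2 * r p.1 p.2 : ℂ))
      (fun p u => (crossing j p.2 p.1 u : ℂ) * spPart φs n j u)
      (fun p u => (crossing j' p.2 p.1 u : ℂ) * spPart φ n j' u)
    simp only [Fintype.sum_prod_type] at h2
    rw [Finset.mul_sum, ← Finset.sum_neg_distrib]
    refine Eq.trans ?_ (h2.trans ?_)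
    · refine Finset.sum_congr rfl fun u _ => Finset.sum_congr rfl fun u' _ =>
        Finset.sum_congr rfl fun x _ => Finset.sum_congr rfl fun y _ => ?_
      ring
    · refine Finset.sum_congr rfl fun x _ => ?_
      rw [Finset.mul_sum, ← Finset.sum_neg_distrib]
      refine Finset.sum_congr rfl fun y _ => ?_
      ring
  change ∑ a, ∑ b, ∑ u, ∑ u', (bilKernel ρ r a b u u' : ℂ) * φs a u * φ b u' = _
  simp only [Fintype.sum_option, Fin.sum_univ_succ (n := 3)]
  simp only [e00, e01, e0s, e10, es0, et0, et1, ess, Finset.sum_const_zero, zero_add, add_zero]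
  -- the sums over all directions of the first and of the second path
  have e : ∑ n, ∑ x, ∑ y, r x y * pathSum (spPart φs n) y x * pathSum (spPart φ n) y x
      = ∑ j, ∑ j', ∑ n, ∑ x, ∑ y, (r x y : ℂ) *
        lineSum (spPart φs n j) j (corner y x j) (steps y x j)
        * lineSum (spPart φ n j') j' (corner y x j') (steps y x j') := by
    have h2 := sum_mul_sum_mul_sum (P := ZMod Lt × Sp L × Sp L) (U := Fin 3)
      (fun p => (r p.2.1 p.2.2 : ℂ))
      (fun p j => lineSum (spPart φs p.1 j) j (corner p.2.2 p.2.1 j) (steps p.2.2 p.2.1 j))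
      (fun p j => lineSum (spPart φ p.1 j) j (corner p.2.2 p.2.1 j) (steps p.2.2 p.2.1 j))
    simp only [Fintype.sum_prod_type] at h2
    exact h2.symm
  rw [e, Finset.mul_sum]
  simp only [Finset.mul_sum, Finset.sum_neg_distrib]
  ring

/-- Reindexing by a translation. -/
lemma sum_sub_sub (a : STLat Lt L) (g : ZMod Lt → Sp L → Sp L → ℂ) :
    ∑ n, ∑ x, ∑ y, g (n - a.1) (x - a.2) (y - a.2) = ∑ n, ∑ x, ∑ y, g n x y := by
  refine ((Equiv.subRight a.1).sum_comp
    (fun n => ∑ x, ∑ y, g n (x - a.2) (y - a.2))).trans ?_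
  refine Finset.sum_congr rfl fun n _ => ?_
  refine ((Equiv.subRight a.2).sum_comp (fun x => ∑ y, g n x (y - a.2))).trans ?_
  exact Finset.sum_congr rfl fun x _ => (Equiv.subRight a.2).sum_comp (g n x)

lemma sum_refl_refl (j : Fin 3) (g : ZMod Lt → Sp L → Sp L → ℂ) :
    ∑ n, ∑ x, ∑ y, g n (spRefl j x) (spRefl j y) = ∑ n, ∑ x, ∑ y, g n x y := by
  refine Finset.sum_congr rfl fun n _ => ?_
  refine ((spReflEquiv L j).sum_comp (fun x => ∑ y, g n x (spRefl j y))).trans ?_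
  exact Finset.sum_congr rfl fun x _ => (spReflEquiv L j).sum_comp (g n x)

lemma conj_extEval (F : FieldSeries (Fin 2 × Option (Fin 4)) (STLat Lt L)) (φs φ : TField Lt L) :
    conj (extEval F φs φ) = extEval F (star φs) (star φ) := by
  unfold extEval
  rw [FieldSeries.conj_eval]
  congr 1
  funext s
  rcases s with ⟨i, o⟩
  fin_cases i <;> rfl

/-- Translations and reflections map paths to paths. The time reflection exchanges the first two of
the three forms in `bilKernel`, because `r` is symmetric. -/
lemma sInvariant_bilKernel (hL : Odd L) (hsymm : ∀ x y, r x y = r y x)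
    (htrans : ∀ a x y, r (x + a) (y + a) = r x y)
    (hrefl : ∀ j x y, r (spRefl j x) (spRefl j y) = r x y) :
    SInvariant (extEval (quad (bilKernel (Lt := Lt) ρ r))) where
  trans a φs φ := by
    have hr : ∀ x y, r (x - a.2) (y - a.2) = r x y := fun x y => by
      simpa using (htrans a.2 (x - a.2) (y - a.2)).symm
    have hp : ∀ (φ : TField Lt L) n x y, pathSum (spPart (tTrans a φ) n) y x
        = pathSum (spPart φ (n - a.1)) (y - a.2) (x - a.2) := by
      intro φ n x y
      rw [← pathSum_sub]; rfl
    have h0 : ∀ (φ : TField Lt L) o n x, tTrans a φ o (n, x) = φ o (n - a.1, x - a.2) :=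
      fun _ _ _ _ => rfl
    have h1 := sum_sub_sub a fun n x y => (r x y : ℂ) * φs none (n, x) * φ (some 0) (n, y)
    have h2 := sum_sub_sub a fun n x y => (r x y : ℂ) * φs (some 0) (n, x) * φ none (n + 1, y)
    have h3 := sum_sub_sub a fun n x y =>
      (r x y : ℂ) * pathSum (spPart φs n) y x * pathSum (spPart φ n) y x
    simp only [hr, sub_add_eq_add_sub] at h1 h2 h3
    rw [extEval_bilKernel, extEval_bilKernel]
    simp only [h0, hp]
    rw [h1, h2, h3]
  refl j φs φ := by
    have hp : ∀ (φ : TField Lt L) n x y, pathSum (spPart (tRefl j.succ φ) n) y x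
        = pathSum (spPart φ n) (spRefl j y) (spRefl j x) := by
      intro φ n x y
      rw [← pathSum_refl hL]
      congr 1
      funext i u
      by_cases hi : i = j
      · subst hi
        simp [spPart, tRefl, stRefl, stUnit]
      · simp [spPart, tRefl, stRefl, hi]
    have h0 : ∀ (φ : TField Lt L) n x, tRefl j.succ φ none (n, x) = φ none (n, spRefl j x) :=
      fun _ _ _ => rfl
    have h1 : ∀ (φ : TField Lt L) n x, tRefl j.succ φ (some 0) (n, x)
        = φ (some 0) (n, spRefl j x) := by
      intro φ n x
      simp only [tRefl]
      rw [if_neg (Fin.succ_ne_zero j).symm]; rfl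
    have e1 := sum_refl_refl j fun n x y => (r x y : ℂ) * φs none (n, x) * φ (some 0) (n, y)
    have e2 := sum_refl_refl j fun n x y => (r x y : ℂ) * φs (some 0) (n, x) * φ none (n + 1, y)
    have e3 := sum_refl_refl j fun n x y =>
      (r x y : ℂ) * pathSum (spPart φs n) y x * pathSum (spPart φ n) y x
    simp only [hrefl] at e1 e2 e3
    rw [extEval_bilKernel, extEval_bilKernel]
    simp only [h0, h1, hp]
    rw [e1, e2, e3]
  timeRefl φs φ := by
    have h0 : ∀ (φ : TField Lt L), star (tRefl 0 (star φ)) = tRefl 0 φ := by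
      intro φ
      funext o u
      rcases o with _ | ν
      · simp [tRefl]
      · simp only [Pi.star_apply, tRefl]; split_ifs <;> simp
    rw [conj_extEval, h0, h0, extEval_bilKernel, extEval_bilKernel]
    have h1 : ∀ (φ : TField Lt L) n x, tRefl 0 φ none (n, x) = φ none (-n, x) := fun _ _ _ => rfl
    have h2 : ∀ (φ : TField Lt L) n x, tRefl 0 φ (some 0) (n, x) = -φ (some 0) (-n - 1, x) := by
      intro φ n x; simp [tRefl, stRefl, stUnit]
    have h3 : ∀ (φ : TField Lt L) n, spPart (tRefl 0 φ) n = spPart φ (-n) := by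
      intro φ n; funext j u; simp [spPart, tRefl, stRefl]
    simp only [h1, h2, h3]
    -- substitute `n ↦ -1 - n`
    have e1 : ∑ n : ZMod Lt, ∑ x, ∑ y, (r x y : ℂ) * φ none (-n, x) * -φs (some 0) (-n - 1, y)
        = -∑ n, ∑ x, ∑ y, r x y * φs (some 0) (n, x) * φ none (n + 1, y) := by
      refine ((Equiv.subLeft (-1 : ZMod Lt)).sum_comp _).symm.trans ?_
      rw [← Finset.sum_neg_distrib]
      refine Finset.sum_congr rfl fun n _ => ?_
      rw [Finset.sum_comm, ← Finset.sum_neg_distrib]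
      refine Finset.sum_congr rfl fun x _ => ?_
      rw [← Finset.sum_neg_distrib]
      refine Finset.sum_congr rfl fun y _ => ?_
      simp only [Equiv.subLeft_apply]
      rw [hsymm y x, show -(-1 - n) = n + 1 by ring, show n + 1 - 1 = n by ring]
      ring
    have e2 : ∑ n : ZMod Lt, ∑ x, ∑ y, (r x y : ℂ) * -φ (some 0) (-n - 1, x) *
        φs none (-(n + 1), y)
        = -∑ n, ∑ x, ∑ y, r x y * φs none (n, x) * φ (some 0) (n, y) := by
      refine ((Equiv.subLeft (-1 : ZMod Lt)).sum_comp _).symm.trans ?_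
      rw [← Finset.sum_neg_distrib]
      refine Finset.sum_congr rfl fun n _ => ?_
      rw [Finset.sum_comm, ← Finset.sum_neg_distrib]
      refine Finset.sum_congr rfl fun x _ => ?_
      rw [← Finset.sum_neg_distrib]
      refine Finset.sum_congr rfl fun y _ => ?_
      simp only [Equiv.subLeft_apply]
      rw [hsymm y x, show -(-1 - n) - 1 = n by ring, show -(-1 - n + 1) = n by ring]
      ring
    have e3 : ∑ n : ZMod Lt, ∑ x, ∑ y, (r x y : ℂ) * pathSum (spPart φ (-n)) y x *
        pathSum (spPart φs (-n)) y x
        = ∑ n, ∑ x, ∑ y, (r x y : ℂ) * pathSum (spPart φs n) y x * pathSum (spPart φ n) y x := by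
      refine (Equiv.sum_comp (Equiv.neg (ZMod Lt)) _).symm.trans ?_
      refine Finset.sum_congr rfl fun n _ => Finset.sum_congr rfl fun x _ =>
        Finset.sum_congr rfl fun y _ => ?_
      simp only [Equiv.neg_apply, neg_neg]
      ring
    rw [e1, e2, e3]; ring

lemma numberPreserving_bilKernel :
    NumberPreserving (extEval (quad (bilKernel (Lt := Lt) ρ r))) := by
  intro t φs φ
  have hc : Complex.exp (-(t * Complex.I)) * Complex.exp (t * Complex.I) = 1 := by
    rw [← Complex.exp_add]; simp
  unfold extEval
  rw [eval_quad, eval_quad]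
  refine Finset.sum_congr rfl fun a _ => Finset.sum_congr rfl fun b _ =>
    Finset.sum_congr rfl fun u _ => Finset.sum_congr rfl fun u' _ => ?_
  simp only [Matrix.cons_val_zero, Matrix.cons_val_one, Pi.smul_apply, smul_eq_mul]
  linear_combination (bilKernel ρ r a b u u' : ℂ) * φs a u * φ b u' * hc

/-- On the fields `(ψ, {∂_ν ψ})` the bilinear form reduces to the original one, up to a shift of
the chemical potential: `ψ(n+1) = ψ(n) + ∂_0 ψ(n)`, and
`∑ r(x,y) ψ_*(x) ψ(y) = r̂ ⟨ψ_*, ψ⟩ - ½ ∑ r(x,y) (ψ_*(x) - ψ_*(y)) (ψ(x) - ψ(y))`. -/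
lemma extEval_bilKernel_jet (hsymm : ∀ x y, r x y = r y x)
    (htrans : ∀ a x y, r (x + a) (y + a) = r x y) (ψs ψ : STLat Lt L → ℂ) :
    extEval (quad (bilKernel ρ r)) (jet ψs) (jet ψ)
      = ρ * (∑ n, ∑ x, ∑ y, r x y * ψs (n - 1, x) * ψ (n, y))
        - ρ * ((∑ y, r 0 y : ℝ) : ℂ) * ∑ n, ∑ x, ψs (n, x) * ψ (n, x) := by
  have hrow : ∀ x, ∑ y, r x y = ∑ y, r 0 y := by
    intro x
    refine (Equiv.sum_comp (Equiv.addRight x) _).symm.trans ?_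
    refine Finset.sum_congr rfl fun y _ => ?_
    rw [← htrans x 0 y, zero_add]; rfl
  have hrow' : ∀ x, ∑ y, (r x y : ℂ) = ((∑ y, r 0 y : ℝ) : ℂ) := by
    intro x; rw [← hrow x]; push_cast; rfl
  have hp : ∀ (ψ : STLat Lt L → ℂ) n x y, pathSum (spPart (jet ψ) n) y x
      = ψ (n, x) - ψ (n, y) := by
    intro ψ n x y
    rw [← pathSum_grad (fun z => ψ (n, z))]
    congr 1
    funext j u
    simp [spPart, jet, fwd, stUnit]
  have h0 : ∀ (ψ : STLat Lt L → ℂ), jet ψ none = ψ := fun _ => rfl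
  have h1 : ∀ (ψ : STLat Lt L → ℂ) n x, jet ψ (some 0) (n, x) = ψ (n + 1, x) - ψ (n, x) := by
    intro ψ n x; simp [jet, fwd, stUnit]
  rw [extEval_bilKernel]
  simp only [h0, h1, hp]
  -- the forms that are nonlocal in time (`T`), local in time (`S`), and local in space-time (`N`)
  set T := ∑ n : ZMod Lt, ∑ x, ∑ y, (r x y : ℂ) * ψs (n, x) * ψ (n + 1, y) with hT
  set S := ∑ n : ZMod Lt, ∑ x, ∑ y, (r x y : ℂ) * ψs (n, x) * ψ (n, y) with hS
  set N := ∑ n : ZMod Lt, ∑ x, ψs (n, x) * ψ (n, x) with hN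
  have eT : ∑ n : ZMod Lt, ∑ x, ∑ y, (r x y : ℂ) * ψs (n - 1, x) * ψ (n, y) = T := by
    refine (Equiv.sum_comp (Equiv.addRight (1 : ZMod Lt)) _).symm.trans ?_
    simp [hT]
  have e1 : ∑ n : ZMod Lt, ∑ x, ∑ y, (r x y : ℂ) * ψs (n, x) * (ψ (n + 1, y) - ψ (n, y))
      = T - S := by
    simp only [mul_sub, Finset.sum_sub_distrib, hT, hS]
  have eS : ∑ n : ZMod Lt, ∑ x, ∑ y, (r x y : ℂ) * ψs (n + 1, x) * ψ (n + 1, y) = S := by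
    exact Equiv.sum_comp (Equiv.addRight (1 : ZMod Lt))
      (fun n => ∑ x, ∑ y, (r x y : ℂ) * ψs (n, x) * ψ (n, y))
  have e2 : ∑ n : ZMod Lt, ∑ x, ∑ y, (r x y : ℂ) * (ψs (n + 1, x) - ψs (n, x)) * ψ (n + 1, y)
      = S - T := by
    simp only [mul_sub, sub_mul, Finset.sum_sub_distrib, eS, hT]
  have e4 : ∑ n : ZMod Lt, ∑ x, ∑ y, (r x y : ℂ) * ψs (n, x) * ψ (n, x)
      = ((∑ y, r 0 y : ℝ) : ℂ) * N := by
    simp only [← Finset.sum_mul, hrow', hN, Finset.mul_sum, mul_assoc]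
  have e5 : ∑ n : ZMod Lt, ∑ x, ∑ y, (r x y : ℂ) * ψs (n, y) * ψ (n, y)
      = ((∑ y, r 0 y : ℝ) : ℂ) * N := by
    rw [← e4]
    refine Finset.sum_congr rfl fun n _ => ?_
    rw [Finset.sum_comm]
    simp only [hsymm]
  have e6 : ∑ n : ZMod Lt, ∑ x, ∑ y, (r x y : ℂ) * ψs (n, y) * ψ (n, x) = S := by
    rw [hS]
    refine Finset.sum_congr rfl fun n _ => ?_
    rw [Finset.sum_comm]
    refine Finset.sum_congr rfl fun x _ => Finset.sum_congr rfl fun y _ => ?_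
    rw [hsymm]
  have e3 : ∑ n : ZMod Lt, ∑ x, ∑ y, (r x y : ℂ) * (ψs (n, x) - ψs (n, y)) *
      (ψ (n, x) - ψ (n, y)) = 2 * (((∑ y, r 0 y : ℝ) : ℂ) * N) - 2 * S := by
    have : ∀ n x y, (r x y : ℂ) * (ψs (n, x) - ψs (n, y)) * (ψ (n, x) - ψ (n, y))
        = (r x y : ℂ) * ψs (n, x) * ψ (n, x) - r x y * ψs (n, x) * ψ (n, y)
          - r x y * ψs (n, y) * ψ (n, x) + r x y * ψs (n, y) * ψ (n, y) := by
      intro n x y; ring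
    simp only [this, Finset.sum_add_distrib, Finset.sum_sub_distrib, e4, e5, e6]
    rw [← hS]; ring
  rw [e1, e2, e3, eT]
  ring

end

/-! ### The norm of the bilinear part -/

section
variable {Lt L : ℕ} [NeZero Lt] [NeZero L] {ρ m N : ℝ} {r : Sp L → Sp L → ℝ}

lemma exp_le_exp_two_mul {m : ℝ} (hm : 0 < m) {t : ℝ} (ht : 0 ≤ t) :
    Real.exp (m * t) ≤ Real.exp (2 * m * t) := by
  rw [Real.exp_le_exp]; nlinarith [mul_nonneg hm.le ht]

lemma sq_mul_exp_le {m : ℝ} (hm : 0 < m) {t : ℝ} (ht : 0 ≤ t) :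
    t ^ 2 * Real.exp (m * t) ≤ 2 / m ^ 2 * Real.exp (2 * m * t) := by
  have h1 := Real.quadratic_le_exp_of_nonneg (mul_nonneg hm.le ht)
  have h2 : t ^ 2 ≤ 2 / m ^ 2 * Real.exp (m * t) := by
    rw [div_mul_eq_mul_div, le_div_iff₀ (by positivity)]
    nlinarith [mul_nonneg hm.le ht]
  calc t ^ 2 * Real.exp (m * t) ≤ 2 / m ^ 2 * Real.exp (m * t) * Real.exp (m * t) := by gcongr
    _ = _ := by rw [mul_assoc, ← Real.exp_add]; ring_nf

/-- The paths through a given bond: by translation invariance, their total number with a given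
displacement is the number of steps of one of them. -/
lemma sum_abs_crossing_crossing_le (hm : 0 < m)
    (htrans : ∀ a x y, r (x + a) (y + a) = r x y) (hsymm : ∀ x y, r x y = r y x)
    (hN : ∀ x, ∑ y, |r x y| * Real.exp (2 * m * spDist x y) ≤ N) (j j' : Fin 3) (u : Sp L) :
    ∑ u', |∑ x, ∑ y, r x y * crossing j y x u * crossing j' y x u'| *
      Real.exp (m * spDist u u') ≤ 2 / m ^ 2 * N := by
  set w : Sp L → Sp L → ℝ := fun x y => |r x y| * (spDist x y * Real.exp (m * spDist x y)) with hw
  have hw0 : ∀ x y, 0 ≤ w x y := fun x y =>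
    mul_nonneg (abs_nonneg _) (mul_nonneg (spDist_nonneg _ _) (Real.exp_pos _).le)
  have hwt : ∀ x y a, w (x + a) (y + a) = w x y := fun x y a => by
    simp only [hw, htrans, spDist_add_right]
  calc _ ≤ ∑ u', ∑ x, ∑ y, (|r x y| * |crossing j y x u| * Real.exp (m * spDist x y)) *
        |crossing j' y x u'| := by
        refine Finset.sum_le_sum fun u' _ => ?_
        refine (mul_le_mul_of_nonneg_right (Finset.abs_sum_le_sum_abs _ _)
          (Real.exp_pos _).le).trans ?_
        rw [Finset.sum_mul]
        refine Finset.sum_le_sum fun x _ => ?_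
        refine (mul_le_mul_of_nonneg_right (Finset.abs_sum_le_sum_abs _ _)
          (Real.exp_pos _).le).trans ?_
        rw [Finset.sum_mul]
        refine Finset.sum_le_sum fun y _ => ?_
        rw [abs_mul, abs_mul]
        by_cases h : crossing j y x u = 0
        · simp [h]
        by_cases h' : crossing j' y x u' = 0
        · simp [h']
        have := spDist_le_of_crossing_ne_zero h h'
        calc _ ≤ |r x y| * |crossing j y x u| * |crossing j' y x u'| *
              Real.exp (m * spDist x y) := by gcongr
          _ = _ := by ring
    _ = ∑ x, ∑ y, (|r x y| * |crossing j y x u| * Real.exp (m * spDist x y)) *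
        ∑ u', |crossing j' y x u'| := by
        rw [Finset.sum_comm]
        refine Finset.sum_congr rfl fun x _ => ?_
        rw [Finset.sum_comm]
        simp only [Finset.mul_sum]
    -- the second path has at most `d(x,y)` bonds
    _ ≤ ∑ x, ∑ y, w x y * |crossing j y x u| := by
        refine Finset.sum_le_sum fun x _ => Finset.sum_le_sum fun y _ => ?_
        have h := (sum_abs_crossing_le j' y x).trans (absMin_le_spDist x y j')
        calc _ ≤ (|r x y| * |crossing j y x u| * Real.exp (m * spDist x y)) * spDist x y := by
              gcongr
          _ = _ := by simp only [hw]; ring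
    -- translate the path such that it starts at the origin
    _ = ∑ y, ∑ z, w (z + y) (0 + y) * |crossing j (0 + y) (z + y) (u - y + y)| := by
        rw [Finset.sum_comm]
        refine Finset.sum_congr rfl fun y _ => ?_
        rw [← Equiv.sum_comp (Equiv.addRight y)]
        simp
    _ = ∑ z, w z 0 * ∑ y, |crossing j 0 z (u - y)| := by
        rw [Finset.sum_comm]
        simp only [hwt, crossing_add, Finset.mul_sum]
    _ = ∑ z, w z 0 * ∑ y, |crossing j 0 z y| := by
        refine Finset.sum_congr rfl fun z _ => ?_
        congr 1
        exact Equiv.sum_comp (Equiv.subLeft u) fun y => |crossing j 0 z y|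
    _ ≤ ∑ z, w z 0 * spDist z 0 := by
        refine Finset.sum_le_sum fun z _ => mul_le_mul_of_nonneg_left ?_ (hw0 _ _)
        exact (sum_abs_crossing_le j 0 z).trans (absMin_le_spDist z 0 j)
    _ ≤ ∑ z, 2 / m ^ 2 * (|r 0 z| * Real.exp (2 * m * spDist 0 z)) := by
        refine Finset.sum_le_sum fun z _ => ?_
        simp only [hw]
        rw [hsymm z 0, isPseudoDist_spDist.symm z 0]
        calc _ = |r 0 z| * (spDist 0 z ^ 2 * Real.exp (m * spDist 0 z)) := by ring
          _ ≤ |r 0 z| * (2 / m ^ 2 * Real.exp (2 * m * spDist 0 z)) := by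
              exact mul_le_mul_of_nonneg_left (sq_mul_exp_le hm (spDist_nonneg _ _)) (abs_nonneg _)
          _ = _ := by ring
    _ ≤ _ := by
        rw [← Finset.mul_sum]
        gcongr
        exact hN 0

lemma sum_stLat_eq_single (n : ZMod Lt) (g : Sp L → ℝ) (d : STLat Lt L → ℝ) :
    ∑ u : STLat Lt L, |if u.1 = n then g u.2 else 0| * d u = ∑ x, |g x| * d (n, x) := by
  rw [Fintype.sum_prod_type, Finset.sum_eq_single n]
  · simp
  · intro n' _ hn; simp [hn]
  · simp

lemma sum_stLat_single_eq (n : ZMod Lt) (g : Sp L → ℝ) (d : STLat Lt L → ℝ) :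
    ∑ u : STLat Lt L, |if n = u.1 then g u.2 else 0| * d u = ∑ x, |g x| * d (n, x) := by
  rw [← sum_stLat_eq_single]
  simp only [eq_comm]

lemma stDist_add_one_le {Lt L : ℕ} (n : ZMod Lt) (x y : Sp L) :
    stDist (Lt := Lt) (n, x) (n + 1, y) ≤ 1 + spDist x y := by
  refine (stDist_le _ _).trans ?_
  have := absMin_one_le (n := Lt)
  simpa using this

/-- There are `25` kernels, one for each pair of the fields `ψ_(*)`, `ψ_(*)ν`. The summands of the
last factor come from the parts with derivatives `∂₀ψ`, `∂₀ψ_*` (one vertical edge), and with two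
spatial derivatives (the square of the length of a path). -/
lemma norm_bilKernel_le (hm : 0 < m) (hρ : 0 ≤ ρ)
    (htrans : ∀ a x y, r (x + a) (y + a) = r x y) (hsymm : ∀ x y, r x y = r y x)
    (hN : ∀ x, ∑ y, |r x y| * Real.exp (2 * m * spDist x y) ≤ N) :
    (quad (bilKernel (Lt := Lt) ρ r)).norm stDist m (fun _ => 1)
      ≤ ENNReal.ofReal (25 * (ρ * N * (1 + Real.exp m + 1 / m ^ 2))) := by
  have hN0 : 0 ≤ N := le_trans (Finset.sum_nonneg fun y _ => by positivity) (hN 0)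
  set B := ρ * N * (1 + Real.exp m + 1 / m ^ 2) with hB
  have hB0 : 0 ≤ B := by positivity
  have hN1 : ∀ x, ∑ y, |r x y| * Real.exp (m * spDist x y) ≤ N := fun x =>
    (Finset.sum_le_sum fun y _ => mul_le_mul_of_nonneg_left
      (exp_le_exp_two_mul hm (spDist_nonneg _ _)) (abs_nonneg _)).trans (hN x)
  have hN1' : ∀ y, ∑ x, |r x y| * Real.exp (m * spDist x y) ≤ N := fun y => by
    simp_rw [hsymm _ y, isPseudoDist_spDist.symm _ y]; exact hN1 y
  have h1 : ρ / 2 * N ≤ B := by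
    have : 0 ≤ ρ * N := by positivity
    have h2 : 0 ≤ ρ * N * Real.exp m := by positivity
    have h3 : 0 ≤ ρ * N * (1 / m ^ 2) := by positivity
    rw [hB]; nlinarith
  have h2 : ρ / 2 * (Real.exp m * N) ≤ B := by
    have : 0 ≤ ρ * N := by positivity
    have h2 : 0 ≤ ρ * N * Real.exp m := by positivity
    have h3 : 0 ≤ ρ * N * (1 / m ^ 2) := by positivity
    rw [hB]; nlinarith
  have h3 : ρ / 2 * (2 / m ^ 2 * N) ≤ B := by
    have : 0 ≤ ρ * N := by positivity
    have h2 : 0 ≤ ρ * N * Real.exp m := by positivity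
    have h4 : ρ / 2 * (2 / m ^ 2 * N) = ρ * N * (1 / m ^ 2) := by ring
    rw [hB, h4]; nlinarith
  have hz : ∀ u : STLat Lt L, ∑ u' : STLat Lt L, |(0 : ℝ)| * Real.exp (m * stDist u u') ≤ B := by
    intro u; simpa using hB0
  have hz' : ∀ u' : STLat Lt L, ∑ u : STLat Lt L, |(0 : ℝ)| * Real.exp (m * stDist u u') ≤ B := by
    intro u; simpa using hB0
  have flip1 : ∀ (n n' : ZMod Lt), (n' = n + 1) = (n = n' - 1) := fun n n' =>
    propext ⟨fun h => by rw [h]; ring, fun h => by rw [h]; ring⟩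
  have key : ∀ a b, kernelNorm stDist m (quad (bilKernel (Lt := Lt) ρ r) (bideg a b))
      ≤ ENNReal.ofReal B := by
    intro a b
    refine kernelNorm_quad_le isPseudoDist_stDist hm.le _ a b ?_ ?_
    -- the sum over the second argument
    · rintro ⟨n, u⟩
      rcases a with _ | ν <;> rcases b with _ | ν'
      · exact hz _
      · induction ν' using Fin.cases with
        | zero =>
          simp only [bilKernel, Fin.cases_zero]
          rw [sum_stLat_eq_single n (fun y => ρ / 2 * r u y)]
          simp only [stDist_same_time, abs_mul, abs_of_nonneg (div_nonneg hρ zero_le_two),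
            mul_assoc,
            ← Finset.mul_sum]
          exact (mul_le_mul_of_nonneg_left (hN1 u) (by positivity)).trans h1
        | succ j => exact hz _
      · induction ν using Fin.cases with
        | zero =>
          simp only [bilKernel, Fin.cases_zero]
          rw [sum_stLat_eq_single (n + 1) (fun y => -(ρ / 2 * r u y))]
          simp only [abs_neg, abs_mul, abs_of_nonneg (div_nonneg hρ zero_le_two), mul_assoc,
            ← Finset.mul_sum]
          refine le_trans (mul_le_mul_of_nonneg_left ?_ (by positivity)) h2
          refine le_trans (Finset.sum_le_sum fun y _ => ?_)
            (le_trans (le_of_eq (Finset.mul_sum _ _ _).symm)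
            (mul_le_mul_of_nonneg_left (hN1 u) (Real.exp_pos m).le))
          rw [mul_left_comm, ← Real.exp_add]
          gcongr
          nlinarith [stDist_add_one_le n u y]
        | succ j => exact hz _
      · induction ν using Fin.cases with
        | zero => exact hz _
        | succ j =>
          induction ν' using Fin.cases with
          | zero => exact hz _
          | succ j' =>
            simp only [bilKernel, Fin.cases_succ]
            rw [sum_stLat_eq_single n (fun u' =>
              -(ρ / 2 * ∑ x, ∑ y, r x y * crossing j y x u * crossing j' y x u'))]
            simp only [stDist_same_time, abs_neg, abs_mul (ρ / 2),
              abs_of_nonneg (div_nonneg hρ zero_le_two), mul_assoc (ρ / 2), ← Finset.mul_sum]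
            exact le_trans (mul_le_mul_of_nonneg_left
              (sum_abs_crossing_crossing_le hm htrans hsymm hN j j' u) (by positivity)) h3
    -- the sum over the first argument
    · rintro ⟨n, u⟩
      rcases a with _ | ν <;> rcases b with _ | ν'
      · exact hz' _
      · induction ν' using Fin.cases with
        | zero =>
          simp only [bilKernel, Fin.cases_zero]
          rw [sum_stLat_single_eq n (fun y => ρ / 2 * r y u)]
          simp only [stDist_same_time, abs_mul, abs_of_nonneg (div_nonneg hρ zero_le_two),
            mul_assoc,
            ← Finset.mul_sum]
          exact (mul_le_mul_of_nonneg_left (hN1' u) (by positivity)).trans h1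
        | succ j => exact hz' _
      · induction ν using Fin.cases with
        | zero =>
          simp only [bilKernel, Fin.cases_zero, flip1]
          rw [sum_stLat_eq_single (n - 1) (fun y => -(ρ / 2 * r y u))]
          simp only [abs_neg, abs_mul, abs_of_nonneg (div_nonneg hρ zero_le_two), mul_assoc,
            ← Finset.mul_sum]
          refine le_trans (mul_le_mul_of_nonneg_left ?_ (by positivity)) h2
          refine le_trans (Finset.sum_le_sum fun y _ => ?_)
            (le_trans (le_of_eq (Finset.mul_sum _ _ _).symm)
            (mul_le_mul_of_nonneg_left (hN1' u) (Real.exp_pos m).le))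
          rw [mul_left_comm, ← Real.exp_add]
          gcongr
          have := stDist_add_one_le (n - 1) y u
          rw [sub_add_cancel] at this
          nlinarith
        | succ j => exact hz' _
      · induction ν using Fin.cases with
        | zero => exact hz' _
        | succ j =>
          induction ν' using Fin.cases with
          | zero => exact hz' _
          | succ j' =>
            simp only [bilKernel, Fin.cases_succ]
            rw [sum_stLat_single_eq n (fun u' =>
              -(ρ / 2 * ∑ x, ∑ y, r x y * crossing j y x u' * crossing j' y x u))]
            simp only [stDist_same_time, abs_neg, abs_mul (ρ / 2),
              abs_of_nonneg (div_nonneg hρ zero_le_two), mul_assoc (ρ / 2), ← Finset.mul_sum]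
            refine le_trans (mul_le_mul_of_nonneg_left ?_ (by positivity)) h3
            have := sum_abs_crossing_crossing_le hm htrans hsymm hN j' j u
            simp_rw [isPseudoDist_spDist.symm _ u, mul_right_comm _ (crossing j _ _ _)]
            exact this
  refine (norm_quad_le _ (fun _ _ => hB0) key).trans (ENNReal.ofReal_le_ofReal (le_of_eq ?_))
  simp only [Finset.sum_const, Finset.card_univ, Fintype.card_option, Fintype.card_fin,
    nsmul_eq_mul]
  push_cast; ring

end

/-! ### Kernels with one argument for each field -/

section Deg
variable {X : Type*}

/-- The kernel of the part of a power series that is linear in each of its two fields. -/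
def linKernel (F : FieldSeries (Fin 2) X) (x y : X) : ℝ :=
  F (fun _ => 1) (fun q => ![x, y] q.1)

/-- The two arguments of a kernel that is linear in each field. -/
def linArg : Fin 2 ≃ ((_ : Fin 2) × Fin 1) := (Equiv.sigmaUnique (Fin 2) fun _ => Fin 1).symm

/-- Pairs of points as functions on the arguments of a kernel that is linear in each field. -/
def linFun : X × X ≃ (((_ : Fin 2) × Fin 1) → X) :=
  (finTwoArrowEquiv X).symm.trans (Equiv.arrowCongr linArg (Equiv.refl X))

lemma linFun_apply (p : X × X) (q : (_ : Fin 2) × Fin 1) : linFun p q = ![p.1, p.2] q.1 := rfl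

lemma hom_one [Fintype X] (F : FieldSeries (Fin 2) X) (φ : Fin 2 → X → ℂ) :
    F.hom (fun _ => 1) φ = ∑ x, ∑ y, (linKernel F x y : ℂ) * φ 0 x * φ 1 y := by
  unfold FieldSeries.hom
  rw [← linFun.sum_comp, Fintype.sum_prod_type]
  refine Finset.sum_congr rfl fun x _ => Finset.sum_congr rfl fun y _ => ?_
  rw [← linArg.prod_comp, Fin.prod_univ_two, ← mul_assoc]
  rfl

/-- The tree length of two points is at least their distance. -/
lemma sum_linKernel_le [Fintype X] {d : X → X → ℝ} (hd : IsPseudoDist d) {m : ℝ} (hm : 0 ≤ m)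
    (F : FieldSeries (Fin 2) X) {B : ℝ} (hB : 0 ≤ B)
    (h : kernelNorm d m (F (fun _ => 1)) ≤ ENNReal.ofReal B) (x : X) :
    ∑ y, |linKernel F x y| * Real.exp (m * d x y) ≤ B := by
  classical
  have h1 := (le_kernelNorm m (F (fun _ => 1)) ⟨0, 0⟩ x).trans h
  rw [tsum_fintype, ← linFun.sum_comp, Fintype.sum_prod_type,
    Finset.sum_eq_single x (fun x' _ hx => by simp [linFun_apply, hx]) (by simp)] at h1
  simp only [linFun_apply, Matrix.cons_val_zero, if_true] at h1
  rw [← ENNReal.ofReal_sum_of_nonneg (fun _ _ => by positivity), ENNReal.ofReal_le_ofReal_iff hB]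
    at h1
  refine le_trans (Finset.sum_le_sum fun y _ => ?_) h1
  have h2 := dist_le_treeLength hd (linFun (x, y)) ⟨0, 0⟩ ⟨1, 0⟩
  have h3 : d x y ≤ treeLength d (linFun (x, y)) := h2
  have h4 : linKernel F x y = F (fun _ => 1) (linFun (x, y)) := rfl
  rw [h4]
  gcongr

end Deg

section
variable {L : ℕ} {F : FieldSeries (Fin 2) (Sp L)}

lemma linKernel_symm (hF : KernelSymm F) (x y : Sp L) : linKernel F x y = linKernel F y x := by
  have := congrFun (congrFun hF.swap fun _ => 1) fun q => ![x, y] q.1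
  unfold linKernel
  rw [← this]
  unfold FieldSeries.swap
  congr 1
  funext q
  rcases q with ⟨i, k⟩
  fin_cases i <;> rfl

lemma linKernel_add (hF : KernelSymm F) (a x y : Sp L) :
    linKernel F (x + a) (y + a) = linKernel F x y := by
  refine Eq.trans ?_ (hF.trans a _ _)
  unfold linKernel
  congr 1
  funext q
  rcases q with ⟨i, k⟩
  fin_cases i <;> rfl

lemma linKernel_refl (hF : KernelSymm F) (j : Fin 3) (x y : Sp L) :
    linKernel F (spRefl j x) (spRefl j y) = linKernel F x y := by
  refine Eq.trans ?_ (hF.refl j _ _)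
  unfold linKernel
  congr 1
  funext q
  rcases q with ⟨i, k⟩
  fin_cases i <;> rfl

end

/-! ### Kernels on a discrete space -/

section Kernels

variable {C D : Type*}

lemma summable_of_tsum_enorm_ne_top {E : Type*} [NormedAddCommGroup E] [CompleteSpace E]
    {f : C → E} (h : ∑' a, ‖f a‖ₑ ≠ ⊤) : Summable f :=
  (tsum_enorm_ne_top_iff_summable_norm.mp h).of_norm

lemma summable_prod_of_tsum_enorm_ne_top {E : Type*} [NormedAddCommGroup E] [CompleteSpace E]
    {f : C → D → E} (h : ∑' a, ∑' b, ‖f a b‖ₑ ≠ ⊤) : Summable (Function.uncurry f) := by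
  apply summable_of_tsum_enorm_ne_top
  rw [ENNReal.tsum_prod']
  exact h

lemma tsum_comm_of_enorm {E : Type*} [NormedAddCommGroup E] [CompleteSpace E]
    {f : C → D → E} (h : ∑' a, ∑' b, ‖f a b‖ₑ ≠ ⊤) :
    ∑' a, ∑' b, f a b = ∑' b, ∑' a, f a b :=
  (summable_prod_of_tsum_enorm_ne_top h).tsum_comm.symm

variable [DecidableEq C]

lemma kerPow_zero_apply (A : C → C → ℝ) (x y : C) :
    kerPow A 0 x y = if x = y then 1 else 0 := rfl

lemma kerPow_succ_apply (A : C → C → ℝ) (n : ℕ) (x y : C) :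
    kerPow A (n + 1) x y = ∑' z, A x z * kerPow A n z y := rfl

lemma kerPow_smul (a : ℝ) (A : C → C → ℝ) (n : ℕ) (x y : C) :
    kerPow (fun x y => a * A x y) n x y = a ^ n * kerPow A n x y := by
  induction n generalizing x with
  | zero => simp [kerPow_zero_apply]
  | succ n ih =>
    simp only [kerPow_succ_apply, ih]
    rw [← tsum_mul_left]
    exact tsum_congr fun z => by ring

lemma kerPow_equiv (A : C → C → ℝ) (e : C ≃ C) (h : ∀ x y, A (e x) (e y) = A x y) (n : ℕ)
    (x y : C) : kerPow A n (e x) (e y) = kerPow A n x y := by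
  induction n generalizing x with
  | zero => simp [kerPow_zero_apply]
  | succ n ih =>
    simp only [kerPow_succ_apply]
    rw [← e.tsum_eq]
    simp only [h, ih]

lemma kerExp_equiv (A : C → C → ℝ) (e : C ≃ C) (h : ∀ x y, A (e x) (e y) = A x y)
    (x y : C) : kerExp A (e x) (e y) = kerExp A x y := by
  simp only [kerExp, kerPow_equiv A e h]

/-- Weighted `ℓ¹` bounds on the rows are submultiplicative for submultiplicative weights. -/
lemma tsum_kerPow_le {W : C → C → ℝ≥0∞} (hW1 : ∀ x, W x x ≤ 1)
    (hW : ∀ x y z, W x z ≤ W x y * W y z) {A : C → C → ℝ} {N : ℝ≥0∞}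
    (hA : ∀ x, ∑' y, W x y * ‖A x y‖ₑ ≤ N) (n : ℕ) (x : C) :
    ∑' y, W x y * ‖kerPow A n x y‖ₑ ≤ N ^ n := by
  induction n generalizing x with
  | zero =>
    rw [tsum_eq_single x (fun y hy => by simp [kerPow_zero_apply, hy.symm])]
    simpa [kerPow_zero_apply] using hW1 x
  | succ n ih =>
    calc ∑' y, W x y * ‖kerPow A (n + 1) x y‖ₑ
        ≤ ∑' y, ∑' z, (W x z * ‖A x z‖ₑ) * (W z y * ‖kerPow A n z y‖ₑ) := by
          refine ENNReal.tsum_le_tsum fun y => ?_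
          rw [kerPow_succ_apply]
          calc W x y * ‖∑' z, A x z * kerPow A n z y‖ₑ
              ≤ W x y * ∑' z, ‖A x z * kerPow A n z y‖ₑ := by
                gcongr; exact enorm_tsum_le_tsum_enorm
            _ = ∑' z, W x y * ‖A x z * kerPow A n z y‖ₑ := ENNReal.tsum_mul_left.symm
            _ ≤ _ := by
                refine ENNReal.tsum_le_tsum fun z => ?_
                rw [enorm_mul]
                calc W x y * (‖A x z‖ₑ * ‖kerPow A n z y‖ₑ)
                    ≤ (W x z * W z y) * (‖A x z‖ₑ * ‖kerPow A n z y‖ₑ) := by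
                      gcongr; exact hW x z y
                  _ = _ := by ring
      _ = ∑' z, (W x z * ‖A x z‖ₑ) * ∑' y, W z y * ‖kerPow A n z y‖ₑ := by
          rw [ENNReal.tsum_comm]
          exact tsum_congr fun z => ENNReal.tsum_mul_left
      _ ≤ ∑' z, (W x z * ‖A x z‖ₑ) * N ^ n := by
          gcongr with z
          exact ih z
      _ ≤ N * N ^ n := by
          rw [ENNReal.tsum_mul_right]
          gcongr
          exact hA x
      _ = N ^ (n + 1) := by rw [pow_succ, mul_comm]

/-- A majorant of the kernels of `e^{-tA}`, uniform in `|t| ≤ θ`. -/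
def expMajorant (A : C → C → ℝ) (θ : ℝ) (x y : C) : ℝ≥0∞ :=
  ∑' n : ℕ, ENNReal.ofReal (θ ^ n / n.factorial) * ‖kerPow A n x y‖ₑ

lemma tsum_ofReal_pow_div_factorial {θ N : ℝ} (hθ : 0 ≤ θ) (hN : 0 ≤ N) :
    ∑' n : ℕ, ENNReal.ofReal (θ ^ n / n.factorial) * ENNReal.ofReal N ^ n
      = ENNReal.ofReal (Real.exp (θ * N)) := by
  have h1 : ∀ n : ℕ, ENNReal.ofReal (θ ^ n / n.factorial) * ENNReal.ofReal N ^ n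
      = ENNReal.ofReal ((θ * N) ^ n / n.factorial) := fun n => by
    rw [← ENNReal.ofReal_pow hN, ← ENNReal.ofReal_mul (by positivity), mul_pow]
    congr 1
    ring
  simp only [h1]
  rw [← ENNReal.ofReal_tsum_of_nonneg (fun n => by positivity)
    (Real.summable_pow_div_factorial _), Real.exp_eq_exp_ℝ,
    NormedSpace.exp_eq_tsum_div]

/-- The exponential series inherits the weighted `ℓ¹` bound of its exponent. -/
lemma tsum_expMajorant_le {W : C → C → ℝ≥0∞} (hW1 : ∀ x, W x x ≤ 1)
    (hW : ∀ x y z, W x z ≤ W x y * W y z) {A : C → C → ℝ} {N θ : ℝ} (hN : 0 ≤ N) (hθ : 0 ≤ θ)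
    (hA : ∀ x, ∑' y, W x y * ‖A x y‖ₑ ≤ ENNReal.ofReal N) (x : C) :
    ∑' y, W x y * expMajorant A θ x y ≤ ENNReal.ofReal (Real.exp (θ * N)) := by
  rw [← tsum_ofReal_pow_div_factorial hθ hN]
  simp only [expMajorant]
  simp only [← ENNReal.tsum_mul_left]
  rw [ENNReal.tsum_comm]
  refine ENNReal.tsum_le_tsum fun n => ?_
  calc ∑' y, W x y * (ENNReal.ofReal (θ ^ n / n.factorial) * ‖kerPow A n x y‖ₑ)
      = ENNReal.ofReal (θ ^ n / n.factorial) * ∑' y, W x y * ‖kerPow A n x y‖ₑ := by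
        rw [← ENNReal.tsum_mul_left]
        exact tsum_congr fun y => by ring
    _ ≤ _ := by gcongr; exact tsum_kerPow_le hW1 hW hA n x

lemma kerExp_smul (a : ℝ) (A : C → C → ℝ) (x y : C) :
    kerExp (fun x y => a * A x y) x y
      = ∑' n : ℕ, ((n.factorial : ℝ)⁻¹) * a ^ n * kerPow A n x y := by
  simp only [kerExp, kerPow_smul, mul_assoc]

lemma enorm_term_le {θ a : ℝ} (ha : |a| ≤ θ) (A : C → C → ℝ) (x y : C) (n : ℕ) :
    ‖((n.factorial : ℝ)⁻¹) * a ^ n * kerPow A n x y‖ₑ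
      ≤ ENNReal.ofReal (θ ^ n / n.factorial) * ‖kerPow A n x y‖ₑ := by
  rw [enorm_mul]
  gcongr
  rw [Real.enorm_eq_ofReal_abs]
  apply ENNReal.ofReal_le_ofReal
  rw [abs_mul, abs_pow, abs_of_pos (by positivity), div_eq_inv_mul]
  gcongr

lemma enorm_kerExp_smul_le {θ a : ℝ} (ha : |a| ≤ θ) (A : C → C → ℝ) (x y : C) :
    ‖kerExp (fun x y => a * A x y) x y‖ₑ ≤ expMajorant A θ x y := by
  rw [kerExp_smul]
  exact enorm_tsum_le_tsum_enorm.trans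
    (ENNReal.tsum_le_tsum fun n => enorm_term_le ha A x y n)

lemma continuousOn_kerExp {θ : ℝ} {A : C → C → ℝ} {x y : C} (h : expMajorant A θ x y ≠ ⊤) :
    ContinuousOn (fun t : ℝ => kerExp (fun x y => -t * A x y) x y) (Set.Icc 0 θ) := by
  simp only [kerExp_smul]
  have hs : Summable fun n : ℕ =>
      (ENNReal.ofReal (θ ^ n / n.factorial) * ‖kerPow A n x y‖ₑ).toReal :=
    ENNReal.summable_toReal h
  refine continuousOn_tsum (fun n => by fun_prop) hs fun n t ht => ?_
  have hle := enorm_term_le (θ := θ) (a := -t) (by rw [abs_neg, abs_of_nonneg ht.1]; exact ht.2)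
    A x y n
  have := ENNReal.toReal_mono (ENNReal.ne_top_of_tsum_ne_top h n) hle
  simpa using this

end Kernels

/-! ### Periodization -/

section Periodize

variable {C X : Type*} {n : ℕ}

open Classical in
lemma periodize_cons (π : C → X) (σ : X → C) (f : (Fin (n + 1) → C) → ℝ) (x₀ : X)
    (hσ : π (σ x₀) = x₀) (y : Fin n → X) :
    periodize π σ f (Fin.cons x₀ y)
      = ∑' ζ : Fin n → C, if (fun i => π (ζ i)) = y then f (Fin.cons (σ x₀) ζ) else 0 := by
  let e : {ζ : Fin n → C | (fun i => π (ζ i)) = y} ≃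
      {ξ : Fin (n + 1) → C // ξ 0 = σ ((Fin.cons x₀ y : Fin (n + 1) → X) 0) ∧
        ∀ i, π (ξ i) = (Fin.cons x₀ y : Fin (n + 1) → X) i} :=
    { toFun := fun ζ => ⟨Fin.cons (σ x₀) ζ.1, rfl, fun i => by
        refine Fin.cases ?_ (fun j => ?_) i
        · simpa using hσ
        · simpa using congrFun ζ.2 j⟩
      invFun := fun ξ => ⟨fun i => ξ.1 i.succ, funext fun i => by simpa using ξ.2.2 i.succ⟩
      left_inv := fun ζ => by ext; simp
      right_inv := fun ξ => by
        apply Subtype.ext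
        funext i
        refine Fin.cases ?_ (fun j => ?_) i
        · simpa using ξ.2.1.symm
        · simp }
  unfold periodize
  rw [← e.tsum_eq]
  refine (tsum_subtype {ζ : Fin n → C | (fun i => π (ζ i)) = y}
    (fun ζ => f (Fin.cons (σ x₀) ζ))).trans (tsum_congr fun ζ => ?_)
  simp [Set.indicator_apply]

/-- Summing a periodized kernel against a function on the quotient is the same as summing the
kernel against the pulled back function. -/
lemma sum_periodize_mul [Fintype X] {π : C → X} {σ : X → C}
    {f : (Fin (n + 1) → C) → ℝ} {x₀ : X} (hσ : π (σ x₀) = x₀)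
    (hf : Summable fun ζ : Fin n → C => f (Fin.cons (σ x₀) ζ)) (g : (Fin n → X) → ℂ) :
    ∑ y : Fin n → X, (periodize π σ f (Fin.cons x₀ y) : ℂ) * g y
      = ∑' ζ : Fin n → C, (f (Fin.cons (σ x₀) ζ) : ℂ) * g (fun i => π (ζ i)) := by
  classical
  have hf' : Summable fun ζ : Fin n → C => ((f (Fin.cons (σ x₀) ζ) : ℝ) : ℂ) :=
    (Complex.summable_ofReal).mpr hf
  have h1 : ∀ y : Fin n → X, (periodize π σ f (Fin.cons x₀ y) : ℂ) * g y
      = ∑' ζ : Fin n → C, if (fun i => π (ζ i)) = y then (f (Fin.cons (σ x₀) ζ) : ℂ) * g y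
        else 0 := fun y => by
    rw [periodize_cons π σ f x₀ hσ y, Complex.ofReal_tsum, ← tsum_mul_right]
    refine tsum_congr fun ζ => ?_
    split_ifs <;> simp
  have h2 : ∀ y : Fin n → X, Summable fun ζ : Fin n → C =>
      if (fun i => π (ζ i)) = y then (f (Fin.cons (σ x₀) ζ) : ℂ) * g y else 0 := fun y => by
    have := (hf'.mul_right (g y)).indicator {ζ : Fin n → C | (fun i => π (ζ i)) = y}
    refine this.congr fun ζ => ?_
    simp [Set.indicator_apply]
  simp only [h1]
  rw [← Summable.tsum_finsetSum (fun y _ => h2 y)]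
  refine tsum_congr fun ζ => ?_
  simp

end Periodize

/-! ### Translation invariant operators and their periodizations -/

section Intertwine

variable {L : ℕ}

lemma spProj_add (x y : Sp 0) : spProj L (x + y) = spProj L x + spProj L y := by
  funext i; simp [spProj]

lemma spProj_sub (x y : Sp 0) : spProj L (x - y) = spProj L x - spProj L y := by
  funext i; simp [spProj]

lemma spProj_spLift [NeZero L] (x : Sp L) : spProj L (spLift x) = x := by
  funext i
  exact (map_intCast (ZMod.castHom (dvd_zero L) (ZMod L)) (x i).valMinAbs).trans
    (ZMod.coe_valMinAbs _)

/-- The operator on `ℓ^∞(ℤ³)` with kernel `A` acts on periodic functions as `a`. -/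
def Intertwines [NeZero L] (A : Sp 0 → Sp 0 → ℝ) (a : Matrix (Sp L) (Sp L) ℝ) : Prop :=
  ∀ (f : Sp L → ℂ) (x : Sp 0), ∑' y, (A x y : ℂ) * f (spProj L y) = act a f (spProj L x)

variable [NeZero L]

lemma sum_periodize₂_mul {A : Sp 0 → Sp 0 → ℝ} (x : Sp L) (hA : Summable (A (spLift x)))
    (f : Sp L → ℂ) :
    act (periodize₂ L A) f x = ∑' y, (A (spLift x) y : ℂ) * f (spProj L y) := by
  have h := sum_periodize_mul (π := spProj L) (σ := spLift) (n := 1) (x₀ := x)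
    (f := fun ξ : Fin 2 → Sp 0 => A (ξ 0) (ξ 1)) (spProj_spLift x)
    (by
      have := (Equiv.funUnique (Fin 1) (Sp 0)).summable_iff.mpr hA
      exact this) (fun y => f (y 0))
  rw [← (Equiv.funUnique (Fin 1) (Sp 0)).symm.tsum_eq] at h
  unfold act
  rw [← Equiv.sum_comp (Equiv.funUnique (Fin 1) (Sp L))]
  refine Eq.trans ?_ (h.trans ?_)
  · refine Finset.sum_congr rfl fun y _ => ?_
    have : ![x, y 0] = Fin.cons x y := by
      funext i; fin_cases i <;> rfl
    simp only [periodize₂, Matrix.of_apply, Equiv.funUnique_apply]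
    change ((periodize (spProj L) spLift _ ![x, y 0] : ℝ) : ℂ) * f (y 0) = _
    rw [this]
  · rfl

lemma tsum_shift {M : Type*} [AddCommMonoid M] [TopologicalSpace M] (f : Sp 0 → M) (a : Sp 0) :
    ∑' y, f (y + a) = ∑' y, f y := (Equiv.addRight a).tsum_eq f

lemma intertwines_periodize₂ {A : Sp 0 → Sp 0 → ℝ} (hT : ∀ a x y, A (x + a) (y + a) = A x y)
    (hA : ∀ x, Summable (A x)) : Intertwines A (periodize₂ L A) := by
  intro f x
  rw [sum_periodize₂_mul _ (hA _)]
  have hx : spLift (spProj L x) = x + (spLift (spProj L x) - x) := by abel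
  rw [← tsum_shift (fun y => (A (spLift (spProj L x)) y : ℂ) * f (spProj L y))
    (spLift (spProj L x) - x)]
  refine tsum_congr fun y => ?_
  have h0 : spProj L (spLift (spProj L x) - x) = 0 := by
    rw [spProj_sub, spProj_spLift, sub_self]
  rw [spProj_add, h0, add_zero]
  congr 2
  have := hT (spLift (spProj L x) - x) x y
  rw [← hx] at this
  exact this.symm

lemma act_mul (a b : Matrix (Sp L) (Sp L) ℝ) (f : Sp L → ℂ) : act (a * b) f = act a (act b f) := by
  funext x
  simp only [act, Matrix.mul_apply, Complex.ofReal_sum, Complex.ofReal_mul, Finset.sum_mul,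
    Finset.mul_sum]
  rw [Finset.sum_comm]
  exact Finset.sum_congr rfl fun y _ => Finset.sum_congr rfl fun z _ => by ring

lemma act_one (f : Sp L → ℂ) : act (1 : Matrix (Sp L) (Sp L) ℝ) f = f := by
  funext x
  simp [act, Matrix.one_apply, apply_ite (fun r : ℝ => (r : ℂ))]

lemma act_smul (r : ℝ) (a : Matrix (Sp L) (Sp L) ℝ) (f : Sp L → ℂ) :
    act (r • a) f = (r : ℂ) • act a f := by
  funext x
  simp [act, Finset.mul_sum, mul_assoc]

/-- A bound for a function on the finite torus. -/
def supBound (f : Sp L → ℂ) : ℝ≥0∞ := ∑ x, ‖f x‖ₑ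

lemma enorm_le_supBound (f : Sp L → ℂ) (x : Sp L) : ‖f x‖ₑ ≤ supBound f :=
  Finset.single_le_sum (f := fun x => ‖f x‖ₑ) (fun _ _ => zero_le) (Finset.mem_univ x)

lemma supBound_ne_top (f : Sp L → ℂ) : supBound f ≠ ⊤ :=
  ENNReal.sum_ne_top.mpr fun _ _ => enorm_ne_top

lemma enorm_ofReal_complex (r : ℝ) : ‖(r : ℂ)‖ₑ = ‖r‖ₑ := by
  rw [← ofReal_norm, ← ofReal_norm, Complex.norm_real]

/-- The composition of operators on `ℤ³` acts on periodic functions as the product of the matrices.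
-/
lemma intertwines_mul {A B : Sp 0 → Sp 0 → ℝ} {a b : Matrix (Sp L) (Sp L) ℝ} {N N' : ℝ≥0∞}
    (hA : ∀ x, ∑' y, ‖A x y‖ₑ ≤ N) (hB : ∀ x, ∑' y, ‖B x y‖ₑ ≤ N') (hN : N ≠ ⊤) (hN' : N' ≠ ⊤)
    (ha : Intertwines A a) (hb : Intertwines B b) :
    Intertwines (fun x y => ∑' z, A x z * B z y) (a * b) := by
  intro f x
  have hfin : ∑' z, ∑' y, ‖(A x z : ℂ) * ((B z y : ℂ) * f (spProj L y))‖ₑ ≠ ⊤ := by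
    refine ne_top_of_le_ne_top (b := N * (N' * supBound f)) ?_ ?_
    · exact ENNReal.mul_ne_top hN (ENNReal.mul_ne_top hN' (supBound_ne_top f))
    · calc ∑' z, ∑' y, ‖(A x z : ℂ) * ((B z y : ℂ) * f (spProj L y))‖ₑ
          ≤ ∑' z, ‖A x z‖ₑ * (N' * supBound f) := by
            refine ENNReal.tsum_le_tsum fun z => ?_
            simp only [enorm_mul, enorm_ofReal_complex]
            rw [ENNReal.tsum_mul_left]
            gcongr
            calc ∑' y, ‖B z y‖ₑ * ‖f (spProj L y)‖ₑ ≤ ∑' y, ‖B z y‖ₑ * supBound f := by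
                  gcongr; exact enorm_le_supBound f _
              _ ≤ _ := by rw [ENNReal.tsum_mul_right]; gcongr; exact hB z
        _ ≤ _ := by rw [ENNReal.tsum_mul_right]; gcongr; exact hA x
  calc ∑' y, ((∑' z, A x z * B z y : ℝ) : ℂ) * f (spProj L y)
      = ∑' y, ∑' z, (A x z : ℂ) * ((B z y : ℂ) * f (spProj L y)) := by
        refine tsum_congr fun y => ?_
        rw [Complex.ofReal_tsum, ← tsum_mul_right]
        exact tsum_congr fun z => by push_cast; ring
    _ = ∑' z, ∑' y, (A x z : ℂ) * ((B z y : ℂ) * f (spProj L y)) :=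
        (tsum_comm_of_enorm hfin).symm
    _ = ∑' z, (A x z : ℂ) * act b f (spProj L z) := by
        refine tsum_congr fun z => ?_
        rw [tsum_mul_left, hb f z]
    _ = act (a * b) f (spProj L x) := by rw [ha, act_mul]

lemma tsum_enorm_kerPow_le {C : Type*} [DecidableEq C] {A : C → C → ℝ} {N : ℝ≥0∞}
    (hA : ∀ x, ∑' y, ‖A x y‖ₑ ≤ N) (n : ℕ) (x : C) : ∑' y, ‖kerPow A n x y‖ₑ ≤ N ^ n := by
  simpa using tsum_kerPow_le (W := fun _ _ => 1) (by simp) (by simp) (by simpa using hA) n x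

lemma intertwines_kerPow {A : Sp 0 → Sp 0 → ℝ} {a : Matrix (Sp L) (Sp L) ℝ} {N : ℝ≥0∞}
    (hA : ∀ x, ∑' y, ‖A x y‖ₑ ≤ N) (hN : N ≠ ⊤) (ha : Intertwines A a) (n : ℕ) :
    Intertwines (kerPow A n) (a ^ n) := by
  induction n with
  | zero =>
    intro f x
    rw [tsum_eq_single x (fun y hy => by simp [kerPow_zero_apply, hy.symm]), pow_zero, act_one]
    simp [kerPow_zero_apply]
  | succ n ih =>
    rw [pow_succ']
    exact intertwines_mul hA (tsum_enorm_kerPow_le hA n) hN (ENNReal.pow_ne_top hN) ha ih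

attribute [local instance] Matrix.linftyOpNormedAddCommGroup Matrix.linftyOpNormedRing
  Matrix.linftyOpNormedAlgebra in
lemma hasSum_act_exp (a : Matrix (Sp L) (Sp L) ℝ) (f : Sp L → ℂ) (x : Sp L) :
    HasSum (fun n : ℕ => (((n.factorial : ℝ)⁻¹ : ℝ) : ℂ) * act (a ^ n) f x)
      (act (NormedSpace.exp a) f x) := by
  have h := NormedSpace.exp_series_hasSum_exp' (𝕂 := ℝ) a
  have hxy : ∀ y, HasSum (fun n : ℕ => ((n.factorial : ℝ)⁻¹ • a ^ n) x y)
      ((NormedSpace.exp a : Matrix (Sp L) (Sp L) ℝ) x y) := fun y => by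
    have h1 := Pi.hasSum.mp (Pi.hasSum.mp h x) y
    exact h1
  have := hasSum_sum (s := Finset.univ) fun y _ =>
    ((Complex.hasSum_ofReal).mpr (hxy y)).mul_right (f y)
  refine this.congr_fun ?_
  intro n
  simp only [act, Finset.mul_sum, Matrix.smul_apply, smul_eq_mul, Complex.ofReal_mul, mul_assoc]

/-- Periodization commutes with the exponential. -/
lemma intertwines_kerExp {A : Sp 0 → Sp 0 → ℝ} {a : Matrix (Sp L) (Sp L) ℝ} {N : ℝ} (hN : 0 ≤ N)
    (hA : ∀ x, ∑' y, ‖A x y‖ₑ ≤ ENNReal.ofReal N) (ha : Intertwines A a) :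
    Intertwines (kerExp A) (NormedSpace.exp a) := by
  intro f x
  have hfin : ∑' n : ℕ, ∑' y, ‖(((n.factorial : ℝ)⁻¹ : ℝ) : ℂ) *
      ((kerPow A n x y : ℂ) * f (spProj L y))‖ₑ ≠ ⊤ := by
    refine ne_top_of_le_ne_top (b := ENNReal.ofReal (Real.exp (1 * N)) * supBound f) ?_ ?_
    · exact ENNReal.mul_ne_top ENNReal.ofReal_ne_top (supBound_ne_top f)
    · rw [← tsum_ofReal_pow_div_factorial zero_le_one hN, ← ENNReal.tsum_mul_right]
      refine ENNReal.tsum_le_tsum fun n => ?_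
      simp only [enorm_mul, enorm_ofReal_complex]
      rw [ENNReal.tsum_mul_left, Real.enorm_eq_ofReal_abs, abs_of_pos (by positivity), one_pow,
        one_div, mul_assoc]
      gcongr
      calc ∑' y, ‖kerPow A n x y‖ₑ * ‖f (spProj L y)‖ₑ
          ≤ ∑' y, ‖kerPow A n x y‖ₑ * supBound f := by gcongr; exact enorm_le_supBound f _
        _ ≤ _ := by rw [ENNReal.tsum_mul_right]; gcongr; exact tsum_enorm_kerPow_le hA n x
  rw [← (hasSum_act_exp a f (spProj L x)).tsum_eq]
  calc ∑' y, ((kerExp A x y : ℝ) : ℂ) * f (spProj L y)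
      = ∑' y, ∑' n : ℕ, (((n.factorial : ℝ)⁻¹ : ℝ) : ℂ) *
          ((kerPow A n x y : ℂ) * f (spProj L y)) := by
        refine tsum_congr fun y => ?_
        rw [kerExp, Complex.ofReal_tsum, ← tsum_mul_right]
        exact tsum_congr fun z => by push_cast; ring
    _ = _ := (tsum_comm_of_enorm hfin).symm
    _ = _ := by
        refine tsum_congr fun n => ?_
        rw [tsum_mul_left, intertwines_kerPow hA ENNReal.ofReal_ne_top ha n f x]

end Intertwine

/-! ### The kinetic operator and its heat kernel -/

/-- The exponential weight `e^{m d(x,y)}` on `ℤ³`. -/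
def wt (m : ℝ) (x y : Sp 0) : ℝ≥0∞ := ENNReal.ofReal (Real.exp (m * spDist x y))

lemma wt_self (m : ℝ) (x : Sp 0) : wt m x x = 1 := by simp [wt, isPseudoDist_spDist.self]

lemma one_le_wt {m : ℝ} (hm : 0 ≤ m) (x y : Sp 0) : 1 ≤ wt m x y := by
  rw [wt, ← ENNReal.ofReal_one]
  exact ENNReal.ofReal_le_ofReal (Real.one_le_exp (mul_nonneg hm (spDist_nonneg x y)))

lemma wt_symm (m : ℝ) (x y : Sp 0) : wt m x y = wt m y x := by
  rw [wt, wt, isPseudoDist_spDist.symm]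

lemma wt_triangle {m : ℝ} (hm : 0 ≤ m) (x y z : Sp 0) : wt m x z ≤ wt m x y * wt m y z := by
  rw [wt, wt, wt, ← ENNReal.ofReal_mul (Real.exp_pos _).le, ← Real.exp_add, ← mul_add]
  exact ENNReal.ofReal_le_ofReal (Real.exp_le_exp.mpr
    (mul_le_mul_of_nonneg_left (isPseudoDist_spDist.triangle x y z) hm))

lemma wt_add_right (m : ℝ) (x y a : Sp 0) : wt m (x + a) (y + a) = wt m x y := by
  rw [wt, wt, spDist_add_right]

lemma wt_mono {m m' : ℝ} (h : m ≤ m') (x y : Sp 0) : wt m x y ≤ wt m' x y := by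
  refine ENNReal.ofReal_le_ofReal (Real.exp_le_exp.mpr ?_)
  exact mul_le_mul_of_nonneg_right h (spDist_nonneg x y)

/-- The size of `𝓗` that controls the kernels of `𝐡` and `e^{-t𝐡}`. Each of the two gradients in `𝐡
= ∇*𝓗∇` is a difference of two terms, which gives the factor `4`, and displaces an end point by at
most one lattice unit, which gives the factor `e^{2m}`. -/
def kinBound (m : ℝ) (H : Bond 0 → Bond 0 → ℝ) : ℝ :=
  4 * Real.exp (2 * m) * (∑' x : Sp 0, ∑ i : Fin 3, ∑ j : Fin 3,
    ENNReal.ofReal (Real.exp (6 * m * spDist x 0) * |H (0, i) (x, j)|)).toReal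

lemma kinBound_nonneg (m : ℝ) (H : Bond 0 → Bond 0 → ℝ) : 0 ≤ kinBound m H := by
  unfold kinBound; positivity

/-- The kernel `⟨∇δ_x, 𝓗∇δ_y⟩` with the gradients moved to `𝓗`. -/
lemma kinetic_eq (H : Bond 0 → Bond 0 → ℝ) (x y : Sp 0) :
    kinetic H x y = gradAdj (fun b => gradAdj (H b) y) x := by
  unfold kinetic
  congr 1
  funext b
  have hs : ∀ c : Bond 0, HasSum (fun b' : Bond 0 => if b' = c then H b c else 0) (H b c) :=
    fun c => hasSum_ite_eq c _
  have h := hasSum_sum (s := Finset.univ) fun (j : Fin 3) _ =>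
    (hs (y - spUnit j, j)).sub (hs (y, j))
  refine Eq.trans (tsum_congr fun b' => ?_) h.tsum_eq
  obtain ⟨z, k⟩ := b'
  rw [Finset.sum_eq_single k]
  · have e1 : ((z, k) = (y - spUnit k, k)) = (z + spUnit k = y) := by
      simp [eq_sub_iff_add_eq]
    have e2 : ((z, k) = (y, k)) = (z = y) := by simp
    have t1 : H b (z, k) * (if z + spUnit k = y then 1 else 0)
        = if z + spUnit k = y then H b (y - spUnit k, k) else 0 := by
      split_ifs with h1
      · rw [mul_one, ← h1, add_sub_cancel_right]
      · simp
    have t2 : H b (z, k) * (if z = y then 1 else 0) = if z = y then H b (y, k) else 0 := by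
      split_ifs with h1
      · rw [mul_one, h1]
      · simp
    simp only [grad, Pi.single_apply, e1, e2, mul_sub, t1, t2]
  · intro j _ hj
    simp [Ne.symm hj]
  · simp

section Kinetic

variable {c : Constants} {L : ℕ} [NeZero L] {H : Bond 0 → Bond 0 → ℝ}

lemma KineticHyp.tsum_bond_le (h : KineticHyp c L H) (hm : 0 < c.mass) (x : Sp 0) :
    4 * ENNReal.ofReal (Real.exp (2 * c.mass)) *
      ∑ i, ∑ j, ∑' y, wt c.mass x y * ‖H (x, i) (y, j)‖ₑ ≤ ENNReal.ofReal (kinBound c.mass H) := by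
  have hfin := ne_top_of_le_ne_top ENNReal.ofReal_ne_top h.decay
  rw [kinBound, ENNReal.ofReal_mul (by positivity), ENNReal.ofReal_mul (by positivity),
    ENNReal.ofReal_toReal hfin, ENNReal.ofReal_ofNat,
    Summable.tsum_finsetSum (fun _ _ => ENNReal.summable)]
  gcongr with i _
  rw [Summable.tsum_finsetSum (fun _ _ => ENNReal.summable)]
  refine Finset.sum_le_sum fun j _ => ?_
  rw [← tsum_shift _ x]
  refine ENNReal.tsum_le_tsum fun z => ?_
  have h1 : H (x, i) (z + x, j) = H (0, i) (z, j) := by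
    have := h.trans x (0, i) (z, j)
    simpa using this
  have h2 : wt c.mass x (z + x) = wt c.mass 0 z := by
    have := wt_add_right c.mass 0 z x
    simpa using this
  rw [h1, h2, ENNReal.ofReal_mul (Real.exp_pos _).le, Real.enorm_eq_ofReal_abs, wt_symm]
  gcongr
  exact wt_mono (by linarith) z 0

lemma wt_shift_le {m : ℝ} (hm : 0 ≤ m) {x y a b : Sp 0} (ha : spDist a 0 ≤ 1)
    (hb : spDist b 0 ≤ 1) :
    wt m x y ≤ ENNReal.ofReal (Real.exp (2 * m)) * wt m (x - a) (y - b) := by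
  rw [wt, wt, ← ENNReal.ofReal_mul (Real.exp_pos _).le, ← Real.exp_add]
  refine ENNReal.ofReal_le_ofReal (Real.exp_le_exp.mpr ?_)
  have h1 : spDist x (x - a) ≤ 1 := by rw [spDist_eq_sub, sub_sub_cancel]; exact ha
  have h2 : spDist (y - b) y ≤ 1 := by
    rw [isPseudoDist_spDist.symm, spDist_eq_sub, sub_sub_cancel]; exact hb
  have h3 := isPseudoDist_spDist.triangle x (x - a) y
  have h4 := isPseudoDist_spDist.triangle (x - a) (y - b) y
  nlinarith

lemma spDist_spUnit_le {L : ℕ} (j : Fin 3) : spDist (spUnit j : Sp L) 0 ≤ 1 := by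
  simpa using spDist_add_spUnit_le (0 : Sp L) j

lemma spDist_zero_le_one {L : ℕ} : spDist (0 : Sp L) 0 ≤ 1 := by
  rw [isPseudoDist_spDist.self]; exact zero_le_one

lemma KineticHyp.tsum_shift_bond_eq (h : KineticHyp c L H) (m : ℝ) (x a b : Sp 0) (i j : Fin 3) :
    ∑' y, wt m (x - a) (y - b) * ‖H (x - a, i) (y - b, j)‖ₑ
      = ∑' y, wt m x y * ‖H (x, i) (y, j)‖ₑ := by
  rw [← tsum_shift _ (b - a)]
  refine tsum_congr fun y => ?_
  have e : y + (b - a) - b = y + -a := by abel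
  rw [e, sub_eq_add_neg x a, wt_add_right]
  congr 2
  exact h.trans (-a) (x, i) (y, j)

lemma KineticHyp.tsum_kinetic_le (h : KineticHyp c L H) (hm : 0 < c.mass) (x : Sp 0) :
    ∑' y, wt c.mass x y * ‖kinetic H x y‖ₑ ≤ ENNReal.ofReal (kinBound c.mass H) := by
  refine le_trans ?_ (h.tsum_bond_le hm x)
  set q := ENNReal.ofReal (Real.exp (2 * c.mass))
  have hterm : ∀ (i j : Fin 3) (a b : Sp 0), spDist a 0 ≤ 1 → spDist b 0 ≤ 1 →
      ∑' y, wt c.mass x y * ‖H (x - a, i) (y - b, j)‖ₑ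
        ≤ q * ∑' y, wt c.mass x y * ‖H (x, i) (y, j)‖ₑ := fun i j a b ha hb => by
    rw [← h.tsum_shift_bond_eq c.mass x a b i j, ← ENNReal.tsum_mul_left]
    refine ENNReal.tsum_le_tsum fun y => ?_
    rw [← mul_assoc]
    gcongr
    exact wt_shift_le hm.le ha hb
  have hpt : ∀ y, wt c.mass x y * ‖kinetic H x y‖ₑ ≤ ∑ i, ∑ j,
      ((wt c.mass x y * ‖H (x - spUnit i, i) (y - spUnit j, j)‖ₑ
        + wt c.mass x y * ‖H (x - spUnit i, i) (y - 0, j)‖ₑ)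
        + (wt c.mass x y * ‖H (x - 0, i) (y - spUnit j, j)‖ₑ
        + wt c.mass x y * ‖H (x - 0, i) (y - 0, j)‖ₑ)) := fun y => by
    simp only [← mul_add, ← Finset.mul_sum, sub_zero]
    gcongr
    rw [kinetic_eq]
    simp only [gradAdj]
    refine (enorm_sum_le _ _).trans (Finset.sum_le_sum fun i _ => ?_)
    refine enorm_sub_le.trans ?_
    rw [Finset.sum_add_distrib]
    gcongr
    · exact (enorm_sum_le _ _).trans (Finset.sum_le_sum fun j _ => enorm_sub_le)
    · exact (enorm_sum_le _ _).trans (Finset.sum_le_sum fun j _ => enorm_sub_le)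
  refine (ENNReal.tsum_le_tsum hpt).trans ?_
  rw [Summable.tsum_finsetSum (fun _ _ => ENNReal.summable), Finset.mul_sum]
  refine Finset.sum_le_sum fun i _ => ?_
  rw [Summable.tsum_finsetSum (fun _ _ => ENNReal.summable), Finset.mul_sum]
  refine Finset.sum_le_sum fun j _ => ?_
  rw [ENNReal.tsum_add, ENNReal.tsum_add, ENNReal.tsum_add]
  refine (add_le_add
    (add_le_add (hterm i j _ _ (spDist_spUnit_le i) (spDist_spUnit_le j))
      (hterm i j _ _ (spDist_spUnit_le i) spDist_zero_le_one))
    (add_le_add (hterm i j _ _ spDist_zero_le_one (spDist_spUnit_le j))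
      (hterm i j _ _ spDist_zero_le_one spDist_zero_le_one))).trans (le_of_eq ?_)
  ring

lemma KineticHyp.kinetic_trans (h : KineticHyp c L H) (a x y : Sp 0) :
    kinetic H (x + a) (y + a) = kinetic H x y := by
  have hs : ∀ z b : Sp 0, z + a - b = z - b + a := fun z b => by abel
  have hH : ∀ z i w j, H (z + a, i) (w + a, j) = H (z, i) (w, j) :=
    fun z i w j => h.trans a (z, i) (w, j)
  simp only [kinetic_eq, gradAdj, hs, hH]

/-- The divergence commutes with reflections, if these act on functions on bonds as on gradients. -/
lemma gradAdj_refl (F : Bond 0 → ℝ) (j : Fin 3) (x : Sp 0) :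
    gradAdj (fun b => bondSign j b * F (bondRefl j b)) x = gradAdj F (spRefl j x) := by
  unfold gradAdj
  refine Finset.sum_congr rfl fun i _ => ?_
  by_cases hij : i = j
  · subst hij
    have e : spRefl i (x - spUnit i) - spUnit i = spRefl i x := by
      funext k
      by_cases hk : k = i
      · subst hk; simp [spRefl, spUnit]
      · simp [spRefl, spUnit, hk]
    simp only [bondSign, bondRefl, if_true, e]
    ring
  · have e : spRefl j (x - spUnit i) = spRefl j x - spUnit i := by
      funext k
      by_cases hk : k = j
      · subst hk
        simp [spRefl, spUnit, Ne.symm hij]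
      · simp [spRefl, spUnit, hk]
    simp [bondSign, bondRefl, hij, e]

lemma KineticHyp.kinetic_refl (h : KineticHyp c L H) (j : Fin 3) (x y : Sp 0) :
    kinetic H (spRefl j x) (spRefl j y) = kinetic H x y := by
  rw [kinetic_eq, kinetic_eq, ← gradAdj_refl]
  congr 1
  funext b
  rw [← gradAdj_refl]
  have hmul : ∀ (r : ℝ) (F : Bond 0 → ℝ), r * gradAdj F y = gradAdj (fun b' => r * F b') y :=
    fun r F => by simp only [gradAdj, Finset.mul_sum, mul_sub]
  rw [hmul]
  congr 1
  funext b'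
  rw [← h.refl j b b']
  ring

/-- The point reflection is the product of the three reflections. -/
lemma spRefl_three {L : ℕ} (x : Sp L) : spRefl 0 (spRefl 1 (spRefl 2 x)) = -x := by
  funext k; fin_cases k <;> simp [spRefl]

/-- A translation and reflection invariant kernel depends on `x - y` only, up to sign, and is
symmetric. -/
lemma eq_symm_of_trans_refl {A : Sp 0 → Sp 0 → ℝ}
    (hT : ∀ a x y, A (x + a) (y + a) = A x y)
    (hR : ∀ j x y, A (spRefl j x) (spRefl j y) = A x y) (x y : Sp 0) : A x y = A y x := by
  have h1 : A (-x) (-y) = A x y := by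
    rw [← spRefl_three x, ← spRefl_three y, hR, hR, hR]
  rw [← h1, ← hT (x + y) (-x) (-y)]
  congr 1 <;> abel

lemma KineticHyp.heatZ_trans (h : KineticHyp c L H) (t : ℝ) (a x y : Sp 0) :
    heatZ H t (x + a) (y + a) = heatZ H t x y :=
  kerExp_equiv _ (Equiv.addRight a) (fun x y => by simp [h.kinetic_trans]) x y

lemma KineticHyp.heatZ_refl (h : KineticHyp c L H) (t : ℝ) (j : Fin 3) (x y : Sp 0) :
    heatZ H t (spRefl j x) (spRefl j y) = heatZ H t x y :=
  kerExp_equiv _ (spReflEquiv 0 j) (fun x y => by simp [h.kinetic_refl]) x y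

lemma KineticHyp.heatZ_symm (h : KineticHyp c L H) (t : ℝ) (x y : Sp 0) :
    heatZ H t x y = heatZ H t y x :=
  eq_symm_of_trans_refl (fun a x y => h.heatZ_trans t a x y) (fun j x y => h.heatZ_refl t j x y) x y

/-- The majorant of the heat kernels `e^{-t𝐡}` with `0 ≤ t ≤ θ`. -/
def heatMaj (H : Bond 0 → Bond 0 → ℝ) (θ : ℝ) : Sp 0 → Sp 0 → ℝ≥0∞ := expMajorant (kinetic H) θ

lemma KineticHyp.heatMaj_symm (h : KineticHyp c L H) (θ : ℝ) (x y : Sp 0) :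
    heatMaj H θ x y = heatMaj H θ y x := by
  unfold heatMaj expMajorant
  refine tsum_congr fun n => ?_
  rw [eq_symm_of_trans_refl (A := kerPow (kinetic H) n)
    (fun a x y => kerPow_equiv _ (Equiv.addRight a) (fun x y => by simp [h.kinetic_trans]) n x y)
    (fun j x y => kerPow_equiv _ (spReflEquiv 0 j) (fun x y => by simp [h.kinetic_refl]) n x y)
    x y]

lemma enorm_heatZ_le {θ t : ℝ} (ht : t ∈ Set.Icc 0 θ) (x y : Sp 0) :
    ‖heatZ H t x y‖ₑ ≤ heatMaj H θ x y :=
  enorm_kerExp_smul_le (by rw [abs_neg, abs_of_nonneg ht.1]; exact ht.2) _ x y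

/-- The bound on the weighted row sums of `heatMaj`. -/
def heatBound (m θ : ℝ) (H : Bond 0 → Bond 0 → ℝ) : ℝ := Real.exp (θ * kinBound m H)

lemma heatBound_pos (m θ : ℝ) (H : Bond 0 → Bond 0 → ℝ) : 0 < heatBound m θ H := Real.exp_pos _

lemma KineticHyp.tsum_heatMaj_le (h : KineticHyp c L H) (hm : 0 < c.mass) {θ : ℝ} (hθ : 0 ≤ θ)
    (x : Sp 0) :
    ∑' y, wt c.mass x y * heatMaj H θ x y ≤ ENNReal.ofReal (heatBound c.mass θ H) :=
  tsum_expMajorant_le (fun x => (wt_self _ x).le) (wt_triangle hm.le) (kinBound_nonneg _ _) hθ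
    (h.tsum_kinetic_le hm) x

lemma KineticHyp.tsum_heatMaj_le' (h : KineticHyp c L H) (hm : 0 < c.mass) {θ : ℝ} (hθ : 0 ≤ θ)
    (x : Sp 0) : ∑' y, heatMaj H θ x y ≤ ENNReal.ofReal (heatBound c.mass θ H) :=
  (ENNReal.tsum_le_tsum fun y => le_mul_of_one_le_left' (one_le_wt hm.le x y)).trans
    (h.tsum_heatMaj_le hm hθ x)

lemma KineticHyp.heatMaj_ne_top (h : KineticHyp c L H) (hm : 0 < c.mass) {θ : ℝ} (hθ : 0 ≤ θ)
    (x y : Sp 0) : heatMaj H θ x y ≠ ⊤ :=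
  ENNReal.ne_top_of_tsum_ne_top
    (ne_top_of_le_ne_top ENNReal.ofReal_ne_top (h.tsum_heatMaj_le' hm hθ x)) y

lemma KineticHyp.continuousOn_heatZ (h : KineticHyp c L H) (hm : 0 < c.mass) {θ : ℝ} (hθ : 0 ≤ θ)
    (x y : Sp 0) : ContinuousOn (fun t => heatZ H t x y) (Set.Icc 0 θ) :=
  continuousOn_kerExp (h.heatMaj_ne_top hm hθ x y)

lemma KineticHyp.tsum_enorm_kinetic_le (h : KineticHyp c L H) (hm : 0 < c.mass) (x : Sp 0) :
    ∑' y, ‖kinetic H x y‖ₑ ≤ ENNReal.ofReal (kinBound c.mass H) :=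
  (ENNReal.tsum_le_tsum fun y => le_mul_of_one_le_left' (one_le_wt hm.le x y)).trans
    (h.tsum_kinetic_le hm x)

lemma KineticHyp.intertwines_kinetic (h : KineticHyp c L H) (hm : 0 < c.mass) :
    Intertwines (kinetic H) (periodize₂ L (kinetic H)) :=
  intertwines_periodize₂ (fun a x y => h.kinetic_trans a x y) fun x =>
    summable_of_tsum_enorm_ne_top
      (ne_top_of_le_ne_top ENNReal.ofReal_ne_top (h.tsum_enorm_kinetic_le hm x))

lemma Intertwines.smul {A : Sp 0 → Sp 0 → ℝ} {a : Matrix (Sp L) (Sp L) ℝ} (h : Intertwines A a)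
    (r : ℝ) : Intertwines (fun x y => r * A x y) (r • a) := by
  intro f x
  rw [act_smul, Pi.smul_apply, smul_eq_mul, ← h f x, ← tsum_mul_left]
  exact tsum_congr fun y => by push_cast; ring

lemma KineticHyp.intertwines_heatZ (h : KineticHyp c L H) (hm : 0 < c.mass) (t : ℝ) :
    Intertwines (heatZ H t) (NormedSpace.exp (-t • periodize₂ L (kinetic H))) := by
  refine intertwines_kerExp (N := |t| * kinBound c.mass H)
    (mul_nonneg (abs_nonneg _) (kinBound_nonneg _ _)) (fun x => ?_)
    ((h.intertwines_kinetic hm).smul (-t))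
  simp only [enorm_mul, ENNReal.tsum_mul_left]
  rw [ENNReal.ofReal_mul (abs_nonneg _), Real.enorm_eq_ofReal_abs, abs_neg]
  gcongr
  exact h.tsum_enorm_kinetic_le hm x

/-- `𝐡` annihilates the constants. -/
lemma KineticHyp.act_kinetic_one (h : KineticHyp c L H) (hm : 0 < c.mass) :
    act (periodize₂ L (kinetic H)) (1 : Sp L → ℂ) = 0 := by
  funext x
  have hx := h.intertwines_kinetic hm (1 : Sp L → ℂ) (spLift x)
  rw [spProj_spLift] at hx
  rw [← hx]
  have hS : ∀ (x : Sp 0) (i j : Fin 3), Summable fun y : Sp 0 => H (x, i) (y, j) := fun x i j => by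
    apply summable_of_tsum_enorm_ne_top
    have hfin := ne_top_of_le_ne_top ENNReal.ofReal_ne_top (h.tsum_bond_le hm x)
    have h1 : ∑ i, ∑ j, ∑' y, wt c.mass x y * ‖H (x, i) (y, j)‖ₑ ≠ ⊤ := by
      intro htop
      apply hfin
      rw [htop]
      exact ENNReal.mul_top (by simp [Real.exp_pos])
    have h2 := (ENNReal.sum_ne_top.mp (ENNReal.sum_ne_top.mp h1 i (Finset.mem_univ i))) j
      (Finset.mem_univ j)
    exact ne_top_of_le_ne_top h2
      (ENNReal.tsum_le_tsum fun y => le_mul_of_one_le_left' (one_le_wt hm.le x y))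
  -- the divergence of a summable function has vanishing sum
  have hz : ∀ (z : Sp 0) (i : Fin 3), HasSum (fun y => gradAdj (H (z, i)) y) 0 := fun z i => by
    have : HasSum (fun y => ∑ j, (H (z, i) (y - spUnit j, j) - H (z, i) (y, j)))
        (∑ j : Fin 3, (0 : ℝ)) := by
      refine hasSum_sum fun j _ => ?_
      have h1 := (hS z i j).hasSum
      have h2 : HasSum (fun y => H (z, i) (y - spUnit j, j)) (∑' y, H (z, i) (y, j)) := by
        have := (Equiv.subRight (spUnit j : Sp 0)).hasSum_iff.mpr h1
        exact this
      simpa using h2.sub h1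
    rw [Finset.sum_const_zero] at this
    exact this
  have hk : HasSum (fun y => kinetic H (spLift x) y) (∑ i : Fin 3, ((0 : ℝ) - 0)) := by
    simp only [kinetic_eq]
    exact hasSum_sum fun i _ => (hz _ i).sub (hz _ i)
  have := (Complex.hasSum_ofReal.mpr hk).tsum_eq
  simpa using this

lemma KineticHyp.act_exp_one (h : KineticHyp c L H) (hm : 0 < c.mass) (t : ℝ) :
    act (NormedSpace.exp (-t • periodize₂ L (kinetic H))) (1 : Sp L → ℂ) = 1 := by
  funext x
  rw [← (hasSum_act_exp _ _ _).tsum_eq, tsum_eq_single 0]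
  · simp [act_one]
  · intro n hn
    obtain ⟨k, rfl⟩ := Nat.exists_eq_succ_of_ne_zero hn
    rw [pow_succ, act_mul, act_smul, h.act_kinetic_one hm]
    simp [act]

end Kinetic

attribute [local instance] Matrix.linftyOpNormedAddCommGroup Matrix.linftyOpNormedRing
  Matrix.linftyOpNormedAlgebra in
/-- The chemical potential is a multiple of the identity, and splits off from the exponential. -/
lemma jop_eq (H : Bond 0 → Bond 0 → ℝ) (μ : ℝ) (L : ℕ) [NeZero L] (t : ℝ) :
    jop H μ L t = Real.exp (t * μ) • NormedSpace.exp (-t • periodize₂ L (kinetic H)) := by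
  unfold jop
  have h1 : -t • (periodize₂ L (kinetic H) - μ • (1 : Matrix (Sp L) (Sp L) ℝ))
      = -t • periodize₂ L (kinetic H) + (t * μ) • (1 : Matrix (Sp L) (Sp L) ℝ) := by
    rw [smul_sub, smul_smul, sub_eq_add_neg, ← neg_smul]
    congr 2
    ring
  have hc : Commute (-t • periodize₂ L (kinetic H)) ((t * μ) • (1 : Matrix (Sp L) (Sp L) ℝ)) :=
    (Commute.one_right _).smul_right _
  rw [h1, Matrix.exp_add_of_commute _ _ hc]
  have h2 : NormedSpace.exp ((t * μ) • (1 : Matrix (Sp L) (Sp L) ℝ))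
      = Real.exp (t * μ) • (1 : Matrix (Sp L) (Sp L) ℝ) := by
    have : (t * μ) • (1 : Matrix (Sp L) (Sp L) ℝ) = Matrix.diagonal fun _ => t * μ := by
      rw [Matrix.smul_one_eq_diagonal]
    rw [this, Matrix.exp_diagonal, Matrix.smul_one_eq_diagonal]
    congr 1
    rw [Pi.exp_def]
    simp [Real.exp_eq_exp_ℝ]
  rw [h2, mul_smul_comm, mul_one]

/-! ### The quartic kernel on `ℤ³` -/

/-- The kernel `B(p,x₁) B(p,x₂) V(p,q) B(q,x₃) B(q,x₄)`, summed over `p` and `q`. -/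
def doubleStar (B V : Sp 0 → Sp 0 → ℝ≥0∞) (x : Fin 4 → Sp 0) : ℝ≥0∞ :=
  ∑' p, ∑' q, B p (x 0) * B p (x 1) * V p q * B q (x 2) * B q (x 3)

lemma doubleStar_swap (B V : Sp 0 → Sp 0 → ℝ≥0∞) (x : Fin 4 → Sp 0) :
    doubleStar B V ![x 1, x 0, x 2, x 3] = doubleStar B V x := by
  unfold doubleStar
  refine tsum_congr fun p => tsum_congr fun q => ?_
  change B p (x 1) * B p (x 0) * V p q * B q (x 2) * B q (x 3) = _
  ring

lemma doubleStar_exchange {B V : Sp 0 → Sp 0 → ℝ≥0∞} (hV : ∀ p q, V p q = V q p)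
    (x : Fin 4 → Sp 0) : doubleStar B V ![x 2, x 3, x 0, x 1] = doubleStar B V x := by
  unfold doubleStar
  rw [ENNReal.tsum_comm]
  refine tsum_congr fun p => tsum_congr fun q => ?_
  change B q (x 2) * B q (x 3) * V q p * B p (x 0) * B p (x 1) = _
  rw [hV q p]
  ring

/-- The triple of points as a function on `Fin 3`. -/
def tripleEquiv (C : Type*) : C × C × C ≃ (Fin 3 → C) where
  toFun a := ![a.1, a.2.1, a.2.2]
  invFun ζ := (ζ 0, ζ 1, ζ 2)
  left_inv _ := rfl
  right_inv ζ := by funext i; fin_cases i <;> rfl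

lemma tsum_triple {C : Type*} (f : (Fin 3 → C) → ℝ≥0∞) :
    ∑' ζ, f ζ = ∑' a, ∑' b, ∑' c, f ![a, b, c] := by
  rw [← (tripleEquiv C).tsum_eq, ENNReal.tsum_prod']
  refine tsum_congr fun a => ?_
  rw [ENNReal.tsum_prod']
  rfl

/-- Sum over the three free leaves, then over `q`, and finally over `p`. -/
lemma tsum_doubleStar_le {B V : Sp 0 → Sp 0 → ℝ≥0∞} {NB NV : ℝ≥0∞}
    (hBs : ∀ x y, B x y = B y x) (hB : ∀ x, ∑' y, B x y ≤ NB) (hV : ∀ x, ∑' y, V x y ≤ NV)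
    (x : Sp 0) : ∑' ζ : Fin 3 → Sp 0, doubleStar B V (Fin.cons x ζ) ≤ NB ^ 4 * NV := by
  rw [tsum_triple]
  have h1 : ∀ a b c, doubleStar B V (Fin.cons x ![a, b, c])
      = ∑' p, ∑' q, B x p * V p q * (B p a * (B q b * B q c)) := fun a b c => by
    unfold doubleStar
    refine tsum_congr fun p => tsum_congr fun q => ?_
    rw [hBs x p]
    change B p x * B p a * V p q * B q b * B q c = _
    ring
  simp only [h1]
  calc ∑' a, ∑' b, ∑' c, ∑' p, ∑' q, B x p * V p q * (B p a * (B q b * B q c))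
      = ∑' p, ∑' q, B x p * V p q * ((∑' a, B p a) * ((∑' b, B q b) * ∑' c, B q c)) := by
        have e1 : ∀ a b, ∑' c, ∑' p, ∑' q, B x p * V p q * (B p a * (B q b * B q c))
            = ∑' p, ∑' q, B x p * V p q * (B p a * (B q b * ∑' c, B q c)) := fun a b => by
          rw [ENNReal.tsum_comm]
          refine tsum_congr fun p => ?_
          rw [ENNReal.tsum_comm]
          simp only [ENNReal.tsum_mul_left]
        have e2 : ∀ a, ∑' b, ∑' p, ∑' q, B x p * V p q * (B p a * (B q b * ∑' c, B q c))
            = ∑' p, ∑' q, B x p * V p q * (B p a * ((∑' b, B q b) * ∑' c, B q c)) := fun a => by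
          rw [ENNReal.tsum_comm]
          refine tsum_congr fun p => ?_
          rw [ENNReal.tsum_comm]
          simp only [ENNReal.tsum_mul_left, ENNReal.tsum_mul_right]
        simp only [e1, e2]
        rw [ENNReal.tsum_comm]
        refine tsum_congr fun p => ?_
        rw [ENNReal.tsum_comm]
        simp only [ENNReal.tsum_mul_left, ENNReal.tsum_mul_right]
    _ ≤ ∑' p, ∑' q, B x p * V p q * (NB * (NB * NB)) := by
        gcongr with p q
        · exact hB p
        · exact hB q
        · exact hB q
    _ = ∑' p, B x p * (∑' q, V p q) * (NB * (NB * NB)) := by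
        simp only [ENNReal.tsum_mul_right, ENNReal.tsum_mul_left]
    _ ≤ ∑' p, B x p * NV * (NB * (NB * NB)) := by
        gcongr with p
        exact hV p
    _ ≤ NB * NV * (NB * (NB * NB)) := by
        rw [ENNReal.tsum_mul_right, ENNReal.tsum_mul_right]
        gcongr
        exact hB x
    _ = NB ^ 4 * NV := by ring

/-- One of the two terms of `vθ`. -/
def vHalf (H : Bond 0 → Bond 0 → ℝ) (v : Sp 0 → Sp 0 → ℝ) (θ : ℝ) (x : Fin 4 → Sp 0) : ℝ :=
  ∑' p : Sp 0 × Sp 0, ∫ t in (0 : ℝ)..θ,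
    heatZ H t p.1 (x 0) * heatZ H (θ - t) p.1 (x 1) * v p.1 p.2 *
      heatZ H t p.2 (x 2) * heatZ H (θ - t) p.2 (x 3)

lemma vHalf_exchange (H : Bond 0 → Bond 0 → ℝ) {v : Sp 0 → Sp 0 → ℝ} (hv : ∀ x y, v x y = v y x)
    (θ : ℝ) (x : Fin 4 → Sp 0) : vHalf H v θ ![x 2, x 3, x 0, x 1] = vHalf H v θ x := by
  unfold vHalf
  rw [← (Equiv.prodComm (Sp 0) (Sp 0)).tsum_eq]
  refine tsum_congr fun p => ?_
  congr 1
  funext t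
  change heatZ H t p.2 (x 2) * heatZ H (θ - t) p.2 (x 3) * v p.2 p.1 *
      heatZ H t p.1 (x 0) * heatZ H (θ - t) p.1 (x 1) = _
  rw [hv p.2 p.1]
  ring

/-- Invariance under `t ↦ θ - t`. -/
lemma vHalf_timeRefl (H : Bond 0 → Bond 0 → ℝ) (v : Sp 0 → Sp 0 → ℝ)
    (θ : ℝ) (x : Fin 4 → Sp 0) : vHalf H v θ ![x 1, x 0, x 3, x 2] = vHalf H v θ x := by
  unfold vHalf
  refine tsum_congr fun p => ?_
  have := intervalIntegral.integral_comp_sub_left (a := 0) (b := θ) (fun t => heatZ H t p.1 (x 0) *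
    heatZ H (θ - t) p.1 (x 1) * v p.1 p.2 * heatZ H t p.2 (x 2) * heatZ H (θ - t) p.2 (x 3)) θ
  rw [sub_self, sub_zero] at this
  rw [← this]
  congr 1
  funext t
  rw [sub_sub_cancel]
  change heatZ H t p.1 (x 1) * heatZ H (θ - t) p.1 (x 0) * v p.1 p.2 *
      heatZ H t p.2 (x 3) * heatZ H (θ - t) p.2 (x 2) = _
  ring

section VHalf

variable {c : Constants} {L : ℕ} [NeZero L] {H : Bond 0 → Bond 0 → ℝ} {v : Sp 0 → Sp 0 → ℝ}

lemma KineticHyp.vHalf_equiv {θ : ℝ} (e : Sp 0 ≃ Sp 0)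
    (hh : ∀ t x y, heatZ H t (e x) (e y) = heatZ H t x y) (hv : ∀ x y, v (e x) (e y) = v x y)
    (x : Fin 4 → Sp 0) : vHalf H v θ (fun i => e (x i)) = vHalf H v θ x := by
  unfold vHalf
  rw [← (e.prodCongr e).tsum_eq]
  simp only [Equiv.prodCongr_apply, Prod.map_fst, Prod.map_snd, hh, hv]

lemma enorm_intervalIntegral_le {E : Type*} [NormedAddCommGroup E] [NormedSpace ℝ E] {f : ℝ → E}
    {θ : ℝ} (hθ : 0 ≤ θ) {K : ℝ≥0∞} (h : ∀ t ∈ Set.Icc 0 θ, ‖f t‖ₑ ≤ K) :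
    ‖∫ t in (0 : ℝ)..θ, f t‖ₑ ≤ ENNReal.ofReal θ * K := by
  rw [intervalIntegral.integral_of_le hθ]
  refine (MeasureTheory.enorm_integral_le_lintegral_enorm _).trans ?_
  refine (MeasureTheory.setLIntegral_mono' measurableSet_Ioc
    (fun t ht => h t (Set.Ioc_subset_Icc_self ht))).trans ?_
  rw [MeasureTheory.setLIntegral_const, Real.volume_Ioc, sub_zero, mul_comm]

lemma sub_mem_Icc {θ t : ℝ} (ht : t ∈ Set.Icc 0 θ) : θ - t ∈ Set.Icc 0 θ :=
  ⟨by linarith [ht.2], by linarith [ht.1]⟩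

lemma enorm_vHalf_term_le {θ t : ℝ} (ht : t ∈ Set.Icc 0 θ) (p q : Sp 0) (x : Fin 4 → Sp 0) :
    ‖heatZ H t p (x 0) * heatZ H (θ - t) p (x 1) * v p q *
      heatZ H t q (x 2) * heatZ H (θ - t) q (x 3)‖ₑ
      ≤ heatMaj H θ p (x 0) * heatMaj H θ p (x 1) * ‖v p q‖ₑ *
        heatMaj H θ q (x 2) * heatMaj H θ q (x 3) := by
  simp only [enorm_mul]
  gcongr
  · exact enorm_heatZ_le ht _ _
  · exact enorm_heatZ_le (sub_mem_Icc ht) _ _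
  · exact enorm_heatZ_le ht _ _
  · exact enorm_heatZ_le (sub_mem_Icc ht) _ _

lemma enorm_vHalf_le {θ : ℝ} (hθ : 0 ≤ θ) (x : Fin 4 → Sp 0) :
    ‖vHalf H v θ x‖ₑ
      ≤ ENNReal.ofReal θ * doubleStar (heatMaj H θ) (fun p q => ‖v p q‖ₑ) x := by
  refine enorm_tsum_le_tsum_enorm.trans ?_
  rw [ENNReal.tsum_prod', doubleStar, ← ENNReal.tsum_mul_left]
  refine ENNReal.tsum_le_tsum fun p => ?_
  rw [← ENNReal.tsum_mul_left]
  exact ENNReal.tsum_le_tsum fun q =>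
    enorm_intervalIntegral_le hθ fun t ht => enorm_vHalf_term_le ht p q x

instance : Countable (ZMod 0) := inferInstanceAs (Countable ℤ)

/-- The regrouping of the five summation points in `∑ vHalf`. -/
def fiveEquiv (C : Type*) : (Fin 3 → C) × (C × C) ≃ C × C × C × C × C where
  toFun a := (a.2.1, a.2.2, a.1 0, a.1 1, a.1 2)
  invFun b := (![b.2.2.1, b.2.2.2.1, b.2.2.2.2], (b.1, b.2.1))
  left_inv a := by
    obtain ⟨ζ, p, q⟩ := a
    simp only [Prod.mk.injEq, and_true]
    funext i; fin_cases i <;> rfl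
  right_inv _ := rfl

/-- Testing `vHalf` against periodic functions. -/
lemma KineticHyp.tsum_vHalf_mul (h : KineticHyp c L H) (hm : 0 < c.mass) {θ : ℝ} (hθ : 0 ≤ θ)
    {NV : ℝ≥0∞} (hNV : NV ≠ ⊤) (hv : ∀ x, ∑' y, ‖v x y‖ₑ ≤ NV)
    (hvi : Intertwines v (periodize₂ L v)) (x : Sp 0) (g₁ g₂ g₃ : Sp L → ℂ) :
    ∑' ζ : Fin 3 → Sp 0, (vHalf H v θ (Fin.cons x ζ) : ℂ) *
        (g₁ (spProj L (ζ 0)) * g₂ (spProj L (ζ 1)) * g₃ (spProj L (ζ 2)))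
      = ∫ t in (0 : ℝ)..θ,
          act (NormedSpace.exp (-t • periodize₂ L (kinetic H)))
            (act (NormedSpace.exp (-(θ - t) • periodize₂ L (kinetic H))) g₁ *
              act (periodize₂ L v)
                (act (NormedSpace.exp (-t • periodize₂ L (kinetic H))) g₂ *
                  act (NormedSpace.exp (-(θ - t) • periodize₂ L (kinetic H))) g₃))
          (spProj L x) := by
  classical
  let I := Sp 0 × Sp 0 × Sp 0 × Sp 0 × Sp 0
  let F : I → ℝ → ℂ := fun i t =>
    ((heatZ H t i.1 x * heatZ H (θ - t) i.1 i.2.2.1 * v i.1 i.2.1 *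
      heatZ H t i.2.1 i.2.2.2.1 * heatZ H (θ - t) i.2.1 i.2.2.2.2 : ℝ) : ℂ) *
      (g₁ (spProj L i.2.2.1) * g₂ (spProj L i.2.2.2.1) * g₃ (spProj L i.2.2.2.2))
  let S : ℝ≥0∞ := supBound g₁ * supBound g₂ * supBound g₃
  let G : I → ℝ≥0∞ := fun i =>
    (heatMaj H θ i.1 x * heatMaj H θ i.1 i.2.2.1 * ‖v i.1 i.2.1‖ₑ *
      heatMaj H θ i.2.1 i.2.2.2.1 * heatMaj H θ i.2.1 i.2.2.2.2) * S
  have hS : S ≠ ⊤ := ENNReal.mul_ne_top (ENNReal.mul_ne_top (supBound_ne_top _) (supBound_ne_top _))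
    (supBound_ne_top _)
  have hFG : ∀ i, ∀ t ∈ Set.Icc 0 θ, ‖F i t‖ₑ ≤ G i := fun i t ht => by
    simp only [F, G]
    rw [enorm_mul, enorm_ofReal_complex]
    refine mul_le_mul' ?_ ?_
    · exact enorm_vHalf_term_le ht i.1 i.2.1 ![x, i.2.2.1, i.2.2.2.1, i.2.2.2.2]
    · rw [enorm_mul, enorm_mul]
      exact mul_le_mul' (mul_le_mul' (enorm_le_supBound _ _) (enorm_le_supBound _ _))
        (enorm_le_supBound _ _)
  have hG : ∑' i, G i ≠ ⊤ := by
    rw [← (fiveEquiv (Sp 0)).tsum_eq, ENNReal.tsum_prod']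
    have : ∀ ζ : Fin 3 → Sp 0, ∑' b : Sp 0 × Sp 0, G (fiveEquiv (Sp 0) (ζ, b))
        = doubleStar (heatMaj H θ) (fun p q => ‖v p q‖ₑ) (Fin.cons x ζ) * S := fun ζ => by
      rw [ENNReal.tsum_mul_right, ENNReal.tsum_prod']
      rfl
    simp only [this]
    rw [ENNReal.tsum_mul_right]
    refine ENNReal.mul_ne_top (ne_top_of_le_ne_top ?_ (tsum_doubleStar_le (h.heatMaj_symm θ)
      (h.tsum_heatMaj_le' hm hθ) hv x)) hS
    exact ENNReal.mul_ne_top (ENNReal.pow_ne_top ENNReal.ofReal_ne_top) hNV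
  have hGi : ∀ i, G i ≠ ⊤ := ENNReal.ne_top_of_tsum_ne_top hG
  have hcont : ∀ i, ContinuousOn (F i) (Set.Icc 0 θ) := fun i => by
    have h1 : ∀ p y : Sp 0, ContinuousOn (fun t => heatZ H t p y) (Set.Icc 0 θ) :=
      fun p y => h.continuousOn_heatZ hm hθ p y
    have h2 : ∀ p y : Sp 0, ContinuousOn (fun t => heatZ H (θ - t) p y) (Set.Icc 0 θ) :=
      fun p y => (h1 p y).comp (by fun_prop) fun t ht => sub_mem_Icc ht
    refine ContinuousOn.mul ?_ continuousOn_const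
    refine Complex.continuous_ofReal.comp_continuousOn ?_
    exact ((((h1 _ _).mul (h2 _ _)).mul continuousOn_const).mul (h1 _ _)).mul (h2 _ _)
  have hmem : ∀ t, t ∈ Set.uIoc 0 θ → t ∈ Set.Icc 0 θ := fun t ht => by
    rw [Set.uIoc_of_le hθ] at ht; exact Set.Ioc_subset_Icc_self ht
  have hsumF : ∀ t ∈ Set.Icc 0 θ, Summable fun i => F i t := fun t ht =>
    summable_of_tsum_enorm_ne_top
      (ne_top_of_le_ne_top hG (ENNReal.tsum_le_tsum fun i => hFG i t ht))
  -- exchange the sums with the integral over `t`; the majorant `G` does not depend on `t`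
  have key := intervalIntegral.hasSum_integral_of_dominated_convergence
    (μ := MeasureTheory.volume) (a := 0) (b := θ) (F := F) (f := fun t => ∑' i, F i t)
    (fun i _ => (G i).toReal)
    (fun i => ((hcont i).aestronglyMeasurable measurableSet_Icc).mono_measure
      (MeasureTheory.Measure.restrict_mono (fun t ht => hmem t ht) le_rfl))
    (fun i => Filter.Eventually.of_forall fun t ht => by
      have := ENNReal.toReal_mono (hGi i) (hFG i t (hmem t ht))
      simpa using this)
    (Filter.Eventually.of_forall fun t _ => ENNReal.summable_toReal hG)
    intervalIntegrable_const
    (Filter.Eventually.of_forall fun t ht => (hsumF t (hmem t ht)).hasSum)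
  -- the left hand side
  have hL : ∑' ζ : Fin 3 → Sp 0, (vHalf H v θ (Fin.cons x ζ) : ℂ) *
        (g₁ (spProj L (ζ 0)) * g₂ (spProj L (ζ 1)) * g₃ (spProj L (ζ 2)))
      = ∑' i, ∫ t in (0 : ℝ)..θ, F i t := by
    have hs : Summable fun i => ∫ t in (0 : ℝ)..θ, F i t := key.summable
    rw [← (fiveEquiv (Sp 0)).tsum_eq]
    refine Eq.trans (tsum_congr fun ζ => ?_)
      ((fiveEquiv (Sp 0)).summable_iff.mpr hs).tsum_prod.symm
    rw [vHalf, Complex.ofReal_tsum, ← tsum_mul_right]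
    refine tsum_congr fun p => ?_
    rw [← intervalIntegral.integral_ofReal, ← intervalIntegral.integral_mul_const]
    rfl
  rw [hL, key.tsum_eq]
  refine intervalIntegral.integral_congr fun t ht => ?_
  rw [Set.uIcc_of_le hθ] at ht
  -- the sum at a fixed time
  have s0 := hsumF t ht
  set a := NormedSpace.exp (-t • periodize₂ L (kinetic H))
  set b := NormedSpace.exp (-(θ - t) • periodize₂ L (kinetic H))
  have ha : Intertwines (heatZ H t) a := h.intertwines_heatZ hm t
  have hb : Intertwines (heatZ H (θ - t)) b := h.intertwines_heatZ hm (θ - t)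
  change ∑' i, F i t = _
  rw [s0.tsum_prod, ← ha]
  refine tsum_congr fun p => ?_
  have s1 := s0.prod_factor p
  rw [s1.tsum_prod, Pi.mul_apply, ← hvi, ← mul_assoc, ← tsum_mul_left]
  refine tsum_congr fun q => ?_
  have s2 := s1.prod_factor q
  rw [s2.tsum_prod, Pi.mul_apply]
  have e : ∀ y₁ : Sp 0, ∑' z : Sp 0 × Sp 0, F (p, q, y₁, z) t
      = ((heatZ H (θ - t) p y₁ : ℝ) : ℂ) * g₁ (spProj L y₁) *
        (((heatZ H t x p : ℝ) : ℂ) * (v p q : ℂ) * (act a g₂ (spProj L q) *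
          act b g₃ (spProj L q))) := fun y₁ => by
    have s3 := s2.prod_factor y₁
    rw [s3.tsum_prod]
    have e' : ∀ y₂ : Sp 0, ∑' y₃ : Sp 0, F (p, q, y₁, y₂, y₃) t
        = ((heatZ H t q y₂ : ℝ) : ℂ) * g₂ (spProj L y₂) *
          (((heatZ H (θ - t) p y₁ : ℝ) : ℂ) * g₁ (spProj L y₁) *
            (((heatZ H t x p : ℝ) : ℂ) * (v p q : ℂ) * act b g₃ (spProj L q))) := fun y₂ => by
      rw [← hb g₃ q, ← tsum_mul_left, ← tsum_mul_left, ← tsum_mul_left]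
      refine tsum_congr fun y₃ => ?_
      simp only [F]
      rw [h.heatZ_symm t x p]
      push_cast
      ring
    simp only [e']
    rw [tsum_mul_right, ha g₂ q]
    ring
  simp only [e]
  rw [tsum_mul_right, hb g₁ p]
  ring

end VHalf

/-! ### Quartic kernels that are local in time -/

/-- The times of the four arguments are `n - 1, n, n - 1, n` for some `n`. -/
def IsQuartTime {Lt M : ℕ} (x : Fin 4 → STLat Lt M) : Prop :=
  (x 0).1 = (x 2).1 ∧ (x 1).1 = (x 3).1 ∧ (x 0).1 = (x 1).1 - 1

instance {Lt M : ℕ} (x : Fin 4 → STLat Lt M) : Decidable (IsQuartTime x) :=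
  inferInstanceAs (Decidable (_ ∧ _ ∧ _))

/-- The space-time kernel with spatial part `w` and times `n - 1, n, n - 1, n`. -/
def stKernel {Lt : ℕ} (w : (Fin 4 → Sp 0) → ℝ) (x : Fin 4 → STLat Lt 0) : ℝ :=
  if IsQuartTime x then w (fun q => (x q).2) else 0

lemma leadingKernel_eq (H : Bond 0 → Bond 0 → ℝ) (v : Sp 0 → Sp 0 → ℝ) (θ : ℝ) {Lt : ℕ}
    (x : Fin 4 → STLat Lt 0) :
    leadingKernel H v θ x = stKernel (fun y => vθ H v θ (y 0) (y 1) (y 2) (y 3)) x := rfl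

/-- The time offset of the `q`-th argument. -/
def quartOffset (Lt : ℕ) : Fin 4 → ZMod Lt := ![0, 1, 0, 1]

/-- The time of any of the four arguments determines the times of the others. -/
lemma isQuartTime_iff {Lt M : ℕ} (x : Fin 4 → STLat Lt M) (i : Fin 4) :
    IsQuartTime x ↔ ∀ q, (x q).1 = (x i).1 + quartOffset Lt q - quartOffset Lt i := by
  unfold IsQuartTime
  simp only [Fin.forall_fin_succ, IsEmpty.forall_iff, and_true]
  constructor
  · rintro ⟨h1, h2, h3⟩
    fin_cases i <;> simp [quartOffset] <;> grind
  · intro h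
    fin_cases i <;> simp [quartOffset] at h ⊢ <;> grind

/-- The star with centre at the time of the first point: the two arguments at the other time need a
vertical edge. -/
lemma treeLength_quart_le {Lt M : ℕ} {x : Fin 4 → STLat Lt M} (hx : IsQuartTime x) (p : Sp M) :
    treeLength stDist x ≤ 2 + ∑ q, spDist p (x q).2 := by
  refine (treeLength_le_star isPseudoDist_stDist ((x 0).1, p) x).trans ?_
  have h : ∀ q, stDist ((x 0).1, p) (x q) ≤ absMin ((x 0).1 - (x q).1) + spDist p (x q).2 :=
    fun q => stDist_le _ _
  refine (Finset.sum_le_sum fun q _ => h q).trans ?_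
  rw [Finset.sum_add_distrib]
  gcongr
  obtain ⟨h1, h2, h3⟩ := hx
  have h4 : (x 0).1 - (x 1).1 = -1 := by rw [h3]; ring
  have h5 : (x 0).1 - (x 3).1 = -1 := by rw [← h2]; exact h4
  have h6 : (x 0).1 - (x 2).1 = 0 := sub_eq_zero.mpr h1
  rw [Fin.sum_univ_four, h4, h5, h6, sub_self, absMin_zero, absMin_neg]
  linarith [absMin_one_le (n := Lt)]

/-- As one time determines the others, the norm of `stKernel w` is bounded by spatial sums. -/
lemma kernelNorm_stKernel_le {Lt : ℕ} {w : (Fin 4 → Sp 0) → ℝ} {m : ℝ}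
    {G : (Fin 4 → Sp 0) → ℝ≥0∞} {N : ℝ≥0∞}
    (hG : ∀ x : Fin 4 → STLat Lt 0, IsQuartTime x →
      ENNReal.ofReal (|w (fun q => (x q).2)| * Real.exp (m * treeLength stDist x))
        ≤ G (fun q => (x q).2))
    (hN : ∀ (i : Fin 4) (u : Sp 0), ∑' y : Fin 4 → Sp 0, (if y i = u then G y else 0) ≤ N) :
    kernelNorm stDist m (stKernel (Lt := Lt) w) ≤ N := by
  classical
  refine kernelNorm_le fun i u => ?_
  refine le_trans ?_ (hN i u.2)
  let T : Fin 4 → ZMod Lt := fun q => u.1 + quartOffset Lt q - quartOffset Lt i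
  rw [← tsum_ite_fst_eq T (fun x : Fin 4 → STLat Lt 0 =>
    if (x i).2 = u.2 then G (fun q => (x q).2) else 0)]
  refine ENNReal.tsum_le_tsum fun x => ?_
  by_cases hu : x i = u
  · by_cases hx : IsQuartTime x
    · have hT : ∀ q, (x q).1 = T q := by
        have := (isQuartTime_iff x i).mp hx
        rw [hu] at this
        exact this
      rw [if_pos hu, if_pos hT, if_pos (by rw [hu]), stKernel, if_pos hx]
      exact hG x hx
    · rw [if_pos hu, stKernel, if_neg hx]
      simp
  · rw [if_neg hu]; exact zero_le

lemma stKernel_swap₀₂ {Lt : ℕ} {w : (Fin 4 → Sp 0) → ℝ}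
    (hw : ∀ y, w ![y 2, y 1, y 0, y 3] = w y) (x : Fin 4 → STLat Lt 0) :
    stKernel w ![x 2, x 1, x 0, x 3] = stKernel w x := by
  have e : (fun q => ((![x 2, x 1, x 0, x 3] : Fin 4 → STLat Lt 0) q).2)
      = ![(x 2).2, (x 1).2, (x 0).2, (x 3).2] := by funext q; fin_cases q <;> rfl
  unfold stKernel
  rw [e, hw (fun q => (x q).2)]
  refine if_congr ?_ rfl rfl
  simp only [IsQuartTime, Matrix.cons_val]
  grind

lemma stKernel_swap₁₃ {Lt : ℕ} {w : (Fin 4 → Sp 0) → ℝ}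
    (hw : ∀ y, w ![y 0, y 3, y 2, y 1] = w y) (x : Fin 4 → STLat Lt 0) :
    stKernel w ![x 0, x 3, x 2, x 1] = stKernel w x := by
  have e : (fun q => ((![x 0, x 3, x 2, x 1] : Fin 4 → STLat Lt 0) q).2)
      = ![(x 0).2, (x 3).2, (x 2).2, (x 1).2] := by funext q; fin_cases q <;> rfl
  unfold stKernel
  rw [e, hw (fun q => (x q).2)]
  refine if_congr ?_ rfl rfl
  simp only [IsQuartTime, Matrix.cons_val]
  grind

lemma quarticSInvariant_stKernel {Lt : ℕ} {w : (Fin 4 → Sp 0) → ℝ}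
    (hT : ∀ (a : Sp 0) y, w (fun q => y q + a) = w y)
    (hR : ∀ (j : Fin 3) y, w (fun q => spRefl j (y q)) = w y)
    (hC : ∀ y, w ![y 1, y 0, y 3, y 2] = w y) :
    QuarticSInvariant (stKernel (Lt := Lt) w) where
  trans a x := by
    unfold stKernel
    refine if_congr ?_ (hT a.2 fun q => (x q).2) rfl
    simp only [IsQuartTime, Prod.fst_add]
    grind
  refl j x := by
    unfold stKernel
    exact if_congr Iff.rfl (hR j fun q => (x q).2) rfl
  timeRefl x := by
    have e : (fun q => ((![stRefl 0 (x 1), stRefl 0 (x 0), stRefl 0 (x 3), stRefl 0 (x 2)] :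
        Fin 4 → STLat Lt 0) q).2) = ![(x 1).2, (x 0).2, (x 3).2, (x 2).2] := by
      funext q; fin_cases q <;> rfl
    unfold stKernel
    rw [e, hC (fun q => (x q).2)]
    refine if_congr ?_ rfl rfl
    simp only [IsQuartTime, Matrix.cons_val]
    change (-(x 1).1 = -(x 3).1 ∧ -(x 0).1 = -(x 2).1 ∧ -(x 1).1 = -(x 0).1 - 1) ↔ _
    grind

/-- The times of the last three arguments when the first one is at time `n`. -/
def tripleTime {Lt : ℕ} (n : ZMod Lt) : Fin 3 → ZMod Lt := ![n + 1, n, n + 1]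

lemma isQuartTime_cons {Lt M : ℕ} (x : STLat Lt M) (ζ : Fin 3 → STLat Lt M) :
    IsQuartTime (Fin.cons x ζ : Fin 4 → STLat Lt M) ↔ ∀ q, (ζ q).1 = tripleTime x.1 q := by
  have e : IsQuartTime (Fin.cons x ζ : Fin 4 → STLat Lt M)
      ↔ (x.1 = (ζ 1).1 ∧ (ζ 0).1 = (ζ 2).1 ∧ x.1 = (ζ 0).1 - 1) := Iff.rfl
  rw [e]
  simp only [Fin.forall_fin_succ, IsEmpty.forall_iff, and_true]
  simp only [tripleTime, Fin.succ_zero_eq_one, Fin.succ_one_eq_two, Matrix.cons_val]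
  grind

lemma sum_fin_four {A : Type*} [Fintype A] (F : (Fin 4 → A) → ℂ) :
    ∑ x, F x = ∑ a, ∑ y : Fin 3 → A, F (Fin.cons a y) := by
  rw [← Equiv.sum_comp (Fin.consEquiv fun _ : Fin 4 => A), Fintype.sum_prod_type]
  rfl

section

variable {Lt L : ℕ} [NeZero Lt] [NeZero L]

lemma stProj_stLift (x : STLat Lt L) : stProj Lt L (stLift x) = x := by
  simp [stProj, stLift, spProj_spLift]

lemma stKernel_cons (w : (Fin 4 → Sp 0) → ℝ) (x : STLat Lt 0) (ζ : Fin 3 → STLat Lt 0) :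
    stKernel w (Fin.cons x ζ)
      = if ∀ q, (ζ q).1 = tripleTime x.1 q then w (Fin.cons x.2 fun q => (ζ q).2) else 0 := by
  unfold stKernel
  refine if_congr (isQuartTime_cons x ζ) ?_ rfl
  congr 1
  funext q
  refine Fin.cases rfl (fun _ => rfl) q

/-- A periodized quartic kernel, with its first argument fixed, as a sum over `ℤ³`. -/
lemma sum_periodize₄_mul {w : (Fin 4 → Sp 0) → ℝ} (x : STLat Lt L)
    (hw : ∑' ζ : Fin 3 → Sp 0, ‖w (Fin.cons (spLift x.2) ζ)‖ₑ ≠ ⊤)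
    (g : (Fin 3 → STLat Lt L) → ℂ) :
    ∑ y : Fin 3 → STLat Lt L, (periodize₄ L (stKernel w) (Fin.cons x y) : ℂ) * g y
      = ∑' ζ : Fin 3 → Sp 0, (w (Fin.cons (spLift x.2) ζ) : ℂ) *
          g (fun q => (tripleTime x.1 q, spProj L (ζ q))) := by
  have hs : Summable fun ζ : Fin 3 → STLat Lt 0 => stKernel w (Fin.cons (stLift x) ζ) := by
    apply summable_of_tsum_enorm_ne_top
    have e : ∀ ζ : Fin 3 → STLat Lt 0, ‖stKernel w (Fin.cons (stLift x) ζ)‖ₑ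
        = if ∀ q, (ζ q).1 = tripleTime x.1 q then
            ‖w (Fin.cons (spLift x.2) fun q => (ζ q).2)‖ₑ else 0 := fun ζ => by
      rw [stKernel_cons]
      change ‖if ∀ q, (ζ q).1 = tripleTime x.1 q then _ else _‖ₑ = _
      split_ifs
      · rfl
      · simp
    simp only [e]
    rw [tsum_ite_fst_eq (tripleTime x.1) (fun ζ : Fin 3 → STLat Lt 0 =>
      ‖w (Fin.cons (spLift x.2) fun q => (ζ q).2)‖ₑ)]
    exact hw
  unfold periodize₄
  rw [sum_periodize_mul (stProj_stLift x) hs]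
  refine Eq.trans (tsum_congr fun ζ => ?_)
    (tsum_ite_fst_eq (tripleTime x.1) (fun ζ : Fin 3 → STLat Lt 0 =>
      (w (Fin.cons (spLift x.2) fun q => (ζ q).2) : ℂ) * g (fun q => stProj Lt L (ζ q))))
  rw [stKernel_cons]
  change ((if ∀ q, (ζ q).1 = tripleTime x.1 q then _ else _ : ℝ) : ℂ) * _ = _
  split_ifs
  · rfl
  · simp

/-- The quartic monomial of a periodized kernel. -/
lemma quartic_periodize₄ {w : (Fin 4 → Sp 0) → ℝ}
    (hw : ∀ x : Sp 0, ∑' ζ : Fin 3 → Sp 0, ‖w (Fin.cons x ζ)‖ₑ ≠ ⊤) (ψs ψ : STLat Lt L → ℂ) :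
    quartic (periodize₄ L (stKernel w)) ψs ψ
      = 1 / 2 * ∑ n : ZMod Lt, ∑ x : Sp L, ψs (n - 1, x) *
        ∑' ζ : Fin 3 → Sp 0, (w (Fin.cons (spLift x) ζ) : ℂ) *
          (ψ (n, spProj L (ζ 0)) * ψs (n - 1, spProj L (ζ 1)) * ψ (n, spProj L (ζ 2))) := by
  have key : ∀ (n : ZMod Lt) (x : Sp L), ∑ y : Fin 3 → STLat Lt L,
      (periodize₄ L (stKernel w) (Fin.cons (n - 1, x) y) : ℂ) * ψs (n - 1, x) * ψ (y 0) *
        ψs (y 1) * ψ (y 2)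
      = ψs (n - 1, x) * ∑' ζ : Fin 3 → Sp 0, (w (Fin.cons (spLift x) ζ) : ℂ) *
          (ψ (n, spProj L (ζ 0)) * ψs (n - 1, spProj L (ζ 1)) * ψ (n, spProj L (ζ 2))) :=
    fun n x => by
    have h := sum_periodize₄_mul (w := w) (((n - 1 : ZMod Lt), x) : STLat Lt L) (hw _)
      (fun y => ψ (y 0) * ψs (y 1) * ψ (y 2))
    have e : tripleTime (n - 1) = ![n, n - 1, n] := by simp [tripleTime]
    simp only [e] at h
    refine Eq.trans ?_ (congrArg (fun z => ψs (n - 1, x) * z) h)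
    rw [Finset.mul_sum]
    exact Finset.sum_congr rfl fun y _ => by ring
  simp only [← key]
  unfold quartic
  rw [sum_fin_four, Fintype.sum_prod_type]
  congr 1
  exact (Equiv.sum_comp (Equiv.subRight (1 : ZMod Lt)) _).symm

end

/-- Sums over configurations with prescribed first point. -/
lemma tsum_rooted_zero {C M : Type*} [DecidableEq C] [AddCommMonoid M] [TopologicalSpace M]
    (G : (Fin 4 → C) → M) (u : C) :
    ∑' y : Fin 4 → C, (if y 0 = u then G y else 0) = ∑' ζ : Fin 3 → C, G (Fin.cons u ζ) := by
  have hinj : Function.Injective fun ζ : Fin 3 → C => (Fin.cons u ζ : Fin 4 → C) :=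
    Fin.cons_right_injective (α := fun _ => C) u
  rw [← hinj.tsum_eq]
  · simp
  · intro y hy
    have h0 : y 0 = u := by
      by_contra h
      simp [h] at hy
    exact ⟨Fin.tail y, by simp only [← h0, Fin.cons_self_tail]⟩

lemma sum_rooted_perm (G : (Fin 4 → Sp 0) → ℝ≥0∞) (σ : Equiv.Perm (Fin 4)) (i : Fin 4) (u : Sp 0) :
    ∑' y : Fin 4 → Sp 0, (if y i = u then G (fun q => y (σ q)) else 0)
      = ∑' y : Fin 4 → Sp 0, (if y (σ.symm i) = u then G y else 0) := by
  rw [← (Equiv.arrowCongr σ (Equiv.refl (Sp 0))).tsum_eq]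
  refine tsum_congr fun y => ?_
  simp [Equiv.arrowCongr, Function.comp_def]

/-! ### The explicit part of the quartic kernel -/

section Leading

variable {c : Constants} {fv : ℝ} {L : ℕ} [NeZero L] {H : Bond 0 → Bond 0 → ℝ}
  {v : Sp 0 → Sp 0 → ℝ}

lemma InteractionHyp.tsum_wt_le (h : InteractionHyp c fv L v) (x : Sp 0) :
    ∑' y, wt (5 * c.mass) x y * ‖v x y‖ₑ ≤ ENNReal.ofReal (fv / 2) := by
  refine le_trans (le_of_eq ?_) ((le_iSup (fun x => ∑' y, ENNReal.ofReal
    (Real.exp (5 * c.mass * spDist x y) * |v x y|)) x).trans h.upper)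
  refine tsum_congr fun y => ?_
  rw [ENNReal.ofReal_mul (Real.exp_pos _).le, Real.enorm_eq_ofReal_abs, wt]

lemma InteractionHyp.tsum_enorm_le (h : InteractionHyp c fv L v) (hm : 0 < c.mass) (x : Sp 0) :
    ∑' y, ‖v x y‖ₑ ≤ ENNReal.ofReal (fv / 2) :=
  (ENNReal.tsum_le_tsum fun y => le_mul_of_one_le_left' (one_le_wt (by linarith) x y)).trans
    (h.tsum_wt_le x)

lemma InteractionHyp.intertwines (h : InteractionHyp c fv L v) (hm : 0 < c.mass) :
    Intertwines v (periodize₂ L v) :=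
  intertwines_periodize₂ h.trans fun x => summable_of_tsum_enorm_ne_top
    (ne_top_of_le_ne_top ENNReal.ofReal_ne_top (h.tsum_enorm_le hm x))

/-- The kernel `𝐯_θ` as a function of four points. -/
def vθ₄ (H : Bond 0 → Bond 0 → ℝ) (v : Sp 0 → Sp 0 → ℝ) (θ : ℝ) (y : Fin 4 → Sp 0) : ℝ :=
  vθ H v θ (y 0) (y 1) (y 2) (y 3)

lemma vθ₄_eq (H : Bond 0 → Bond 0 → ℝ) (v : Sp 0 → Sp 0 → ℝ) (θ : ℝ) (y : Fin 4 → Sp 0) :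
    vθ₄ H v θ y = vHalf H v θ y + vHalf H v θ ![y 2, y 1, y 0, y 3] := rfl

lemma vθ₄_swap₀₂ (H : Bond 0 → Bond 0 → ℝ) (v : Sp 0 → Sp 0 → ℝ) (θ : ℝ) (y : Fin 4 → Sp 0) :
    vθ₄ H v θ ![y 2, y 1, y 0, y 3] = vθ₄ H v θ y := by
  rw [vθ₄_eq, vθ₄_eq, add_comm]
  congr 2
  funext q
  fin_cases q <;> rfl

lemma vθ₄_swap₁₃ (H : Bond 0 → Bond 0 → ℝ) (hv : ∀ x y, v x y = v y x) (θ : ℝ)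
    (y : Fin 4 → Sp 0) : vθ₄ H v θ ![y 0, y 3, y 2, y 1] = vθ₄ H v θ y := by
  rw [vθ₄_eq, vθ₄_eq, add_comm]
  congr 1
  · exact vHalf_exchange H hv θ y
  · exact (vHalf_exchange H hv θ ![y 0, y 3, y 2, y 1]).symm

lemma vθ₄_timeRefl (H : Bond 0 → Bond 0 → ℝ) (hv : ∀ x y, v x y = v y x) (θ : ℝ)
    (y : Fin 4 → Sp 0) : vθ₄ H v θ ![y 1, y 0, y 3, y 2] = vθ₄ H v θ y := by
  rw [vθ₄_eq, vθ₄_eq]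
  congr 1
  · exact vHalf_timeRefl H v θ y
  · refine Eq.trans (vHalf_timeRefl H v θ ![y 0, y 3, y 2, y 1]) ?_
    exact (vHalf_exchange H hv θ ![y 0, y 3, y 2, y 1]).symm

lemma vθ₄_equiv {θ : ℝ} (e : Sp 0 ≃ Sp 0)
    (hh : ∀ t x y, heatZ H t (e x) (e y) = heatZ H t x y) (hv : ∀ x y, v (e x) (e y) = v x y)
    (y : Fin 4 → Sp 0) : vθ₄ H v θ (fun i => e (y i)) = vθ₄ H v θ y := by
  rw [vθ₄_eq, vθ₄_eq, KineticHyp.vHalf_equiv e hh hv]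
  congr 1
  refine Eq.trans ?_ (KineticHyp.vHalf_equiv e hh hv ![y 2, y 1, y 0, y 3])
  congr 1
  funext q
  fin_cases q <;> rfl

lemma KineticHyp.tsum_enorm_vHalf_ne_top (h : KineticHyp c L H) (hv : InteractionHyp c fv L v)
    (hm : 0 < c.mass) {θ : ℝ} (hθ : 0 ≤ θ) (x : Sp 0) :
    ∑' ζ : Fin 3 → Sp 0, ‖vHalf H v θ (Fin.cons x ζ)‖ₑ ≠ ⊤ := by
  refine ne_top_of_le_ne_top ?_ (ENNReal.tsum_le_tsum fun ζ => enorm_vHalf_le hθ _)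
  rw [ENNReal.tsum_mul_left]
  refine ENNReal.mul_ne_top ENNReal.ofReal_ne_top (ne_top_of_le_ne_top ?_
    (tsum_doubleStar_le (h.heatMaj_symm θ) (h.tsum_heatMaj_le' hm hθ) (hv.tsum_enorm_le hm) x))
  exact ENNReal.mul_ne_top (ENNReal.pow_ne_top ENNReal.ofReal_ne_top) ENNReal.ofReal_ne_top

/-- Reversal of three points. -/
def revEquiv (C : Type*) : (Fin 3 → C) ≃ (Fin 3 → C) :=
  Equiv.arrowCongr Fin.revPerm (Equiv.refl C)

/-- After an exchange of the two ends of the interaction line, the second term of `𝐯_θ` arises from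
the first one by an exchange of the arguments `x₂` and `x₄`. -/
lemma vθ₄_cons (H : Bond 0 → Bond 0 → ℝ) (hv : ∀ x y, v x y = v y x) (θ : ℝ) (x : Sp 0)
    (ζ : Fin 3 → Sp 0) : vθ₄ H v θ (Fin.cons x ζ)
      = vHalf H v θ (Fin.cons x ζ) + vHalf H v θ (Fin.cons x (revEquiv _ ζ)) := by
  rw [vθ₄_eq]
  congr 1
  rw [← vHalf_exchange H hv θ (Fin.cons x (revEquiv _ ζ))]
  congr 1

lemma KineticHyp.tsum_enorm_vθ₄_ne_top (h : KineticHyp c L H) (hv : InteractionHyp c fv L v)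
    (hm : 0 < c.mass) {θ : ℝ} (hθ : 0 ≤ θ) (x : Sp 0) :
    ∑' ζ : Fin 3 → Sp 0, ‖vθ₄ H v θ (Fin.cons x ζ)‖ₑ ≠ ⊤ := by
  have h1 := h.tsum_enorm_vHalf_ne_top hv hm hθ x
  refine ne_top_of_le_ne_top (ENNReal.add_ne_top.mpr ⟨h1, h1⟩) ?_
  calc ∑' ζ : Fin 3 → Sp 0, ‖vθ₄ H v θ (Fin.cons x ζ)‖ₑ
      ≤ ∑' ζ : Fin 3 → Sp 0, (‖vHalf H v θ (Fin.cons x ζ)‖ₑ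
          + ‖vHalf H v θ (Fin.cons x (revEquiv _ ζ))‖ₑ) := by
        refine ENNReal.tsum_le_tsum fun ζ => ?_
        rw [vθ₄_cons H hv.symm]
        exact enorm_add_le _ _
    _ = _ := by
        rw [ENNReal.tsum_add]
        congr 1
        exact (revEquiv (Sp 0)).tsum_eq (fun ζ => ‖vHalf H v θ (Fin.cons x ζ)‖ₑ)

/-- The heat operators on the torus. -/
def torusHeat (H : Bond 0 → Bond 0 → ℝ) (L : ℕ) [NeZero L] (t : ℝ) : Matrix (Sp L) (Sp L) ℝ :=
  NormedSpace.exp (-t • periodize₂ L (kinetic H))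

/-- Testing `𝐯_θ` against a function that is symmetric under the exchange of `x₂` and `x₄`: the two
terms of `𝐯_θ` contribute equally. -/
lemma KineticHyp.tsum_vθ₄_mul (h : KineticHyp c L H) (hv : InteractionHyp c fv L v)
    (hm : 0 < c.mass) {θ : ℝ} (hθ : 0 ≤ θ) (x : Sp 0) (g g' : Sp L → ℂ) :
    ∑' ζ : Fin 3 → Sp 0, (vθ₄ H v θ (Fin.cons x ζ) : ℂ) *
        (g (spProj L (ζ 0)) * g' (spProj L (ζ 1)) * g (spProj L (ζ 2)))
      = 2 * ∫ t in (0 : ℝ)..θ, act (torusHeat H L t) (act (torusHeat H L (θ - t)) g *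
          act (periodize₂ L v) (act (torusHeat H L t) g' * act (torusHeat H L (θ - t)) g))
            (spProj L x) := by
  have hQ := h.tsum_vHalf_mul hm hθ ENNReal.ofReal_ne_top (hv.tsum_enorm_le hm) (hv.intertwines hm)
    x g g' g
  set φ : (Fin 3 → Sp 0) → ℂ := fun ζ => (vHalf H v θ (Fin.cons x ζ) : ℂ) *
        (g (spProj L (ζ 0)) * g' (spProj L (ζ 1)) * g (spProj L (ζ 2))) with hφ
  have hs : Summable φ := by
    apply summable_of_tsum_enorm_ne_top
    refine ne_top_of_le_ne_top (b := (∑' ζ : Fin 3 → Sp 0, ‖vHalf H v θ (Fin.cons x ζ)‖ₑ) *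
      (supBound g * supBound g' * supBound g)) ?_ ?_
    · exact ENNReal.mul_ne_top (h.tsum_enorm_vHalf_ne_top hv hm hθ x) (ENNReal.mul_ne_top
        (ENNReal.mul_ne_top (supBound_ne_top _) (supBound_ne_top _)) (supBound_ne_top _))
    · rw [← ENNReal.tsum_mul_right]
      refine ENNReal.tsum_le_tsum fun ζ => ?_
      rw [hφ]
      simp only [enorm_mul, enorm_ofReal_complex]
      gcongr <;> exact enorm_le_supBound _ _
  have hsplit : ∀ ζ : Fin 3 → Sp 0, (vθ₄ H v θ (Fin.cons x ζ) : ℂ) *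
        (g (spProj L (ζ 0)) * g' (spProj L (ζ 1)) * g (spProj L (ζ 2)))
      = φ ζ + φ (revEquiv _ ζ) := fun ζ => by
    rw [vθ₄_cons H hv.symm, hφ]
    have e0 : revEquiv (Sp 0) ζ 0 = ζ 2 := rfl
    have e1 : revEquiv (Sp 0) ζ 1 = ζ 1 := rfl
    have e2 : revEquiv (Sp 0) ζ 2 = ζ 0 := rfl
    simp only [e0, e1, e2]
    push_cast
    ring
  simp only [hsplit]
  have hs' : Summable fun ζ => φ (revEquiv _ ζ) := (revEquiv (Sp 0)).summable_iff.mpr hs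
  rw [hs.tsum_add hs', (revEquiv (Sp 0)).tsum_eq φ, hQ, two_mul]
  rfl

/-- The periodization of a translation invariant kernel depends on `Y - X`. -/
lemma periodize₂_apply {A : Sp 0 → Sp 0 → ℝ} (hT : ∀ a x y, A (x + a) (y + a) = A x y)
    (X Y : Sp L) :
    periodize₂ L A X Y = ∑' z, if spProj L z = Y - X then A 0 z else 0 := by
  have h := periodize_cons (n := 1) (spProj L) spLift (fun ξ : Fin 2 → Sp 0 => A (ξ 0) (ξ 1)) X
    (spProj_spLift X) (fun _ => Y)
  have e : ![X, Y] = Fin.cons X (fun _ => Y) := by funext i; fin_cases i <;> rfl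
  simp only [periodize₂, Matrix.of_apply]
  rw [e, h, ← (Equiv.funUnique (Fin 1) (Sp 0)).symm.tsum_eq]
  refine ((Equiv.addRight (spLift X)).tsum_eq _).symm.trans ?_
  refine tsum_congr fun z => ?_
  have h1 : ((fun i => spProj L ((Equiv.funUnique (Fin 1) (Sp 0)).symm (z + spLift X) i))
      = fun _ : Fin 1 => Y) ↔ spProj L z = Y - X := by
    rw [eq_sub_iff_add_eq]
    have e2 : spProj L z + X = spProj L (z + spLift X) := by rw [spProj_add, spProj_spLift]
    rw [e2]
    exact ⟨fun h => congrFun h 0, fun h => funext fun _ => h⟩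
  have h2 : A 0 z = A (spLift X) (z + spLift X) := by
    have := hT (spLift X) 0 z
    rw [zero_add] at this
    exact this.symm
  rw [h2]
  by_cases hz : spProj L z = Y - X
  · rw [if_pos hz]
    exact if_pos (h1.mpr hz)
  · rw [if_neg hz]
    exact if_neg fun h => hz (h1.mp h)

lemma periodize₂_symm {A : Sp 0 → Sp 0 → ℝ} (hT : ∀ a x y, A (x + a) (y + a) = A x y)
    (hS : ∀ x y, A x y = A y x) : (periodize₂ L A).transpose = periodize₂ L A := by
  funext X Y
  rw [Matrix.transpose_apply, periodize₂_apply hT, periodize₂_apply hT,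
    ← (Equiv.neg (Sp 0)).tsum_eq]
  refine tsum_congr fun z => ?_
  have h1 : spProj L (-z) = -spProj L z := by
    have h0 : spProj L (0 : Sp 0) = 0 := funext fun _ => map_zero _
    rw [← zero_sub, spProj_sub, h0, zero_sub]
  have h2 : A 0 (-z) = A 0 z := by
    rw [← hT z 0 (-z), hS]
    simp
  rw [Equiv.neg_apply, h1, h2]
  refine if_congr ?_ rfl rfl
  rw [neg_eq_iff_eq_neg, neg_sub]

lemma bil_act (A : Matrix (Sp L) (Sp L) ℝ) (f g : Sp L → ℂ) :
    bil f (act A g) = bil (act A.transpose f) g := by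
  simp only [bil, act, Finset.mul_sum, Finset.sum_mul, Matrix.transpose_apply]
  rw [Finset.sum_comm]
  exact Finset.sum_congr rfl fun x _ => Finset.sum_congr rfl fun y _ => by ring

lemma KineticHyp.torusHeat_transpose (h : KineticHyp c L H) (t : ℝ) :
    (torusHeat H L t).transpose = torusHeat H L t := by
  rw [torusHeat, ← Matrix.exp_transpose, Matrix.transpose_smul,
    periodize₂_symm (fun a x y => h.kinetic_trans a x y)
      (eq_symm_of_trans_refl (fun a x y => h.kinetic_trans a x y)
        fun j x y => h.kinetic_refl j x y)]

attribute [local instance] Matrix.linftyOpNormedAddCommGroup Matrix.linftyOpNormedRing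
  Matrix.linftyOpNormedAlgebra in
lemma continuous_torusHeat (H : Bond 0 → Bond 0 → ℝ) : Continuous (torusHeat H L) := by
  have h1 : Continuous fun t : ℝ => -t • periodize₂ L (kinetic H) := by fun_prop
  exact (NormedSpace.exp_continuous (𝔸 := Matrix (Sp L) (Sp L) ℝ)).comp h1

lemma continuous_act {A : ℝ → Matrix (Sp L) (Sp L) ℝ} (hA : Continuous A) {f : ℝ → Sp L → ℂ}
    (hf : Continuous f) : Continuous fun t => act (A t) (f t) := by
  refine continuous_pi fun x => ?_
  unfold act
  refine continuous_finsetSum _ fun y _ => ?_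
  exact (Complex.continuous_ofReal.comp (hA.matrix_elem x y)).mul ((continuous_apply y).comp hf)

lemma act_smul_right (A : Matrix (Sp L) (Sp L) ℝ) (z : ℂ) (f : Sp L → ℂ) :
    act A (z • f) = z • act A f := by
  funext x
  simp only [act, Pi.smul_apply, smul_eq_mul, Finset.mul_sum]
  exact Finset.sum_congr rfl fun y _ => by ring

/-- The dependence of `V_θ` on the chemical potential. -/
lemma Vθ_eq (H : Bond 0 → Bond 0 → ℝ) (v : Sp 0 → Sp 0 → ℝ) (μ θ : ℝ) (αs β : Sp L → ℂ) :
    Vθ H v μ θ αs β = -(((Real.exp (θ * μ) ^ 2 : ℝ) : ℂ) * ∫ t in (0 : ℝ)..θ,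
      bil (act (torusHeat H L t) αs * act (torusHeat H L (θ - t)) β)
        (act (periodize₂ L v) (act (torusHeat H L t) αs * act (torusHeat H L (θ - t)) β))) := by
  unfold Vθ
  rw [← intervalIntegral.integral_const_mul]
  congr 1
  refine intervalIntegral.integral_congr fun t _ => ?_
  have e : act (jop H μ L t) αs * act (jop H μ L (θ - t)) β = ((Real.exp (θ * μ) : ℝ) : ℂ) •
      (act (torusHeat H L t) αs * act (torusHeat H L (θ - t)) β) := by
    rw [jop_eq, jop_eq, act_smul, act_smul, smul_mul_smul_comm, ← Complex.ofReal_mul,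
      ← Real.exp_add]
    congr 4
    ring
  simp only [e, act_smul_right]
  simp only [bil, Pi.smul_apply, smul_eq_mul, Finset.mul_sum]
  refine Finset.sum_congr rfl fun x _ => ?_
  push_cast
  ring

/-- The kernel `𝐯_θ` reproduces the interaction `V_θ`. -/
lemma KineticHyp.sum_vθ₄_eq_Vθ (h : KineticHyp c L H) (hv : InteractionHyp c fv L v)
    (hm : 0 < c.mass) {θ : ℝ} (hθ : 0 ≤ θ) (μ : ℝ) (ψs ψ : Sp L → ℂ) :
    ((Real.exp (θ * μ) ^ 2 : ℝ) : ℂ) * (1 / 2 * ∑ x : Sp L, ψs x *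
      ∑' ζ : Fin 3 → Sp 0, (vθ₄ H v θ (Fin.cons (spLift x) ζ) : ℂ) *
        (ψ (spProj L (ζ 0)) * ψs (spProj L (ζ 1)) * ψ (spProj L (ζ 2))))
      = -Vθ H v μ θ ψs ψ := by
  rw [Vθ_eq, neg_neg]
  congr 1
  simp only [h.tsum_vθ₄_mul hv hm hθ, spProj_spLift]
  have hc1 : ∀ f : Sp L → ℂ, Continuous fun t : ℝ => act (torusHeat H L t) f :=
    fun f => continuous_act (continuous_torusHeat H) continuous_const
  have hc2 : ∀ f : Sp L → ℂ, Continuous fun t : ℝ => act (torusHeat H L (θ - t)) f :=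
    fun f => (hc1 f).comp (by fun_prop)
  have hY : Continuous fun t : ℝ => act (torusHeat H L t) (act (torusHeat H L (θ - t)) ψ *
      act (periodize₂ L v) (act (torusHeat H L t) ψs * act (torusHeat H L (θ - t)) ψ)) :=
    continuous_act (continuous_torusHeat H)
      ((hc2 ψ).mul (continuous_act continuous_const ((hc1 ψs).mul (hc2 ψ))))
  have e1 : ∀ x : Sp L, ψs x * (2 * ∫ t in (0 : ℝ)..θ,
      act (torusHeat H L t) (act (torusHeat H L (θ - t)) ψ *
        act (periodize₂ L v) (act (torusHeat H L t) ψs * act (torusHeat H L (θ - t)) ψ)) x)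
      = 2 * ∫ t in (0 : ℝ)..θ, ψs x *
      act (torusHeat H L t) (act (torusHeat H L (θ - t)) ψ *
        act (periodize₂ L v) (act (torusHeat H L t) ψs * act (torusHeat H L (θ - t)) ψ)) x :=
    fun x => by rw [intervalIntegral.integral_const_mul]; ring
  simp only [e1]
  rw [← Finset.mul_sum, ← mul_assoc, one_div, inv_mul_cancel₀ two_ne_zero, one_mul,
    ← intervalIntegral.integral_finsetSum]
  · refine intervalIntegral.integral_congr fun t _ => ?_
    change bil ψs _ = _
    -- move the outer heat operator to `ψ_*`
    rw [bil_act, h.torusHeat_transpose]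
    simp only [bil, Pi.mul_apply, mul_assoc]
  · intro x _
    exact (continuous_const.mul ((continuous_apply x).comp hY)).intervalIntegrable _ _

/-- The total strength `∑_x v(0,x)` of the periodized interaction. -/
def vHat (v : Sp 0 → Sp 0 → ℝ) (L : ℕ) [NeZero L] : ℝ := ∑ x : Sp L, periodize₂ L v 0 x

lemma InteractionHyp.sum_periodize₂ (hv : InteractionHyp c fv L v) (X : Sp L) :
    ∑ x : Sp L, periodize₂ L v X x = vHat v L := by
  unfold vHat
  simp only [periodize₂_apply hv.trans, sub_zero]
  exact Equiv.sum_comp (Equiv.subRight X)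
    (fun x => ∑' z, if spProj L z = x then v 0 z else 0)

lemma InteractionHyp.act_one (hv : InteractionHyp c fv L v) :
    act (periodize₂ L v) (1 : Sp L → ℂ) = ((vHat v L : ℝ) : ℂ) • 1 := by
  funext x
  simp only [act, Pi.one_apply, mul_one, Pi.smul_apply, smul_eq_mul]
  rw [← Complex.ofReal_sum, hv.sum_periodize₂]

/-- The constants are eigenvectors of `v` with eigenvalue `∑_x v(0,x)`. -/
lemma InteractionHyp.le_vHat (hv : InteractionHyp c fv L v) (hc : 0 < c.c_v) :
    c.c_v * (fv / 4) ≤ vHat v L := by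
  have h1 : Module.End.HasEigenvalue (Matrix.toLin' (periodize₂ L v)) (vHat v L) := by
    refine Module.End.hasEigenvalue_of_hasEigenvector (x := 1) ⟨?_, one_ne_zero⟩
    rw [Module.End.mem_eigenspace_iff]
    funext x
    simp only [Matrix.toLin'_apply, Matrix.mulVec, dotProduct, Pi.one_apply, mul_one,
      Pi.smul_apply, smul_eq_mul]
    exact hv.sum_periodize₂ x
  refine le_trans (mul_le_mul_of_nonneg_left ?_ hc.le) (hv.eigenvalues _ h1)
  exact (ENNReal.ofReal_le_iff_le_toReal
    (ne_top_of_le_ne_top ENNReal.ofReal_ne_top hv.upper)).mp hv.lower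

/-- The sum of `𝐯_θ` over three of its arguments: the heat operators preserve the constants. -/
lemma KineticHyp.tsum_vθ₄ (h : KineticHyp c L H) (hv : InteractionHyp c fv L v)
    (hm : 0 < c.mass) {θ : ℝ} (hθ : 0 ≤ θ) (x : Sp 0) :
    ∑' ζ : Fin 3 → Sp 0, vθ₄ H v θ (Fin.cons x ζ) = 2 * (θ * vHat v L) := by
  have h1 := h.tsum_vθ₄_mul hv hm hθ x (1 : Sp L → ℂ) 1
  have ht : ∀ t, act (torusHeat H L t) (1 : Sp L → ℂ) = 1 := fun t => h.act_exp_one hm t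
  simp only [Pi.one_apply, mul_one, ht, hv.act_one, act_smul_right, one_mul] at h1
  rw [← Complex.ofReal_tsum] at h1
  simp only [Pi.smul_apply, Pi.one_apply, smul_eq_mul, mul_one,
    intervalIntegral.integral_const, sub_zero] at h1
  have h2 : ((∑' ζ : Fin 3 → Sp 0, vθ₄ H v θ (Fin.cons x ζ) : ℝ) : ℂ)
      = ((2 * (θ * vHat v L) : ℝ) : ℂ) := by
    rw [h1]
    push_cast
    simp
  exact_mod_cast h2

end Leading

/-! ### The norm of the explicit part -/

section LeadingNorm

/-- By its symmetries, a bound for `doubleStar` with fixed first argument is valid for all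
arguments. -/
lemma tsum_rooted_doubleStar {B V : Sp 0 → Sp 0 → ℝ≥0∞} {N : ℝ≥0∞}
    (hV : ∀ p q, V p q = V q p)
    (hN : ∀ u, ∑' ζ : Fin 3 → Sp 0, doubleStar B V (Fin.cons u ζ) ≤ N) (i : Fin 4) (u : Sp 0) :
    ∑' y : Fin 4 → Sp 0, (if y i = u then doubleStar B V y else 0) ≤ N := by
  have h0 : ∀ u, ∑' y : Fin 4 → Sp 0, (if y 0 = u then doubleStar B V y else 0) ≤ N := fun u => by
    rw [tsum_rooted_zero]; exact hN u
  have hs : ∀ y : Fin 4 → Sp 0, doubleStar B V (fun q => y (Equiv.swap 0 1 q))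
      = doubleStar B V y := fun y => by
    rw [← doubleStar_swap B V y]
    congr 1
    funext q; fin_cases q <;> rfl
  have he : ∀ y : Fin 4 → Sp 0, doubleStar B V
      (fun q => y ((Equiv.swap 0 2 * Equiv.swap 1 3 : Equiv.Perm (Fin 4)) q))
      = doubleStar B V y := fun y => by
    rw [← doubleStar_exchange hV y]
    congr 1
    funext q; fin_cases q <;> rfl
  have h1 : ∀ u, ∑' y : Fin 4 → Sp 0, (if y 1 = u then doubleStar B V y else 0) ≤ N := fun u => by
    have := sum_rooted_perm (doubleStar B V) (Equiv.swap 0 1) 1 u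
    simp only [hs] at this
    rw [this]
    exact h0 u
  have h2 : ∀ u, ∑' y : Fin 4 → Sp 0, (if y 2 = u then doubleStar B V y else 0) ≤ N := fun u => by
    have := sum_rooted_perm (doubleStar B V) (Equiv.swap 0 2 * Equiv.swap 1 3) 2 u
    simp only [he] at this
    rw [this]
    exact h0 u
  have h3 : ∀ u, ∑' y : Fin 4 → Sp 0, (if y 3 = u then doubleStar B V y else 0) ≤ N := fun u => by
    have := sum_rooted_perm (doubleStar B V) (Equiv.swap 0 2 * Equiv.swap 1 3) 3 u
    simp only [he] at this
    rw [this]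
    exact h1 u
  fin_cases i
  exacts [h0 u, h1 u, h2 u, h3 u]

variable {c : Constants} {fv : ℝ} {L : ℕ} [NeZero L] {H : Bond 0 → Bond 0 → ℝ}
  {v : Sp 0 → Sp 0 → ℝ}

/-- The star with centre `p` and the triangle inequality through `q` turn the exponential weight
into weights on the lines of `doubleStar`. The line `{p, q}` is used twice, and `2 · 2/3 ≤ 5`. -/
lemma enorm_vHalf_mul_exp_le {m θ τ : ℝ} (hm : 0 ≤ m) (hθ : 0 ≤ θ) (y : Fin 4 → Sp 0)
    (hτ : ∀ p, τ ≤ 2 + ∑ q, spDist p (y q)) :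
    ‖vHalf H v θ y‖ₑ * ENNReal.ofReal (Real.exp (2 / 3 * m * τ))
      ≤ ENNReal.ofReal (θ * Real.exp (4 / 3 * m)) *
        doubleStar (fun p q => wt m p q * heatMaj H θ p q)
          (fun p q => wt (5 * m) p q * ‖v p q‖ₑ) y := by
  calc ‖vHalf H v θ y‖ₑ * ENNReal.ofReal (Real.exp (2 / 3 * m * τ))
      ≤ (ENNReal.ofReal θ * doubleStar (heatMaj H θ) (fun p q => ‖v p q‖ₑ) y) *
        ENNReal.ofReal (Real.exp (2 / 3 * m * τ)) := by gcongr; exact enorm_vHalf_le hθ y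
    _ = ENNReal.ofReal θ * ∑' p, ∑' q, (heatMaj H θ p (y 0) * heatMaj H θ p (y 1) * ‖v p q‖ₑ *
          heatMaj H θ q (y 2) * heatMaj H θ q (y 3)) *
          ENNReal.ofReal (Real.exp (2 / 3 * m * τ)) := by
        simp only [doubleStar, ENNReal.tsum_mul_right]
        ring
    _ ≤ ENNReal.ofReal θ * ∑' p, ∑' q, ENNReal.ofReal (Real.exp (4 / 3 * m)) *
          ((wt m p (y 0) * heatMaj H θ p (y 0)) * (wt m p (y 1) * heatMaj H θ p (y 1)) *
          (wt (5 * m) p q * ‖v p q‖ₑ) * (wt m q (y 2) * heatMaj H θ q (y 2)) *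
          (wt m q (y 3) * heatMaj H θ q (y 3))) := by
        refine mul_le_mul_right (ENNReal.tsum_le_tsum fun p => ENNReal.tsum_le_tsum fun q => ?_) _
        have hE : ENNReal.ofReal (Real.exp (2 / 3 * m * τ))
            ≤ ENNReal.ofReal (Real.exp (4 / 3 * m)) * wt m p (y 0) * wt m p (y 1) *
              wt (5 * m) p q * wt m q (y 2) * wt m q (y 3) := by
          simp only [wt]
          rw [← ENNReal.ofReal_mul (by positivity), ← ENNReal.ofReal_mul (by positivity),
            ← ENNReal.ofReal_mul (by positivity), ← ENNReal.ofReal_mul (by positivity),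
            ← ENNReal.ofReal_mul (by positivity)]
          simp only [← Real.exp_add]
          refine ENNReal.ofReal_le_ofReal (Real.exp_le_exp.mpr ?_)
          -- `τ ≤ 2 + d(p,y₀) + d(p,y₁) + 2 d(p,q) + d(q,y₂) + d(q,y₃)`
          have h1 := mul_le_mul_of_nonneg_left (hτ p) hm
          have h2 := mul_le_mul_of_nonneg_left (isPseudoDist_spDist.triangle p q (y 2)) hm
          have h3 := mul_le_mul_of_nonneg_left (isPseudoDist_spDist.triangle p q (y 3)) hm
          have p0 := mul_nonneg hm (spDist_nonneg p (y 0))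
          have p1 := mul_nonneg hm (spDist_nonneg p (y 1))
          have p2 := mul_nonneg hm (spDist_nonneg p q)
          have p3 := mul_nonneg hm (spDist_nonneg q (y 2))
          have p4 := mul_nonneg hm (spDist_nonneg q (y 3))
          rw [Fin.sum_univ_four] at h1
          linarith
        refine (mul_le_mul_right hE _).trans (le_of_eq ?_)
        ring
    _ = _ := by
        simp only [ENNReal.tsum_mul_left]
        rw [ENNReal.ofReal_mul hθ, mul_assoc]
        rfl

lemma ofReal_abs_mul (a b : ℝ) : ENNReal.ofReal (|a| * b) = ‖a‖ₑ * ENNReal.ofReal b := by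
  rw [ENNReal.ofReal_mul (abs_nonneg a), Real.enorm_eq_ofReal_abs]

/-- The decay of the heat kernels and of the interaction gives the exponential decay of `𝐯_θ`. -/
lemma KineticHyp.kernelNorm_vθ₄_le {Lt : ℕ} (h : KineticHyp c L H) (hv : InteractionHyp c fv L v)
    (hm : 0 < c.mass) (hfv : 0 ≤ fv) {θ : ℝ} (hθ : 0 ≤ θ) :
    kernelNorm stDist (2 / 3 * c.mass) (stKernel (Lt := Lt) (vθ₄ H v θ))
      ≤ ENNReal.ofReal (θ * Real.exp (4 / 3 * c.mass) * heatBound c.mass θ H ^ 4 * fv) := by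
  set B : Sp 0 → Sp 0 → ℝ≥0∞ := fun p q => wt c.mass p q * heatMaj H θ p q
  set V : Sp 0 → Sp 0 → ℝ≥0∞ := fun p q => wt (5 * c.mass) p q * ‖v p q‖ₑ
  have hBs : ∀ x y, B x y = B y x := fun x y => by
    simp only [B]; rw [wt_symm, h.heatMaj_symm]
  have hVs : ∀ x y, V x y = V y x := fun x y => by
    simp only [V]; rw [wt_symm, hv.symm]
  set N : ℝ≥0∞ := ENNReal.ofReal (heatBound c.mass θ H) ^ 4 * ENNReal.ofReal (fv / 2)
  have hroot : ∀ (i : Fin 4) u, ∑' y : Fin 4 → Sp 0,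
      (if y i = u then doubleStar B V y else 0) ≤ N :=
    tsum_rooted_doubleStar hVs (tsum_doubleStar_le hBs (h.tsum_heatMaj_le hm hθ) hv.tsum_wt_le)
  refine (kernelNorm_stKernel_le (N := ENNReal.ofReal (θ * Real.exp (4 / 3 * c.mass)) * (N + N))
    (G := fun y => ENNReal.ofReal (θ * Real.exp (4 / 3 * c.mass)) *
    (doubleStar B V y + doubleStar B V ![y 2, y 1, y 0, y 3])) ?_ ?_).trans (le_of_eq ?_)
  · intro x hx
    set y : Fin 4 → Sp 0 := fun q => (x q).2
    have hτ : ∀ p, treeLength stDist x ≤ 2 + ∑ q, spDist p (y q) := treeLength_quart_le hx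
    rw [ofReal_abs_mul]
    calc ‖vθ₄ H v θ y‖ₑ * ENNReal.ofReal (Real.exp (2 / 3 * c.mass * treeLength stDist x))
        ≤ (‖vHalf H v θ y‖ₑ + ‖vHalf H v θ ![y 2, y 1, y 0, y 3]‖ₑ) *
          ENNReal.ofReal (Real.exp (2 / 3 * c.mass * treeLength stDist x)) := by
          gcongr
          rw [vθ₄_eq]
          exact enorm_add_le _ _
      _ ≤ _ := by
          rw [add_mul, mul_add]
          refine add_le_add (enorm_vHalf_mul_exp_le hm.le hθ y hτ)
            (enorm_vHalf_mul_exp_le hm.le hθ _ fun p => (hτ p).trans (le_of_eq ?_))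
          simp only [Fin.sum_univ_four, Matrix.cons_val]
          ring
  · intro i u
    have hG : ∀ y : Fin 4 → Sp 0, (if y i = u then
        ENNReal.ofReal (θ * Real.exp (4 / 3 * c.mass)) *
          (doubleStar B V y + doubleStar B V ![y 2, y 1, y 0, y 3]) else 0)
        = ENNReal.ofReal (θ * Real.exp (4 / 3 * c.mass)) *
          ((if y i = u then doubleStar B V y else 0) +
            if y i = u then doubleStar B V (fun q => y (Equiv.swap 0 2 q)) else 0) := fun y => by
      have e : (![y 2, y 1, y 0, y 3] : Fin 4 → Sp 0) = fun q => y (Equiv.swap 0 2 q) := by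
        funext q; fin_cases q <;> rfl
      rw [e]
      split_ifs <;> simp
    simp only [hG]
    rw [ENNReal.tsum_mul_left, ENNReal.tsum_add, sum_rooted_perm]
    gcongr
    · exact hroot i u
    · exact hroot _ u
  · have hb := (heatBound_pos c.mass θ H).le
    simp only [N]
    rw [← ENNReal.ofReal_pow hb, ← ENNReal.ofReal_mul (by positivity),
      ← ENNReal.ofReal_add (by positivity) (by positivity), ← ENNReal.ofReal_mul (by positivity)]
    congr 1
    ring

end LeadingNorm

/-! ### Lifting a quartic kernel from the torus -/

section Lift

variable {L : ℕ} [NeZero L]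

/-- Seen from `y k`, the points `y j` lie in the centred fundamental domain. -/
def Near (L : ℕ) (k : Fin 4) (y : Fin 4 → Sp 0) : Prop :=
  ∀ j, y j - y k = spLift (spProj L (y j - y k))

lemma spLift_zero : spLift (0 : Sp L) = 0 := by
  funext i
  simp [spLift]
  rfl

open Classical in
/-- For every root, a configuration on the torus has exactly one lift close to the `k`-th point. -/
lemma tsum_near {M : Type*} [AddCommMonoid M] [TopologicalSpace M] (f : (Fin 4 → Sp L) → M)
    (k i : Fin 4) (u : Sp 0) :
    ∑' y : Fin 4 → Sp 0, (if y i = u then if Near L k y then f (fun q => spProj L (y q)) else 0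
      else 0) = ∑' z : Fin 4 → Sp L, if z i = spProj L u then f z else 0 := by
  -- the lift of `z` that is close to the `k`-th point and has its `i`-th point at `u`
  let Λ : {z : Fin 4 → Sp L // z i = spProj L u} → (Fin 4 → Sp 0) := fun z j =>
    u - spLift (z.1 i - z.1 k) + spLift (z.1 j - z.1 k)
  have hdiff : ∀ z j, Λ z j - Λ z k = spLift (z.1 j - z.1 k) := fun z j => by
    simp [Λ, spLift_zero]
  have hπ : ∀ z j, spProj L (Λ z j) = z.1 j := fun z j => by
    simp only [Λ]
    rw [spProj_add, spProj_sub, spProj_spLift, spProj_spLift, z.2]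
    abel
  have hnear : ∀ z, Near L k (Λ z) := fun z j => by
    rw [hdiff, spProj_spLift]
  have hroot : ∀ z, Λ z i = u := fun z => by simp [Λ]
  have hinj : Function.Injective Λ := fun z z' h => by
    apply Subtype.ext
    funext j
    rw [← hπ z j, h, hπ]
  rw [← hinj.tsum_eq]
  · have e : ∀ z, (if Λ z i = u then if Near L k (Λ z) then f (fun q => spProj L (Λ z q)) else 0
        else 0) = f z.1 := fun z => by
      rw [if_pos (hroot z), if_pos (hnear z)]
      congr 1
      funext q
      exact hπ z q
    simp only [e]
    refine (tsum_subtype {z : Fin 4 → Sp L | z i = spProj L u} f).trans (tsum_congr fun z => ?_)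
    simp [Set.indicator_apply]
  · intro y hy
    have hy1 : y i = u := by
      by_contra h
      simp [h] at hy
    have hy2 : Near L k y := by
      by_contra h
      simp [h] at hy
    refine ⟨⟨fun q => spProj L (y q), by simp [hy1]⟩, ?_⟩
    funext j
    simp only [Λ]
    rw [← spProj_sub, ← spProj_sub, ← hy2 i, ← hy2 j, hy1]
    abel

open Classical in
/-- A symmetric lift to `ℤ³` of a translation invariant quartic kernel on the torus: the average
over `k` of the lifts that are supported on configurations close to their `k`-th point. The average
makes the lift equivariant under permutations of the arguments. -/
def liftKernel (e : (Fin 4 → Sp L) → ℝ) (y : Fin 4 → Sp 0) : ℝ :=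
  1 / 4 * ∑ k, if Near L k y then e (fun q => spProj L (y q)) else 0

lemma liftKernel_perm {e : (Fin 4 → Sp L) → ℝ} (σ : Equiv.Perm (Fin 4))
    (he : ∀ z, e (fun q => z (σ q)) = e z) (y : Fin 4 → Sp 0) :
    liftKernel e (fun q => y (σ q)) = liftKernel e y := by
  classical
  unfold liftKernel
  congr 1
  refine ((Equiv.sum_comp σ _).symm.trans ?_).symm
  refine Finset.sum_congr rfl fun k _ => ?_
  have h1 : Near L k (fun q => y (σ q)) ↔ Near L (σ k) y :=
    ⟨fun h j => by simpa using h (σ.symm j), fun h j => h (σ j)⟩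
  rw [he fun q => spProj L (y q)]
  by_cases h : Near L (σ k) y
  · rw [if_pos h, if_pos (h1.mpr h)]
  · rw [if_neg h, if_neg fun h' => h (h1.mp h')]

lemma liftKernel_trans {e : (Fin 4 → Sp L) → ℝ} (he : ∀ a z, e (fun q => z q + a) = e z)
    (a : Sp 0) (y : Fin 4 → Sp 0) : liftKernel e (fun q => y q + a) = liftKernel e y := by
  classical
  have hN : ∀ k, Near L k (fun q => y q + a) ↔ Near L k y := fun k => by simp [Near]
  unfold liftKernel
  congr 1
  refine Finset.sum_congr rfl fun k _ => ?_
  refine if_congr (hN k) ?_ rfl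
  simp only [spProj_add, he]

lemma spProj_spRefl (j : Fin 3) (x : Sp 0) : spProj L (spRefl j x) = spRefl j (spProj L x) := by
  funext i
  by_cases h : i = j
  · subst h
    simp [spProj, spRefl]
  · simp [spProj, spRefl, h]

lemma spLift_spRefl (hL : Odd L) (j : Fin 3) (x : Sp L) :
    spLift (spRefl j x) = spRefl j (spLift x) := by
  funext i
  by_cases h : i = j
  · subst h
    simp only [spLift, spRefl, Function.update_self]
    refine ZMod.valMinAbs_neg_of_ne_half ?_
    intro h
    obtain ⟨k, hk⟩ := hL
    omega
  · simp [spLift, spRefl, h]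
    rfl

lemma spRefl_sub {M : ℕ} (j : Fin 3) (x y : Sp M) :
    spRefl j (x - y) = spRefl j x - spRefl j y := by
  funext i
  by_cases h : i = j
  · subst h
    simp [spRefl]
    abel
  · simp [spRefl, h]

/-- For odd `L` the centred fundamental domain is invariant under reflections. -/
lemma liftKernel_refl (hL : Odd L) {e : (Fin 4 → Sp L) → ℝ}
    (he : ∀ j z, e (fun q => spRefl j (z q)) = e z) (j : Fin 3) (y : Fin 4 → Sp 0) :
    liftKernel e (fun q => spRefl j (y q)) = liftKernel e y := by
  classical
  have hN : ∀ k, Near L k (fun q => spRefl j (y q)) ↔ Near L k y := fun k => by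
    unfold Near
    refine forall_congr' fun i => ?_
    rw [← spRefl_sub, spProj_spRefl, spLift_spRefl hL]
    exact (spRefl_involutive j).injective.eq_iff
  unfold liftKernel
  congr 1
  refine Finset.sum_congr rfl fun k _ => ?_
  refine if_congr (hN k) ?_ rfl
  simp only [spProj_spRefl]
  rw [he j fun q => spProj L (y q)]

open Classical in
lemma enorm_liftKernel_le (e : (Fin 4 → Sp L) → ℝ) (y : Fin 4 → Sp 0) :
    ‖liftKernel e y‖ₑ ≤ ENNReal.ofReal (1 / 4) *
      ∑ k, if Near L k y then ‖e (fun q => spProj L (y q))‖ₑ else 0 := by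
  unfold liftKernel
  rw [enorm_mul, Real.enorm_eq_ofReal_abs, abs_of_pos (by norm_num)]
  gcongr
  refine (enorm_sum_le _ _).trans (Finset.sum_le_sum fun k _ => ?_)
  split_ifs
  · exact le_rfl
  · simp

lemma tsum_enorm_liftKernel_ne_top (e : (Fin 4 → Sp L) → ℝ) (x : Sp 0) :
    ∑' ζ : Fin 3 → Sp 0, ‖liftKernel e (Fin.cons x ζ)‖ₑ ≠ ⊤ := by
  classical
  refine ne_top_of_le_ne_top ?_ (ENNReal.tsum_le_tsum fun ζ => enorm_liftKernel_le e _)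
  rw [ENNReal.tsum_mul_left, Summable.tsum_finsetSum (fun _ _ => ENNReal.summable)]
  refine ENNReal.mul_ne_top ENNReal.ofReal_ne_top (ENNReal.sum_ne_top.mpr fun k _ => ?_)
  rw [← tsum_rooted_zero (fun y => if Near L k y then ‖e (fun q => spProj L (y q))‖ₑ else 0) x,
    tsum_near (fun z => ‖e z‖ₑ) k 0 x, tsum_fintype]
  refine ENNReal.sum_ne_top.mpr fun z _ => ?_
  split_ifs
  · exact enorm_ne_top
  · simp

/-- The periodization of the lift is the original kernel. -/
lemma tsum_liftKernel_mul (e : (Fin 4 → Sp L) → ℝ) (x : Sp 0) (g : (Fin 3 → Sp L) → ℂ) :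
    ∑' ζ : Fin 3 → Sp 0, (liftKernel e (Fin.cons x ζ) : ℂ) * g (fun q => spProj L (ζ q))
      = ∑ z : Fin 3 → Sp L, (e (Fin.cons (spProj L x) z) : ℂ) * g z := by
  classical
  let f : (Fin 4 → Sp L) → ℂ := fun z => (e z : ℂ) * g (fun q => z q.succ)
  have hk : ∀ k : Fin 4, ∑' ζ : Fin 3 → Sp 0, (if Near L k (Fin.cons x ζ) then
      f (fun q => spProj L ((Fin.cons x ζ : Fin 4 → Sp 0) q)) else 0)
      = ∑ z : Fin 3 → Sp L, (e (Fin.cons (spProj L x) z) : ℂ) * g z := fun k => by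
    rw [← tsum_rooted_zero (fun y => if Near L k y then f (fun q => spProj L (y q)) else 0) x,
      tsum_near f k 0 x]
    have := tsum_rooted_zero f (spProj L x)
    rw [tsum_fintype (fun ζ : Fin 3 → Sp L => _)] at this
    simp only [f, Fin.cons_succ] at this
    rw [← this]
  have hs : ∀ k : Fin 4, Summable fun ζ : Fin 3 → Sp 0 => (if Near L k (Fin.cons x ζ) then
      f (fun q => spProj L ((Fin.cons x ζ : Fin 4 → Sp 0) q)) else 0) := fun k => by
    apply summable_of_tsum_enorm_ne_top
    have e1 : ∀ ζ : Fin 3 → Sp 0, ‖if Near L k (Fin.cons x ζ) then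
        f (fun q => spProj L ((Fin.cons x ζ : Fin 4 → Sp 0) q)) else 0‖ₑ
        = (fun y : Fin 4 → Sp 0 => if Near L k y then ‖f (fun q => spProj L (y q))‖ₑ else 0)
          (Fin.cons x ζ) := fun ζ => by
      dsimp only
      split_ifs
      · rfl
      · simp
    simp only [e1]
    rw [← tsum_rooted_zero (fun y => if Near L k y then ‖f (fun q => spProj L (y q))‖ₑ else 0) x,
      tsum_near (fun z => ‖f z‖ₑ) k 0 x, tsum_fintype]
    refine ENNReal.sum_ne_top.mpr fun z _ => ?_
    split_ifs
    · exact enorm_ne_top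
    · simp
  have hexp : ∀ ζ : Fin 3 → Sp 0,
      (liftKernel e (Fin.cons x ζ) : ℂ) * g (fun q => spProj L (ζ q))
      = 1 / 4 * ∑ k : Fin 4, (if Near L k (Fin.cons x ζ) then
      f (fun q => spProj L ((Fin.cons x ζ : Fin 4 → Sp 0) q)) else 0) := fun ζ => by
    unfold liftKernel
    push_cast
    rw [mul_assoc, Finset.sum_mul]
    congr 1
    refine Finset.sum_congr rfl fun k _ => ?_
    split_ifs
    · rfl
    · simp
  simp only [hexp]
  rw [tsum_mul_left, Summable.tsum_finsetSum (fun k _ => hs k)]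
  simp only [hk, Finset.sum_const, Finset.card_univ, Fintype.card_fin, nsmul_eq_mul]
  push_cast
  ring

/-- For points in the centred fundamental domain the distance on the torus is the distance in `ℤ³`.
-/
lemma spDist_le_of_lift {a b : Sp 0} (h : a - b = spLift (spProj L (a - b))) :
    spDist b a ≤ spDist (spProj L b) (spProj L a) := by
  rw [isPseudoDist_spDist.symm b a, isPseudoDist_spDist.symm (spProj L b)]
  refine spDist_le_of_absMin_le fun i => le_of_eq ?_
  have h1 : a i - b i = ((spProj L (a - b) i).valMinAbs : ZMod 0) := congrFun h i
  have h2 : spProj L a i - spProj L b i = spProj L (a - b) i := by rw [spProj_sub]; rfl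
  rw [h1, h2]
  rfl

/-- The lift decays at a third of the rate of the original kernel: the star with centre at the
`k`-th point has three edges, and each of them is at most as long as a tree on the torus. -/
lemma kernelNorm_liftKernel_le {Lt : ℕ} {m : ℝ} (hm : 0 ≤ m) (e : (Fin 4 → Sp L) → ℝ) :
    kernelNorm stDist (2 / 3 * m) (stKernel (Lt := Lt) (liftKernel e))
      ≤ ENNReal.ofReal (Real.exp (4 / 3 * m)) * kernelNorm spDist (2 * m) e := by
  classical
  let f : (Fin 4 → Sp L) → ℝ≥0∞ := fun z =>
    ENNReal.ofReal (|e z| * Real.exp (2 * m * treeLength spDist z))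
  refine (kernelNorm_stKernel_le (N := ENNReal.ofReal (1 / 4) *
    ∑ k : Fin 4, ENNReal.ofReal (Real.exp (4 / 3 * m)) * kernelNorm spDist (2 * m) e)
    (G := fun y => ENNReal.ofReal (1 / 4) * ∑ k, ENNReal.ofReal (Real.exp (4 / 3 * m)) *
      if Near L k y then f (fun q => spProj L (y q)) else 0) ?_ ?_).trans (le_of_eq ?_)
  · intro x hx
    set y : Fin 4 → Sp 0 := fun q => (x q).2
    rw [ofReal_abs_mul]
    refine (mul_le_mul_left (enorm_liftKernel_le e y) _).trans ?_
    rw [mul_assoc, Finset.sum_mul]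
    refine mul_le_mul_right (Finset.sum_le_sum fun k _ => ?_) _
    split_ifs with hk
    · simp only [f]
      rw [ofReal_abs_mul, mul_left_comm]
      refine mul_le_mul_right ?_ _
      rw [← ENNReal.ofReal_mul (by positivity), ← Real.exp_add]
      refine ENNReal.ofReal_le_ofReal (Real.exp_le_exp.mpr ?_)
      have h1 := treeLength_quart_le hx (y k)
      have h2 : ∀ j, spDist (y k) (y j) ≤ treeLength spDist (fun q => spProj L (y q)) := fun j =>
        (spDist_le_of_lift (hk j)).trans
          (dist_le_treeLength isPseudoDist_spDist (fun q => spProj L (y q)) k j)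
      have h3 : ∑ q, spDist (y k) (x q).2 ≤ 3 * treeLength spDist (fun q => spProj L (y q)) := by
        change ∑ q, spDist (y k) (y q) ≤ _
        rw [← Finset.add_sum_erase _ _ (Finset.mem_univ k), isPseudoDist_spDist.self, zero_add]
        refine (Finset.sum_le_card_nsmul _ _ _ fun j _ => h2 j).trans (le_of_eq ?_)
        simp
      have h4 : treeLength stDist x ≤ 2 + 3 * treeLength spDist (fun q => spProj L (y q)) := by
        linarith
      have := mul_le_mul_of_nonneg_left h4 hm
      linarith
    · simp
  · intro i u
    have hG : ∀ y : Fin 4 → Sp 0, (if y i = u then ENNReal.ofReal (1 / 4) *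
        ∑ k, ENNReal.ofReal (Real.exp (4 / 3 * m)) *
          (if Near L k y then f (fun q => spProj L (y q)) else 0) else 0)
        = ENNReal.ofReal (1 / 4) * ∑ k, ENNReal.ofReal (Real.exp (4 / 3 * m)) *
          (if y i = u then if Near L k y then f (fun q => spProj L (y q)) else 0 else 0) :=
      fun y => by
        by_cases h : y i = u
        · simp [h]
        · simp [h]
    simp only [hG]
    rw [ENNReal.tsum_mul_left, Summable.tsum_finsetSum (fun _ _ => ENNReal.summable)]
    gcongr with k _
    rw [ENNReal.tsum_mul_left, tsum_near f k i u]
    gcongr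
    refine le_trans (le_of_eq (tsum_congr fun z => ?_))
      (le_kernelNorm (2 * m) e i (spProj L u))
    congr 1
  · rw [Finset.sum_const, Finset.card_univ, Fintype.card_fin, nsmul_eq_mul, ← mul_assoc]
    have : ENNReal.ofReal (1 / 4) * ((4 : ℕ) : ℝ≥0∞) = 1 := by
      rw [← ENNReal.ofReal_natCast, ← ENNReal.ofReal_mul (by norm_num)]
      norm_num
    rw [this, one_mul]

end Lift

/-! ### The quartic kernel on space-time -/

section KernelNorm

variable {X ι ι' : Type*} {d : X → X → ℝ}

lemma treeLength_comp_equiv (σ : ι ≃ ι') (z : ι' → X) :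
    treeLength d (fun i => z (σ i)) = treeLength d z := by
  unfold treeLength
  have h : ∀ V : Finset X, (∀ i, z (σ i) ∈ V) ↔ ∀ i, z i ∈ V := fun V =>
    σ.forall_congr_left.trans (by simp)
  simp only [h]

lemma kernelNorm_comp_equiv_le [Nonempty ι'] (m : ℝ) (σ : ι ≃ ι') (f : (ι → X) → ℝ) :
    kernelNorm d m (fun z : ι' → X => f (fun i => z (σ i))) ≤ kernelNorm d m f := by
  classical
  refine kernelNorm_le fun i u => ?_
  refine le_trans (le_of_eq ?_) (le_kernelNorm m f (σ.symm i) u)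
  rw [← (Equiv.arrowCongr σ (Equiv.refl X)).tsum_eq]
  refine tsum_congr fun x => ?_
  have e : (fun j => (Equiv.arrowCongr σ (Equiv.refl X)) x (σ j)) = x := by
    funext j; simp [Equiv.arrowCongr]
  rw [e, ← treeLength_comp_equiv σ ((Equiv.arrowCongr σ (Equiv.refl X)) x), e]
  congr 1

lemma kernelNorm_add_le [Nonempty ι] (m : ℝ) (f g : (ι → X) → ℝ) :
    kernelNorm d m (fun x => f x + g x) ≤ kernelNorm d m f + kernelNorm d m g := by
  classical
  refine kernelNorm_le fun i u => ?_
  refine le_trans ?_ (add_le_add (le_kernelNorm m f i u) (le_kernelNorm m g i u))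
  rw [← ENNReal.tsum_add]
  refine ENNReal.tsum_le_tsum fun x => ?_
  split_ifs
  · rw [← ENNReal.ofReal_add (by positivity) (by positivity), ← add_mul]
    refine ENNReal.ofReal_le_ofReal ?_
    gcongr
    exact abs_add_le _ _
  · simp

lemma kernelNorm_mul_left_le [Nonempty ι] (m a : ℝ) (f : (ι → X) → ℝ) :
    kernelNorm d m (fun x => a * f x) ≤ ENNReal.ofReal |a| * kernelNorm d m f := by
  classical
  refine kernelNorm_le fun i u => ?_
  refine le_trans (le_of_eq ?_) (mul_le_mul_right (le_kernelNorm m f i u) _)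
  rw [← ENNReal.tsum_mul_left]
  refine tsum_congr fun x => ?_
  split_ifs
  · rw [← ENNReal.ofReal_mul (abs_nonneg a), abs_mul, mul_assoc]
  · simp

end KernelNorm

/-- The arguments of a kernel of degree two in both fields, in the order
`ψ_*, ψ, ψ_*, ψ`. -/
def quartEquiv : ((s : Fin 2) × Fin ((fun _ : Fin 2 => 2) s)) ≃ Fin 4 where
  toFun q := ⟨2 * q.2.1 + q.1.1, by have h1 := q.2.2; have h2 := q.1.2; simp only at h1; omega⟩
  invFun i := ⟨⟨i.1 % 2, by omega⟩, ⟨i.1 / 2, by have := i.2; simp only; omega⟩⟩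
  left_inv q := by
    obtain ⟨s, k⟩ := q
    fin_cases s <;> fin_cases k <;> rfl
  right_inv i := by fin_cases i <;> rfl

/-- The kernel of degree two in both fields as a function of four points. -/
def quarticPart {X : Type*} (F : FieldSeries (Fin 2) X) (z : Fin 4 → X) : ℝ :=
  F (fun _ => 2) (fun q => z (quartEquiv q))

section QuarticPart

variable {L : ℕ} {F : FieldSeries (Fin 2) (Sp L)}

lemma quarticPart_swap₀₂ (hF : KernelSymm F) (z : Fin 4 → Sp L) :
    quarticPart F (fun q => z (Equiv.swap 0 2 q)) = quarticPart F z := by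
  unfold quarticPart
  have := hF.isSymm (fun _ => 2) (fun s => if s = 0 then Equiv.swap 0 1 else 1)
    (fun q => z (quartEquiv q))
  refine Eq.trans ?_ this
  congr 1
  funext q
  obtain ⟨s, k⟩ := q
  fin_cases s <;> fin_cases k <;> rfl

lemma quarticPart_swap₁₃ (hF : KernelSymm F) (z : Fin 4 → Sp L) :
    quarticPart F (fun q => z (Equiv.swap 1 3 q)) = quarticPart F z := by
  unfold quarticPart
  have := hF.isSymm (fun _ => 2) (fun s => if s = 1 then Equiv.swap 0 1 else 1)
    (fun q => z (quartEquiv q))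
  refine Eq.trans ?_ this
  congr 1
  funext q
  obtain ⟨s, k⟩ := q
  fin_cases s <;> fin_cases k <;> rfl

lemma quarticPart_timeRefl (hF : KernelSymm F) (z : Fin 4 → Sp L) :
    quarticPart F (fun q => z ((Equiv.swap 0 1 * Equiv.swap 2 3 : Equiv.Perm (Fin 4)) q))
      = quarticPart F z := by
  unfold quarticPart
  have := congrFun (congrFun hF.swap (fun _ => 2)) (fun q => z (quartEquiv q))
  refine Eq.trans ?_ this
  unfold FieldSeries.swap
  congr 1
  funext q
  obtain ⟨s, k⟩ := q
  fin_cases s <;> fin_cases k <;> rfl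

lemma hom_two [NeZero L] (F : FieldSeries (Fin 2) (Sp L)) (φ : Fin 2 → Sp L → ℂ) :
    F.hom (fun _ => 2) φ = ∑ z : Fin 4 → Sp L, (quarticPart F z : ℂ) *
      (φ 0 (z 0) * φ 1 (z 1) * φ 0 (z 2) * φ 1 (z 3)) := by
  unfold FieldSeries.hom
  rw [← Equiv.sum_comp (Equiv.arrowCongr quartEquiv.symm (Equiv.refl (Sp L)))]
  refine Finset.sum_congr rfl fun z _ => ?_
  have e : (Equiv.arrowCongr quartEquiv.symm (Equiv.refl (Sp L))) z
      = fun q => z (quartEquiv q) := rfl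
  rw [e]
  congr 1
  rw [← Equiv.prod_comp quartEquiv.symm, Fin.prod_univ_four]
  rfl

lemma kernelNorm_quarticPart_le (m : ℝ) :
    kernelNorm spDist m (quarticPart F) ≤ kernelNorm spDist m (F (fun _ => 2)) :=
  kernelNorm_comp_equiv_le m quartEquiv _

/-- The spatial part of the kernel `𝐕₀`, where `a e` is the contribution of the quartic part of
the output of the ultraviolet flow. -/
def fullKernel (H : Bond 0 → Bond 0 → ℝ) (v : Sp 0 → Sp 0 → ℝ) (θ a : ℝ)
    (F : FieldSeries (Fin 2) (Sp L)) (y : Fin 4 → Sp 0) : ℝ :=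
  vθ₄ H v θ y + a * liftKernel (quarticPart F) y

variable {c : Constants} {fv : ℝ} [NeZero L] {H : Bond 0 → Bond 0 → ℝ} {v : Sp 0 → Sp 0 → ℝ}
  {a : ℝ}

lemma fullKernel_swap₀₂ (hF : KernelSymm F) (θ : ℝ) (y : Fin 4 → Sp 0) :
    fullKernel H v θ a F ![y 2, y 1, y 0, y 3] = fullKernel H v θ a F y := by
  unfold fullKernel
  rw [vθ₄_swap₀₂]
  have e : (![y 2, y 1, y 0, y 3] : Fin 4 → Sp 0) = fun q => y (Equiv.swap 0 2 q) := by
    funext q; fin_cases q <;> rfl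
  rw [e, liftKernel_perm _ (quarticPart_swap₀₂ hF)]

lemma fullKernel_swap₁₃ (hF : KernelSymm F) (hv : InteractionHyp c fv L v) (θ : ℝ)
    (y : Fin 4 → Sp 0) :
    fullKernel H v θ a F ![y 0, y 3, y 2, y 1] = fullKernel H v θ a F y := by
  unfold fullKernel
  rw [vθ₄_swap₁₃ H hv.symm]
  have e : (![y 0, y 3, y 2, y 1] : Fin 4 → Sp 0) = fun q => y (Equiv.swap 1 3 q) := by
    funext q; fin_cases q <;> rfl
  rw [e, liftKernel_perm _ (quarticPart_swap₁₃ hF)]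

lemma quarticSInvariant_fullKernel {Lt : ℕ} (hL : Odd L) (hF : KernelSymm F)
    (h : KineticHyp c L H) (hv : InteractionHyp c fv L v) (θ : ℝ) :
    QuarticSInvariant (stKernel (Lt := Lt) (fullKernel H v θ a F)) := by
  refine quarticSInvariant_stKernel (fun b y => ?_) (fun j y => ?_) fun y => ?_
  · unfold fullKernel
    have := vθ₄_equiv (θ := θ) (v := v) (H := H) (Equiv.addRight b)
      (fun t x y => h.heatZ_trans t b x y) (hv.trans b) y
    simp only [Equiv.coe_addRight] at this
    rw [this, liftKernel_trans fun b z => hF.trans b _ _]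
  · unfold fullKernel
    have := vθ₄_equiv (θ := θ) (v := v) (H := H) (spReflEquiv 0 j)
      (fun t x y => h.heatZ_refl t j x y) (hv.refl j) y
    simp only [spReflEquiv_apply] at this
    rw [this, liftKernel_refl hL fun j z => hF.refl j _ _]
  · unfold fullKernel
    rw [vθ₄_timeRefl H hv.symm]
    have e : (![y 1, y 0, y 3, y 2] : Fin 4 → Sp 0)
        = fun q => y ((Equiv.swap 0 1 * Equiv.swap 2 3 : Equiv.Perm (Fin 4)) q) := by
      funext q; fin_cases q <;> rfl
    rw [e, liftKernel_perm _ (quarticPart_timeRefl hF)]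

lemma tsum_enorm_fullKernel_ne_top (h : KineticHyp c L H) (hv : InteractionHyp c fv L v)
    (hm : 0 < c.mass) {θ : ℝ} (hθ : 0 ≤ θ) (x : Sp 0) :
    ∑' ζ : Fin 3 → Sp 0, ‖fullKernel H v θ a F (Fin.cons x ζ)‖ₑ ≠ ⊤ := by
  have h1 := h.tsum_enorm_vθ₄_ne_top hv hm hθ x
  have h2 := tsum_enorm_liftKernel_ne_top (quarticPart F) x
  refine ne_top_of_le_ne_top (ENNReal.add_ne_top.mpr
    ⟨h1, ENNReal.mul_ne_top (enorm_ne_top (x := a)) h2⟩) ?_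
  rw [← ENNReal.tsum_mul_left, ← ENNReal.tsum_add]
  refine ENNReal.tsum_le_tsum fun ζ => ?_
  rw [← enorm_mul]
  exact enorm_add_le _ _

/-- Testing `fullKernel` against periodic functions. -/
lemma tsum_fullKernel_mul (h : KineticHyp c L H) (hv : InteractionHyp c fv L v)
    (hm : 0 < c.mass) {θ : ℝ} (hθ : 0 ≤ θ) (x : Sp 0) (g : (Fin 3 → Sp L) → ℂ) :
    ∑' ζ : Fin 3 → Sp 0, (fullKernel H v θ a F (Fin.cons x ζ) : ℂ) * g (fun q => spProj L (ζ q))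
      = (∑' ζ : Fin 3 → Sp 0, (vθ₄ H v θ (Fin.cons x ζ) : ℂ) * g (fun q => spProj L (ζ q)))
        + a * ∑ z : Fin 3 → Sp L, (quarticPart F (Fin.cons (spProj L x) z) : ℂ) * g z := by
  rw [← tsum_liftKernel_mul, ← tsum_mul_left]
  have hsum : ∀ w : (Fin 4 → Sp 0) → ℝ, ∑' ζ : Fin 3 → Sp 0, ‖w (Fin.cons x ζ)‖ₑ ≠ ⊤ →
      Summable fun ζ : Fin 3 → Sp 0 => (w (Fin.cons x ζ) : ℂ) * g (fun q => spProj L (ζ q)) :=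
    fun w hw => by
      apply summable_of_tsum_enorm_ne_top
      refine ne_top_of_le_ne_top (b := (∑' ζ : Fin 3 → Sp 0, ‖w (Fin.cons x ζ)‖ₑ) *
        ∑ z, ‖g z‖ₑ) (ENNReal.mul_ne_top hw (ENNReal.sum_ne_top.mpr fun _ _ => enorm_ne_top)) ?_
      rw [← ENNReal.tsum_mul_right]
      refine ENNReal.tsum_le_tsum fun ζ => ?_
      rw [enorm_mul, enorm_ofReal_complex]
      gcongr
      exact Finset.single_le_sum (f := fun z => ‖g z‖ₑ) (fun _ _ => zero_le) (Finset.mem_univ _)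
  rw [← (hsum _ (h.tsum_enorm_vθ₄_ne_top hv hm hθ x)).tsum_add
    ((hsum _ (tsum_enorm_liftKernel_ne_top (quarticPart F) x)).mul_left _)]
  refine tsum_congr fun ζ => ?_
  unfold fullKernel
  push_cast
  ring

lemma tsum_fullKernel (h : KineticHyp c L H) (hv : InteractionHyp c fv L v)
    (hm : 0 < c.mass) {θ : ℝ} (hθ : 0 ≤ θ) (x : Sp 0) :
    ∑' ζ : Fin 3 → Sp 0, fullKernel H v θ a F (Fin.cons x ζ)
      = 2 * (θ * vHat v L)
        + a * ∑ z : Fin 3 → Sp L, quarticPart F (Fin.cons (spProj L x) z) := by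
  have h1 := tsum_fullKernel_mul (F := F) (a := a) h hv hm hθ x (fun _ => 1)
  simp only [mul_one] at h1
  rw [← Complex.ofReal_tsum, ← Complex.ofReal_tsum, ← Complex.ofReal_sum, ← Complex.ofReal_mul,
    ← Complex.ofReal_add, h.tsum_vθ₄ hv hm hθ] at h1
  exact_mod_cast h1

lemma abs_sum_quarticPart_le {m N : ℝ} (hm : 0 ≤ m) (hN : 0 ≤ N)
    (h : kernelNorm spDist m (F (fun _ => 2)) ≤ ENNReal.ofReal N) (x : Sp L) :
    |∑ z : Fin 3 → Sp L, quarticPart F (Fin.cons x z)| ≤ N := by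
  classical
  have h1 := (le_kernelNorm m (quarticPart F) 0 x).trans ((kernelNorm_quarticPart_le m).trans h)
  have h2 : ∑' z : Fin 4 → Sp L, (if z 0 = x then ENNReal.ofReal |quarticPart F z| else 0)
      ≤ ENNReal.ofReal N := by
    refine le_trans (ENNReal.tsum_le_tsum fun z => ?_) h1
    split_ifs
    · refine ENNReal.ofReal_le_ofReal (le_mul_of_one_le_right (abs_nonneg _) ?_)
      exact Real.one_le_exp (mul_nonneg hm (treeLength_nonneg isPseudoDist_spDist _))
    · exact le_rfl
  have h3 := tsum_rooted_zero (fun z => ENNReal.ofReal |quarticPart F z|) x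
  rw [tsum_fintype (fun ζ : Fin 3 → Sp L => _)] at h3
  have h4 : ∑ ζ : Fin 3 → Sp L, ENNReal.ofReal |quarticPart F (Fin.cons x ζ)|
      ≤ ENNReal.ofReal N := by
    rw [← h3]; exact h2
  rw [← ENNReal.ofReal_sum_of_nonneg (fun _ _ => abs_nonneg _)] at h4
  exact (Finset.abs_sum_le_sum_abs _ _).trans ((ENNReal.ofReal_le_ofReal_iff hN).mp h4)

/-- Bounds for the difference between the kernel `𝐕₀` and the explicit kernel. -/
lemma kernelNorm_fullKernel_sub_le {Lt : ℕ} {m N θ : ℝ} (hm : 0 ≤ m)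
    (h : kernelNorm spDist (2 * m) (F (fun _ => 2)) ≤ ENNReal.ofReal N) :
    kernelNorm stDist (2 / 3 * m) (fun x : Fin 4 → STLat Lt 0 =>
        stKernel (fullKernel H v θ a F) x - leadingKernel H v θ x)
      ≤ ENNReal.ofReal (|a| * Real.exp (4 / 3 * m) * N) := by
  have e : (fun x : Fin 4 → STLat Lt 0 =>
        stKernel (fullKernel H v θ a F) x - leadingKernel H v θ x)
      = fun x => a * stKernel (liftKernel (quarticPart F)) x := by
    funext x
    rw [leadingKernel_eq]
    unfold stKernel fullKernel
    split_ifs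
    · exact add_sub_cancel_left _ _
    · simp
  rw [e]
  refine (kernelNorm_mul_left_le _ _ _).trans ?_
  rw [mul_assoc, ENNReal.ofReal_mul (abs_nonneg a), ENNReal.ofReal_mul (Real.exp_pos _).le]
  gcongr
  exact (kernelNorm_liftKernel_le hm _).trans
    (by gcongr; exact (kernelNorm_quarticPart_le _).trans h)

lemma kernelNorm_fullKernel_le {Lt : ℕ} (h : KineticHyp c L H) (hv : InteractionHyp c fv L v)
    (hm : 0 < c.mass) (hfv : 0 ≤ fv) {θ N : ℝ} (hθ : 0 ≤ θ) (hN : 0 ≤ N)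
    (hF : kernelNorm spDist (2 * c.mass) (F (fun _ => 2)) ≤ ENNReal.ofReal N) :
    kernelNorm stDist (2 / 3 * c.mass) (stKernel (Lt := Lt) (fullKernel H v θ a F))
      ≤ ENNReal.ofReal (θ * Real.exp (4 / 3 * c.mass) * heatBound c.mass θ H ^ 4 * fv
        + |a| * Real.exp (4 / 3 * c.mass) * N) := by
  have hb := (heatBound_pos c.mass θ H).le
  rw [ENNReal.ofReal_add (by positivity) (by positivity)]
  refine le_trans (le_of_eq ?_) ((kernelNorm_add_le _ _ _).trans (add_le_add
    (h.kernelNorm_vθ₄_le (Lt := Lt) hv hm hfv hθ)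
    (kernelNorm_fullKernel_sub_le (H := H) (v := v) (θ := θ) (a := a) hm.le hF)))
  congr 1
  funext x
  exact (add_sub_cancel _ _).symm

/-- The norm with mass zero bounds the sum over three of the arguments. -/
lemma ofReal_abs_tsum_le_kernelNorm {Lt : ℕ} {d : STLat Lt 0 → STLat Lt 0 → ℝ}
    (w : (Fin 4 → Sp 0) → ℝ) (n : ZMod Lt) (x : Sp 0) :
    ENNReal.ofReal |∑' ζ : Fin 3 → Sp 0, w (Fin.cons x ζ)|
      ≤ kernelNorm d 0 (stKernel (Lt := Lt) w) := by
  classical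
  refine le_trans (b := ∑' y : Fin 4 → STLat Lt 0, if y 0 = (n, x) then ‖stKernel w y‖ₑ else 0)
    ?_ (le_trans (le_of_eq (tsum_congr fun y => ?_))
      (le_kernelNorm 0 (stKernel (Lt := Lt) w) 0 (n, x)))
  swap
  · rw [zero_mul, Real.exp_zero, mul_one, Real.enorm_eq_ofReal_abs]
    congr 1
  rw [tsum_rooted_zero (fun y => ‖stKernel w y‖ₑ)]
  have e2 : ∀ ζ : Fin 3 → STLat Lt 0, ‖stKernel w (Fin.cons (n, x) ζ)‖ₑ
      = if ∀ q, (ζ q).1 = tripleTime n q then ‖w (Fin.cons x fun q => (ζ q).2)‖ₑ else 0 :=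
    fun ζ => by
      unfold stKernel
      by_cases hq : ∀ q, (ζ q).1 = tripleTime n q
      · rw [if_pos hq, if_pos ((isQuartTime_cons (n, x) ζ).mpr hq)]
        congr 2
        funext q
        refine Fin.cases rfl (fun _ => rfl) q
      · rw [if_neg hq, if_neg fun h => hq ((isQuartTime_cons (n, x) ζ).mp h), enorm_zero]
  simp only [e2]
  rw [tsum_ite_fst_eq (tripleTime n) (fun ζ : Fin 3 → STLat Lt 0 =>
    ‖w (Fin.cons x fun q => (ζ q).2)‖ₑ), ← Real.enorm_eq_ofReal_abs]
  exact enorm_tsum_le_tsum_enorm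

/-- The sum over three arguments of the explicit kernel is known exactly. -/
lemma le_kernelNorm_fullKernel {Lt : ℕ} (h : KineticHyp c L H) (hv : InteractionHyp c fv L v)
    (hm : 0 < c.mass) {θ N : ℝ} (hθ : 0 ≤ θ) (hN : 0 ≤ N)
    (hF : kernelNorm spDist (2 * c.mass) (F (fun _ => 2)) ≤ ENNReal.ofReal N) :
    ENNReal.ofReal (2 * (θ * vHat v L) - |a| * N)
      ≤ kernelNorm stDist 0 (stKernel (Lt := Lt) (fullKernel H v θ a F)) := by
  refine le_trans (ENNReal.ofReal_le_ofReal ?_) (ofReal_abs_tsum_le_kernelNorm _ 0 0)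
  rw [tsum_fullKernel h hv hm hθ]
  refine le_trans ?_ (le_abs_self _)
  have := mul_le_mul_of_nonneg_left
    (abs_sum_quarticPart_le (by linarith : 0 ≤ 2 * c.mass) hN hF (spProj L 0)) (abs_nonneg a)
  rw [← abs_mul] at this
  have h2 := neg_abs_le (a * ∑ z : Fin 3 → Sp L, quarticPart F (Fin.cons (spProj L 0) z))
  linarith

lemma abs_half_sum_fullKernel_sub_le {Lt : ℕ} [NeZero Lt] (h : KineticHyp c L H)
    (hv : InteractionHyp c fv L v)
    (hm : 0 < c.mass) {θ N : ℝ} (hθ : 0 ≤ θ) (hN : 0 ≤ N)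
    (hF : kernelNorm spDist (2 * c.mass) (F (fun _ => 2)) ≤ ENNReal.ofReal N)
    (x : STLat Lt L) :
    |1 / 2 * ∑ y : Fin 3 → STLat Lt L,
        periodize₄ L (stKernel (fullKernel H v θ a F)) ![x, y 0, y 1, y 2]
        - θ * ∑ x : Sp L, periodize₂ L v 0 x| ≤ |a| * N := by
  have h1 := sum_periodize₄_mul (w := fullKernel H v θ a F) x
    (tsum_enorm_fullKernel_ne_top h hv hm hθ _) (fun _ => 1)
  simp only [mul_one] at h1
  rw [← Complex.ofReal_tsum, ← Complex.ofReal_sum, tsum_fullKernel h hv hm hθ] at h1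
  have h2 := Complex.ofReal_injective h1
  have e : ∀ y : Fin 3 → STLat Lt L, (![x, y 0, y 1, y 2] : Fin 4 → STLat Lt L)
      = Fin.cons x y := fun y => by funext q; fin_cases q <;> rfl
  simp only [e]
  rw [h2, spProj_spLift]
  have h3 := abs_sum_quarticPart_le (by linarith : 0 ≤ 2 * c.mass) hN hF x.2
  have h4 : 1 / 2 * (2 * (θ * vHat v L)
        + a * ∑ z : Fin 3 → Sp L, quarticPart F (Fin.cons x.2 z))
        - θ * ∑ x : Sp L, periodize₂ L v 0 x
      = 1 / 2 * (a * ∑ z : Fin 3 → Sp L, quarticPart F (Fin.cons x.2 z)) := by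
    unfold vHat; ring
  rw [h4, abs_mul, abs_mul, abs_of_pos (by norm_num : (0 : ℝ) < 1 / 2)]
  have := mul_le_mul_of_nonneg_left h3 (abs_nonneg a)
  have h0 := mul_nonneg (abs_nonneg a) hN
  linarith

end QuarticPart

/-! ### The action in the rescaled fields -/

section Decompose

variable {S X : Type*} [Fintype S] [DecidableEq S] [Fintype X]

lemma FieldSeries.hom_restrict (F : FieldSeries S X) (p : (S → ℕ) → Prop) [DecidablePred p]
    (r : S → ℕ) (φ : S → X → ℂ) :
    (F.restrict p).hom r φ = if p r then F.hom r φ else 0 := by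
  unfold FieldSeries.hom
  rw [FieldSeries.restrict_apply]
  split_ifs
  · rfl
  · simp

lemma FieldSeries.absSum_restrict_le (F : FieldSeries S X) (p : (S → ℕ) → Prop) [DecidablePred p]
    (r : S → ℕ) : (F.restrict p).absSum r ≤ F.absSum r := by
  unfold FieldSeries.absSum
  rw [FieldSeries.restrict_apply]
  split_ifs
  · exact le_rfl
  · refine le_trans (le_of_eq ?_) (F.absSum_nonneg r)
    simp

lemma FieldSeries.summable_restrict {F : FieldSeries S X} {κ : S → ℝ} (hκ : ∀ s, 0 ≤ κ s)
    (hF : Summable fun r => F.absSum r * ∏ s, κ s ^ r s) (p : (S → ℕ) → Prop) [DecidablePred p] :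
    Summable fun r => (F.restrict p).absSum r * ∏ s, κ s ^ r s := by
  have h0 : ∀ r : S → ℕ, 0 ≤ ∏ s, κ s ^ r s := fun r =>
    Finset.prod_nonneg fun s _ => pow_nonneg (hκ s) _
  exact Summable.of_nonneg_of_le (fun r => mul_nonneg (FieldSeries.absSum_nonneg _ _) (h0 r))
    (fun r => mul_le_mul_of_nonneg_right (F.absSum_restrict_le p r) (h0 r)) hF

end Decompose

/-- The multidegrees `(3,3)`. -/
def IsSextic (r : Fin 2 → ℕ) : Prop := r 0 = 3 ∧ r 1 = 3

/-- The multidegrees at least four in both fields. -/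
def IsHigh (r : Fin 2 → ℕ) : Prop := 4 ≤ r 0 ∧ 4 ≤ r 1

instance : DecidablePred IsSextic := fun _ => inferInstanceAs (Decidable (_ ∧ _))

instance : DecidablePred IsHigh := fun _ => inferInstanceAs (Decidable (_ ∧ _))

section

variable {L : ℕ} [NeZero L] {F : FieldSeries (Fin 2) (Sp L)}

/-- A power series that conserves the particle number, and has no constant term, is the sum of its
parts of degree one, two, three, and at least four in both fields. -/
lemma eval_decompose {κ : Fin 2 → ℝ} (hκ : ∀ s, 0 ≤ κ s)
    (hF : Summable fun r => F.absSum r * ∏ s, κ s ^ r s) (hcharge : ∀ r, r 0 ≠ r 1 → F r = 0)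
    (h0 : ∀ r, r 0 = 0 → F r = 0) {φ : Fin 2 → Sp L → ℂ} (hφ : ∀ s x, ‖φ s x‖ ≤ κ s) :
    F.eval φ = F.hom (fun _ => 1) φ + F.hom (fun _ => 2) φ + (F.restrict IsSextic).eval φ
      + (F.restrict IsHigh).eval φ := by
  classical
  have hs : ∀ (p : (Fin 2 → ℕ) → Prop) [DecidablePred p],
      Summable fun r => (F.restrict p).hom r φ := fun p _ =>
    (FieldSeries.summable_hom (FieldSeries.summable_restrict hκ hF p) hφ).of_norm
  have h1 : ∀ k : ℕ, F.hom (fun _ => k) φ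
      = ∑' r : Fin 2 → ℕ, if r = (fun _ => k) then F.hom r φ else 0 := fun k =>
    (tsum_ite_eq (fun _ => k) fun r => F.hom r φ).symm
  have hs1 : ∀ k : ℕ, Summable fun r : Fin 2 → ℕ => if r = (fun _ => k) then F.hom r φ else 0 :=
    fun k => (hasSum_ite_eq (fun _ : Fin 2 => k) (F.hom (fun _ => k) φ)).summable.congr fun r => by
      by_cases h : r = fun _ => k
      · rw [if_pos h, if_pos h, h]
      · rw [if_neg h, if_neg h]
  rw [FieldSeries.eval_eq_tsum_hom, FieldSeries.eval_eq_tsum_hom, FieldSeries.eval_eq_tsum_hom,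
    h1 1, h1 2, ← (hs1 1).tsum_add (hs1 2), ← ((hs1 1).add (hs1 2)).tsum_add (hs IsSextic),
    ← (((hs1 1).add (hs1 2)).add (hs IsSextic)).tsum_add (hs IsHigh)]
  refine tsum_congr fun r => ?_
  simp only [FieldSeries.hom_restrict]
  have hr : ∀ k : ℕ, r = (fun _ => k) ↔ r 0 = k ∧ r 1 = k := fun k => by
    rw [funext_iff, Fin.forall_fin_two]
  simp only [hr, IsSextic, IsHigh]
  by_cases hz : F r = 0
  · have : F.hom r φ = 0 := by simp [FieldSeries.hom, hz]
    simp [this]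
  · have e1 : r 0 = r 1 := by by_contra h; exact hz (hcharge r h)
    have e2 : r 0 ≠ 0 := fun h => hz (h0 r h)
    rcases Nat.lt_or_ge (r 0) 4 with h4 | h4
    · have : r 0 = 1 ∨ r 0 = 2 ∨ r 0 = 3 := by omega
      rcases this with h | h | h <;> simp [h, e1.symm.trans h]
    · have a1 : r 0 ≠ 1 := by omega
      have a2 : r 0 ≠ 2 := by omega
      have a3 : r 0 ≠ 3 := by omega
      have h4' : 4 ≤ r 1 := e1 ▸ h4
      simp [a1, a2, a3, h4, h4']

end

section Action

variable {c : Constants} {fv μ : ℝ} {Lt L : ℕ} [NeZero Lt] [NeZero L] {H : Bond 0 → Bond 0 → ℝ}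
  {v : Sp 0 → Sp 0 → ℝ}

/-- The field at time `n`, rescaled by `s`. -/
def slice (s : ℝ) (ψ : STLat Lt L → ℂ) (n : ZMod Lt) (x : Sp L) : ℂ := s * ψ (n, x)

/-- As `D₀ψ(n) = ψ(n) - e^{-θh} ψ(n+1)`, the form `⟨ψ_*, D₀ψ⟩` is the sum of the Gaussian weight and
of the coupling of neighbouring times. -/
lemma bil_D₀ (H : Bond 0 → Bond 0 → ℝ) (θ : ℝ) (ψs ψ : STLat Lt L → ℂ) :
    bil ψs (D₀ H θ ψ) = bil ψs ψ
      - ∑ n : ZMod Lt, bil (fun x => ψs (n - 1, x)) (act (torusHeat H L θ) fun x => ψ (n, x)) := by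
  have hE : NormedSpace.exp (-(θ • periodize₂ L (kinetic H))) = torusHeat H L θ := by
    rw [torusHeat, neg_smul]
  have h1 : ∀ (n : ZMod Lt) (x : Sp L), D₀ H θ ψ (n, x)
      = ψ (n, x) - act (torusHeat H L θ) (fun y => ψ (n + 1, y)) x := fun n x => by
    unfold D₀
    rw [hE]
    simp only [act, fwd]
    have e : ∀ y : Sp L, ((n, y) : STLat Lt L) + stUnit 0 = (n + 1, y) := fun y => by
      simp [stUnit]
    simp only [e, mul_sub, Finset.sum_sub_distrib]
    ring
  unfold bil
  rw [sum_stLat, sum_stLat]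
  simp only [h1, mul_sub, Finset.sum_sub_distrib]
  congr 1
  refine (Equiv.sum_comp (Equiv.subRight (1 : ZMod Lt)) _).symm.trans ?_
  refine Finset.sum_congr rfl fun n _ => Finset.sum_congr rfl fun x _ => ?_
  simp

lemma act_slice (A : Matrix (Sp L) (Sp L) ℝ) (s : ℝ) (ψ : STLat Lt L → ℂ) (n : ZMod Lt) :
    act A (slice s ψ n) = (s : ℂ) • act A (fun x => ψ (n, x)) := by
  rw [← act_smul_right]
  rfl

lemma star_slice (s : ℝ) (ψ : STLat Lt L → ℂ) (n : ZMod Lt) :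
    star (slice s ψ n) = slice s (star ψ) n := by
  funext x
  simp [slice]

lemma Vθ_slice (H : Bond 0 → Bond 0 → ℝ) (v : Sp 0 → Sp 0 → ℝ) (μ θ s : ℝ)
    (ψs ψ : STLat Lt L → ℂ) (n n' : ZMod Lt) :
    Vθ H v μ θ (slice s ψs n) (slice s ψ n')
      = (s : ℂ) ^ 4 * Vθ H v μ θ (fun x => ψs (n, x)) (fun x => ψ (n', x)) := by
  rw [Vθ_eq, Vθ_eq, mul_neg, mul_left_comm,
    ← intervalIntegral.integral_const_mul ((s : ℂ) ^ 4)]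
  congr 2
  refine intervalIntegral.integral_congr fun t _ => ?_
  simp only [act_slice, smul_mul_smul_comm, act_smul_right]
  simp only [bil, Pi.smul_apply, smul_eq_mul, Finset.mul_sum]
  exact Finset.sum_congr rfl fun x _ => by ring

variable {F : FieldSeries (Fin 2) (Sp L)}

lemma sum_fin_three_quartic (e : (Fin 4 → Sp L) → ℝ) (f g : Sp L → ℂ) :
    ∑ z : Fin 4 → Sp L, (e z : ℂ) * (f (z 0) * g (z 1) * f (z 2) * g (z 3))
      = ∑ x, f x * ∑ z : Fin 3 → Sp L, (e (Fin.cons x z) : ℂ) * (g (z 0) * f (z 1) * g (z 2)) := by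
  rw [sum_fin_four]
  refine Finset.sum_congr rfl fun x _ => ?_
  rw [Finset.mul_sum]
  refine Finset.sum_congr rfl fun z _ => ?_
  change (e (Fin.cons x z) : ℂ) * (f x * g (z 0) * f (z 1) * g (z 2)) = _
  ring

/-- The quartic monomial `𝓥₀` collects `V_θ` and the quartic part of the output of the ultraviolet
flow. -/
lemma quartic_fullKernel (h : KineticHyp c L H) (hv : InteractionHyp c fv L v) (hm : 0 < c.mass)
    {θ s : ℝ} (hθ : 0 ≤ θ) (hs : s ^ 2 * Real.exp (θ * μ) = 1) (ψs ψ : STLat Lt L → ℂ) :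
    quartic (periodize₄ L (stKernel (fullKernel H v θ (-(2 * s ^ 4)) F))) ψs ψ
      = -∑ n : ZMod Lt, (Vθ H v μ θ (slice s ψs (n - 1)) (slice s ψ n)
        + F.hom (fun _ => 2) ![slice s ψs (n - 1), slice s ψ n]) := by
  rw [quartic_periodize₄ (tsum_enorm_fullKernel_ne_top h hv hm hθ), ← Finset.sum_neg_distrib,
    Finset.mul_sum]
  refine Finset.sum_congr rfl fun n _ => ?_
  set f : Sp L → ℂ := fun x => ψs (n - 1, x)
  set g : Sp L → ℂ := fun x => ψ (n, x)
  have h1 : ∀ x : Sp L, ∑' ζ : Fin 3 → Sp 0,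
      (fullKernel H v θ (-(2 * s ^ 4)) F (Fin.cons (spLift x) ζ) : ℂ) *
        (g (spProj L (ζ 0)) * f (spProj L (ζ 1)) * g (spProj L (ζ 2)))
      = (∑' ζ : Fin 3 → Sp 0, (vθ₄ H v θ (Fin.cons (spLift x) ζ) : ℂ) *
          (g (spProj L (ζ 0)) * f (spProj L (ζ 1)) * g (spProj L (ζ 2))))
        + ((-(2 * s ^ 4) : ℝ) : ℂ) * ∑ z : Fin 3 → Sp L, (quarticPart F (Fin.cons x z) : ℂ) *
          (g (z 0) * f (z 1) * g (z 2)) := fun x => by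
    have := tsum_fullKernel_mul (F := F) (a := -(2 * s ^ 4)) h hv hm hθ (spLift x)
      (fun z => g (z 0) * f (z 1) * g (z 2))
    rw [spProj_spLift] at this
    exact this
  change 1 / 2 * ∑ x : Sp L, f x * ∑' ζ : Fin 3 → Sp 0,
      (fullKernel H v θ (-(2 * s ^ 4)) F (Fin.cons (spLift x) ζ) : ℂ) *
        (g (spProj L (ζ 0)) * f (spProj L (ζ 1)) * g (spProj L (ζ 2))) = _
  simp only [h1, mul_add, Finset.sum_add_distrib]
  have h2 := h.sum_vθ₄_eq_Vθ hv hm hθ μ f g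
  have h3 : (F.hom (fun _ => 2) ![slice s ψs (n - 1), slice s ψ n])
      = (s : ℂ) ^ 4 * ∑ x, f x * ∑ z : Fin 3 → Sp L, (quarticPart F (Fin.cons x z) : ℂ) *
          (g (z 0) * f (z 1) * g (z 2)) := by
    rw [hom_two, ← sum_fin_three_quartic (quarticPart F) f g, Finset.mul_sum]
    refine Finset.sum_congr rfl fun z _ => ?_
    change _ * ((s * ψs (n - 1, z 0)) * (s * ψ (n, z 1)) * (s * ψs (n - 1, z 2)) *
      (s * ψ (n, z 3))) = _
    ring
  rw [h3, Vθ_slice]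
  -- the four factors `s` compensate the chemical potential in `V_θ`
  have h4 : (s : ℂ) ^ 4 * ((Real.exp (θ * μ) ^ 2 : ℝ) : ℂ) = 1 := by
    have : s ^ 4 * Real.exp (θ * μ) ^ 2 = 1 := by
      calc s ^ 4 * Real.exp (θ * μ) ^ 2 = (s ^ 2 * Real.exp (θ * μ)) ^ 2 := by ring
        _ = 1 := by rw [hs, one_pow]
    exact_mod_cast this
  have h5 : (s : ℂ) ^ 4 * Vθ H v μ θ f g = -(1 / 2 * ∑ x : Sp L, f x *
      ∑' ζ : Fin 3 → Sp 0, (vθ₄ H v θ (Fin.cons (spLift x) ζ) : ℂ) *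
        (g (spProj L (ζ 0)) * f (spProj L (ζ 1)) * g (spProj L (ζ 2)))) := by
    rw [← neg_neg (Vθ H v μ θ f g), ← h2, mul_neg, ← mul_assoc, h4, one_mul]
  rw [h5]
  have h6 : ∑ x : Sp L, f x * (((-(2 * s ^ 4) : ℝ) : ℂ) * ∑ z : Fin 3 → Sp L,
      (quarticPart F (Fin.cons x z) : ℂ) * (g (z 0) * f (z 1) * g (z 2)))
      = -(2 * (s : ℂ) ^ 4) * ∑ x, f x * ∑ z : Fin 3 → Sp L, (quarticPart F (Fin.cons x z) : ℂ) *
          (g (z 0) * f (z 1) * g (z 2)) := by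
    rw [Finset.mul_sum]
    refine Finset.sum_congr rfl fun x _ => ?_
    push_cast
    ring
  rw [h6]
  ring

lemma hom_one_slice (s : ℝ) (ψs ψ : STLat Lt L → ℂ) (n : ZMod Lt) :
    F.hom (fun _ => 1) ![slice s ψs (n - 1), slice s ψ n]
      = (s : ℂ) ^ 2 * ∑ x, ∑ y, (linKernel F x y : ℂ) * ψs (n - 1, x) * ψ (n, y) := by
  rw [hom_one, Finset.mul_sum]
  refine Finset.sum_congr rfl fun x _ => ?_
  rw [Finset.mul_sum]
  refine Finset.sum_congr rfl fun y _ => ?_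
  change _ * (s * ψs (n - 1, x)) * (s * ψ (n, y)) = _
  ring

/-- The chemical potential `μ₀`. Here `1 - ρ` is what remains of the Gaussian weight after the
rescaling, and the sum is what the bilinear part of `F` contributes. -/
def chemPot (ρ : ℝ) (F : FieldSeries (Fin 2) (Sp L)) : ℝ := 1 - ρ + ρ * ∑ y, linKernel F 0 y

/-- The action of the small field integral, in the rescaled fields. -/
lemma action_eq (h : KineticHyp c L H) (hv : InteractionHyp c fv L v) (hm : 0 < c.mass)
    {θ s K : ℝ} (hθ : 0 ≤ θ) (hs0 : 0 ≤ s) (hs : s ^ 2 * Real.exp (θ * μ) = 1)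
    (hF : KernelSymm F) (hF0 : ∀ r, r 0 = 0 → F r = 0) (hK : 0 ≤ K)
    (hsum : Summable fun r => F.absSum r * ∏ s, (fun _ : Fin 2 => K) s ^ r s)
    {ψs ψ : STLat Lt L → ℂ} (hψs : ∀ x, s * ‖ψs x‖ ≤ K) (hψ : ∀ x, s * ‖ψ x‖ ≤ K) :
    ∑ n : ZMod Lt, (-bil (slice s ψs n) (slice s ψ n)
        + (bil (slice s ψs (n - 1)) (act (jop H μ L θ) (slice s ψ n))
          + Vθ H v μ θ (slice s ψs (n - 1)) (slice s ψ n)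
          + F.eval ![slice s ψs (n - 1), slice s ψ n]))
      = -bil ψs (D₀ H θ ψ)
        - quartic (periodize₄ L (stKernel (fullKernel H v θ (-(2 * s ^ 4)) F))) ψs ψ
        + (chemPot (s ^ 2) F : ℂ) * bil ψs ψ
        + R₀ (quad (bilKernel (s ^ 2) (linKernel F))) (place Lt s (F.restrict IsSextic)) ψs ψ
        + (place Lt s (F.restrict IsHigh)).eval ![ψs, ψ] := by
  have hb : ∀ (n : ZMod Lt) (i : Fin 2) (y : Sp L),
      ‖(![slice s ψs (n - 1), slice s ψ n] : Fin 2 → Sp L → ℂ) i y‖ ≤ (fun _ : Fin 2 => K) i := by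
    intro n i y
    have hn : ∀ (φ : STLat Lt L → ℂ) (m : ZMod Lt), ‖slice s φ m y‖ = s * ‖φ (m, y)‖ :=
      fun φ m => by
        rw [slice, norm_mul, Complex.norm_real, Real.norm_of_nonneg hs0]
    fin_cases i
    · exact (hn ψs (n - 1)).le.trans (hψs _)
    · exact (hn ψ n).le.trans (hψ _)
  have hplace : ∀ (p : (Fin 2 → ℕ) → Prop) [DecidablePred p],
      (place Lt s (F.restrict p)).eval ![ψs, ψ]
        = ∑ n, (F.restrict p).eval ![slice s ψs (n - 1), slice s ψ n] := fun p _ => by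
    rw [eval_place_eq (F.restrict p) hs0 (FieldSeries.summable_restrict (fun _ => hK) hsum p)
      (φ := ![ψs, ψ])]
    · refine Finset.sum_congr rfl fun n _ => ?_
      congr 1
      funext i
      fin_cases i <;> rfl
    · intro i x
      fin_cases i
      · exact hψs x
      · exact hψ x
  unfold R₀
  rw [extEval_bilKernel_jet (linKernel_symm hF) (linKernel_add hF), hplace, hplace, bil_D₀,
    quartic_fullKernel h hv hm hθ hs]
  simp only [eval_decompose (fun _ => hK) hsum hF.charge hF0 (hb _), hom_one_slice]
  -- the factor `s²` compensates the chemical potential in `j(θ)`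
  have hj : ∀ n : ZMod Lt, bil (slice s ψs (n - 1)) (act (jop H μ L θ) (slice s ψ n))
      = bil (fun x => ψs (n - 1, x)) (act (torusHeat H L θ) fun x => ψ (n, x)) := fun n => by
    rw [jop_eq, act_smul, act_slice]
    have h1 : (s : ℂ) * s * ((Real.exp (θ * μ) : ℝ) : ℂ) = 1 := by
      have : s * s * Real.exp (θ * μ) = 1 := by rw [← hs]; ring
      exact_mod_cast this
    unfold bil
    refine Finset.sum_congr rfl fun x _ => ?_
    simp only [slice, Pi.smul_apply, smul_eq_mul]
    calc _ = ((s : ℂ) * s * ((Real.exp (θ * μ) : ℝ) : ℂ)) * (ψs (n - 1, x) *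
          act (torusHeat H L θ) (fun x => ψ (n, x)) x) := by unfold torusHeat; ring
      _ = _ := by rw [h1, one_mul]
  have hd : ∑ n : ZMod Lt, bil (slice s ψs n) (slice s ψ n) = (s : ℂ) ^ 2 * bil ψs ψ := by
    unfold bil
    rw [sum_stLat, Finset.mul_sum]
    refine Finset.sum_congr rfl fun n _ => ?_
    rw [Finset.mul_sum]
    refine Finset.sum_congr rfl fun x _ => ?_
    simp only [slice]
    ring
  have hbil : ∑ n : ZMod Lt, ∑ x : Sp L, ψs (n, x) * ψ (n, x) = bil ψs ψ := by
    unfold bil; rw [sum_stLat]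
  simp only [hj, Finset.sum_add_distrib, Finset.sum_neg_distrib, hd, hbil, chemPot]
  rw [← Finset.mul_sum]
  push_cast
  ring

end Action

/-! ### Cutoffs, integrability and the change of variables -/

section Measure

open MeasureTheory

instance isAddHaarMeasure_fieldMeasure (X : Type*) [Fintype X] :
    (fieldMeasure X).IsAddHaarMeasure := by
  have : (ENNReal.ofReal (1 / Real.pi) • (volume : Measure ℂ)).IsAddHaarMeasure :=
    Measure.IsAddHaarMeasure.smul _ (by simpa using Real.pi_pos) ENNReal.ofReal_ne_top
  exact Measure.pi.isAddHaarMeasure _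

variable {c : Constants} {fv μ : ℝ} {Lt L : ℕ}

/-- The rescaling factor `e^{-θμ/2}`. -/
def rescale (c : Constants) (μ : ℝ) : ℝ := Real.exp (-(c.θ * μ / 2))

lemma rescale_pos (c : Constants) (μ : ℝ) : 0 < rescale c μ := Real.exp_pos _

lemma rescale_inv (c : Constants) (μ : ℝ) : (rescale c μ)⁻¹ = Real.exp (c.θ * μ / 2) := by
  rw [rescale, Real.exp_neg, inv_inv]

lemma rescale_sq (c : Constants) (μ : ℝ) : rescale c μ ^ 2 = Real.exp (-(c.θ * μ)) := by
  rw [rescale, ← Real.exp_nat_mul]; congr 1; push_cast; ring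

lemma rescale_sq_mul (c : Constants) (μ : ℝ) : rescale c μ ^ 2 * Real.exp (c.θ * μ) = 1 := by
  rw [rescale_sq, ← Real.exp_add]; simp

lemma rescale_mul_le_iff (c : Constants) (μ t B : ℝ) :
    rescale c μ * t ≤ B ↔ t ≤ Real.exp (c.θ * μ / 2) * B := by
  rw [← rescale_inv, ← div_eq_inv_mul, le_div_iff₀' (rescale_pos c μ)]

lemma norm_slice {s : ℝ} (hs : 0 ≤ s) (ψ : STLat Lt L → ℂ) (n : ZMod Lt) (x : Sp L) :
    ‖slice s ψ n x‖ = s * ‖ψ (n, x)‖ := by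
  rw [slice, norm_mul, Complex.norm_real, Real.norm_of_nonneg hs]

lemma norm_grad_slice {s : ℝ} (hs : 0 ≤ s) (ψ : STLat Lt L → ℂ) (n : ZMod Lt) (x : Sp L)
    (j : Fin 3) : ‖grad (slice s ψ n) (x, j)‖ = s * ‖fwd j.succ ψ (n, x)‖ := by
  have : grad (slice s ψ n) (x, j) = s * fwd j.succ ψ (n, x) := by
    simp [grad, slice, fwd, stUnit, mul_sub]
  rw [this, norm_mul, Complex.norm_real, Real.norm_of_nonneg hs]

lemma norm_slice_sub_slice {s : ℝ} (hs : 0 ≤ s) (ψ : STLat Lt L → ℂ) (n : ZMod Lt) (x : Sp L) :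
    ‖slice s ψ (n - 1) x - slice s ψ n x‖ = s * ‖fwd 0 ψ (n - 1, x)‖ := by
  have : slice s ψ (n - 1) x - slice s ψ n x = -(s * fwd 0 ψ (n - 1, x)) := by
    simp [slice, fwd, stUnit, mul_sub]
  rw [this, norm_neg, norm_mul, Complex.norm_real, Real.norm_of_nonneg hs]

lemma prod_ite_one_zero {ι : Type*} [Fintype ι] {p : ι → Prop} [DecidablePred p] {q : Prop}
    [Decidable q] (h : (∀ i, p i) ↔ q) :
    ∏ i, (if p i then (1 : ℂ) else 0) = if q then 1 else 0 := by
  by_cases hq : q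
  · simp [hq, h.2 hq]
  · obtain ⟨i, hi⟩ := not_forall.1 fun h' => hq (h.1 h')
    rw [if_neg hq]
    exact Finset.prod_eq_zero (Finset.mem_univ i) (if_neg hi)

/-- The bounds of the cutoffs `χ_θ` are those of `χ₀`, divided by `e^{θμ/2}`. The difference of the
fields at neighbouring times is the derivative `∂₀ψ`. -/
lemma prod_χθ_slice [NeZero Lt] (c : Constants) (fv μ : ℝ) (ψ : STLat Lt L → ℂ) :
    ∏ n : ZMod Lt, χθ c fv (slice (rescale c μ) ψ (n - 1)) (slice (rescale c μ) ψ n)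
      = χ₀ c fv μ ψ := by
  classical
  have hs := (rescale_pos c μ).le
  unfold χθ χ₀
  refine prod_ite_one_zero ?_
  simp only [norm_slice hs, norm_slice_sub_slice hs, Prod.forall, norm_grad_slice hs,
    rescale_mul_le_iff]
  constructor
  · intro h
    refine ⟨fun n x => ((h n).1 x).2, fun j n x => ((h n).2.1 x j).2, fun n x => ?_⟩
    have := (h (n + 1)).2.2 x
    rwa [add_sub_cancel_right] at this
  · rintro ⟨h1, h2, h3⟩ n
    exact ⟨fun x => ⟨h1 _ x, h1 _ x⟩, fun x j => ⟨h2 j _ x, h2 j _ x⟩, fun x => h3 _ x⟩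

/-- The support of the cutoff `χ₀`. -/
def smallFields (c : Constants) (fv μ : ℝ) (Lt L : ℕ) : Set (STLat Lt L → ℂ) :=
  {ψ | (∀ x, ‖ψ x‖ ≤ Real.exp (c.θ * μ / 2) * c.fieldBound fv) ∧
      (∀ (j : Fin 3) x, ‖fwd j.succ ψ x‖ ≤ Real.exp (c.θ * μ / 2) * c.gradBound fv) ∧
      (∀ x, ‖fwd 0 ψ x‖ ≤ Real.exp (c.θ * μ / 2) * c.diffBound fv)}

lemma χ₀_of_notMem {ψ : STLat Lt L → ℂ} (h : ψ ∉ smallFields c fv μ Lt L) : χ₀ c fv μ ψ = 0 :=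
  if_neg h

lemma χ₀_of_mem {ψ : STLat Lt L → ℂ} (h : ψ ∈ smallFields c fv μ Lt L) : χ₀ c fv μ ψ = 1 :=
  if_pos h

lemma isCompact_smallFields [NeZero Lt] [NeZero L] (c : Constants) (fv μ : ℝ) :
    IsCompact (smallFields c fv μ Lt L) := by
  have hc : IsClosed (smallFields c fv μ Lt L) := by
    unfold smallFields fwd
    simp only [Set.ofPred_and, Set.ofPred_forall]
    refine IsClosed.inter ?_ (IsClosed.inter ?_ ?_)
    · exact isClosed_iInter fun x => isClosed_le (by fun_prop) continuous_const
    · exact isClosed_iInter fun j => isClosed_iInter fun x =>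
        isClosed_le (by fun_prop) continuous_const
    · exact isClosed_iInter fun x => isClosed_le (by fun_prop) continuous_const
  refine IsCompact.of_isClosed_subset
    (isCompact_closedBall 0 (Real.exp (c.θ * μ / 2) * c.fieldBound fv)) hc fun ψ hψ => ?_
  rw [mem_closedBall_zero_iff]
  have h0 : 0 ≤ Real.exp (c.θ * μ / 2) * c.fieldBound fv := (norm_nonneg _).trans (hψ.1 0)
  exact (pi_norm_le_iff_of_nonneg h0).2 hψ.1

lemma continuousOn_eval [NeZero Lt] [NeZero L] {F : FieldSeries (Fin 2) (STLat Lt L)} {K : ℝ}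
    (hF : Summable fun r => F.absSum r * ∏ s, (fun _ : Fin 2 => K) s ^ r s)
    {S : Set (STLat Lt L → ℂ)} (hS : ∀ ψ ∈ S, ∀ x, ‖ψ x‖ ≤ K) :
    ContinuousOn (fun ψ : STLat Lt L → ℂ => F.eval ![star ψ, ψ]) S := by
  simp only [FieldSeries.eval_eq_tsum_hom]
  refine continuousOn_tsum (fun r => Continuous.continuousOn ?_) hF fun r ψ hψ => ?_
  · unfold FieldSeries.hom
    refine continuous_finsetSum _ fun x _ => continuous_const.mul
      (continuous_finsetProd _ fun q _ => ?_)
    rcases q with ⟨i, k⟩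
    fin_cases i
    · exact continuous_star.comp (continuous_apply _)
    · exact continuous_apply _
  · refine F.norm_hom_le r fun i x => ?_
    fin_cases i
    · simpa using hS ψ hψ x
    · exact hS ψ hψ x

lemma continuous_bil_D₀ [NeZero Lt] [NeZero L] (H : Bond 0 → Bond 0 → ℝ) (θ : ℝ) :
    Continuous fun ψ : STLat Lt L → ℂ => bil (star ψ) (D₀ H θ ψ) := by
  unfold bil D₀ act fwd
  refine continuous_finsetSum _ fun x _ => ?_
  simp only [Pi.star_apply]
  fun_prop

lemma continuous_quartic [NeZero Lt] [NeZero L] (V : (Fin 4 → STLat Lt L) → ℝ) :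
    Continuous fun ψ : STLat Lt L → ℂ => quartic V (star ψ) ψ := by
  unfold quartic
  refine continuous_const.mul (continuous_finsetSum _ fun x _ => ?_)
  simp only [Pi.star_apply]
  fun_prop

/-- The integrand is a continuous function on a compact set, extended by zero. -/
lemma integrable_blockSpinIntegrand [NeZero Lt] [NeZero L] (H : Bond 0 → Bond 0 → ℝ)
    (V : (Fin 4 → STLat Lt L) → ℝ) (μ₀ : ℝ) {ρ : ℝ} {r : Sp L → Sp L → ℝ}
    (hsymm : ∀ x y, r x y = r y x) (htrans : ∀ a x y, r (x + a) (y + a) = r x y)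
    {R6 E0 : FieldSeries (Fin 2) (STLat Lt L)} {K : ℝ}
    (hR6 : Summable fun r => R6.absSum r * ∏ s, (fun _ : Fin 2 => K) s ^ r s)
    (hE0 : Summable fun r => E0.absSum r * ∏ s, (fun _ : Fin 2 => K) s ^ r s)
    (hK : Real.exp (c.θ * μ / 2) * c.fieldBound fv ≤ K) :
    Integrable (blockSpinIntegrand c fv H μ V μ₀ (quad (bilKernel ρ r)) R6 E0)
      (fieldMeasure (STLat Lt L)) := by
  classical
  set S := smallFields c fv μ Lt L
  have hSK : ∀ ψ ∈ S, ∀ x, ‖ψ x‖ ≤ K := fun ψ hψ x => (hψ.1 x).trans hK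
  set A : (STLat Lt L → ℂ) → ℂ := fun ψ => Complex.exp (-bil (star ψ) (D₀ H c.θ ψ)
    - quartic V (star ψ) ψ + (μ₀ : ℂ) * bil (star ψ) ψ
    + R₀ (quad (bilKernel ρ r)) R6 (star ψ) ψ + E0.eval ![star ψ, ψ])
  have hA : ContinuousOn A S := by
    refine Complex.continuous_exp.comp_continuousOn ?_
    have hb : Continuous fun ψ : STLat Lt L → ℂ => bil (star ψ) ψ := by
      unfold bil
      simp only [Pi.star_apply]
      fun_prop
    have hR : Continuous fun ψ : STLat Lt L → ℂ =>
        extEval (quad (bilKernel ρ r)) (jet (star ψ)) (jet ψ) := by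
      simp only [extEval_bilKernel_jet hsymm htrans, Pi.star_apply]
      fun_prop
    unfold R₀
    exact ((((continuous_bil_D₀ H c.θ).neg.sub (continuous_quartic V)).add
      (continuous_const.mul hb)).continuousOn.add
      (hR.continuousOn.add (continuousOn_eval hR6 hSK))).add (continuousOn_eval hE0 hSK)
  have hS := isCompact_smallFields (Lt := Lt) (L := L) c fv μ
  have he : blockSpinIntegrand c fv H μ V μ₀ (quad (bilKernel ρ r)) R6 E0 = S.indicator A := by
    funext ψ
    unfold blockSpinIntegrand
    by_cases h : ψ ∈ S
    · rw [Set.indicator_of_mem h, χ₀_of_mem h, mul_one]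
    · rw [Set.indicator_of_notMem h, χ₀_of_notMem h, mul_zero]
  rw [he, integrable_indicator_iff hS.measurableSet]
  exact hA.integrableOn_compact hS

/-- In the rescaled fields the integrands agree up to a constant. -/
lemma smallFieldIntegrand_smul [NeZero Lt] [NeZero L] {H : Bond 0 → Bond 0 → ℝ}
    {v : Sp 0 → Sp 0 → ℝ} {R E : FieldSeries (Fin 2) (Sp L)} (hc : c.Admissible) (hfv : 0 < fv)
    (hH : KineticHyp c L H) (hv : InteractionHyp c fv L v) (h : UVOutput c fv L R E) (Zθ : ℂ)
    (ψ : STLat Lt L → ℂ) :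
    smallFieldIntegrand c fv H v μ Lt Zθ R E (rescale c μ • ψ)
      = Zθ ^ Fintype.card (STLat Lt L) * blockSpinIntegrand c fv H μ
        (periodize₄ L (stKernel (fullKernel H v c.θ (-(2 * rescale c μ ^ 4)) (R + E))))
        (chemPot (rescale c μ ^ 2) (R + E))
        (quad (bilKernel (rescale c μ ^ 2) (linKernel (R + E))))
        (place Lt (rescale c μ) (FieldSeries.restrict (R + E) IsSextic))
        (place Lt (rescale c μ) (FieldSeries.restrict (R + E) IsHigh)) ψ := by
  set s := rescale c μ with hsdef
  have hs0 : 0 ≤ s := (rescale_pos c μ).le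
  have hB := hc.fieldBound_pos hfv
  have hsl : ∀ n : ZMod Lt, (fun x => (s • ψ) (n, x)) = slice s ψ n := fun n => by
    funext x; simp [slice]
  have hcard : Fintype.card (STLat Lt L) = Fintype.card (Sp L) * Lt := by
    rw [Fintype.card_prod, ZMod.card, mul_comm]
  have h1 : ∀ n : ZMod Lt, ∏ x : Sp L, Complex.exp (-(conj ((s • ψ) (n, x)) * (s • ψ) (n, x)))
      = Complex.exp (-bil (slice s (star ψ) n) (slice s ψ n)) := fun n => by
    rw [← Complex.exp_sum, Finset.sum_neg_distrib]
    congr 2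
    refine Finset.sum_congr rfl fun x _ => ?_
    simp [slice]
  unfold smallFieldIntegrand ISF
  simp only [h1, hsl]
  have h2 : ∀ n : ZMod Lt, Complex.exp (-bil (slice s (star ψ) n) (slice s ψ n)) *
      (Zθ ^ Fintype.card (Sp L) * Complex.exp (bil (star (slice s ψ (n - 1)))
        (act (jop H μ L c.θ) (slice s ψ n)) + Vθ H v μ c.θ (star (slice s ψ (n - 1))) (slice s ψ n)
        + Dθ R E (star (slice s ψ (n - 1))) (slice s ψ n)) *
        χθ c fv (slice s ψ (n - 1)) (slice s ψ n))
      = Zθ ^ Fintype.card (Sp L) * Complex.exp (-bil (slice s (star ψ) n) (slice s ψ n)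
        + (bil (slice s (star ψ) (n - 1)) (act (jop H μ L c.θ) (slice s ψ n))
          + Vθ H v μ c.θ (slice s (star ψ) (n - 1)) (slice s ψ n)
          + Dθ R E (slice s (star ψ) (n - 1)) (slice s ψ n))) *
        χθ c fv (slice s ψ (n - 1)) (slice s ψ n) := fun n => by
    rw [Complex.exp_add (-bil _ _), star_slice]
    ring
  simp only [h2]
  rw [Finset.prod_mul_distrib, Finset.prod_mul_distrib, prod_χθ_slice, Finset.prod_const,
    Finset.card_univ, ZMod.card, ← pow_mul, ← hcard, ← Complex.exp_sum, mul_assoc]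
  unfold blockSpinIntegrand
  -- outside the support of the cutoff, where the power series need not converge, both sides vanish
  by_cases hψ : ψ ∈ smallFields c fv μ Lt L
  swap
  · rw [χ₀_of_notMem hψ]; simp
  have hψK : ∀ x, s * ‖ψ x‖ ≤ 2 * c.fieldBound fv := fun x =>
    ((rescale_mul_le_iff c μ _ _).2 (hψ.1 x)).trans (by linarith)
  have hψsK : ∀ x, s * ‖star ψ x‖ ≤ 2 * c.fieldBound fv := fun x => by
    rw [Pi.star_apply, norm_star]; exact hψK x
  have hF0 : ∀ r : Fin 2 → ℕ, r 0 = 0 → (R + E) r = 0 := fun r hr => by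
    rw [Pi.add_apply, h.R_bilinear r (by omega), h.E_degree r (by omega), add_zero]
  have hD : ∀ n : ZMod Lt, Dθ R E (slice s (star ψ) (n - 1)) (slice s ψ n)
      = FieldSeries.eval (R + E) ![slice s (star ψ) (n - 1), slice s ψ n] := fun n => by
    refine h.Dθ_eq hc hfv (φ := ![slice s (star ψ) (n - 1), slice s ψ n]) fun i x => ?_
    fin_cases i
    · exact (norm_slice hs0 _ _ _).le.trans (hψsK _)
    · exact (norm_slice hs0 _ _ _).le.trans (hψK _)
  simp only [hD]
  rw [action_eq hH hv hc.mass_pos hc.θ_pos.le hs0 (rescale_sq_mul c μ) (h.kernelSymm hc hfv) hF0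
    (by linarith) (h.summable_add hc hfv) hψsK hψK]

/-- The field at each of the points has two real components, and `(e^{-θμ/2})² = e^{-θμ}`. -/
lemma integral_comp_rescale [NeZero Lt] [NeZero L] (f : (STLat Lt L → ℂ) → ℂ) :
    ∫ α, f α ∂(fieldMeasure (STLat Lt L))
      = Complex.exp (-(c.θ * μ)) ^ Fintype.card (STLat Lt L) *
        ∫ ψ, f (rescale c μ • ψ) ∂(fieldMeasure (STLat Lt L)) := by
  have hr : Module.finrank ℝ (STLat Lt L → ℂ) = 2 * Fintype.card (STLat Lt L) := by
    rw [Module.finrank_pi_fintype, Finset.sum_const, Complex.finrank_real_complex,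
      Finset.card_univ, smul_eq_mul, mul_comm]
  have h0 : (0 : ℝ) < rescale c μ ^ Module.finrank ℝ (STLat Lt L → ℂ) :=
    pow_pos (rescale_pos c μ) _
  rw [Measure.integral_comp_smul, abs_of_pos (inv_pos.2 h0), Complex.real_smul, ← mul_assoc]
  have h1 : Complex.exp (-(c.θ * μ)) ^ Fintype.card (STLat Lt L)
      = ((rescale c μ ^ Module.finrank ℝ (STLat Lt L → ℂ) : ℝ) : ℂ) := by
    rw [hr, pow_mul, rescale_sq]; push_cast; rfl
  rw [h1, ← Complex.ofReal_mul, mul_inv_cancel₀ h0.ne', Complex.ofReal_one, one_mul]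

end Measure

/-! ### Constants and bounds -/

lemma exists_rpow_le {A B p : ℝ} (hA : 0 < A) (hB : 0 < B) (hp : 0 < p) :
    ∃ w : ℝ, 0 < w ∧ ∀ t, 0 < t → t ≤ w → A * t ^ p ≤ B := by
  refine ⟨(B / A) ^ p⁻¹, Real.rpow_pos_of_pos (div_pos hB hA) _, fun t ht htw => ?_⟩
  have h := Real.rpow_le_rpow ht.le htw hp.le
  rw [Real.rpow_inv_rpow (div_pos hB hA).le hp.ne', le_div_iff₀ hA] at h
  linarith

/-- A threshold below which the chemical potential is small, and the explicit part of the quartic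
kernel dominates the contribution of the output of the ultraviolet flow. -/
lemma exists_threshold (c : Constants) : ∃ w : ℝ, 0 < w ∧ w ≤ 1 ∧ (c.Admissible →
    ∀ fv, 0 < fv → fv ≤ w → c.K_μ * fv ^ c.e_μ ≤ 1 ∧
      Real.exp 1 ^ 2 * c.K / 8 * fv ^ (1 - 2 * c.e_R - 4 * c.e_r) ≤ c.θ * c.c_v / 4) := by
  by_cases hc : c.Admissible
  · have := hc.K_pos
    have := hc.θ_pos
    have := hc.c_v_pos
    obtain ⟨w₁, h₁, H₁⟩ := exists_rpow_le hc.K_μ_pos one_pos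
      (lt_trans (by norm_num) hc.e_μ_gt : 0 < c.e_μ)
    obtain ⟨w₂, h₂, H₂⟩ := exists_rpow_le (A := Real.exp 1 ^ 2 * c.K / 8) (B := c.θ * c.c_v / 4)
      (p := 1 - 2 * c.e_R - 4 * c.e_r) (by positivity) (by positivity)
      (by linarith [hc.exp₁, hc.e_R_pos])
    exact ⟨min 1 (min w₁ w₂), by positivity, min_le_left _ _, fun _ fv h0 hw =>
      ⟨H₁ fv h0 (hw.trans ((min_le_right _ _).trans (min_le_left _ _))),
        H₂ fv h0 (hw.trans ((min_le_right _ _).trans (min_le_right _ _)))⟩⟩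
  -- for inadmissible constants nothing is claimed
  · exact ⟨1, one_pos, le_rfl, fun h => absurd h hc⟩

/-- The constant in the bounds on the quartic kernel. The absolute values make it positive for all
arguments. -/
def quarticConst (θ mass c_v K : ℝ) (H : Bond 0 → Bond 0 → ℝ) : ℝ :=
  |θ| * Real.exp (4 / 3 * mass) * heatBound mass θ H ^ 4
    + Real.exp (4 / 3 * mass) * Real.exp 1 ^ 2 * |K|
    + Real.exp 1 ^ 2 * |K| + 4 / (|θ| * |c_v|) + 1

lemma quarticConst_pos (θ mass c_v K : ℝ) (H : Bond 0 → Bond 0 → ℝ) :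
    0 < quarticConst θ mass c_v K H := by
  have := heatBound_pos mass θ H
  unfold quarticConst
  positivity

/-- The constant in the bound on the part of `𝓡₀` that is quadratic in the fields. It bounds
`norm_bilKernel_le` for `ρ = e^{-θμ} ≤ e`. -/
def quadraticConst (mass K : ℝ) : ℝ :=
  1 + 25 * (Real.exp 1 * |K| * (1 + Real.exp mass + 1 / mass ^ 2))

lemma quadraticConst_pos (mass K : ℝ) : 0 < quadraticConst mass K := by
  unfold quadraticConst
  positivity

/-- A bound on the norm of a power series bounds every kernel, divided by the powers of the weight.
-/
lemma kernelNorm_le_of_norm_le {X : Type*} {d : X → X → ℝ} {m k B : ℝ} (hk : 0 < k)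
    {F : FieldSeries (Fin 2) X} (h : F.norm d m (fun _ => k) ≤ ENNReal.ofReal B) (r : Fin 2 → ℕ) :
    kernelNorm d m (F r) ≤ ENNReal.ofReal (B / k ^ (r 0 + r 1)) := by
  have h1 := (kernelNorm_mul_le_norm m (fun _ => k) F r).trans h
  rw [Fin.prod_univ_two, ← pow_add, ← ENNReal.ofReal_pow hk.le] at h1
  rw [ENNReal.ofReal_div_of_pos (by positivity), ENNReal.le_div_iff_mul_le]
  · exact h1
  · left; simpa using pow_pos hk _
  · left; simp

lemma place_eq_zero {Lt L : ℕ} [NeZero Lt] {κ : ℝ} {F : FieldSeries (Fin 2) (Sp L)} {r : Fin 2 → ℕ}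
    (h : F r = 0) : place Lt κ F r = 0 := by
  funext x
  simp [place, h]

section Bounds

variable {c : Constants} {fv μ : ℝ} {Lt L : ℕ} [NeZero Lt] [NeZero L]
  {R E : FieldSeries (Fin 2) (Sp L)}

lemma UVOutput.add_apply_of_two_le (h : UVOutput c fv L R E) {r : Fin 2 → ℕ} (hr : 2 ≤ r 0) :
    (R + E) r = E r := by
  rw [Pi.add_apply, h.R_bilinear r (by omega), zero_add]

/-- Every factor of the weight `2 (1/(θ𝔳))^{e_R + e_r}` improves the bound on the kernel. -/
lemma UVOutput.kernelNorm_E_le (hc : c.Admissible) (hfv : 0 < fv) (h : UVOutput c fv L R E)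
    (r : Fin 2 → ℕ) (n : ℕ) (hn : r 0 + r 1 = n) :
    kernelNorm spDist (2 * c.mass) (E r) ≤ ENNReal.ofReal
      (c.K / 2 ^ n * (fv * c.θ) ^ (2 - 6 * c.e_R - 8 * c.e_r + (c.e_R + c.e_r) * n)) := by
  have hp := mul_pos hfv hc.θ_pos
  refine (kernelNorm_le_of_norm_le (by linarith [hc.fieldBound_pos hfv]) h.E_norm r).trans
    (le_of_eq ?_)
  congr 1
  have hB : c.fieldBound fv ^ n = ((fv * c.θ) ^ ((c.e_R + c.e_r) * n))⁻¹ := by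
    rw [Constants.fieldBound, one_div, mul_comm c.θ, ← Real.rpow_natCast, ← Real.rpow_mul
      (inv_pos.2 hp).le, Real.inv_rpow hp.le]
  rw [hn, mul_pow, hB, Real.rpow_add hp]
  have := (Real.rpow_pos_of_pos hp ((c.e_R + c.e_r) * n)).ne'
  field_simp

lemma UVOutput.kernelNorm_quartic_le (hc : c.Admissible) (hfv : 0 < fv)
    (h : UVOutput c fv L R E) :
    kernelNorm spDist (2 * c.mass) ((R + E) (fun _ => 2)) ≤ ENNReal.ofReal
      (c.K / 16 * fv ^ (2 - 2 * c.e_R - 4 * c.e_r)) := by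
  have hp := mul_pos hfv hc.θ_pos
  rw [h.add_apply_of_two_le le_rfl]
  refine (h.kernelNorm_E_le hc hfv _ 4 rfl).trans (ENNReal.ofReal_le_ofReal ?_)
  have e : 2 - 6 * c.e_R - 8 * c.e_r + (c.e_R + c.e_r) * (4 : ℕ) = 2 - 2 * c.e_R - 4 * c.e_r := by
    push_cast; ring
  rw [e]
  have h1 : (fv * c.θ) ^ (2 - 2 * c.e_R - 4 * c.e_r) ≤ fv ^ (2 - 2 * c.e_R - 4 * c.e_r) :=
    Real.rpow_le_rpow hp.le (mul_le_of_le_one_right hfv.le hc.θ_le)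
      (by linarith [hc.exp₁, hc.e_R_pos])
  have := hc.K_pos
  have e16 : (2 : ℝ) ^ 4 = 16 := by norm_num
  rw [e16]
  gcongr

lemma nonpert_nonneg (m : ℝ) (hfv : 0 < fv) : 0 ≤ nonpert m fv := Real.rpow_nonneg hfv.le _

lemma UVOutput.kernelNorm_bilinear_le (hc : c.Admissible) (hfv : 0 < fv) (h1 : fv ≤ 1)
    (h : UVOutput c fv L R E) :
    kernelNorm spDist (2 * c.mass) ((R + E) (fun _ => 1)) ≤ ENNReal.ofReal
      (c.K * c.θ * nonpert c.mass fv / 4) := by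
  rw [Pi.add_apply, h.E_degree _ (by simp), add_zero]
  have hB := hc.one_le_fieldBound hfv h1
  refine (kernelNorm_le_of_norm_le (by linarith) h.R_norm _).trans (ENNReal.ofReal_le_ofReal ?_)
  have := hc.K_pos
  have := hc.θ_pos
  have := nonpert_nonneg c.mass hfv
  refine div_le_div_of_nonneg_left (by positivity) (by norm_num) ?_
  calc (4 : ℝ) = 2 ^ (1 + 1) := by norm_num
    _ ≤ _ := pow_le_pow_left₀ zero_le_two (by linarith) _

lemma UVOutput.sum_linKernel_le (hc : c.Admissible) (hfv : 0 < fv) (h1 : fv ≤ 1)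
    (h : UVOutput c fv L R E) (x : Sp L) :
    ∑ y, |linKernel (R + E) x y| * Real.exp (2 * c.mass * spDist x y)
      ≤ c.K * c.θ * nonpert c.mass fv / 4 := by
  have := hc.K_pos
  have := hc.θ_pos
  have := nonpert_nonneg c.mass hfv
  exact BoseFlow.sum_linKernel_le isPseudoDist_spDist (by linarith [hc.mass_pos]) _ (by positivity)
    (h.kernelNorm_bilinear_le hc hfv h1) x

lemma rescale_sq_le (hc : c.Admissible) (hμ : |μ| ≤ 1) : rescale c μ ^ 2 ≤ Real.exp 1 := by
  rw [rescale_sq, Real.exp_le_exp]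
  have := hc.θ_pos
  have := hc.θ_le
  nlinarith [neg_abs_le μ, abs_nonneg μ]

/-- The correction to the chemical potential is `e^{-θμ} ∑_y r(0,y)`. The weights of the two fields
give a factor `1/4`, which absorbs `e^{-θμ} ≤ e`. -/
lemma UVOutput.abs_chemPot_sub_le (hc : c.Admissible) (hfv : 0 < fv) (h1 : fv ≤ 1)
    (h : UVOutput c fv L R E) (hμ : |μ| ≤ 1) :
    |chemPot (rescale c μ ^ 2) (R + E) - (1 - Real.exp (-(c.θ * μ)))|
      ≤ c.K * c.θ * nonpert c.mass fv := by
  have hs := rescale_sq_le hc hμ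
  have he := Real.exp_one_lt_d9
  have e : chemPot (rescale c μ ^ 2) (R + E) - (1 - Real.exp (-(c.θ * μ)))
      = rescale c μ ^ 2 * ∑ y, linKernel (R + E) 0 y := by
    rw [chemPot, ← rescale_sq]; ring
  have hsum : |∑ y, linKernel (R + E) 0 y| ≤ c.K * c.θ * nonpert c.mass fv / 4 := by
    refine (Finset.abs_sum_le_sum_abs _ _).trans
      (le_trans (Finset.sum_le_sum fun y _ => ?_) (h.sum_linKernel_le hc hfv h1 0))
    refine le_mul_of_one_le_right (abs_nonneg _) (Real.one_le_exp ?_)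
    have := hc.mass_pos
    have := spDist_nonneg (0 : Sp L) y
    positivity
  rw [e, abs_mul, abs_of_nonneg (sq_nonneg _)]
  calc _ ≤ 4 * (c.K * c.θ * nonpert c.mass fv / 4) := by gcongr; linarith
    _ = _ := by ring

lemma UVOutput.norm_quadratic_le (hc : c.Admissible) (hfv : 0 < fv) (h1 : fv ≤ 1)
    (h : UVOutput c fv L R E) (hμ : |μ| ≤ 1) :
    (quad (bilKernel (Lt := Lt) (rescale c μ ^ 2) (linKernel (R + E)))).norm stDist c.mass
        (fun _ => 1)
      ≤ ENNReal.ofReal (quadraticConst c.mass c.K * nonpert c.mass fv) := by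
  have hF := h.kernelSymm hc hfv
  have hK := hc.K_pos
  have hθ := hc.θ_pos
  have hm := hc.mass_pos
  have hn := nonpert_nonneg c.mass hfv
  refine (norm_bilKernel_le hm (sq_nonneg _) (linKernel_add hF) (linKernel_symm hF)
    (h.sum_linKernel_le hc hfv h1)).trans (ENNReal.ofReal_le_ofReal ?_)
  have hs := rescale_sq_le hc hμ
  have hN : c.K * c.θ * nonpert c.mass fv / 4 ≤ c.K * nonpert c.mass fv := by
    have : 0 ≤ c.K * nonpert c.mass fv := by positivity
    nlinarith [hc.θ_le]
  rw [quadraticConst, abs_of_pos hK]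
  calc _ ≤ 25 * (Real.exp 1 * (c.K * nonpert c.mass fv) *
        (1 + Real.exp c.mass + 1 / c.mass ^ 2)) := by gcongr
    _ = 25 * (Real.exp 1 * c.K * (1 + Real.exp c.mass + 1 / c.mass ^ 2)) * nonpert c.mass fv := by
        ring
    _ ≤ _ := by gcongr; linarith

/-- In degree three the six fields are rescaled by `e^{-3θμ}`, and the three vertical edges cost
`e^{6m}`. -/
lemma UVOutput.norm_sextic_le (hc : c.Admissible) (hfv : 0 < fv) (h : UVOutput c fv L R E) :
    (place Lt (rescale c μ) (FieldSeries.restrict (R + E) IsSextic)).norm stDist (2 * c.mass)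
        (fun _ => 1)
      ≤ ENNReal.ofReal (Real.exp (-(3 * c.θ * μ) + 6 * c.mass) * c.K *
        (fv * c.θ) ^ (2 - 2 * c.e_r)) := by
  have hK := hc.K_pos
  have hp := mul_pos hfv hc.θ_pos
  unfold FieldSeries.norm
  rw [tsum_eq_single (fun _ => 3) fun r hr => ?_]
  · have hr : IsSextic fun _ => 3 := ⟨rfl, rfl⟩
    simp only [ENNReal.ofReal_one, one_pow, Finset.prod_const_one, mul_one]
    refine (kernelNorm_place_le (rescale_pos c μ).le (by linarith [hc.mass_pos]) _ _
      (by norm_num)).trans ?_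
    rw [FieldSeries.restrict_apply, if_pos hr, h.add_apply_of_two_le (by norm_num)]
    refine (mul_le_mul_right (h.kernelNorm_E_le hc hfv _ 6 rfl) _).trans ?_
    rw [← ENNReal.ofReal_mul (by have := rescale_pos c μ; positivity)]
    refine ENNReal.ofReal_le_ofReal ?_
    have e1 : 2 - 6 * c.e_R - 8 * c.e_r + (c.e_R + c.e_r) * (6 : ℕ) = 2 - 2 * c.e_r := by
      push_cast; ring
    have e2 : rescale c μ ^ (3 + 3) * Real.exp (2 * c.mass * (3 : ℕ))
        = Real.exp (-(3 * c.θ * μ) + 6 * c.mass) := by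
      rw [rescale, ← Real.exp_nat_mul, ← Real.exp_add]; congr 1; push_cast; ring
    rw [e1, e2, mul_assoc (Real.exp _) c.K]
    have := Real.rpow_pos_of_pos hp (2 - 2 * c.e_r)
    refine mul_le_mul_of_nonneg_left (mul_le_mul_of_nonneg_right ?_ this.le) (Real.exp_pos _).le
    exact div_le_self hK.le (by norm_num)
  · have hn : ¬IsSextic r := fun h' => hr (by funext i; fin_cases i; exacts [h'.1, h'.2])
    rw [place_eq_zero (by rw [FieldSeries.restrict_apply, if_neg hn]), kernelNorm_zero, zero_mul]

/-- The weight of `𝓔₀` is chosen such that `place` does not increase the norm: the factor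
`e^{-θμ/2}` of each field and the factor `e^{2m}` of each pair of fields cancel. -/
lemma UVOutput.norm_high_le (hc : c.Admissible) (hfv : 0 < fv) (h : UVOutput c fv L R E) :
    (place Lt (rescale c μ) (FieldSeries.restrict (R + E) IsHigh)).norm stDist (2 * c.mass)
        (fun _ => 2 * Real.exp (c.θ * μ / 2 - c.mass) * c.fieldBound fv)
      ≤ ENNReal.ofReal (c.K * (fv * c.θ) ^ (2 - 6 * c.e_R - 8 * c.e_r)) := by
  refine le_trans (ENNReal.tsum_le_tsum fun r => ?_) h.E_norm
  have hB := hc.fieldBound_pos hfv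
  have hs := rescale_pos c μ
  by_cases hr : IsHigh r ∧ r 0 = r 1
  · refine (mul_le_mul_left (kernelNorm_place_le hs.le (by linarith [hc.mass_pos]) _ _
      (by have := hr.1.1; omega)) _).trans (le_of_eq ?_)
    rw [FieldSeries.restrict_apply, if_pos hr.1,
      h.add_apply_of_two_le (by have := hr.1.1; omega), mul_right_comm, mul_comm]
    congr 1
    rw [Fin.prod_univ_two, Fin.prod_univ_two, ← pow_add, ← pow_add,
      ← ENNReal.ofReal_pow (by positivity), ← ENNReal.ofReal_mul (by positivity),
      ← ENNReal.ofReal_pow (by positivity)]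
    congr 1
    have e1 : rescale c μ * Real.exp (c.θ * μ / 2 - c.mass) = Real.exp (-c.mass) := by
      rw [rescale, ← Real.exp_add]; congr 1; ring
    have e2 : Real.exp (2 * c.mass * r 0) * Real.exp (-c.mass) ^ (r 0 + r 1) = 1 := by
      rw [← Real.exp_nat_mul, ← Real.exp_add, ← hr.2]
      push_cast
      rw [Real.exp_eq_one_iff]; ring
    calc rescale c μ ^ (r 0 + r 1) * Real.exp (2 * c.mass * r 0) *
          (2 * Real.exp (c.θ * μ / 2 - c.mass) * c.fieldBound fv) ^ (r 0 + r 1)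
        = Real.exp (2 * c.mass * r 0) *
          (rescale c μ * Real.exp (c.θ * μ / 2 - c.mass)) ^ (r 0 + r 1) *
          (2 * c.fieldBound fv) ^ (r 0 + r 1) := by
          simp only [mul_pow]; ring
      _ = _ := by rw [e1, e2, one_mul]
  · have h0 : FieldSeries.restrict (R + E) IsHigh r = 0 := by
      rw [FieldSeries.restrict_apply]
      split_ifs with hh
      · exact (h.kernelSymm hc hfv).charge r fun he => hr ⟨hh, he⟩
      · rfl
    rw [place_eq_zero h0, kernelNorm_zero, zero_mul]
    exact zero_le

/-- The explicit part of the quartic kernel has size of order `𝔳`. The contribution of the output of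
the ultraviolet flow is of higher order, and hence does not spoil the lower bound. -/
lemma UVOutput.quarticKernel_bounds {H : Bond 0 → Bond 0 → ℝ} {v : Sp 0 → Sp 0 → ℝ}
    (hc : c.Admissible) (hfv : 0 < fv) (h1 : fv ≤ 1) (h : UVOutput c fv L R E)
    (hH : KineticHyp c L H) (hv : InteractionHyp c fv L v) (hμ' : |μ| ≤ 1)
    (hsmall : Real.exp 1 ^ 2 * c.K / 8 * fv ^ (1 - 2 * c.e_R - 4 * c.e_r) ≤ c.θ * c.c_v / 4) :
    kernelNorm stDist (2 / 3 * c.mass)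
        (stKernel (Lt := Lt) (fullKernel H v c.θ (-(2 * rescale c μ ^ 4)) (R + E)))
      ≤ ENNReal.ofReal (quarticConst c.θ c.mass c.c_v c.K H * fv) ∧
    ENNReal.ofReal (1 / quarticConst c.θ c.mass c.c_v c.K H * fv) ≤ kernelNorm stDist 0
        (stKernel (Lt := Lt) (fullKernel H v c.θ (-(2 * rescale c μ ^ 4)) (R + E))) ∧
    (∀ x : STLat Lt L, |1 / 2 * ∑ y : Fin 3 → STLat Lt L,
        periodize₄ L (stKernel (fullKernel H v c.θ (-(2 * rescale c μ ^ 4)) (R + E)))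
          ![x, y 0, y 1, y 2] - c.θ * ∑ x : Sp L, periodize₂ L v 0 x|
      ≤ quarticConst c.θ c.mass c.c_v c.K H * fv ^ (2 - 2 * c.e_R - 4 * c.e_r)) ∧
    kernelNorm stDist (2 / 3 * c.mass) (fun x : Fin 4 → STLat Lt 0 =>
        stKernel (fullKernel H v c.θ (-(2 * rescale c μ ^ 4)) (R + E)) x
          - leadingKernel H v c.θ x)
      ≤ ENNReal.ofReal
        (quarticConst c.θ c.mass c.c_v c.K H * fv ^ (2 - 2 * c.e_R - 4 * c.e_r)) := by
  have hm := hc.mass_pos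
  have hθ := hc.θ_pos
  have hK := hc.K_pos
  have hcv := hc.c_v_pos
  have hs := rescale_pos c μ
  set a : ℝ := -(2 * rescale c μ ^ 4) with ha
  set p : ℝ := 2 - 2 * c.e_R - 4 * c.e_r with hp
  have hF2 := h.kernelNorm_quartic_le hc hfv
  have hN : 0 ≤ c.K / 16 * fv ^ p := by positivity
  have haN : |a| * (c.K / 16 * fv ^ p) ≤ Real.exp 1 ^ 2 * c.K / 8 * fv ^ p := by
    have h4 : rescale c μ ^ 4 ≤ Real.exp 1 ^ 2 := by
      have := pow_le_pow_left₀ (sq_nonneg _) (rescale_sq_le hc hμ') 2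
      rwa [← pow_mul] at this
    rw [ha, abs_neg, abs_of_pos (by positivity)]
    calc _ ≤ 2 * Real.exp 1 ^ 2 * (c.K / 16 * fv ^ p) := by gcongr
      _ = _ := by ring
  have hpfv : fv ^ p ≤ fv := by
    have := Real.rpow_le_rpow_of_exponent_ge hfv h1
      (show 1 ≤ p by linarith [hc.exp₁, hc.e_R_pos])
    rwa [Real.rpow_one] at this
  have hsmall' : Real.exp 1 ^ 2 * c.K / 8 * fv ^ p ≤ c.θ * c.c_v / 4 * fv := by
    have e : fv ^ p = fv ^ (1 - 2 * c.e_R - 4 * c.e_r) * fv := by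
      rw [← Real.rpow_add_one hfv.ne']; congr 1; rw [hp]; ring
    rw [e, ← mul_assoc]
    gcongr
  have hE4 := (Real.exp_pos (4 / 3 * c.mass)).le
  have hE1 := Real.exp_pos 1
  have hb := heatBound_pos c.mass c.θ H
  have hfp : 0 ≤ fv ^ p := (Real.rpow_pos_of_pos hfv p).le
  have hKv : quarticConst c.θ c.mass c.c_v c.K H
      = c.θ * Real.exp (4 / 3 * c.mass) * heatBound c.mass c.θ H ^ 4
        + Real.exp (4 / 3 * c.mass) * Real.exp 1 ^ 2 * c.K + Real.exp 1 ^ 2 * c.K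
        + 4 / (c.θ * c.c_v) + 1 := by
    rw [quarticConst, abs_of_pos hθ, abs_of_pos hK, abs_of_pos hcv]
  have hKv0 := quarticConst_pos c.θ c.mass c.c_v c.K H
  have q1 : 0 ≤ c.θ * Real.exp (4 / 3 * c.mass) * heatBound c.mass c.θ H ^ 4 := by positivity
  have q2 : 0 ≤ Real.exp (4 / 3 * c.mass) * Real.exp 1 ^ 2 * c.K := by positivity
  have q3 : 0 ≤ Real.exp 1 ^ 2 * c.K := by positivity
  have q4 : 0 ≤ 4 / (c.θ * c.c_v) := by positivity
  have haN4 : |a| * Real.exp (4 / 3 * c.mass) * (c.K / 16 * fv ^ p)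
      ≤ Real.exp (4 / 3 * c.mass) * Real.exp 1 ^ 2 * c.K * fv ^ p := by
    calc _ = Real.exp (4 / 3 * c.mass) * (|a| * (c.K / 16 * fv ^ p)) := by ring
      _ ≤ Real.exp (4 / 3 * c.mass) * (Real.exp 1 ^ 2 * c.K / 8 * fv ^ p) := by gcongr
      _ = Real.exp (4 / 3 * c.mass) * Real.exp 1 ^ 2 * c.K * fv ^ p / 8 := by ring
      _ ≤ _ := div_le_self (by positivity) (by norm_num)
  refine ⟨?_, ?_, fun x => ?_, ?_⟩
  · refine (kernelNorm_fullKernel_le hH hv hm hfv.le hθ.le hN hF2).trans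
      (ENNReal.ofReal_le_ofReal ?_)
    have := mul_le_mul_of_nonneg_left hpfv q2
    have := mul_nonneg q3 hfv.le
    have := mul_nonneg q4 hfv.le
    rw [hKv]
    linarith
  · refine le_trans (ENNReal.ofReal_le_ofReal ?_) (le_kernelNorm_fullKernel hH hv hm hθ.le hN hF2)
    have hv' := mul_le_mul_of_nonneg_left (hv.le_vHat hcv) hθ.le
    have hinv : 1 / quarticConst c.θ c.mass c.c_v c.K H ≤ c.θ * c.c_v / 4 := by
      rw [div_le_iff₀ hKv0]
      have : c.θ * c.c_v / 4 * (4 / (c.θ * c.c_v)) = 1 := by field_simp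
      rw [← this]
      gcongr
      rw [hKv]
      linarith
    have := mul_le_mul_of_nonneg_right hinv hfv.le
    linarith
  · refine (abs_half_sum_fullKernel_sub_le hH hv hm hθ.le hN hF2 x).trans (haN.trans ?_)
    gcongr
    rw [hKv]
    linarith
  · refine (kernelNorm_fullKernel_sub_le hm.le hF2).trans (ENNReal.ofReal_le_ofReal
      (haN4.trans ?_))
    gcongr
    rw [hKv]
    linarith

end Bounds

end BoseFlow

end

theorem propositionD1 :
    ∃ (K_v : (θ mass c_v K_μ K : ℝ) → (H : Bond 0 → Bond 0 → ℝ) → ℝ)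
      (C_r : (mass K_μ K : ℝ) → ℝ) (vbar : Constants → ℝ),
      (∀ θ mass c_v K_μ K H, 0 < K_v θ mass c_v K_μ K H) ∧
      (∀ mass K_μ K, 0 < C_r mass K_μ K) ∧
      (∀ c, 0 < vbar c ∧ vbar c ≤ 1) ∧
      ∀ (c : Constants), c.Admissible →
      ∀ (fv : ℝ), 0 < fv → fv ≤ vbar c →
      ∀ (Lt L : ℕ) [NeZero Lt] [NeZero L], Odd Lt → Odd L →
      ∀ (H : Bond 0 → Bond 0 → ℝ), KineticHyp c L H →
      ∀ (v : Sp 0 → Sp 0 → ℝ), InteractionHyp c fv L v →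
      ∀ (μ : ℝ), |μ| ≤ c.K_μ * fv ^ c.e_μ →
      ∀ (Zθ : ℂ) (R E : FieldSeries (Fin 2) (Sp L)), UVOutput c fv L R E →
      ∃ (V : (Fin 4 → STLat Lt 0) → ℝ) (μ₀ : ℝ)
        (Rt : FieldSeries (Fin 2 × Option (Fin 4)) (STLat Lt L))
        (R6 E0 : FieldSeries (Fin 2) (STLat Lt L)),
        -- the functional integrals
        (MeasureTheory.Integrable (smallFieldIntegrand c fv H v μ Lt Zθ R E)
            (fieldMeasure (STLat Lt L)) ∧
          MeasureTheory.Integrable (blockSpinIntegrand c fv H μ (periodize₄ L V) μ₀ Rt R6 E0)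
            (fieldMeasure (STLat Lt L)) ∧
          ∫ α, smallFieldIntegrand c fv H v μ Lt Zθ R E α ∂(fieldMeasure (STLat Lt L)) =
            (Zθ * Complex.exp (-(c.θ * μ))) ^ Fintype.card (STLat Lt L) *
              ∫ ψ, blockSpinIntegrand c fv H μ (periodize₄ L V) μ₀ Rt R6 E0 ψ
                ∂(fieldMeasure (STLat Lt L))) ∧
        -- the quartic kernel
        ((∀ x, V ![x 2, x 1, x 0, x 3] = V x) ∧
          (∀ x, V ![x 0, x 3, x 2, x 1] = V x) ∧
          QuarticSInvariant V ∧
          kernelNorm stDist (2 / 3 * c.mass) V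
            ≤ ENNReal.ofReal (K_v c.θ c.mass c.c_v c.K_μ c.K H * fv) ∧
          ENNReal.ofReal (1 / K_v c.θ c.mass c.c_v c.K_μ c.K H * fv) ≤ kernelNorm stDist 0 V ∧
          (∀ x₁ : STLat Lt L,
            |1 / 2 * ∑ y : Fin 3 → STLat Lt L, periodize₄ L V ![x₁, y 0, y 1, y 2]
                - c.θ * ∑ x : Sp L, periodize₂ L v 0 x|
              ≤ K_v c.θ c.mass c.c_v c.K_μ c.K H * fv ^ (2 - 2 * c.e_R - 4 * c.e_r)) ∧
          kernelNorm stDist (2 / 3 * c.mass) (fun x => V x - leadingKernel H v c.θ x)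
            ≤ ENNReal.ofReal
              (K_v c.θ c.mass c.c_v c.K_μ c.K H * fv ^ (2 - 2 * c.e_R - 4 * c.e_r))) ∧
        -- the chemical potential
        |μ₀ - (1 - Real.exp (-(c.θ * μ)))| ≤ c.K * c.θ * nonpert c.mass fv ∧
        -- the part of `𝓡₀` that is quadratic in the fields and their derivatives
        (Rt.IsSymm ∧ SInvariant (extEval Rt) ∧ NumberPreserving (extEval Rt) ∧
          (∀ r, monoType r ≠ (1, 1, 0) → monoType r ≠ (0, 0, 2) → Rt r = 0) ∧
          Rt.norm stDist c.mass (fun _ => 1)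
            ≤ ENNReal.ofReal (C_r c.mass c.K_μ c.K * nonpert c.mass fv)) ∧
        -- the part of `𝓡₀` of degree six
        (R6.IsSymm ∧ SInvariant (plainEval R6) ∧ NumberPreserving (plainEval R6) ∧
          (∀ r, ¬(r 0 = 3 ∧ r 1 = 3) → R6 r = 0) ∧
          R6.norm stDist (2 * c.mass) (fun _ => 1)
            ≤ ENNReal.ofReal (Real.exp (-(3 * c.θ * μ) + 6 * c.mass) * c.K *
              (fv * c.θ) ^ (2 - 2 * c.e_r))) ∧
        -- the function `𝓔₀`
        (E0.IsSymm ∧ SInvariant (plainEval E0) ∧ NumberPreserving (plainEval E0) ∧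
          (∀ ψs ψ : STLat Lt L → ℂ,
            (∀ x, ‖ψs x‖ ≤ Real.exp (c.θ * μ / 2) * c.fieldBound fv) →
            (∀ x, ‖ψ x‖ ≤ Real.exp (c.θ * μ / 2) * c.fieldBound fv) → E0.AbsConv ![ψs, ψ]) ∧
          (∀ r, ¬(4 ≤ r 0 ∧ 4 ≤ r 1) → E0 r = 0) ∧
          E0.norm stDist (2 * c.mass)
              (fun _ => 2 * Real.exp (c.θ * μ / 2 - c.mass) * c.fieldBound fv)
            ≤ ENNReal.ofReal (c.K * (fv * c.θ) ^ (2 - 6 * c.e_R - 8 * c.e_r))) := by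
  choose vbar hpos hle hvbar using exists_threshold
  refine ⟨fun θ mass c_v _ K H => quarticConst θ mass c_v K H,
    fun mass _ K => quadraticConst mass K,
    vbar, fun θ mass c_v _ K H => quarticConst_pos θ mass c_v K H,
    fun mass _ K => quadraticConst_pos mass K, fun c => ⟨hpos c, hle c⟩, ?_⟩
  intro c hc fv hfv hfvle Lt L _ _ _ hL H hH v hv μ hμ Zθ R E h
  obtain ⟨hμ1, hsmall⟩ := hvbar c hc fv hfv hfvle
  have h1 : fv ≤ 1 := hfvle.trans (hle c)
  have hμ' : |μ| ≤ 1 := hμ.trans hμ1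
  have hs := rescale_pos c μ
  have hF : KernelSymm (R + E) := h.kernelSymm hc hfv
  have hsum := h.summable_add hc hfv
  have hrev : ∀ p : ℕ → Prop, ∀ r : Fin 2 → ℕ,
      (p (r (Fin.rev 0)) ∧ p (r (Fin.rev 1))) ↔ (p (r 0) ∧ p (r 1)) := fun p r => and_comm
  have hF6 : KernelSymm (FieldSeries.restrict (R + E) IsSextic) :=
    hF.restrict IsSextic (hrev fun k => k = 3)
  have hFh : KernelSymm (FieldSeries.restrict (R + E) IsHigh) :=
    hF.restrict IsHigh (hrev fun k => 4 ≤ k)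
  have hB := hc.fieldBound_pos hfv
  have hsum' : ∀ (p : (Fin 2 → ℕ) → Prop) [DecidablePred p],
      Summable fun r => (place Lt (rescale c μ) (FieldSeries.restrict (R + E) p)).absSum r *
        ∏ s, (fun _ : Fin 2 => (rescale c μ)⁻¹ * (2 * c.fieldBound fv)) s ^ r s := fun p _ =>
    summable_absSum_place hs (by linarith)
      (FieldSeries.summable_restrict (fun _ => by linarith) hsum p)
  -- on the support of the cutoff the rescaled power series converge with a factor two to spare
  have hbound : Real.exp (c.θ * μ / 2) * c.fieldBound fv
      ≤ (rescale c μ)⁻¹ * (2 * c.fieldBound fv) := by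
    rw [rescale_inv]
    gcongr
    linarith
  have hint := integrable_blockSpinIntegrand (c := c) (fv := fv) (μ := μ) (Lt := Lt) H
    (periodize₄ L (stKernel (fullKernel H v c.θ (-(2 * rescale c μ ^ 4)) (R + E))))
    (chemPot (rescale c μ ^ 2) (R + E)) (ρ := rescale c μ ^ 2) (linKernel_symm hF)
    (linKernel_add hF) (hsum' IsSextic) (hsum' IsHigh) hbound
  have hsmul := smallFieldIntegrand_smul (Lt := Lt) (μ := μ) hc hfv hH hv h Zθ
  obtain ⟨hV1, hV2, hV3, hV4⟩ := h.quarticKernel_bounds (Lt := Lt) hc hfv h1 hH hv hμ' hsmall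
  -- the factor `-2` in `𝐕₀` is due to the prefactor of `-𝓥₀`, the powers of `rescale` to the number
  -- of fields
  refine ⟨stKernel (fullKernel H v c.θ (-(2 * rescale c μ ^ 4)) (R + E)),
    chemPot (rescale c μ ^ 2) (R + E),
    quad (bilKernel (rescale c μ ^ 2) (linKernel (R + E))),
    place Lt (rescale c μ) (FieldSeries.restrict (R + E) IsSextic),
    place Lt (rescale c μ) (FieldSeries.restrict (R + E) IsHigh), ⟨?_, hint, ?_⟩,
    ⟨stKernel_swap₀₂ (fullKernel_swap₀₂ hF c.θ), stKernel_swap₁₃ (fullKernel_swap₁₃ hF hv c.θ),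
      quarticSInvariant_fullKernel hL hF hH hv c.θ, hV1, hV2, hV3, hV4⟩,
    h.abs_chemPot_sub_le hc hfv h1 hμ',
    ⟨isSymm_quad _, sInvariant_bilKernel hL (linKernel_symm hF) (linKernel_add hF)
      (linKernel_refl hF), numberPreserving_bilKernel,
      fun r => eq_zero_of_monoType _ _ r, h.norm_quadratic_le hc hfv h1 hμ'⟩,
    ⟨isSymm_place hF6.isSymm, sInvariant_place hF6, numberPreserving_place hF6, fun r hr =>
      place_eq_zero (if_neg hr), h.norm_sextic_le hc hfv⟩,
    ⟨isSymm_place hFh.isSymm, sInvariant_place hFh, numberPreserving_place hFh, ?_, fun r hr =>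
      place_eq_zero (if_neg hr), h.norm_high_le hc hfv⟩⟩
  · rw [← MeasureTheory.integrable_comp_smul_iff _ _ hs.ne']
    simp only [hsmul]
    exact hint.const_mul _
  · rw [integral_comp_rescale (c := c) (μ := μ)]
    simp only [hsmul]
    rw [MeasureTheory.integral_const_mul, mul_pow]
    ring
  · intro ψs ψ hψs hψ
    refine Summable.of_nonneg_of_le (fun r => Finset.sum_nonneg fun x _ => by positivity)
      (fun r => FieldSeries.sum_abs_mul_prod_le _ r fun i x => ?_) (hsum' IsHigh)
    fin_cases i
    · exact (hψs x).trans hbound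
    · exact (hψ x).trans hbound
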